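/- Let $p$ be a prime and let $h\ge 1$. A formal Lie group over a scheme $S$ is an fppf sheaf $X$ of commutative groups on $\mathrm{Sch}_{/S}$ whose underlying pointed sheaf is, Zariski locally on $S$, isomorphic to $\operatorname{Spf}\mathcal O_S[[T]]$ with its zero section. For $n\ge 0$ let $X^{(n)}$ be the $n$-th infinitesimal neighbourhood of the zero section in $X$, and let $I_n\subset\mathcal O_{X^{(n)}}$ be the ideal of the zero section. For $m\ge 0$, $X$ has height $\ge m$ if multiplication by $p$ on $X^{(p^m)}$ carries $I_{p^m}$ into $I_{p^m}^{\,p^m}$; and $X$ has (exact) height $h$ if it has height $\ge h$ and, for every $T\to S$ with $T$ nonempty, $X\times_S T$ does not have height $\ge h+1$. Let $\mathcal{FLG}^h$ be the category fibered in groupoids over $\mathrm{Sch}$ whose objects over $S$ are the formal Lie groups of height $h$ over $S$ and whose morphisms over $S'\to S$ are the isomorphisms from $X'$ to the pullback of $X$. Let $H$ be a commutative one-parameter formal group law over $\mathbb F_p$ such that $[p]_H(T)=T^{p^h}$. Let $\mathcal{A}ut(H)$ be the presheaf of groups on $\mathrm{Sch}_{/\mathbb F_p}$ that sends $S$ to $\mathrm{Aut}_{\Gamma(S,\mathcal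 O_S)}(H)$, the group under composition of the automorphisms of the formal group law $H$ over $\Gamma(S,\mathcal O_S)$, and let $B_{\mathrm{fpqc}}(\mathcal{A}ut(H))$ be the category fibered in groupoids over $\mathrm{Sch}_{/\mathbb F_p}$ of $\mathcal{A}ut(H)$-torsors for the fpqc topology. Then $\mathcal{FLG}^h$ and $B_{\mathrm{fpqc}}(\mathcal{A}ut(H))$ are equivalent as categories over $\mathrm{Sch}$. -/

import Mathlib

open CategoryTheory Opposite AlgebraicGeometry

universe w v u

noncomputable section

/-! ### Formal group laws and their automorphisms -/

namespace FormalGroup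

variable {A B : Type*} [CommRing A] [CommRing B]

/-- The multiplication series `[m]_F`, with `[m + 1]_F(T) = F([m]_F(T), T)`. -/
def mulSeries (F : FormalGroup A) : ℕ → PowerSeries A
  | 0 => 0
  | m + 1 => MvPowerSeries.subst ![F.mulSeries m, PowerSeries.X] F.toPowerSeries

/-- An endomorphism of the formal group law `F`: a power series `f` without constant term such that
`f(F(T₁, T₂)) = F(f(T₁), f(T₂))`. -/
@[ext]
structure Endo (F : FormalGroup A) where
  series : PowerSeries A
  constantCoeff_series : PowerSeries.constantCoeff series = 0
  map_law : PowerSeries.subst F.toPowerSeries series =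
    MvPowerSeries.subst ![PowerSeries.subst (MvPowerSeries.X 0 : MvPowerSeries (Fin 2) A) series,
      PowerSeries.subst (MvPowerSeries.X 1 : MvPowerSeries (Fin 2) A) series] F.toPowerSeries

namespace Endo

variable {F : FormalGroup A}

lemma hasSubst (f : Endo F) : PowerSeries.HasSubst f.series :=
  PowerSeries.HasSubst.of_constantCoeff_zero' f.constantCoeff_series

lemma hasSubst_law (F : FormalGroup A) : PowerSeries.HasSubst F.toPowerSeries :=
  PowerSeries.HasSubst.of_constantCoeff_zero F.zero_constantCoeff

/-- `f(F(a, b)) = F(f(a), f(b))` for all substitutable `a`, `b`. -/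
lemma map_law' (f : Endo F) {σ : Type*} {a b : MvPowerSeries σ A}
    (ha : PowerSeries.HasSubst a) (hb : PowerSeries.HasSubst b) :
    PowerSeries.subst (MvPowerSeries.subst ![a, b] F.toPowerSeries) f.series =
      MvPowerSeries.subst ![PowerSeries.subst a f.series, PowerSeries.subst b f.series]
        F.toPowerSeries := by
  have hab : MvPowerSeries.HasSubst ![a, b] :=
    MvPowerSeries.hasSubst_of_constantCoeff_nilpotent fun s => by
      fin_cases s
      · exact ha
      · exact hb
  have h0 : PowerSeries.HasSubst (MvPowerSeries.X 0 : MvPowerSeries (Fin 2) A) :=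
    PowerSeries.HasSubst.X 0
  have h1 : PowerSeries.HasSubst (MvPowerSeries.X 1 : MvPowerSeries (Fin 2) A) :=
    PowerSeries.HasSubst.X 1
  have hX : MvPowerSeries.HasSubst
      ![PowerSeries.subst (MvPowerSeries.X 0 : MvPowerSeries (Fin 2) A) f.series,
        PowerSeries.subst (MvPowerSeries.X 1 : MvPowerSeries (Fin 2) A) f.series] :=
    MvPowerSeries.hasSubst_of_constantCoeff_zero fun s => by
      fin_cases s
      · exact PowerSeries.constantCoeff_subst_eq_zero (by simp) _ f.constantCoeff_series
      · exact PowerSeries.constantCoeff_subst_eq_zero (by simp) _ f.constantCoeff_series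
  have h := congrArg (MvPowerSeries.subst ![a, b]) f.map_law
  rw [PowerSeries.subst, MvPowerSeries.subst_comp_subst_apply (hasSubst_law F).const hab,
    MvPowerSeries.subst_comp_subst_apply hX hab] at h
  rw [PowerSeries.subst, h]
  congr 1
  funext s
  fin_cases s
  · simp [PowerSeries.subst, MvPowerSeries.subst_comp_subst_apply h0.const hab,
      MvPowerSeries.subst_X hab]
  · simp [PowerSeries.subst, MvPowerSeries.subst_comp_subst_apply h1.const hab,
      MvPowerSeries.subst_X hab]

/-- The composite `f ∘ g`. -/
def comp (f g : Endo F) : Endo F where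
  series := PowerSeries.subst g.series f.series
  constantCoeff_series :=
    PowerSeries.constantCoeff_subst_eq_zero g.constantCoeff_series _ f.constantCoeff_series
  map_law := by
    have h (i : Fin 2) : PowerSeries.HasSubst (MvPowerSeries.X i : MvPowerSeries (Fin 2) A) :=
      PowerSeries.HasSubst.X i
    have h' (i : Fin 2) : PowerSeries.HasSubst
        (PowerSeries.subst (MvPowerSeries.X i : MvPowerSeries (Fin 2) A) g.series) :=
      PowerSeries.HasSubst.of_constantCoeff_zero
        (PowerSeries.constantCoeff_subst_eq_zero (by simp) _ g.constantCoeff_series)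
    rw [PowerSeries.subst_comp_subst_apply g.hasSubst (hasSubst_law F), g.map_law,
      f.map_law' (h' 0) (h' 1), PowerSeries.subst_comp_subst_apply g.hasSubst (h 0),
      PowerSeries.subst_comp_subst_apply g.hasSubst (h 1)]

/-- The identity endomorphism `T`. -/
def id (F : FormalGroup A) : Endo F where
  series := PowerSeries.X
  constantCoeff_series := by simp
  map_law := by
    have h (i : Fin 2) : PowerSeries.HasSubst (MvPowerSeries.X i : MvPowerSeries (Fin 2) A) :=
      PowerSeries.HasSubst.X i
    rw [PowerSeries.subst_X (hasSubst_law F), PowerSeries.subst_X (h 0), PowerSeries.subst_X (h 1)]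
    have : (![MvPowerSeries.X 0, MvPowerSeries.X 1] : Fin 2 → MvPowerSeries (Fin 2) A) =
        MvPowerSeries.X := by
      funext i; fin_cases i <;> rfl
    rw [this, MvPowerSeries.subst_self]
    rfl

/-- Composition of power series makes the endomorphisms of `F` into a monoid. -/
instance : Monoid (Endo F) where
  one := id F
  mul := comp
  one_mul f := Endo.ext (PowerSeries.subst_X f.hasSubst)
  mul_one f := Endo.ext (PowerSeries.X_subst f.series)
  mul_assoc f g h :=
    Endo.ext (PowerSeries.subst_comp_subst_apply g.hasSubst h.hasSubst f.series)

/-- Applying a ring homomorphism to the coefficients of an endomorphism. -/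
def map (F : FormalGroup A) (G : FormalGroup B) (φ : A →+* B)
    (hG : G = F.map φ) : Endo F →* Endo G where
  toFun f :=
    { series := PowerSeries.map φ f.series
      constantCoeff_series := by
        rw [← PowerSeries.coeff_zero_eq_constantCoeff_apply, PowerSeries.coeff_map,
          PowerSeries.coeff_zero_eq_constantCoeff_apply, f.constantCoeff_series, map_zero]
      map_law := by
        subst hG
        have h (i : Fin 2) : PowerSeries.HasSubst (MvPowerSeries.X i : MvPowerSeries (Fin 2) A) :=
          PowerSeries.HasSubst.X i
        have h' : MvPowerSeries.HasSubst
            ![PowerSeries.subst (MvPowerSeries.X 0 : MvPowerSeries (Fin 2) A) f.series,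
              PowerSeries.subst (MvPowerSeries.X 1 : MvPowerSeries (Fin 2) A) f.series] :=
          MvPowerSeries.hasSubst_of_constantCoeff_zero fun s => by
            fin_cases s
            · exact PowerSeries.constantCoeff_subst_eq_zero (by simp) _ f.constantCoeff_series
            · exact PowerSeries.constantCoeff_subst_eq_zero (by simp) _ f.constantCoeff_series
        have e := congrArg (MvPowerSeries.map φ) f.map_law
        rw [PowerSeries.map_subst (hasSubst_law F), MvPowerSeries.map_subst h'] at e
        refine e.trans ?_
        congr 1
        funext i
        fin_cases i
        · simpa using PowerSeries.map_subst (h 0) f.series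
        · simpa using PowerSeries.map_subst (h 1) f.series }
  map_one' := Endo.ext (PowerSeries.map_X φ)
  map_mul' f g := Endo.ext (PowerSeries.map_subst g.hasSubst f.series)

end Endo

end FormalGroup

/-- The map from the coefficient ring `k` to the global sections of a scheme over `Spec k`. -/
def sectionsHom (k : Type u) [CommRing k] (S : Over (Spec (.of k))) : k →+* Γ(S.left, ⊤) :=
  ((Scheme.ΓSpecIso (.of k)).inv ≫ S.hom.appTop).hom

lemma sectionsHom_comp {k : Type u} [CommRing k] {S S' : Over (Spec (.of k))} (g : S' ⟶ S) :
    sectionsHom k S' = g.left.appTop.hom.comp (sectionsHom k S) := by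
  rw [sectionsHom, sectionsHom, ← CommRingCat.hom_comp, Category.assoc, ← Scheme.Hom.comp_appTop,
    Over.w]

lemma map_sectionsHom {k : Type u} [CommRing k] (H : FormalGroup k) {S S' : Over (Spec (.of k))}
    (g : S' ⟶ S) :
    H.map (sectionsHom k S') = (H.map (sectionsHom k S)).map g.left.appTop.hom := by
  rw [sectionsHom_comp g]
  exact FormalGroup.ext rfl

/-- The presheaf of groups `S ↦ Aut_{Γ(S)}(H)` on schemes over `k`, for a formal group law `H`
over `k`. -/
def autPresheaf {k : Type u} [CommRing k] (H : FormalGroup k) :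
    (Over (Spec (.of k)))ᵒᵖ ⥤ GrpCat.{u} where
  obj S := GrpCat.of (FormalGroup.Endo (H.map (sectionsHom k S.unop)))ˣ
  map g := GrpCat.ofHom
    (Units.map (FormalGroup.Endo.map _ _ g.unop.left.appTop.hom (map_sectionsHom H g.unop)))
  map_id S := by
    ext f n
    simp [FormalGroup.Endo.map]
  map_comp g g' := by
    ext f n
    simp [FormalGroup.Endo.map]
    rfl

/-! ### Presheaves on slice categories and maps over a morphism of the base -/

namespace SlicePresheaf

variable {C : Type*} [Category C] {D : Type*} [Category D] {a b c d : C}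

/-- The canonical map from a presheaf to its pullback along the identity. -/
def idMap (P : (Over a)ᵒᵖ ⥤ D) : P ⟶ (Over.map (𝟙 a)).op ⋙ P :=
  Functor.whiskerRight (NatTrans.op (Over.mapId a).hom) P

/-- The composite of a map over `f` and a map over `g`, as a map over `f ≫ g`. -/
def compMap {f : a ⟶ b} {g : b ⟶ c} {P : (Over a)ᵒᵖ ⥤ D} {Q : (Over b)ᵒᵖ ⥤ D}
    {R : (Over c)ᵒᵖ ⥤ D} (α : P ⟶ (Over.map f).op ⋙ Q) (β : Q ⟶ (Over.map g).op ⋙ R) :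
    P ⟶ (Over.map (f ≫ g)).op ⋙ R :=
  α ≫ Functor.whiskerLeft (Over.map f).op β ≫
    Functor.whiskerRight (NatTrans.op (Over.mapComp f g).hom) R

lemma idMap_app (P : (Over a)ᵒᵖ ⥤ D) (T : Over a) :
    (idMap P).app (op T) = P.map ((Over.mapId a).hom.app T).op := rfl

lemma compMap_app {f : a ⟶ b} {g : b ⟶ c} {P : (Over a)ᵒᵖ ⥤ D} {Q : (Over b)ᵒᵖ ⥤ D}
    {R : (Over c)ᵒᵖ ⥤ D} (α : P ⟶ (Over.map f).op ⋙ Q) (β : Q ⟶ (Over.map g).op ⋙ R)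
    (T : Over a) :
    (compMap α β).app (op T) = α.app (op T) ≫ β.app (op ((Over.map f).obj T)) ≫
      R.map ((Over.mapComp f g).hom.app T).op := rfl

instance (P : (Over a)ᵒᵖ ⥤ D) : IsIso (idMap P) := by
  unfold idMap
  infer_instance

instance {f : a ⟶ b} {g : b ⟶ c} {P : (Over a)ᵒᵖ ⥤ D} {Q : (Over b)ᵒᵖ ⥤ D}
    {R : (Over c)ᵒᵖ ⥤ D} (α : P ⟶ (Over.map f).op ⋙ Q) (β : Q ⟶ (Over.map g).op ⋙ R)
    [IsIso α] [IsIso β] : IsIso (compMap α β) := by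
  unfold compMap
  infer_instance

lemma heq_of_app {f g : a ⟶ b} {P : (Over a)ᵒᵖ ⥤ D} {Q : (Over b)ᵒᵖ ⥤ D}
    {α : P ⟶ (Over.map f).op ⋙ Q} {β : P ⟶ (Over.map g).op ⋙ Q} (h : f = g)
    (hm : ∀ T : Over a, α.app (op T) ≫ Q.map (Over.homMk (𝟙 T.left) (by simp [h]) :
      (Over.map g).obj T ⟶ (Over.map f).obj T).op = β.app (op T)) : HEq α β := by
  subst h
  refine heq_of_eq ?_
  ext T : 2
  have e : (Over.homMk (𝟙 T.unop.left) (by simp) :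
      (Over.map f).obj T.unop ⟶ (Over.map f).obj T.unop) = 𝟙 _ := by
    ext
    simp
  have := hm T.unop
  rw [e] at this
  exact ((congrArg (α.app T ≫ ·) (Q.map_id _)).trans (Category.comp_id _)).symm.trans this

lemma idMap_compMap {f : a ⟶ b} {P : (Over a)ᵒᵖ ⥤ D} {Q : (Over b)ᵒᵖ ⥤ D}
    (α : P ⟶ (Over.map f).op ⋙ Q) : HEq (compMap (idMap P) α) α := by
  refine heq_of_app (Category.id_comp f) fun T => ?_
  rw [compMap_app, idMap_app, α.naturality_assoc, Functor.comp_map, Category.assoc,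
    Category.assoc]
  refine (congrArg (α.app (op T) ≫ ·) ?_).trans (Category.comp_id _)
  rw [← Functor.map_comp, ← Functor.map_comp]
  refine Eq.trans (congrArg Q.map ?_) (Q.map_id _)
  apply Quiver.Hom.unop_inj
  ext
  simp

lemma compMap_idMap {f : a ⟶ b} {P : (Over a)ᵒᵖ ⥤ D} {Q : (Over b)ᵒᵖ ⥤ D}
    (α : P ⟶ (Over.map f).op ⋙ Q) : HEq (compMap α (idMap Q)) α := by
  refine heq_of_app (Category.comp_id f) fun T => ?_
  rw [compMap_app, idMap_app, Category.assoc, Category.assoc]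
  refine (congrArg (α.app (op T) ≫ ·) ?_).trans (Category.comp_id _)
  rw [← Functor.map_comp, ← Functor.map_comp]
  refine Eq.trans (congrArg Q.map ?_) (Q.map_id _)
  apply Quiver.Hom.unop_inj
  ext
  simp

lemma compMap_assoc {f : a ⟶ b} {g : b ⟶ c} {k : c ⟶ d} {P : (Over a)ᵒᵖ ⥤ D}
    {Q : (Over b)ᵒᵖ ⥤ D} {R : (Over c)ᵒᵖ ⥤ D} {V : (Over d)ᵒᵖ ⥤ D}
    (α : P ⟶ (Over.map f).op ⋙ Q) (β : Q ⟶ (Over.map g).op ⋙ R) (γ : R ⟶ (Over.map k).op ⋙ V) :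
    HEq (compMap (compMap α β) γ) (compMap α (compMap β γ)) := by
  refine heq_of_app (Category.assoc f g k) fun T => ?_
  simp only [compMap_app, Category.assoc]
  rw [γ.naturality_assoc, Functor.comp_map]
  refine congrArg (α.app (op T) ≫ ·) (congrArg (β.app _ ≫ ·) (congrArg (γ.app _ ≫ ·) ?_))
  simp only [← Functor.map_comp]
  refine congrArg V.map ?_
  apply Quiver.Hom.unop_inj
  ext
  simp

end SlicePresheaf

/-! ### Torsors and classifying stacks -/

section Torsors

variable {C : Type u} [Category.{v} C]

/-- A (right) `G`-torsor over `S` for the topology `J`: a `J`-sheaf on `C/S` with an action of `G`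
that is simply transitive and that has sections `J`-locally on `S`. -/
structure SheafTorsor (J : GrothendieckTopology C) (G : Cᵒᵖ ⥤ GrpCat.{w}) (S : C) where
  sheaf : (Over S)ᵒᵖ ⥤ Type w
  isSheaf : Presheaf.IsSheaf (J.over S) sheaf
  act (T : Over S) : sheaf.obj (op T) → G.obj (op T.left) → sheaf.obj (op T)
  act_one (T : Over S) (x : sheaf.obj (op T)) : act T x 1 = x
  act_mul (T : Over S) (x : sheaf.obj (op T)) (g g' : G.obj (op T.left)) :
    act T x (g * g') = act T (act T x g) g'
  map_act {T T' : Over S} (f : T' ⟶ T) (x : sheaf.obj (op T)) (g : G.obj (op T.left)) :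
    sheaf.map f.op (act T x g) = act T' (sheaf.map f.op x) (G.map f.left.op g)
  existsUnique_act (T : Over S) (x y : sheaf.obj (op T)) : ∃! g, act T x g = y
  locally_nonempty : ∃ R ∈ J S, ∀ ⦃S' : C⦄ (f : S' ⟶ S), R f →
    Nonempty (sheaf.obj (op (Over.mk f)))

/-- The objects of the classifying stack of `G`: pairs of an object `S` of the site and a `G`-torsor
over `S`. -/
structure BG (J : GrothendieckTopology C) (G : Cᵒᵖ ⥤ GrpCat.{w}) where
  base : C
  torsor : SheafTorsor J G base

namespace BG

variable {J : GrothendieckTopology C} {G : Cᵒᵖ ⥤ GrpCat.{w}}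

/-- A morphism of torsors over a morphism `f` of the site: an equivariant map to the pullback along
`f`. -/
@[ext]
structure Hom (X Y : BG J G) where
  base : X.base ⟶ Y.base
  map : X.torsor.sheaf ⟶ (Over.map base).op ⋙ Y.torsor.sheaf
  map_act (T : Over X.base) (x : X.torsor.sheaf.obj (op T)) (g : G.obj (op T.left)) :
    map.app (op T) (X.torsor.act T x g) =
      Y.torsor.act ((Over.map base).obj T) (map.app (op T) x) g

/-- The identity of a torsor. -/
def Hom.id (X : BG J G) : Hom X X where
  base := 𝟙 X.base
  map := SlicePresheaf.idMap X.torsor.sheaf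
  map_act T x g := by
    simpa [SlicePresheaf.idMap] using X.torsor.map_act ((Over.mapId X.base).hom.app T) x g

/-- The composite of two morphisms of torsors. -/
def Hom.comp {X Y Z : BG J G} (f : Hom X Y) (g : Hom Y Z) : Hom X Z where
  base := f.base ≫ g.base
  map := SlicePresheaf.compMap f.map g.map
  map_act T x a := by
    have h := Z.torsor.map_act ((Over.mapComp f.base g.base).hom.app T)
      (g.map.app (op ((Over.map f.base).obj T)) (f.map.app (op T) x)) a
    simpa [SlicePresheaf.compMap, f.map_act, g.map_act] using h

instance : Category (BG J G) where
  Hom := Hom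
  id := Hom.id
  comp := Hom.comp
  id_comp f := Hom.ext (Category.id_comp _) (SlicePresheaf.idMap_compMap f.map)
  comp_id f := Hom.ext (Category.comp_id _) (SlicePresheaf.compMap_idMap f.map)
  assoc f g h := Hom.ext (Category.assoc _ _ _) (SlicePresheaf.compMap_assoc f.map g.map h.map)

/-- The projection of the classifying stack to the site. -/
def proj (J : GrothendieckTopology C) (G : Cᵒᵖ ⥤ GrpCat.{w}) : BG J G ⥤ C where
  obj X := X.base
  map f := f.base

end BG

end Torsors

/-! ### Formal Lie groups -/

/-- The functor of points of `Spf ℤ⟦T⟧`: a point with values in a scheme is a global section that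
is locally nilpotent. -/
def formalLine : Scheme.{u}ᵒᵖ ⥤ Type u where
  obj T := {a : Γ(T.unop, ⊤) // ∀ x : T.unop, ∃ U : T.unop.Opens, x ∈ U ∧
    IsNilpotent (T.unop.presheaf.map (homOfLE le_top : U ⟶ ⊤).op a)}
  map {T T'} f := ↾fun a => ⟨f.unop.appTop a.1, fun x => by
    obtain ⟨U, hU, n, hn⟩ := a.2 (f.unop x)
    refine ⟨f.unop ⁻¹ᵁ U, hU, n, ?_⟩
    have h := congrArg (f.unop.app U) hn
    rw [map_pow, map_zero] at h
    rw [← h]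
    congr 1
    exact (ConcreteCategory.congr_hom (f.unop.naturality (homOfLE le_top : U ⟶ ⊤).op) a.1).symm⟩
  map_id T := by
    ext a
    change (𝟙 T : T ⟶ T).unop.appTop a.1 = a.1
    simp
  map_comp f g := by
    ext a
    change (f ≫ g).unop.appTop a.1 = g.unop.appTop (f.unop.appTop a.1)
    rw [unop_comp, Scheme.Hom.comp_appTop, ConcreteCategory.comp_apply]

/-- The zero section of the formal line. -/
def formalLineZero (T : Scheme.{u}ᵒᵖ) : formalLine.obj T :=
  ⟨0, fun _ => ⟨⊤, trivial, by simp⟩⟩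

section

variable {S : Scheme.{u}}

/-- A (pointed, one-parameter) formal Lie variety over `S`: an fppf sheaf `X` on schemes over `S`
with a section `σ` that is, Zariski locally on `S`, isomorphic as a pointed sheaf to
`Spf 𝒪_S⟦T⟧` with its zero section. -/
structure IsFormalLieVariety (X : (Over S)ᵒᵖ ⥤ Type u) (σ : ∀ T, X.obj T) : Prop where
  isSheaf : Presheaf.IsSheaf (Scheme.fppfTopology.over S) X
  map_section {T T' : (Over S)ᵒᵖ} (f : T ⟶ T') : X.map f (σ T) = σ T'
  locally_trivial (s : S) : ∃ U : S.Opens, s ∈ U ∧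
    ∃ e : (Over.map U.ι).op ⋙ X ≅ (Over.forget (U : Scheme.{u})).op ⋙ formalLine,
      ∀ T, e.hom.app T (σ _) = formalLineZero _

variable (S) in
/-- A (commutative, one-parameter) formal Lie group over `S`. -/
structure FormalLieGroup where
  presheaf : (Over S)ᵒᵖ ⥤ AddCommGrpCat.{u}
  isFormalLieVariety : IsFormalLieVariety (presheaf ⋙ forget _) (fun T => (0 : presheaf.obj T))

/-! ### Infinitesimal neighbourhoods and height -/

variable (X : (Over S)ᵒᵖ ⥤ AddCommGrpCat.{u})

/-- The point `x : T ⟶ X` restricts to the zero section on a closed subscheme of `T` that is defined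
by a quasi-coherent ideal `I` with `I ^ (n + 1) = 0`. -/
def IsInfinitesimalPoint (n : ℕ) {T : Over S} (x : X.obj (op T)) : Prop :=
  ∃ I : T.left.IdealSheafData, I ^ (n + 1) = ⊥ ∧
    X.map (Over.homMk I.subschemeι : Over.mk (I.subschemeι ≫ T.hom) ⟶ T).op x = 0

/-- The `n`-th infinitesimal neighbourhood `X⁽ⁿ⁾` of the zero section in `X`: the points of `X`
that satisfy `IsInfinitesimalPoint` fppf locally. -/
def infNeighbourhood (n : ℕ) : Subfunctor (X ⋙ forget AddCommGrpCat.{u}) where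
  obj T := {x : X.obj T | ∃ R ∈ Scheme.fppfTopology.over S T.unop, ∀ ⦃T' : Over S⦄
    (g : T' ⟶ T.unop), R g → IsInfinitesimalPoint X n (X.map g.op x)}
  map {T T'} f := by
    rintro x ⟨R, hR, h⟩
    refine ⟨R.pullback f.unop, (Scheme.fppfTopology.over S).pullback_stable _ hR,
      fun T'' g hg => ?_⟩
    have h' := h _ hg
    rw [op_comp, Functor.map_comp, ConcreteCategory.comp_apply] at h'
    exact h'

variable {X} in
lemma nsmul_mem_infNeighbourhood {n : ℕ} (m : ℕ) {T : (Over S)ᵒᵖ} {x : X.obj T}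
    (hx : x ∈ (infNeighbourhood X n).obj T) : m • x ∈ (infNeighbourhood X n).obj T := by
  obtain ⟨R, hR, h⟩ := hx
  refine ⟨R, hR, fun T' g hg => ?_⟩
  obtain ⟨I, hI, h0⟩ := h g hg
  exact ⟨I, hI, by rw [map_nsmul, map_nsmul, h0, smul_zero]⟩

/-- The ring of functions on the restriction of `X⁽ⁿ⁾` to an open subscheme `U` of `S`, that is, the
natural transformations from this restriction to the structure sheaf. -/
def infFunctions (n : ℕ) (U : S.Opens) : Subring (∀ T : Over (U : Scheme.{u}),
    (infNeighbourhood X n).obj (op ((Over.map U.ι).obj T)) → Γ(T.left, ⊤)) where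
  carrier := {f | ∀ ⦃T T' : Over (U : Scheme.{u})⦄ (g : T' ⟶ T)
    (x : (infNeighbourhood X n).obj (op ((Over.map U.ι).obj T))),
      f T' ⟨X.map ((Over.map U.ι).map g).op x.1, (infNeighbourhood X n).map _ x.2⟩ =
        g.left.appTop (f T x)}
  mul_mem' := by
    intro f f' hf hf' T T' g x
    simp [hf g x, hf' g x]
  one_mem' := by
    intro T T' g x
    simp
  add_mem' := by
    intro f f' hf hf' T T' g x
    simp [hf g x, hf' g x]
  zero_mem' := by
    intro T T' g x
    simp
  neg_mem' := by
    intro f hf T T' g x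
    simp [hf g x]

/-- The ideal of the functions on `X⁽ⁿ⁾` that vanish on the zero section. -/
def augIdeal (n : ℕ) (U : S.Opens) : Ideal (infFunctions X n U) where
  carrier := {f | ∀ T x, x.1 = (0 : X.obj (op ((Over.map U.ι).obj T))) → f.1 T x = 0}
  add_mem' := by
    intro f f' hf hf' T x hx
    simp [hf T x hx, hf' T x hx]
  zero_mem' := by
    intro T x hx
    simp
  smul_mem' := by
    intro a f hf T x hx
    simp [hf T x hx]

variable {X} in
/-- The pullback of a function on `X⁽ⁿ⁾` along multiplication by `m`. -/
def pullbackMul (m : ℕ) {n : ℕ} {U : S.Opens} (f : infFunctions X n U) : infFunctions X n U :=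
  ⟨fun T x => f.1 T ⟨m • x.1, nsmul_mem_infNeighbourhood m x.2⟩, by
    intro T T' g x
    rw [← f.2 g]
    exact congrArg (f.1 T')
      (Subtype.ext (map_nsmul (X.map ((Over.map U.ι).map g).op).hom m x.1).symm)⟩

/-- Height at least `h`: multiplication by `p` on `X⁽ⁿ⁾`, where `n = p ^ h`, maps the ideal `I` of
the zero section to `I ^ (p ^ h)`. The ideals are quasi-coherent, so this is tested on the affine
open subschemes of `S`. -/
def HasHeightGE (p h : ℕ) : Prop :=
  ∀ U : S.affineOpens, ∀ f ∈ augIdeal X (p ^ h) U.1,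
    pullbackMul p f ∈ augIdeal X (p ^ h) U.1 ^ (p ^ h)

/-- (Exact) height `h`: the height is at least `h`, and no base change of `X` to a nonempty scheme
has height at least `h + 1`. -/
def HasHeight (p h : ℕ) : Prop :=
  HasHeightGE X p h ∧
    ∀ (T : Scheme.{u}) (f : T ⟶ S), HasHeightGE ((Over.map f).op ⋙ X) p (h + 1) → IsEmpty T

end

/-! ### The stack of formal Lie groups and its height strata -/

/-- The objects of the stack of formal Lie groups: a scheme and a formal Lie group over it. -/
structure FLG where
  base : Scheme.{u}
  group : FormalLieGroup base

namespace FLG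

/-- A morphism over a morphism of schemes `f`: an isomorphism of groups to the pullback along `f`. -/
@[ext]
structure Hom (X Y : FLG.{u}) where
  base : X.base ⟶ Y.base
  map : X.group.presheaf ⟶ (Over.map base).op ⋙ Y.group.presheaf
  isIso_map : IsIso map

attribute [instance] Hom.isIso_map

instance : Category FLG.{u} where
  Hom := Hom
  id X := ⟨𝟙 X.base, SlicePresheaf.idMap X.group.presheaf, inferInstance⟩
  comp f g := ⟨f.base ≫ g.base, SlicePresheaf.compMap f.map g.map, inferInstance⟩
  id_comp f := Hom.ext (Category.id_comp _) (SlicePresheaf.idMap_compMap f.map)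
  comp_id f := Hom.ext (Category.comp_id _) (SlicePresheaf.compMap_idMap f.map)
  assoc f g h := Hom.ext (Category.assoc _ _ _) (SlicePresheaf.compMap_assoc f.map g.map h.map)

/-- The projection of the stack of formal Lie groups to the category of schemes. -/
def proj : FLG.{u} ⥤ Scheme.{u} where
  obj X := X.base
  map f := f.base

/-- The formal Lie groups of height `h`. -/
def hasHeight (p h : ℕ) : ObjectProperty FLG.{u} :=
  fun X => HasHeight X.group.presheaf p h

end FLG

/-- The stratum of formal Lie groups of height `h` with respect to `p`, as a category over the
category of schemes. -/
def FLGHeight (p h : ℕ) : BasedCategory Scheme.{u} :=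
  BasedCategory.ofFunctor ((FLG.hasHeight.{u} p h).ι ⋙ FLG.proj)

/-- The prime field `ZMod p` in the universe `u`. -/
abbrev Fp (p : ℕ) : Type u := ULift.{u} (ZMod p)

/-- The category of torsors for the fpqc topology under `Aut(H)` over schemes over `ZMod p`, as a
category over the category of schemes. -/
def BAut (p : ℕ) (H : FormalGroup (ZMod p)) : BasedCategory Scheme.{u} :=
  BasedCategory.ofFunctor
    (BG.proj (Scheme.fpqcTopology.over (Spec (.of (Fp.{u} p))))
      (autPresheaf (H.map (ULift.ringEquiv.symm : ZMod p ≃+* Fp.{u} p).toRingHom)) ⋙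
        Over.forget _)

end

noncomputable section

/-! ### Equivalences of based categories -/

namespace BasedCategory

open CategoryTheory.Functor

universe v₁ u₁ v₂ u₂

variable {𝒮 : Type u₁} [Category.{v₁} 𝒮] {𝒳 𝒴 : BasedCategory.{v₂, u₂} 𝒮}

/-- The functor inverse to a fully faithful functor, on chosen preimages. -/
def chosenInverse (F : 𝒳.obj ⥤ 𝒴.obj) [F.Full] [F.Faithful] (r : 𝒴.obj → 𝒳.obj)
    (e : ∀ y, F.obj (r y) ≅ y) : 𝒴.obj ⥤ 𝒳.obj where
  obj := r
  map {y y'} f := F.preimage ((e y).hom ≫ f ≫ (e y').inv)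
  map_id y := F.map_injective (by simp)
  map_comp f g := F.map_injective (by simp)

/-- The chosen isomorphisms are natural. -/
def chosenInverseCounit (F : 𝒳.obj ⥤ 𝒴.obj) [F.Full] [F.Faithful] (r : 𝒴.obj → 𝒳.obj)
    (e : ∀ y, F.obj (r y) ≅ y) : chosenInverse F r e ⋙ F ≅ 𝟭 𝒴.obj :=
  NatIso.ofComponents e fun {y y'} f => by simp [chosenInverse]

/-- The preimages of the chosen isomorphisms are natural. -/
def chosenInverseUnit (F : 𝒳.obj ⥤ 𝒴.obj) [F.Full] [F.Faithful] (r : 𝒴.obj → 𝒳.obj)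
    (e : ∀ y, F.obj (r y) ≅ y) : 𝟭 𝒳.obj ≅ F ⋙ chosenInverse F r e :=
  NatIso.ofComponents (fun x => (F.preimageIso (e (F.obj x))).symm) fun {x x'} f =>
    F.map_injective (by simp [chosenInverse])

/-- A fully faithful functor over the base that is surjective up to vertical isomorphisms is an
equivalence over the base. -/
theorem nonempty_equivalence (F : BasedFunctor 𝒳 𝒴) [F.toFunctor.Full] [F.toFunctor.Faithful]
    (hF : ∀ y : 𝒴.obj, ∃ (x : 𝒳.obj) (e : F.obj x ≅ y), 𝒴.p.IsHomLift (𝟙 (𝒴.p.obj y)) e.hom) :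
    Nonempty (Bicategory.Equivalence 𝒳 𝒴) := by
  choose r e he using hF
  have hr (y : 𝒴.obj) : 𝒳.p.obj (r y) = 𝒴.p.obj y :=
    (F.w_obj (r y)).symm.trans (IsHomLift.domain_eq 𝒴.p (𝟙 (𝒴.p.obj y)) (e y).hom)
  have hinv (y : 𝒴.obj) : 𝒴.p.IsHomLift (𝟙 (𝒴.p.obj y)) (e y).inv := by
    have := he y
    exact IsHomLift.lift_id_inv 𝒴.p (𝒴.p.obj y) (e y)
  let G : BasedFunctor 𝒴 𝒳 :=
    { toFunctor := chosenInverse F.toFunctor r e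
      w := by
        refine CategoryTheory.Functor.ext hr fun y y' f => ?_
        have h1 : 𝒴.p.IsHomLift (𝒴.p.map f) ((e y).hom ≫ f ≫ (e y').inv) := by
          have := he y
          have := hinv y'
          have h2 : 𝒴.p.IsHomLift (𝒴.p.map f) (f ≫ (e y').inv) :=
            IsHomLift.comp_lift_id_right 𝒴.p (𝒴.p.map f) f _
          exact IsHomLift.comp_lift_id_left' 𝒴.p (𝒴.p.obj y) (e y).hom (𝒴.p.map f) _
        have h3 : 𝒴.p.IsHomLift (𝒴.p.map f)
            (F.map ((chosenInverse F.toFunctor r e).map f)) := by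
          have : F.map ((chosenInverse F.toFunctor r e).map f) = (e y).hom ≫ f ≫ (e y').inv :=
            F.toFunctor.map_preimage _
          rwa [this]
        have h4 := F.isHomLift_map (𝒴.p.map f) ((chosenInverse F.toFunctor r e).map f)
        have := IsHomLift.fac' 𝒳.p (𝒴.p.map f) ((chosenInverse F.toFunctor r e).map f)
        simpa using this }
  let ε : BasedFunctor.comp G F ≅ BasedFunctor.id 𝒴 := BasedNatIso.mkNatIso
    (chosenInverseCounit F.toFunctor r e) he
  let η : BasedFunctor.id 𝒳 ≅ BasedFunctor.comp F G := BasedNatIso.mkNatIso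
    (chosenInverseUnit F.toFunctor r e) fun x => by
    have h1 : 𝒴.p.IsHomLift (𝟙 (𝒳.p.obj x)) (F.map (F.toFunctor.preimage (e (F.obj x)).inv)) := by
      have : F.map (F.toFunctor.preimage (e (F.obj x)).inv) = (e (F.obj x)).inv :=
        F.toFunctor.map_preimage _
      rw [this]
      have := hinv (F.obj x)
      rwa [F.w_obj] at this
    exact F.isHomLift_map (𝟙 (𝒳.p.obj x)) (F.toFunctor.preimage (e (F.obj x)).inv)
  exact ⟨Bicategory.Equivalence.mkOfAdjointifyCounit (f := F) (g := G) η ε⟩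

end BasedCategory

end

noncomputable section

/-! ### Gluing sections of sheaves -/

namespace Presieve'

variable {C : Type u} [Category.{v} C] {J : GrothendieckTopology C} {P : Cᵒᵖ ⥤ Type w}

lemma ext_of_cover (hP : Presieve.IsSheaf J P) {T : C} {R : Sieve T} (hR : R ∈ J T)
    {x y : P.obj (op T)} (h : ∀ ⦃V : C⦄ (f : V ⟶ T), R f → P.map f.op x = P.map f.op y) :
    x = y :=
  (hP R hR).isSeparatedFor.ext fun _ f hf => h f hf

lemma exists_glue (hP : Presieve.IsSheaf J P) {T : C} {R : Sieve T} (hR : R ∈ J T)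
    (x : ∀ ⦃V : C⦄ (f : V ⟶ T), R f → P.obj (op V))
    (hx : ∀ ⦃V W : C⦄ (f : V ⟶ T) (hf : R f) (g : W ⟶ V),
      P.map g.op (x f hf) = x (g ≫ f) (R.downward_closed hf g)) :
    ∃ t : P.obj (op T), ∀ ⦃V : C⦄ (f : V ⟶ T) (hf : R f), P.map f.op t = x f hf := by
  have hc : Presieve.FamilyOfElements.SieveCompatible (P := P) (S := R) x :=
    fun V W f g hf => (hx f hf g).symm
  obtain ⟨t, ht, -⟩ := hP R hR x
    ((Presieve.compatible_iff_sieveCompatible x).2 hc)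
  exact ⟨t, fun V f hf => ht f hf⟩

/-- A family that is locally constant along nonempty sets of parameters descends. -/
lemma exists_descent (hP : Presieve.IsSheaf J P) {T : C} {R : Sieve T} (hR : R ∈ J T)
    {A : C → Type*} (res : ∀ ⦃V W : C⦄ (_ : W ⟶ V), A V → A W)
    (hA : ∀ ⦃V : C⦄ (f : V ⟶ T), R f → Nonempty (A V))
    (K : ∀ ⦃V : C⦄ (_ : V ⟶ T), A V → P.obj (op V))
    (hK : ∀ ⦃V : C⦄ (f : V ⟶ T) (a b : A V), K f a = K f b)
    (hres : ∀ ⦃V W : C⦄ (f : V ⟶ T) (g : W ⟶ V) (a : A V),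
      P.map g.op (K f a) = K (g ≫ f) (res g a)) :
    ∃ t : P.obj (op T), ∀ ⦃V : C⦄ (f : V ⟶ T) (a : A V), P.map f.op t = K f a := by
  obtain ⟨t, ht⟩ := exists_glue hP hR (fun V f hf => K f (hA f hf).some)
    fun V W f hf g => by
      rw [hres]
      exact hK _ _ _
  refine ⟨t, fun V f a => ext_of_cover hP (J.pullback_stable f hR) fun W g hg => ?_⟩
  have h := ht (g ≫ f) hg
  rw [op_comp, P.map_comp, ConcreteCategory.comp_apply] at h
  rw [h, hres]
  exact hK _ _ _

end Presieve'

/-! ### Frames of forms of a sheaf of groups -/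

/-- A sheaf of groups `E` with an action of `G` such that the sections of `G` over `T` are the
automorphisms of the restriction of `E` to `T`. -/
structure AutAction {C : Type u} [Category.{v} C] (J : GrothendieckTopology C)
    (G : Cᵒᵖ ⥤ GrpCat.{w}) (E : Cᵒᵖ ⥤ AddCommGrpCat.{w}) where
  isSheaf : Presieve.IsSheaf J (E ⋙ forget _)
  act (T : C) (g : G.obj (op T)) : E.obj (op T) →+ E.obj (op T)
  act_one {T : C} (e : E.obj (op T)) : act T 1 e = e
  act_mul {T : C} (g g' : G.obj (op T)) (e : E.obj (op T)) : act T (g * g') e = act T g (act T g' e)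
  map_act {T T' : C} (f : T' ⟶ T) (g : G.obj (op T)) (e : E.obj (op T)) :
    E.map f.op (act T g e) = act T' (G.map f.op g) (E.map f.op e)
  existsUnique (T : C) (α : ∀ ⦃W : C⦄ (_ : W ⟶ T), E.obj (op W) →+ E.obj (op W))
    (hα : ∀ ⦃W W' : C⦄ (f : W' ⟶ W) (w : W ⟶ T) (e : E.obj (op W)),
      E.map f.op (α w e) = α (f ≫ w) (E.map f.op e))
    (hb : ∀ ⦃W : C⦄ (w : W ⟶ T), Function.Bijective (α w)) :
    ∃! g : G.obj (op T), ∀ ⦃W : C⦄ (w : W ⟶ T) (e : E.obj (op W)),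
      α w e = act W (G.map w.op g) e
  small (T : C) (R : Sieve T) (_ : R ∈ J T) : ∃ (I : Type w) (Y : I → C) (f : ∀ i, Y i ⟶ T),
    (∀ i, R (f i)) ∧ Sieve.ofArrows Y f ∈ J T

namespace AutAction

variable {C : Type u} [Category.{v} C] {J : GrothendieckTopology C}
  {G : Cᵒᵖ ⥤ GrpCat.{w}} {E : Cᵒᵖ ⥤ AddCommGrpCat.{w}}

lemma act_inv_act (M : AutAction J G E) {T : C} (g : G.obj (op T)) (e : E.obj (op T)) :
    M.act T g⁻¹ (M.act T g e) = e := by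
  rw [← M.act_mul, inv_mul_cancel, M.act_one]

lemma act_act_inv (M : AutAction J G E) {T : C} (g : G.obj (op T)) (e : E.obj (op T)) :
    M.act T g (M.act T g⁻¹ e) = e := by
  rw [← M.act_mul, mul_inv_cancel, M.act_one]

lemma act_bijective (M : AutAction J G E) {T : C} (g : G.obj (op T)) :
    Function.Bijective (M.act T g) :=
  Function.bijective_iff_has_inverse.2 ⟨M.act T g⁻¹, M.act_inv_act g, M.act_act_inv g⟩

end AutAction

section

variable {C : Type u} [Category.{v} C] {J : GrothendieckTopology C}
  {G : Cᵒᵖ ⥤ GrpCat.{w}} {E : Cᵒᵖ ⥤ AddCommGrpCat.{w}} {S : C}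

/-- A frame of `X` over `T`: an isomorphism of the restriction of `E` to `T` with the restriction
of `X`. -/
@[ext]
structure Frame (E : Cᵒᵖ ⥤ AddCommGrpCat.{w}) (X : (Over S)ᵒᵖ ⥤ AddCommGrpCat.{w})
    (T : Over S) where
  hom ⦃V : Over S⦄ (v : V ⟶ T) : E.obj (op V.left) →+ X.obj (op V)
  map_hom ⦃V V' : Over S⦄ (f : V' ⟶ V) (v : V ⟶ T) (e : E.obj (op V.left)) :
    X.map f.op (hom v e) = hom (f ≫ v) (E.map f.left.op e)
  bijective ⦃V : Over S⦄ (v : V ⟶ T) : Function.Bijective (hom v)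

namespace Frame

variable {X : (Over S)ᵒᵖ ⥤ AddCommGrpCat.{w}} {T T' T'' : Over S}

/-- The coordinate of a section with respect to a frame. -/
def coord (φ : Frame E X T) {V : Over S} (v : V ⟶ T) (x : X.obj (op V)) : E.obj (op V.left) :=
  (Equiv.ofBijective _ (φ.bijective v)).symm x

@[simp]
lemma hom_coord (φ : Frame E X T) {V : Over S} (v : V ⟶ T) (x : X.obj (op V)) :
    φ.hom v (φ.coord v x) = x :=
  (Equiv.ofBijective _ (φ.bijective v)).apply_symm_apply x

@[simp]
lemma coord_hom (φ : Frame E X T) {V : Over S} (v : V ⟶ T) (e : E.obj (op V.left)) :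
    φ.coord v (φ.hom v e) = e :=
  (Equiv.ofBijective _ (φ.bijective v)).symm_apply_apply e

lemma map_coord (φ : Frame E X T) {V V' : Over S} (f : V' ⟶ V) (v : V ⟶ T) (x : X.obj (op V)) :
    E.map f.left.op (φ.coord v x) = φ.coord (f ≫ v) (X.map f.op x) := by
  apply (φ.bijective (f ≫ v)).1
  rw [hom_coord, ← φ.map_hom, hom_coord]

/-- Restriction of frames. -/
def restrict (φ : Frame E X T) (f : T' ⟶ T) : Frame E X T' where
  hom V v := φ.hom (v ≫ f)
  map_hom V V' g v e := by rw [φ.map_hom, Category.assoc]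
  bijective V v := φ.bijective _

@[simp]
lemma restrict_hom (φ : Frame E X T) (f : T' ⟶ T) {V : Over S} (v : V ⟶ T') :
    (φ.restrict f).hom v = φ.hom (v ≫ f) := rfl

lemma restrict_id (φ : Frame E X T) : φ.restrict (𝟙 T) = φ := by
  ext V v e
  simp

lemma restrict_comp (φ : Frame E X T) (f : T' ⟶ T) (g : T'' ⟶ T') :
    φ.restrict (g ≫ f) = (φ.restrict f).restrict g := by
  ext V v e
  simp

/-- The action of `G` on frames. -/
def act (M : AutAction J G E) (φ : Frame E X T) (g : G.obj (op T.left)) : Frame E X T where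
  hom V v := (φ.hom v).comp (M.act V.left (G.map v.left.op g))
  map_hom V V' f v e := by
    rw [AddMonoidHom.comp_apply, AddMonoidHom.comp_apply, φ.map_hom, M.map_act, Over.comp_left,
      op_comp, Functor.map_comp_apply]
  bijective V v := (φ.bijective v).comp (M.act_bijective _)

lemma act_hom (M : AutAction J G E) (φ : Frame E X T) (g : G.obj (op T.left)) {V : Over S}
    (v : V ⟶ T) (e : E.obj (op V.left)) :
    (φ.act M g).hom v e = φ.hom v (M.act V.left (G.map v.left.op g) e) := rfl

lemma hom_eq_map (φ : Frame E X T) {V : Over S} (v : V ⟶ T) (e : E.obj (op V.left)) :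
    φ.hom v e = X.map (Over.homMk (𝟙 V.left) : V ⟶ Over.mk (v.left ≫ T.hom)).op
      (φ.hom (Over.homMk v.left : Over.mk (v.left ≫ T.hom) ⟶ T) e) := by
  rw [φ.map_hom]
  have h : (Over.homMk (𝟙 V.left) : V ⟶ Over.mk (v.left ≫ T.hom)) ≫
      (Over.homMk v.left : Over.mk (v.left ≫ T.hom) ⟶ T) = v := by ext; simp
  rw [h]
  exact congrArg (φ.hom v) (by simp)

lemma existsUnique_act (M : AutAction J G E) (φ ψ : Frame E X T) :
    ∃! g : G.obj (op T.left), φ.act M g = ψ := by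
  obtain ⟨g, hg, hu⟩ := M.existsUnique T.left
    (fun W w => AddMonoidHom.mk' (fun e => φ.coord (Over.homMk w : Over.mk (w ≫ T.hom) ⟶ T)
      (ψ.hom (Over.homMk w : Over.mk (w ≫ T.hom) ⟶ T) e)) fun a b => by
        apply (φ.bijective (Over.homMk w : Over.mk (w ≫ T.hom) ⟶ T)).1
        rw [map_add, map_add, hom_coord, hom_coord, hom_coord])
    (fun W W' f w e => by
      have hf := φ.map_coord (Over.homMk f : Over.mk ((f ≫ w) ≫ T.hom) ⟶ Over.mk (w ≫ T.hom))
        (Over.homMk w : Over.mk (w ≫ T.hom) ⟶ T) (ψ.hom (Over.homMk w) e)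
      refine hf.trans ?_
      rw [ψ.map_hom]
      have : (Over.homMk f : Over.mk ((f ≫ w) ≫ T.hom) ⟶ Over.mk (w ≫ T.hom)) ≫
        (Over.homMk w : Over.mk (w ≫ T.hom) ⟶ T) = Over.homMk (f ≫ w) := by ext; simp
      rw [this]
      rfl)
    (fun W w => by
      refine ((Equiv.ofBijective _ (φ.bijective _)).symm.bijective).comp (ψ.bijective _))
  have key (g : G.obj (op T.left)) : φ.act M g = ψ ↔ ∀ ⦃W : C⦄ (w : W ⟶ T.left)
      (e : E.obj (op W)), φ.coord (Over.homMk w : Over.mk (w ≫ T.hom) ⟶ T)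
        (ψ.hom (Over.homMk w : Over.mk (w ≫ T.hom) ⟶ T) e) = M.act W (G.map w.op g) e := by
    refine ⟨?_, fun h => ?_⟩
    · rintro rfl W w e
      rw [act_hom, coord_hom]
      rfl
    · ext V v e
      rw [hom_eq_map, hom_eq_map ψ, act_hom]
      refine congrArg _ (Eq.trans (congrArg (φ.hom (Over.homMk v.left :
        Over.mk (v.left ≫ T.hom) ⟶ T)) (h v.left e).symm) ?_)
      rw [hom_coord]
  exact ⟨g, (key g).2 fun W w e => hg w e, fun g' hg' => hu g' fun W w e => (key g').1 hg' w e⟩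

lemma act_restrict (M : AutAction J G E) (φ : Frame E X T) (g : G.obj (op T.left)) (f : T' ⟶ T) :
    (φ.act M g).restrict f = (φ.restrict f).act M (G.map f.left.op g) := by
  ext V v e
  rw [restrict_hom, act_hom, act_hom, restrict_hom, Over.comp_left, op_comp,
    Functor.map_comp_apply]

lemma act_one (M : AutAction J G E) (φ : Frame E X T) : φ.act M 1 = φ := by
  ext V v e
  rw [act_hom, map_one, M.act_one]

lemma act_mul (M : AutAction J G E) (φ : Frame E X T) (g g' : G.obj (op T.left)) :
    φ.act M (g * g') = (φ.act M g).act M g' := by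
  ext V v e
  rw [act_hom, map_mul, M.act_mul, act_hom, act_hom]

lemma small (M : AutAction J G E) : Small.{w} (Frame E X T) := by
  by_cases h : Nonempty (Frame E X T)
  · obtain ⟨φ⟩ := h
    exact small_of_surjective (f := fun g : G.obj (op T.left) => φ.act M g) fun ψ =>
      (existsUnique_act M φ ψ).exists
  · have := not_nonempty_iff.1 h
    infer_instance

/-- Frames glue. -/
lemma exists_glue (M : AutAction J G E) (hX : Presieve.IsSheaf (J.over S) (X ⋙ forget _))
    {R : Sieve T} (hR : R ∈ J.over S T) (φ : ∀ ⦃V : Over S⦄ (f : V ⟶ T), R f → Frame E X V)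
    (hφ : ∀ ⦃V W : Over S⦄ (f : V ⟶ T) (hf : R f) (g : W ⟶ V),
      (φ f hf).restrict g = φ (g ≫ f) (R.downward_closed hf g)) :
    ∃ ψ : Frame E X T, ∀ ⦃V : Over S⦄ (f : V ⟶ T) (hf : R f), ψ.restrict f = φ f hf := by
  have hE : Presieve.IsSheaf (J.over S) ((Over.forget S).op ⋙ E ⋙ forget _) :=
    (Over.forget S).op_comp_isSheaf_of_isSheaf_type (J := J.over S) (K := J) M.isSheaf
  have hφ' : ∀ ⦃V W : Over S⦄ (f : V ⟶ T) (hf : R f) (g : W ⟶ V) (hg : R (g ≫ f))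
      (e : E.obj (op W.left)), (φ f hf).hom g e = (φ (g ≫ f) hg).hom (𝟙 W) e := by
    intro V W f hf g hg e
    rw [← hφ f hf g]
    simp
  have key (V : Over S) (v : V ⟶ T) (e : E.obj (op V.left)) : ∃ x : X.obj (op V),
      ∀ ⦃W : Over S⦄ (g : W ⟶ V) (hg : R (g ≫ v)),
        X.map g.op x = (φ (g ≫ v) hg).hom (𝟙 W) (E.map g.left.op e) := by
    refine Presieve'.exists_glue hX ((J.over S).pullback_stable v hR)
      (fun W g hg => (φ (g ≫ v) hg).hom (𝟙 W) (E.map g.left.op e)) fun W W' g hg g' => ?_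
    refine ((φ (g ≫ v) hg).map_hom g' (𝟙 W) (E.map g.left.op e)).trans ?_
    have h1 : R (g' ≫ g ≫ v) := R.downward_closed hg g'
    have h2 := hφ' (g ≫ v) hg g' h1 (E.map g'.left.op (E.map g.left.op e))
    rw [Category.comp_id, h2]
    simp only [Category.assoc, Over.comp_left, op_comp, Functor.map_comp_apply]
  choose F hF using key
  have hsep {V : Over S} (v : V ⟶ T) {x y : X.obj (op V)} (h : ∀ ⦃W : Over S⦄ (g : W ⟶ V),
      R (g ≫ v) → X.map g.op x = X.map g.op y) : x = y :=
    Presieve'.ext_of_cover hX ((J.over S).pullback_stable v hR) fun W g hg => h g hg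
  have hsepE {V : Over S} (v : V ⟶ T) {x y : E.obj (op V.left)} (h : ∀ ⦃W : Over S⦄ (g : W ⟶ V),
      R (g ≫ v) → E.map g.left.op x = E.map g.left.op y) : x = y := by
    exact Presieve'.ext_of_cover hE ((J.over S).pullback_stable v hR) fun W g hg => h g hg
  refine ⟨⟨fun V v => AddMonoidHom.mk' (F V v) fun a b => ?_, fun V V' f v e => ?_,
    fun V v => ⟨fun a b hab => ?_, fun x => ?_⟩⟩, fun V f hf => ?_⟩
  · refine hsep v fun W g hg => ?_
    rw [hF _ _ _ g hg, map_add, map_add, map_add, hF _ _ _ g hg, hF _ _ _ g hg]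
  · refine hsep (f ≫ v) fun W g hg => ?_
    change _ = X.map g.op (F V' (f ≫ v) _)
    rw [hF _ _ _ g hg]
    have h1 : R ((g ≫ f) ≫ v) := by simpa using hg
    have := hF _ _ e (g ≫ f) h1
    rw [op_comp, X.map_comp, ConcreteCategory.comp_apply] at this
    refine this.trans ?_
    simp
  · refine hsepE v fun W g hg => ((φ (g ≫ v) hg).bijective (𝟙 W)).1 ?_
    rw [← hF V v a g hg, ← hF V v b g hg]
    exact congrArg (X.map g.op) hab
  · obtain ⟨e, he⟩ := Presieve'.exists_glue hE ((J.over S).pullback_stable v hR)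
      (fun W g hg => (φ (g ≫ v) hg).coord (𝟙 W) (X.map g.op x))
      (fun W W' g hg g' => by
        have h1 : R (g' ≫ g ≫ v) := R.downward_closed hg g'
        refine ((φ (g ≫ v) hg).map_coord g' (𝟙 W) (X.map g.op x)).trans ?_
        have h2 := hφ' (g ≫ v) hg g' h1
        simp only [Category.assoc, op_comp, Functor.map_comp_apply, Category.comp_id]
        apply ((φ (g' ≫ g ≫ v) h1).bijective (𝟙 W')).1
        rw [hom_coord, ← h2, hom_coord])
    refine ⟨e, hsep v fun W g hg => ?_⟩
    refine (hF V v e g hg).trans ((congrArg _ (he g hg)).trans (hom_coord _ _ _))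
  · ext V' v e
    refine hsep (v ≫ f) fun W g hg => ?_
    have h1 : R ((g ≫ v) ≫ f) := by simpa using hg
    refine (hF V' (v ≫ f) e g hg).trans ?_
    rw [(φ f hf).map_hom, hφ' f hf (g ≫ v) h1]
    simp only [Category.assoc]

end Frame

end

end

noncomputable section

section

variable {C : Type u} [Category.{v} C] {J : GrothendieckTopology C}
  {G : Cᵒᵖ ⥤ GrpCat.{w}} {E : Cᵒᵖ ⥤ AddCommGrpCat.{w}} {S S' : C}

/-! ### Frames and maps over a morphism of the base -/

namespace Frame

variable {f : S ⟶ S'} {X : (Over S)ᵒᵖ ⥤ AddCommGrpCat.{w}} {Y : (Over S')ᵒᵖ ⥤ AddCommGrpCat.{w}}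
  {T T' : Over S}

/-- An object over the image of `T` comes from an object over `T`. -/
def liftHom {V : Over S'} (v : V ⟶ (Over.map f).obj T) :
    V ⟶ (Over.map f).obj (Over.mk (v.left ≫ T.hom)) :=
  Over.homMk (𝟙 V.left) (by simpa using! Over.w v)

lemma liftHom_comp {V : Over S'} (v : V ⟶ (Over.map f).obj T) :
    liftHom v ≫ (Over.map f).map (Over.homMk v.left : Over.mk (v.left ≫ T.hom) ⟶ T) = v := by
  ext
  simp [liftHom]

lemma hom_eq_map_liftHom (ψ : Frame E Y ((Over.map f).obj T)) {V : Over S'}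
    (v : V ⟶ (Over.map f).obj T) (e : E.obj (op V.left)) :
    ψ.hom v e = Y.map (liftHom v).op
      (ψ.hom ((Over.map f).map (Over.homMk v.left : Over.mk (v.left ≫ T.hom) ⟶ T)) e) := by
  rw [ψ.map_hom, liftHom_comp]
  exact congrArg (ψ.hom v) (by simp [liftHom])

lemma ext_map {φ ψ : Frame E Y ((Over.map f).obj T)}
    (h : ∀ ⦃V : Over S⦄ (v : V ⟶ T) (e : E.obj (op V.left)),
      φ.hom ((Over.map f).map v) e = ψ.hom ((Over.map f).map v) e) : φ = ψ := by
  ext V v e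
  rw [hom_eq_map_liftHom, hom_eq_map_liftHom ψ]
  exact congrArg _ (h _ _)

/-- The image of a frame under an isomorphism over a morphism of the base. -/
def map (α : X ⟶ (Over.map f).op ⋙ Y) [IsIso α] (φ : Frame E X T) :
    Frame E Y ((Over.map f).obj T) where
  hom V v := (Y.map (liftHom v).op).hom.comp
    ((α.app (op (Over.mk (v.left ≫ T.hom)))).hom.comp
      (φ.hom (Over.homMk v.left : Over.mk (v.left ≫ T.hom) ⟶ T)))
  map_hom V V' g v e := by
    let g' : Over.mk ((g ≫ v).left ≫ T.hom) ⟶ Over.mk (v.left ≫ T.hom) :=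
      Over.homMk g.left (by simp)
    have h1 : liftHom (g ≫ v) ≫ (Over.map f).map g' = g ≫ liftHom v := by
      ext
      simp [g', liftHom]
    have h2 : g' ≫ (Over.homMk v.left : Over.mk (v.left ≫ T.hom) ⟶ T) =
        (Over.homMk (g ≫ v).left : Over.mk ((g ≫ v).left ≫ T.hom) ⟶ T) := by
      ext
      simp [g']
    change Y.map g.op (Y.map (liftHom v).op (α.app _ (φ.hom _ e))) =
      Y.map (liftHom (g ≫ v)).op (α.app _ (φ.hom _ _))
    rw [← Functor.map_comp_apply, ← op_comp, ← h1, op_comp, Functor.map_comp_apply]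
    refine congrArg _ ?_
    have h3 := NatTrans.naturality_apply α g'.op (φ.hom (Over.homMk v.left) e)
    refine h3.symm.trans (congrArg _ ?_)
    rw [φ.map_hom, h2]
    rfl
  bijective V v := by
    have h1 : IsIso (liftHom v) := by
      have : IsIso ((Over.forget S').map (liftHom v)) := by
        change IsIso (𝟙 _)
        infer_instance
      exact isIso_of_reflects_iso _ (Over.forget S')
    have h2 := ConcreteCategory.bijective_of_isIso (Y.map (liftHom v).op)
    have h3 := ConcreteCategory.bijective_of_isIso (α.app (op (Over.mk (v.left ≫ T.hom))))
    exact h2.comp (h3.comp (φ.bijective (Over.homMk v.left : Over.mk (v.left ≫ T.hom) ⟶ T)))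

lemma map_hom_map (α : X ⟶ (Over.map f).op ⋙ Y) [IsIso α] (φ : Frame E X T) {V : Over S}
    (v : V ⟶ T) (e : E.obj (op V.left)) :
    (φ.map α).hom ((Over.map f).map v) e = α.app (op V) (φ.hom v e) := by
  let g' : V ⟶ Over.mk (((Over.map f).map v).left ≫ T.hom) := Over.homMk (𝟙 _) (by simp)
  have h1 : liftHom ((Over.map f).map v) = (Over.map f).map g' := by
    ext
    simp [liftHom, g']
  have h2 : g' ≫ (Over.homMk ((Over.map f).map v).left : Over.mk (_ ≫ T.hom) ⟶ T) = v := by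
    ext
    simp [g']
  change Y.map (liftHom ((Over.map f).map v)).op (α.app _ (φ.hom _ e)) = _
  rw [h1]
  refine (NatTrans.naturality_apply α g'.op _).symm.trans (congrArg _ ?_)
  rw [φ.map_hom, h2]
  exact congrArg (φ.hom v) (by simp [g'])

lemma map_eq_iff (α : X ⟶ (Over.map f).op ⋙ Y) [IsIso α] (φ : Frame E X T)
    (ψ : Frame E Y ((Over.map f).obj T)) :
    φ.map α = ψ ↔ ∀ ⦃V : Over S⦄ (v : V ⟶ T) (e : E.obj (op V.left)),
      α.app (op V) (φ.hom v e) = ψ.hom ((Over.map f).map v) e := by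
  constructor
  · rintro rfl V v e
    rw [map_hom_map]
  · intro h
    refine ext_map fun V v e => ?_
    rw [map_hom_map, h]

lemma map_restrict (α : X ⟶ (Over.map f).op ⋙ Y) [IsIso α] (φ : Frame E X T) (g : T' ⟶ T) :
    (φ.restrict g).map α = (φ.map α).restrict ((Over.map f).map g) := by
  rw [map_eq_iff]
  intro V v e
  rw [restrict_hom, restrict_hom, ← Functor.map_comp, map_hom_map]

lemma map_act (M : AutAction J G E) (α : X ⟶ (Over.map f).op ⋙ Y) [IsIso α] (φ : Frame E X T)
    (g : G.obj (op T.left)) :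
    (φ.act M g).map α = (φ.map α).act M (T := (Over.map f).obj T) g := by
  rw [map_eq_iff]
  intro V v e
  rw [act_hom, act_hom]
  exact (map_hom_map α φ v _).symm

/-- A morphism is determined by its effect on frames. -/
lemma eq_of_map_eq (hY : Presieve.IsSheaf (J.over S') (Y ⋙ forget _))
    (hX : ∀ T : Over S, ∃ R ∈ J.over S T, ∀ ⦃V : Over S⦄ (v : V ⟶ T), R v →
      Nonempty (Frame E X V))
    (α β : X ⟶ (Over.map f).op ⋙ Y) [IsIso α] [IsIso β]
    (h : ∀ (T : Over S) (φ : Frame E X T), φ.map α = φ.map β) : α = β := by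
  have hY' : Presieve.IsSheaf (J.over S) ((Over.map f).op ⋙ Y ⋙ forget _) :=
    (Over.map f).op_comp_isSheaf_of_isSheaf_type (J := J.over S) (K := J.over S') hY
  ext T x
  obtain ⟨T⟩ := T
  obtain ⟨R, hR, hn⟩ := hX T
  refine Presieve'.ext_of_cover hY' hR fun V v hv => ?_
  obtain ⟨φ⟩ := hn v hv
  change ((Over.map f).op ⋙ Y).map v.op (α.app _ x) = ((Over.map f).op ⋙ Y).map v.op (β.app _ x)
  rw [← NatTrans.naturality_apply, ← NatTrans.naturality_apply]
  have h1 := (map_eq_iff α φ (φ.map β)).1 (h V φ) (𝟙 V) (φ.coord (𝟙 V) (X.map v.op x))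
  rw [map_hom_map] at h1
  simpa using h1

/-- An equivariant map between frames comes from an isomorphism. -/
lemma exists_map_eq (M : AutAction J G E) (hXs : Presieve.IsSheaf (J.over S) (X ⋙ forget _))
    (hY : Presieve.IsSheaf (J.over S') (Y ⋙ forget _))
    (hX : ∀ T : Over S, ∃ R ∈ J.over S T, ∀ ⦃V : Over S⦄ (v : V ⟶ T), R v →
      Nonempty (Frame E X V))
    (β : ∀ T : Over S, Frame E X T → Frame E Y ((Over.map f).obj T))
    (hβ : ∀ ⦃T T' : Over S⦄ (g : T' ⟶ T) (φ : Frame E X T),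
      β T' (φ.restrict g) = (β T φ).restrict ((Over.map f).map g))
    (hβ' : ∀ (T : Over S) (φ : Frame E X T) (g : G.obj (op T.left)),
      β T (φ.act M g) = (β T φ).act M (T := (Over.map f).obj T) g) :
    ∃ (α : X ⟶ (Over.map f).op ⋙ Y) (_ : IsIso α), ∀ (T : Over S) (φ : Frame E X T),
      φ.map α = β T φ := by
  have hY' : Presieve.IsSheaf (J.over S) ((Over.map f).op ⋙ Y ⋙ forget _) :=
    (Over.map f).op_comp_isSheaf_of_isSheaf_type (J := J.over S) (K := J.over S') hY
  have hrestr {T V : Over S} (φ : Frame E X T) (v : V ⟶ T) (e : E.obj (op V.left)) :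
      (β V (φ.restrict v)).hom (𝟙 _) e = (β T φ).hom ((Over.map f).map v) e := by
    rw [hβ, restrict_hom, Category.id_comp]
  have key (T : Over S) (x : X.obj (op T)) : ∃ y : Y.obj (op ((Over.map f).obj T)),
      ∀ ⦃V : Over S⦄ (v : V ⟶ T) (φ : Frame E X V), Y.map ((Over.map f).map v).op y =
        (β V φ).hom (𝟙 _) (φ.coord (𝟙 V) (X.map v.op x)) := by
    obtain ⟨R, hR, hn⟩ := hX T
    refine Presieve'.exists_descent hY' hR (A := fun V => Frame E X V)
      (fun V W g φ => φ.restrict g) hn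
      (fun V v φ => (β V φ).hom (𝟙 _) (φ.coord (𝟙 V) (X.map v.op x))) ?_ ?_
    · intro V v φ ψ
      obtain ⟨g, rfl, -⟩ := existsUnique_act M φ ψ
      rw [hβ', act_hom]
      refine congrArg _ ?_
      apply (φ.bijective (𝟙 V)).1
      rw [hom_coord]
      have := hom_coord (φ.act M g) (𝟙 V) (X.map v.op x)
      rw [act_hom] at this
      exact this.symm
    · intro V W v g φ
      refine ((β V φ).map_hom ((Over.map f).map g) (𝟙 _) _).trans ?_
      rw [hrestr, Category.comp_id]
      refine congrArg _ ?_
      refine (φ.map_coord g (𝟙 V) _).trans ?_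
      apply (φ.bijective g).1
      have h1 := hom_coord (φ.restrict g) (𝟙 W) (X.map (g ≫ v).op x)
      rw [restrict_hom, Category.id_comp] at h1
      rw [h1, Category.comp_id, hom_coord, op_comp, Functor.map_comp_apply]
  choose F hF using key
  have hsep {T : Over S} {y y' : Y.obj (op ((Over.map f).obj T))}
      (h : ∀ ⦃V : Over S⦄ (v : V ⟶ T), Frame E X V →
        Y.map ((Over.map f).map v).op y = Y.map ((Over.map f).map v).op y') : y = y' := by
    obtain ⟨R, hR, hn⟩ := hX T
    exact Presieve'.ext_of_cover hY' hR fun V v hv => h v (hn v hv).some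
  let α : X ⟶ (Over.map f).op ⋙ Y :=
    { app T := AddCommGrpCat.ofHom (AddMonoidHom.mk' (F T.unop) fun a b => hsep fun V v φ => by
        rw [map_add, hF _ _ v φ, hF _ _ v φ, hF _ _ v φ, ← map_add ((β V φ).hom _)]
        refine congrArg ((β V φ).hom _) ?_
        apply (φ.bijective (𝟙 V)).1
        rw [map_add, hom_coord, map_add, hom_coord, hom_coord])
      naturality T T' g := by
        ext x
        refine hsep fun V v φ => ?_
        refine (hF _ _ v φ).trans ?_
        have := hF _ x (v ≫ g.unop) φ
        rw [Functor.map_comp, op_comp, Functor.map_comp_apply] at this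
        refine Eq.trans ?_ this.symm
        rw [op_comp, Functor.map_comp_apply]
        rfl }
  have hα (T : Over S) (φ : Frame E X T) ⦃V : Over S⦄ (v : V ⟶ T) (e : E.obj (op V.left)) :
      α.app (op V) (φ.hom v e) = (β T φ).hom ((Over.map f).map v) e := by
    rw [← hrestr]
    have := hF V (φ.hom v e) (𝟙 V) (φ.restrict v)
    rw [CategoryTheory.Functor.map_id, op_id, Functor.map_id_apply] at this
    refine this.trans (congrArg _ ?_)
    apply (φ.bijective v).1
    have h1 := hom_coord (φ.restrict v) (𝟙 V) (X.map (𝟙 (op V)) (φ.hom v e))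
    rw [restrict_hom, Category.id_comp, Functor.map_id_apply] at h1
    rw [op_id, Functor.map_id_apply]
    exact h1
  have hiso : IsIso α := by
    have (T : (Over S)ᵒᵖ) : IsIso (α.app T) := by
      obtain ⟨T⟩ := T
      refine (ConcreteCategory.isIso_iff_bijective _).2 ⟨fun a b hab => ?_, fun y => ?_⟩
      · obtain ⟨R, hR, hn⟩ := hX T
        refine Presieve'.ext_of_cover hXs hR fun V v hv => ?_
        obtain ⟨φ⟩ := hn v hv
        have h1 := congrArg (((Over.map f).op ⋙ Y).map v.op) hab
        rw [← NatTrans.naturality_apply, ← NatTrans.naturality_apply] at h1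
        have h2 := hα V φ (𝟙 V) (φ.coord (𝟙 V) (X.map v.op a))
        have h3 := hα V φ (𝟙 V) (φ.coord (𝟙 V) (X.map v.op b))
        rw [hom_coord] at h2 h3
        have h4 := ((β V φ).bijective _).1 (h2.symm.trans (h1.trans h3))
        have h5 := congrArg (φ.hom (𝟙 V)) h4
        rwa [hom_coord, hom_coord] at h5
      · obtain ⟨R, hR, hn⟩ := hX T
        obtain ⟨x, hx⟩ := Presieve'.exists_descent hXs hR (A := fun V => Frame E X V)
          (fun V W g φ => φ.restrict g) hn
          (fun V v φ => φ.hom (𝟙 V) ((β V φ).coord (𝟙 _) (Y.map ((Over.map f).map v).op y)))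
          (fun V v φ ψ => by
            obtain ⟨g, rfl, -⟩ := existsUnique_act M φ ψ
            rw [act_hom]
            refine congrArg _ ?_
            apply ((β V φ).bijective (𝟙 _)).1
            rw [hom_coord, hβ']
            have := hom_coord ((β V φ).act M (T := (Over.map f).obj V) g) (𝟙 _)
              (Y.map ((Over.map f).map v).op y)
            rw [act_hom] at this
            exact this.symm)
          (fun V W v g φ => by
            refine (φ.map_hom g (𝟙 V) _).trans ?_
            rw [restrict_hom, Category.id_comp, Category.comp_id]
            refine congrArg _ ?_
            apply ((β V φ).bijective ((Over.map f).map g)).1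
            rw [← hrestr φ, ← hrestr φ, hom_coord, hrestr]
            refine (congrArg _ ((β V φ).map_coord ((Over.map f).map g) (𝟙 _)
              (Y.map ((Over.map f).map v).op y))).trans ?_
            rw [Category.comp_id, hom_coord, Functor.map_comp, op_comp, Functor.map_comp_apply])
        refine ⟨x, hsep fun V v φ => ?_⟩
        refine (hF T x v φ).trans ?_
        have h1 := hx v φ
        change X.map v.op x = _ at h1
        rw [h1, coord_hom, hom_coord]
    exact NatIso.isIso_of_isIso_app α
  exact ⟨α, hiso, fun T φ => (map_eq_iff α φ _).2 (hα T φ)⟩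

end Frame

end

end

noncomputable section

section

variable {C : Type u} [Category.{v} C] {J : GrothendieckTopology C}
  {G : Cᵒᵖ ⥤ GrpCat.{w}} {E : Cᵒᵖ ⥤ AddCommGrpCat.{w}} {S S' S'' : C}

/-! ### The torsor of frames -/

/-- The frames of `X` over `T`, as a type in the universe of the sections of `G`. -/
def FrameSections (M : AutAction J G E) (X : (Over S)ᵒᵖ ⥤ AddCommGrpCat.{w}) (T : Over S) :
    Type w :=
  @Shrink.{w} (Frame E X T) (Frame.small M)

/-- The frames of `X` over `T`, up to the change of universe. -/
def frameSectionsEquiv (M : AutAction J G E) (X : (Over S)ᵒᵖ ⥤ AddCommGrpCat.{w}) (T : Over S) :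
    Frame E X T ≃ FrameSections M X T :=
  @equivShrink _ (Frame.small M)

/-- The presheaf of frames. -/
def frameSheaf (M : AutAction J G E) (X : (Over S)ᵒᵖ ⥤ AddCommGrpCat.{w}) :
    (Over S)ᵒᵖ ⥤ Type w where
  obj T := FrameSections M X T.unop
  map {T T'} f := ↾fun x => frameSectionsEquiv M X T'.unop
    (((frameSectionsEquiv M X T.unop).symm x).restrict f.unop)
  map_id T := by
    ext x
    obtain ⟨φ, rfl⟩ := (frameSectionsEquiv M X T.unop).surjective x
    change frameSectionsEquiv M X _ (((frameSectionsEquiv M X _).symm _).restrict _) = _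
    rw [Equiv.symm_apply_apply]
    exact congrArg _ (Frame.restrict_id φ)
  map_comp {T T' T''} f g := by
    ext x
    obtain ⟨φ, rfl⟩ := (frameSectionsEquiv M X T.unop).surjective x
    change frameSectionsEquiv M X _ (((frameSectionsEquiv M X _).symm _).restrict _) =
      frameSectionsEquiv M X _ (((frameSectionsEquiv M X _).symm
        (frameSectionsEquiv M X _ (((frameSectionsEquiv M X _).symm _).restrict _))).restrict _)
    rw [Equiv.symm_apply_apply, Equiv.symm_apply_apply]
    exact congrArg _ (Frame.restrict_comp φ _ _)

/-- The sections of the presheaf of frames. -/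
def frameSheafEquiv (M : AutAction J G E) (X : (Over S)ᵒᵖ ⥤ AddCommGrpCat.{w}) (T : Over S) :
    Frame E X T ≃ (frameSheaf M X).obj (op T) :=
  frameSectionsEquiv M X T

lemma frameSheafEquiv_restrict (M : AutAction J G E) (X : (Over S)ᵒᵖ ⥤ AddCommGrpCat.{w})
    {T T' : Over S} (f : T' ⟶ T) (φ : Frame E X T) :
    frameSheafEquiv M X T' (φ.restrict f) = (frameSheaf M X).map f.op (frameSheafEquiv M X T φ) := by
  change _ = frameSheafEquiv M X T' (((frameSheafEquiv M X T).symm _).restrict f)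
  rw [Equiv.symm_apply_apply]

/-- `X` has frames locally. -/
def LocallyFramed (J : GrothendieckTopology C) (E : Cᵒᵖ ⥤ AddCommGrpCat.{w})
    (X : (Over S)ᵒᵖ ⥤ AddCommGrpCat.{w}) : Prop :=
  ∃ R ∈ J S, ∀ ⦃S' : C⦄ (f : S' ⟶ S), R f → Nonempty (Frame E X (Over.mk f))

lemma LocallyFramed.exists_cover {X : (Over S)ᵒᵖ ⥤ AddCommGrpCat.{w}} (h : LocallyFramed J E X)
    (T : Over S) : ∃ R ∈ J.over S T, ∀ ⦃V : Over S⦄ (v : V ⟶ T), R v →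
      Nonempty (Frame E X V) := by
  obtain ⟨R, hR, h⟩ := h
  refine ⟨(Sieve.overEquiv T).symm (R.pullback T.hom),
    J.overEquiv_symm_mem_over _ _ (J.pullback_stable _ hR), fun V v hv => ?_⟩
  rw [Sieve.overEquiv_symm_iff] at hv
  obtain ⟨φ⟩ := h _ hv
  exact ⟨φ.restrict (Over.homMk (𝟙 _) (by simp))⟩

/-- The torsor of frames of a form of `E`. -/
def frameTorsor (M : AutAction J G E) (X : (Over S)ᵒᵖ ⥤ AddCommGrpCat.{w})
    (hX : Presieve.IsSheaf (J.over S) (X ⋙ forget _)) (hf : LocallyFramed J E X) :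
    SheafTorsor J G S where
  sheaf := frameSheaf M X
  isSheaf := by
    rw [isSheaf_iff_isSheaf_of_type]
    intro T R hR x hx
    have hx' := (Presieve.compatible_iff_sieveCompatible x).1 hx
    obtain ⟨ψ, hψ⟩ := Frame.exists_glue M hX hR
      (fun V f hf => (frameSheafEquiv M X V).symm (x f hf)) fun V W f hf g => by
        apply (frameSheafEquiv M X W).injective
        rw [frameSheafEquiv_restrict, Equiv.apply_symm_apply, Equiv.apply_symm_apply]
        exact (hx' f g hf).symm
    refine ⟨frameSheafEquiv M X T ψ, fun V f hf => ?_, fun y hy => ?_⟩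
    · rw [← frameSheafEquiv_restrict, hψ f hf, Equiv.apply_symm_apply]
    · obtain ⟨φ, rfl⟩ := (frameSheafEquiv M X T).surjective y
      refine congrArg _ ?_
      ext V v e
      refine Presieve'.ext_of_cover hX ((J.over S).pullback_stable v hR) fun W g hg => ?_
      have h1 := hy (g ≫ v) hg
      rw [← hψ _ hg |> (Equiv.eq_symm_apply _).1, ← frameSheafEquiv_restrict,
        EmbeddingLike.apply_eq_iff_eq] at h1
      have h2 := congrArg (fun χ => χ.hom (𝟙 W) (E.map g.left.op e)) h1
      simp only [Frame.restrict_hom, Category.id_comp] at h2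
      exact (φ.map_hom g v e).trans (h2.trans (ψ.map_hom g v e).symm)
  act T x g := frameSheafEquiv M X T (((frameSheafEquiv M X T).symm x).act M g)
  act_one T x := by rw [Frame.act_one, Equiv.apply_symm_apply]
  act_mul T x g g' := by rw [Frame.act_mul, Equiv.symm_apply_apply]
  map_act {T T'} f x g := by
    obtain ⟨φ, rfl⟩ := (frameSheafEquiv M X T).surjective x
    rw [← frameSheafEquiv_restrict, ← frameSheafEquiv_restrict, Equiv.symm_apply_apply,
      Equiv.symm_apply_apply, Frame.act_restrict]
  existsUnique_act T x y := by
    obtain ⟨φ, rfl⟩ := (frameSheafEquiv M X T).surjective x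
    obtain ⟨ψ, rfl⟩ := (frameSheafEquiv M X T).surjective y
    simpa using Frame.existsUnique_act M φ ψ
  locally_nonempty := by
    obtain ⟨R, hR, h⟩ := hf
    exact ⟨R, hR, fun S' f hf => (h f hf).map (frameSheafEquiv M X _)⟩

/-- The torsor of frames, as an object of the classifying stack. -/
abbrev frameBG (M : AutAction J G E) (X : (Over S)ᵒᵖ ⥤ AddCommGrpCat.{w})
    (hX : Presieve.IsSheaf (J.over S) (X ⋙ forget _)) (hf : LocallyFramed J E X) : BG J G :=
  ⟨S, frameTorsor M X hX hf⟩

variable {X : (Over S)ᵒᵖ ⥤ AddCommGrpCat.{w}} {hX : Presieve.IsSheaf (J.over S) (X ⋙ forget _)}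
  {hXf : LocallyFramed J E X}
  {Y : (Over S')ᵒᵖ ⥤ AddCommGrpCat.{w}} {hY : Presieve.IsSheaf (J.over S') (Y ⋙ forget _)}
  {hYf : LocallyFramed J E Y}
  {Z : (Over S'')ᵒᵖ ⥤ AddCommGrpCat.{w}} {hZ : Presieve.IsSheaf (J.over S'') (Z ⋙ forget _)}
  {hZf : LocallyFramed J E Z}

/-- The map of torsors of frames induced by an isomorphism over a morphism of the base. -/
def frameBGMap (M : AutAction J G E) (f : S ⟶ S') (α : X ⟶ (Over.map f).op ⋙ Y) [IsIso α] :
    frameBG M X hX hXf ⟶ frameBG M Y hY hYf :=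
  BG.Hom.mk (X := frameBG M X hX hXf) (Y := frameBG M Y hY hYf) f
    { app T := ↾fun x => frameSheafEquiv M Y ((Over.map f).obj T.unop)
        (((frameSheafEquiv M X T.unop).symm x).map α)
      naturality T T' g := by
        ext x
        obtain ⟨φ, rfl⟩ := (frameSheafEquiv M X T.unop).surjective x
        have h1 := frameSheafEquiv_restrict M X g.unop φ
        have h2 := (congrArg _ (Frame.map_restrict α φ g.unop)).trans
          (frameSheafEquiv_restrict M Y ((Over.map f).map g.unop) (φ.map α))
        change frameSheafEquiv M Y ((Over.map f).obj T'.unop)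
          (((frameSheafEquiv M X T'.unop).symm ((frameSheaf M X).map g _)).map α) =
            (frameSheaf M Y).map ((Over.map f).map g.unop).op (frameSheafEquiv M Y _
              (((frameSheafEquiv M X T.unop).symm (frameSheafEquiv M X T.unop φ)).map α))
        rw [Equiv.symm_apply_apply, ← h2]
        refine congrArg (fun ψ => frameSheafEquiv M Y _ (Frame.map α ψ)) ?_
        exact ((Equiv.symm_apply_eq _).2 h1.symm) }
    fun T x g => by
      obtain ⟨φ, rfl⟩ := (frameSheafEquiv M X T).surjective x
      change frameSheafEquiv M Y _ (((frameSheafEquiv M X T).symm (frameSheafEquiv M X T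
        (((frameSheafEquiv M X T).symm (frameSheafEquiv M X T φ)).act M g))).map α) =
          frameSheafEquiv M Y _ (((frameSheafEquiv M Y _).symm (frameSheafEquiv M Y _
            (((frameSheafEquiv M X T).symm (frameSheafEquiv M X T φ)).map α))).act M g)
      rw [Equiv.symm_apply_apply, Equiv.symm_apply_apply, Equiv.symm_apply_apply]
      exact congrArg _ (Frame.map_act M α φ g)

lemma frameBGMap_app (M : AutAction J G E) (f : S ⟶ S') (α : X ⟶ (Over.map f).op ⋙ Y) [IsIso α]
    {T : Over S} (φ : Frame E X T) :
    (frameBGMap (hX := hX) (hXf := hXf) (hY := hY) (hYf := hYf) M f α).map.app (op T)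
      (frameSheafEquiv M X T φ) = frameSheafEquiv M Y _ (φ.map α) := by
  change frameSheafEquiv M Y _ (((frameSheafEquiv M X T).symm (frameSheafEquiv M X T φ)).map α) = _
  rw [Equiv.symm_apply_apply]

lemma frameBGMap_id (M : AutAction J G E) :
    frameBGMap M (𝟙 S) (SlicePresheaf.idMap X) = 𝟙 (frameBG M X hX hXf) := by
  refine BG.Hom.ext rfl (heq_of_eq ?_)
  ext T x
  obtain ⟨T⟩ := T
  change Over S at T
  obtain ⟨φ, rfl⟩ := (frameSheafEquiv M X T).surjective x
  refine (frameBGMap_app M (𝟙 S) (SlicePresheaf.idMap X) φ).trans ?_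
  refine Eq.trans (congrArg _ ?_) (frameSheafEquiv_restrict M X ((Over.mapId S).hom.app T) φ)
  rw [Frame.map_eq_iff]
  intro V v e
  rw [Frame.restrict_hom, SlicePresheaf.idMap_app]
  refine (φ.map_hom _ v e).trans ?_
  have h1 : (Over.mapId S).hom.app V ≫ v = (Over.map (𝟙 S)).map v ≫ (Over.mapId S).hom.app T :=
    ((Over.mapId S).hom.naturality v).symm
  rw [h1]
  exact congrArg _ (by simp)

lemma frameBGMap_comp (M : AutAction J G E) (f : S ⟶ S') (g : S' ⟶ S'')
    (α : X ⟶ (Over.map f).op ⋙ Y) [IsIso α] (β : Y ⟶ (Over.map g).op ⋙ Z) [IsIso β] :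
    frameBGMap (hX := hX) (hXf := hXf) (hY := hZ) (hYf := hZf) M (f ≫ g)
      (SlicePresheaf.compMap α β) =
        frameBGMap (hY := hY) (hYf := hYf) M f α ≫ frameBGMap M g β := by
  refine BG.Hom.ext rfl (heq_of_eq ?_)
  ext T x
  obtain ⟨T⟩ := T
  change Over S at T
  obtain ⟨φ, rfl⟩ := (frameSheafEquiv M X T).surjective x
  refine (frameBGMap_app M (f ≫ g) (SlicePresheaf.compMap α β) φ).trans ?_
  change _ = (frameSheaf M Z).map ((Over.mapComp f g).hom.app T).op
    ((frameBGMap M g β).map.app (op ((Over.map f).obj T)) ((frameBGMap M f α).map.app (op T)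
      (frameSheafEquiv M X T φ)))
  rw [frameBGMap_app M f α φ]
  refine Eq.trans ?_ (congrArg _ (frameBGMap_app M g β (φ.map α))).symm
  refine Eq.trans (congrArg _ ?_) (frameSheafEquiv_restrict M Z ((Over.mapComp f g).hom.app T) _)
  rw [Frame.map_eq_iff]
  intro V v e
  rw [Frame.restrict_hom, SlicePresheaf.compMap_app]
  change Z.map _ (β.app _ (α.app _ (φ.hom v e))) = _
  rw [← Frame.map_hom_map α, ← Frame.map_hom_map β]
  refine (Frame.map_hom _ _ _ _).trans ?_
  have h1 : (Over.mapComp f g).hom.app V ≫ (Over.map g).map ((Over.map f).map v) =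
      (Over.map (f ≫ g)).map v ≫ (Over.mapComp f g).hom.app T :=
    ((Over.mapComp f g).hom.naturality v).symm
  rw [h1]
  exact congrArg _ (by simp)

/-- A map of torsors of frames comes from an isomorphism. -/
lemma exists_frameBGMap_eq (M : AutAction J G E)
    (b : frameBG M X hX hXf ⟶ frameBG M Y hY hYf) :
    ∃ (α : X ⟶ (Over.map (X := S) (Y := S') b.base).op ⋙ Y) (_ : IsIso α),
      frameBGMap M b.base α = b := by
  obtain ⟨f, m, hm⟩ := b
  change S ⟶ S' at f
  change frameSheaf M X ⟶ (Over.map f).op ⋙ frameSheaf M Y at m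
  obtain ⟨α, hα, h⟩ := Frame.exists_map_eq (f := f) M hX hY hXf.exists_cover
    (fun T φ => (frameSheafEquiv M Y ((Over.map f).obj T)).symm
      (m.app (op T) (frameSheafEquiv M X T φ)))
    (fun T T' g φ => by
      refine (Equiv.symm_apply_eq _).2 ?_
      rw [frameSheafEquiv_restrict]
      refine Eq.trans ?_ (frameSheafEquiv_restrict M Y ((Over.map f).map g) _).symm
      refine Eq.trans ?_ (congrArg _ (Equiv.apply_symm_apply _ _).symm)
      exact NatTrans.naturality_apply m g.op _)
    (fun T φ g => by
      refine (Equiv.symm_apply_eq _).2 ?_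
      have h1 := hm T (frameSheafEquiv M X T φ) g
      change m.app (op T) (frameSheafEquiv M X T (((frameSheafEquiv M X T).symm
        (frameSheafEquiv M X T φ)).act M g)) = _ at h1
      rw [Equiv.symm_apply_apply] at h1
      exact h1)
  refine ⟨α, hα, BG.Hom.ext rfl (heq_of_eq ?_)⟩
  ext T x
  obtain ⟨T⟩ := T
  change Over S at T
  obtain ⟨φ, rfl⟩ := (frameSheafEquiv M X T).surjective x
  refine (frameBGMap_app M f α φ).trans ?_
  rw [h]
  exact Equiv.apply_symm_apply _ _

lemma frameBGMap_injective (M : AutAction J G E) (f : S ⟶ S')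
    (α β : X ⟶ (Over.map f).op ⋙ Y) [IsIso α] [IsIso β]
    (h : frameBGMap (hX := hX) (hXf := hXf) (hY := hY) (hYf := hYf) M f α = frameBGMap M f β) :
    α = β := by
  refine Frame.eq_of_map_eq hY hXf.exists_cover α β fun T φ => ?_
  apply (frameSheafEquiv M Y ((Over.map f).obj T)).injective
  refine (frameBGMap_app (hX := hX) (hXf := hXf) (hY := hY) (hYf := hYf) M f α φ).symm.trans
    (Eq.trans ?_ (frameBGMap_app (hX := hX) (hXf := hXf) (hY := hY) (hYf := hYf) M f β φ))
  have h1 := eq_of_heq (BG.Hom.mk.inj h).2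
  exact congrArg (fun m => m.app (op T) (frameSheafEquiv M X T φ)) h1

end

end

noncomputable section

section

variable {C : Type u} [Category.{v} C] {J : GrothendieckTopology C}
  {G : Cᵒᵖ ⥤ GrpCat.{w}} {E : Cᵒᵖ ⥤ AddCommGrpCat.{w}} {S : C}

/-! ### The form of a sheaf of groups attached to a torsor -/

/-- The sections over `T` of the twist of `E` by the torsor `P`: the equivariant maps from `P` to
`E` over `T`. -/
def twistSections (M : AutAction J G E) (P : SheafTorsor J G S) (T : Over S) :
    AddSubgroup (∀ V : Over S, (V ⟶ T) → P.sheaf.obj (op V) → E.obj (op V.left)) where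
  carrier := {σ | (∀ ⦃V V' : Over S⦄ (f : V' ⟶ V) (v : V ⟶ T) (x : P.sheaf.obj (op V)),
      E.map f.left.op (σ V v x) = σ V' (f ≫ v) (P.sheaf.map f.op x)) ∧
    ∀ ⦃V : Over S⦄ (v : V ⟶ T) (x : P.sheaf.obj (op V)) (g : G.obj (op V.left)),
      M.act V.left g (σ V v (P.act V x g)) = σ V v x}
  zero_mem' := ⟨fun V V' f v x => map_zero (E.map f.left.op).hom,
    fun V v x g => map_zero (M.act V.left g)⟩
  add_mem' {σ τ} hσ hτ := ⟨fun V V' f v x =>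
    (map_add (E.map f.left.op).hom _ _).trans (congrArg₂ (· + ·) (hσ.1 f v x) (hτ.1 f v x)),
    fun V v x g => (map_add (M.act V.left g) _ _).trans
      (congrArg₂ (· + ·) (hσ.2 v x g) (hτ.2 v x g))⟩
  neg_mem' {σ} hσ := ⟨fun V V' f v x =>
    (map_neg (E.map f.left.op).hom _).trans (congrArg (- ·) (hσ.1 f v x)),
    fun V v x g => (map_neg (M.act V.left g) _).trans (congrArg (- ·) (hσ.2 v x g))⟩

namespace twistSections

variable {M : AutAction J G E} {P : SheafTorsor J G S} {T T' T'' : Over S}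

lemma map_val (σ : twistSections M P T) {V V' : Over S} (f : V' ⟶ V) (v : V ⟶ T)
    (x : P.sheaf.obj (op V)) :
    E.map f.left.op (σ.1 V v x) = σ.1 V' (f ≫ v) (P.sheaf.map f.op x) :=
  σ.2.1 f v x

lemma act_val (σ : twistSections M P T) {V : Over S} (v : V ⟶ T) (x : P.sheaf.obj (op V))
    (g : G.obj (op V.left)) : M.act V.left g (σ.1 V v (P.act V x g)) = σ.1 V v x :=
  σ.2.2 v x g

/-- A section of the twist is determined by its value at a section of the torsor. -/
lemma val_eq_of_val_eq {T₁ T₂ : Over S} (σ : twistSections M P T₁) (τ : twistSections M P T₂)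
    {V : Over S} (v₁ : V ⟶ T₁) (v₂ : V ⟶ T₂)
    (x y : P.sheaf.obj (op V)) (h : σ.1 V v₁ x = τ.1 V v₂ x) : σ.1 V v₁ y = τ.1 V v₂ y := by
  obtain ⟨g, rfl, -⟩ := P.existsUnique_act V x y
  apply (M.act_bijective g).1
  rw [act_val, act_val, h]

lemma ext_section {σ τ : twistSections M P T} (x : P.sheaf.obj (op T))
    (h : σ.1 T (𝟙 T) x = τ.1 T (𝟙 T) x) : σ = τ := by
  refine Subtype.ext (funext fun V => funext fun v => funext fun y => ?_)
  refine val_eq_of_val_eq σ τ v v (P.sheaf.map v.op x) y ?_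
  have h1 := map_val σ v (𝟙 T) x
  have h2 := map_val τ v (𝟙 T) x
  rw [Category.comp_id] at h1 h2
  rw [← h1, ← h2, h]

/-- Restriction of sections of the twist. -/
def restrict (f : T' ⟶ T) : twistSections M P T →+ twistSections M P T' where
  toFun σ := ⟨fun V v x => σ.1 V (v ≫ f) x, fun V V' g v x => by
    refine (map_val σ g (v ≫ f) x).trans ?_
    simp only [Category.assoc], fun V v x g => act_val σ _ x g⟩
  map_zero' := rfl
  map_add' _ _ := rfl

lemma restrict_val (f : T' ⟶ T) (σ : twistSections M P T) {V : Over S} (v : V ⟶ T')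
    (x : P.sheaf.obj (op V)) : (restrict f σ).1 V v x = σ.1 V (v ≫ f) x := rfl

lemma restrict_id (σ : twistSections M P T) : restrict (𝟙 T) σ = σ := by
  refine Subtype.ext (funext fun V => funext fun v => funext fun y => ?_)
  rw [restrict_val, Category.comp_id]

lemma restrict_comp (f : T' ⟶ T) (g : T'' ⟶ T') (σ : twistSections M P T) :
    restrict (g ≫ f) σ = restrict g (restrict f σ) := by
  refine Subtype.ext (funext fun V => funext fun v => funext fun y => ?_)
  rw [restrict_val, restrict_val, restrict_val, Category.assoc]

lemma exists_sieve (P : SheafTorsor J G S) (T : Over S) :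
    ∃ R ∈ J T.left, ∀ ⦃W : C⦄ (f : W ⟶ T.left), R f →
      Nonempty (P.sheaf.obj (op (Over.mk (f ≫ T.hom)))) := by
  obtain ⟨R, hR, h⟩ := P.locally_nonempty
  exact ⟨R.pullback T.hom, J.pullback_stable _ hR, fun W f hf => h _ hf⟩

variable (M P T) in
lemma small : Small.{w} (twistSections M P T) := by
  obtain ⟨R, hR, hn⟩ := exists_sieve P T
  obtain ⟨I, Y, f, hf, hYf⟩ := M.small T.left R hR
  let x (i : I) := (hn (f i) (hf i)).some
  refine small_of_injective (f := fun (σ : twistSections M P T) (i : I) =>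
    (σ.1 (Over.mk (f i ≫ T.hom)) (Over.homMk (f i)) (x i) : E.obj (op (Y i)))) fun σ τ h => ?_
  refine Subtype.ext (funext fun V => funext fun v => funext fun y => ?_)
  refine Presieve'.ext_of_cover M.isSheaf (J.pullback_stable v.left hYf) fun W g hg => ?_
  obtain ⟨Z, k, m, ⟨i⟩, hk⟩ := hg
  have hv := Over.w v
  let a : Over.mk (g ≫ V.hom) ⟶ V := Over.homMk g
  let b : Over.mk (g ≫ V.hom) ⟶ Over.mk (f i ≫ T.hom) := Over.homMk k (by
    simp only [Over.mk_left, Over.mk_hom]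
    rw [← Category.assoc, hk, Category.assoc, hv])
  have hab : b ≫ (Over.homMk (f i) : Over.mk (f i ≫ T.hom) ⟶ T) = a ≫ v := by
    ext
    exact hk
  refine (map_val σ a v y).trans (Eq.trans ?_ (map_val τ a v y).symm)
  refine val_eq_of_val_eq σ τ _ _ (P.sheaf.map b.op (x i)) _ ?_
  rw [← hab, ← map_val, ← map_val]
  exact congrArg _ (congrFun h i)

end twistSections

/-- The sections of the twist, in the universe of the sections of `E`. -/
def TwistObj (M : AutAction J G E) (P : SheafTorsor J G S) (T : Over S) : Type w :=
  @Shrink.{w} (twistSections M P T) (twistSections.small M P T)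

/-- The sections of the twist, up to the change of universe. -/
def twistObjEquiv (M : AutAction J G E) (P : SheafTorsor J G S) (T : Over S) :
    twistSections M P T ≃ TwistObj M P T :=
  @equivShrink _ (twistSections.small M P T)

instance (M : AutAction J G E) (P : SheafTorsor J G S) (T : Over S) :
    AddCommGroup (TwistObj M P T) :=
  (twistObjEquiv M P T).symm.addCommGroup

/-- The sections of the twist, up to the change of universe, as a group. -/
def twistObjAddEquiv (M : AutAction J G E) (P : SheafTorsor J G S) (T : Over S) :
    twistSections M P T ≃+ TwistObj M P T :=
  ((twistObjEquiv M P T).symm.addEquiv).symm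

/-- The twist of `E` by the torsor `P`. -/
def twist (M : AutAction J G E) (P : SheafTorsor J G S) : (Over S)ᵒᵖ ⥤ AddCommGrpCat.{w} where
  obj T := AddCommGrpCat.of (TwistObj M P T.unop)
  map {T T'} f := AddCommGrpCat.ofHom ((twistObjAddEquiv M P T'.unop).toAddMonoidHom.comp
    ((twistSections.restrict f.unop).comp (twistObjAddEquiv M P T.unop).symm.toAddMonoidHom))
  map_id T := by
    ext x
    obtain ⟨σ, rfl⟩ := (twistObjAddEquiv M P T.unop).surjective x
    change twistObjAddEquiv M P _ (twistSections.restrict _ ((twistObjAddEquiv M P _).symm _)) = _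
    rw [AddEquiv.symm_apply_apply]
    exact congrArg _ (twistSections.restrict_id σ)
  map_comp {T T' T''} f g := by
    ext x
    obtain ⟨σ, rfl⟩ := (twistObjAddEquiv M P T.unop).surjective x
    change twistObjAddEquiv M P _ (twistSections.restrict _ ((twistObjAddEquiv M P _).symm _)) =
      twistObjAddEquiv M P _ (twistSections.restrict _ ((twistObjAddEquiv M P _).symm
        (twistObjAddEquiv M P _ (twistSections.restrict _ ((twistObjAddEquiv M P _).symm _)))))
    rw [AddEquiv.symm_apply_apply, AddEquiv.symm_apply_apply]
    exact congrArg _ (twistSections.restrict_comp _ _ σ)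

/-- The sections of the twist. -/
def twistEquiv (M : AutAction J G E) (P : SheafTorsor J G S) (T : Over S) :
    twistSections M P T ≃+ (twist M P).obj (op T) :=
  twistObjAddEquiv M P T

lemma twistEquiv_restrict (M : AutAction J G E) (P : SheafTorsor J G S) {T T' : Over S}
    (f : T' ⟶ T) (σ : twistSections M P T) :
    (twist M P).map f.op (twistEquiv M P T σ) =
      twistEquiv M P T' (twistSections.restrict f σ) := by
  change twistObjAddEquiv M P _ (twistSections.restrict _ ((twistObjAddEquiv M P _).symm
    (twistObjAddEquiv M P _ σ))) = _
  rw [AddEquiv.symm_apply_apply]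
  rfl

lemma isSheaf_twist (M : AutAction J G E) (P : SheafTorsor J G S) :
    Presieve.IsSheaf (J.over S) (twist M P ⋙ forget _) := by
  have hE : Presieve.IsSheaf (J.over S) ((Over.forget S).op ⋙ E ⋙ forget _) :=
    (Over.forget S).op_comp_isSheaf_of_isSheaf_type (J := J.over S) (K := J) M.isSheaf
  intro T R hR x hx
  have hx' := (Presieve.compatible_iff_sieveCompatible x).1 hx
  let s : ∀ ⦃V : Over S⦄ (f : V ⟶ T), R f → twistSections M P V :=
    fun V f hf => (twistEquiv M P V).symm (x f hf)
  have hs : ∀ ⦃V W : Over S⦄ (f : V ⟶ T) (hf : R f) (g : W ⟶ V),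
      twistSections.restrict g (s f hf) = s (g ≫ f) (R.downward_closed hf g) := by
    intro V W f hf g
    apply (twistEquiv M P W).injective
    rw [← twistEquiv_restrict, AddEquiv.apply_symm_apply, AddEquiv.apply_symm_apply]
    exact (hx' f g hf).symm
  have hs' : ∀ ⦃V W : Over S⦄ (f : V ⟶ T) (hf : R f) (g : W ⟶ V) (hg : R (g ≫ f))
      (y : P.sheaf.obj (op W)), (s f hf).1 W g y = (s (g ≫ f) hg).1 W (𝟙 W) y := by
    intro V W f hf g hg y
    rw [← hs f hf g, twistSections.restrict_val, Category.id_comp]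
  have key (V : Over S) (v : V ⟶ T) (y : P.sheaf.obj (op V)) : ∃ e : E.obj (op V.left),
      ∀ ⦃W : Over S⦄ (g : W ⟶ V) (hg : R (g ≫ v)), E.map g.left.op e =
        (s (g ≫ v) hg).1 W (𝟙 W) (P.sheaf.map g.op y) := by
    refine Presieve'.exists_glue hE ((J.over S).pullback_stable v hR)
      (fun W g hg => (s (g ≫ v) hg).1 W (𝟙 W) (P.sheaf.map g.op y)) fun W W' g hg k => ?_
    have h1 : R (k ≫ g ≫ v) := R.downward_closed hg k
    refine (twistSections.map_val (s (g ≫ v) hg) k (𝟙 W) _).trans ?_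
    rw [Category.comp_id, hs' (g ≫ v) hg k h1]
    simp only [Category.assoc, op_comp, Functor.map_comp_apply]
  choose F hF using key
  have hsep {V : Over S} (v : V ⟶ T) {a b : E.obj (op V.left)} (h : ∀ ⦃W : Over S⦄ (g : W ⟶ V),
      R (g ≫ v) → E.map g.left.op a = E.map g.left.op b) : a = b := by
    exact Presieve'.ext_of_cover hE ((J.over S).pullback_stable v hR) fun W g hg => h g hg
  refine ⟨twistEquiv M P T ⟨F, fun V V' f v y => ?_, fun V v y g => ?_⟩, fun V f hf => ?_,
    fun y hy => ?_⟩
  · refine hsep (f ≫ v) fun W g hg => ?_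
    rw [hF V' (f ≫ v) _ g hg]
    have h1 : R ((g ≫ f) ≫ v) := by simpa using hg
    have h2 := hF V v y (g ≫ f) h1
    rw [Over.comp_left, op_comp, Functor.map_comp_apply] at h2
    refine h2.trans ?_
    simp only [Category.assoc, op_comp, Functor.map_comp_apply]
  · refine hsep v fun W k hk => ?_
    rw [M.map_act, hF V v _ k hk, hF V v y k hk, P.map_act]
    exact twistSections.act_val _ _ _ _
  · refine (twistEquiv_restrict M P f _).trans ?_
    refine Eq.trans ?_ ((twistEquiv M P V).apply_symm_apply (x f hf))
    refine congrArg _ (Subtype.ext (funext fun W => funext fun g => funext fun z => ?_))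
    have h1 : R (g ≫ f) := R.downward_closed hf g
    have h2 := hF W (g ≫ f) z (𝟙 W) (by simpa using h1)
    rw [Over.id_left, op_id, op_id, Functor.map_id_apply, Functor.map_id_apply] at h2
    refine h2.trans (Eq.trans ?_ (hs' f hf g h1 z).symm)
    simp only [Category.id_comp]
  · obtain ⟨σ, rfl⟩ := (twistEquiv M P T).surjective y
    refine congrArg _ (Subtype.ext (funext fun W => funext fun g => funext fun z => ?_))
    refine hsep g fun V f hf => ?_
    rw [hF W g z f hf]
    have h1 := hy (f ≫ g) hf
    have h2 := (AddEquiv.symm_apply_eq _).2 ((twistEquiv_restrict M P (f ≫ g) σ).symm.trans h1).symm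
    refine (twistSections.map_val σ f g z).trans ?_
    change _ = ((twistEquiv M P V).symm (x (f ≫ g) hf)).1 V (𝟙 V) _
    rw [h2, twistSections.restrict_val, Category.id_comp]

/-- The element of the group that moves one section of a torsor to another. -/
def SheafTorsor.transport (P : SheafTorsor J G S) {T : Over S} (x y : P.sheaf.obj (op T)) :
    G.obj (op T.left) :=
  (P.existsUnique_act T x y).exists.choose

namespace SheafTorsor

variable (P : SheafTorsor J G S) {T T' : Over S}

lemma act_transport (x y : P.sheaf.obj (op T)) : P.act T x (P.transport x y) = y :=
  (P.existsUnique_act T x y).exists.choose_spec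

lemma act_injective (x : P.sheaf.obj (op T)) : Function.Injective (P.act T x) :=
  fun _ b h => (P.existsUnique_act T x (P.act T x b)).unique h rfl

lemma transport_self (x : P.sheaf.obj (op T)) : P.transport x x = 1 :=
  P.act_injective x (by rw [act_transport, P.act_one])

lemma transport_act (x y : P.sheaf.obj (op T)) (g : G.obj (op T.left)) :
    P.transport x (P.act T y g) = P.transport x y * g :=
  P.act_injective x (by rw [act_transport, P.act_mul, act_transport])

lemma map_transport (f : T' ⟶ T) (x y : P.sheaf.obj (op T)) :
    G.map f.left.op (P.transport x y) =
      P.transport (P.sheaf.map f.op x) (P.sheaf.map f.op y) :=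
  P.act_injective (P.sheaf.map f.op x) (by rw [act_transport, ← P.map_act, act_transport])

end SheafTorsor

/-- The section of the twist that has a given value at a section of the torsor. -/
def twistSectionOf (M : AutAction J G E) (P : SheafTorsor J G S) {T : Over S}
    (x : P.sheaf.obj (op T)) (e : E.obj (op T.left)) : twistSections M P T :=
  ⟨fun V v y => M.act V.left (P.transport (P.sheaf.map v.op x) y)⁻¹ (E.map v.left.op e),
    fun V V' f v y => by
      rw [M.map_act, map_inv, P.map_transport, ← Functor.map_comp_apply, ← Functor.map_comp_apply,
        ← op_comp, ← op_comp]
      rfl,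
    fun V v y g => by
      change M.act V.left g (M.act V.left _ _) = M.act V.left _ _
      rw [P.transport_act, mul_inv_rev, ← M.act_mul, mul_inv_cancel_left]⟩

lemma twistSectionOf_val (M : AutAction J G E) (P : SheafTorsor J G S) {T : Over S}
    (x : P.sheaf.obj (op T)) (e : E.obj (op T.left)) :
    (twistSectionOf M P x e).1 T (𝟙 T) x = e := by
  change M.act T.left (P.transport (P.sheaf.map (𝟙 T).op x) x)⁻¹ (E.map (𝟙 T : T ⟶ T).left.op e) = e
  rw [Over.id_left, op_id, op_id, Functor.map_id_apply, Functor.map_id_apply, P.transport_self,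
    inv_one, M.act_one]

lemma eq_twistSectionOf {M : AutAction J G E} {P : SheafTorsor J G S} {T : Over S}
    {x : P.sheaf.obj (op T)} {e : E.obj (op T.left)} {σ : twistSections M P T} 
    (h : σ.1 T (𝟙 T) x = e) : σ = twistSectionOf M P x e :=
  twistSections.ext_section x (h.trans (twistSectionOf_val M P x e).symm)

/-- The frame of the twist by `P` attached to a section of `P`. -/
def twistFrame (M : AutAction J G E) (P : SheafTorsor J G S) {T : Over S}
    (x : P.sheaf.obj (op T)) : Frame E (twist M P) T where
  hom V v := (twistEquiv M P V).toAddMonoidHom.comp (AddMonoidHom.mk'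
    (fun e => twistSectionOf M P (P.sheaf.map v.op x) e) fun a b => by
      refine (eq_twistSectionOf ?_).symm
      exact congrArg₂ (· + ·) (twistSectionOf_val M P _ a) (twistSectionOf_val M P _ b))
  map_hom V V' f v e := by
    refine (twistEquiv_restrict M P f _).trans (congrArg (twistEquiv M P V') ?_)
    refine eq_twistSectionOf ?_
    refine Eq.trans ?_ (congrArg _ (twistSectionOf_val M P (P.sheaf.map v.op x) e))
    refine Eq.trans ?_ (twistSections.map_val _ _ _ _).symm
    change (twistSectionOf M P (P.sheaf.map v.op x) e).1 _ (𝟙 V' ≫ f) _ = _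
    rw [Category.id_comp, Category.comp_id, op_comp, Functor.map_comp_apply]
  bijective V v := by
    refine (twistEquiv M P V).bijective.comp ⟨fun a b h => ?_, fun σ => ?_⟩
    · have h' : twistSectionOf M P (P.sheaf.map v.op x) a =
        twistSectionOf M P (P.sheaf.map v.op x) b := h
      rw [← twistSectionOf_val M P (P.sheaf.map v.op x) a, h', twistSectionOf_val]
    · exact ⟨_, (eq_twistSectionOf (x := P.sheaf.map v.op x) rfl).symm⟩

lemma twistFrame_hom (M : AutAction J G E) (P : SheafTorsor J G S) {T : Over S}
    (x : P.sheaf.obj (op T)) {V : Over S} (v : V ⟶ T) (e : E.obj (op V.left)) :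
    (twistFrame M P x).hom v e = twistEquiv M P V (twistSectionOf M P (P.sheaf.map v.op x) e) :=
  rfl

lemma twistFrame_restrict (M : AutAction J G E) (P : SheafTorsor J G S) {T T' : Over S}
    (f : T' ⟶ T) (x : P.sheaf.obj (op T)) :
    twistFrame M P (P.sheaf.map f.op x) = (twistFrame M P x).restrict f := by
  ext V v e
  rw [Frame.restrict_hom, twistFrame_hom, twistFrame_hom, op_comp, Functor.map_comp_apply]

lemma twistFrame_act (M : AutAction J G E) (P : SheafTorsor J G S) {T : Over S}
    (x : P.sheaf.obj (op T)) (g : G.obj (op T.left)) :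
    twistFrame M P (P.act T x g) = (twistFrame M P x).act M g := by
  ext V v e
  rw [Frame.act_hom, twistFrame_hom, twistFrame_hom]
  refine congrArg _ (eq_twistSectionOf ?_)
  rw [P.map_act, ← twistSections.act_val _ _ _ (G.map v.left.op g), twistSectionOf_val]

lemma locallyFramed_twist (M : AutAction J G E) (P : SheafTorsor J G S) :
    LocallyFramed J E (twist M P) := by
  obtain ⟨R, hR, h⟩ := P.locally_nonempty
  exact ⟨R, hR, fun S' f hf => (h f hf).map (twistFrame M P)⟩

lemma SheafTorsor.isIso_of_equivariant {P Q : SheafTorsor J G S} (m : P.sheaf ⟶ Q.sheaf)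
    (hm : ∀ (T : Over S) (x : P.sheaf.obj (op T)) (g : G.obj (op T.left)),
      m.app (op T) (P.act T x g) = Q.act T (m.app (op T) x) g) : IsIso m := by
  have hP := (isSheaf_iff_isSheaf_of_type _ _).1 P.isSheaf
  have hinj (T : Over S) : Function.Injective (m.app (op T)) := fun x y h => by
    obtain ⟨g, rfl, -⟩ := P.existsUnique_act T x y
    rw [hm] at h
    have : g = 1 := Q.act_injective (m.app (op T) x) (by rw [← h, Q.act_one])
    rw [this, P.act_one]
  have (T : (Over S)ᵒᵖ) : IsIso (m.app T) := by
    obtain ⟨T⟩ := T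
    refine (ConcreteCategory.isIso_iff_bijective _).2 ⟨hinj T, fun y => ?_⟩
    obtain ⟨R, hR, h⟩ := P.locally_nonempty
    have hR' := J.overEquiv_symm_mem_over _ _ (J.pullback_stable T.hom hR)
    have key : ∀ ⦃V : Over S⦄ (v : V ⟶ T), (Sieve.overEquiv T).symm (R.pullback T.hom) v →
        ∃ x : P.sheaf.obj (op V), m.app (op V) x = Q.sheaf.map v.op y := fun V v hv => by
      rw [Sieve.overEquiv_symm_iff] at hv
      obtain ⟨x⟩ := h _ hv
      let x' := P.sheaf.map (Over.homMk (𝟙 V.left) : V ⟶ Over.mk (v.left ≫ T.hom)).op x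
      refine ⟨P.act V x' (Q.transport (m.app (op V) x') (Q.sheaf.map v.op y)), ?_⟩
      rw [hm, Q.act_transport]
    choose F hF using key
    obtain ⟨x, hx⟩ := Presieve'.exists_glue hP hR' F fun V W f hf g => by
      apply hinj
      rw [hF, NatTrans.naturality_apply, hF, op_comp, Functor.map_comp_apply]
    refine ⟨x, Presieve'.ext_of_cover ((isSheaf_iff_isSheaf_of_type _ _).1 Q.isSheaf) hR'
      fun V v hv => ?_⟩
    rw [← hF v hv, ← hx v hv, NatTrans.naturality_apply]
  exact NatIso.isIso_of_isIso_app m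

lemma SlicePresheaf.compMap_comp_idMap {D : Type*} [Category D] {A B : (Over S)ᵒᵖ ⥤ D}
    (n : A ⟶ B) (n' : B ⟶ A) (h : n ≫ n' = 𝟙 A) :
    HEq (compMap (n ≫ idMap B) (n' ≫ idMap A)) (idMap A) := by
  refine heq_of_app (Category.comp_id _) fun T => ?_
  have h0 : n.app (op T) ≫ n'.app (op T) = 𝟙 _ := by
    rw [← NatTrans.comp_app, h, NatTrans.id_app]
  have h1 := n'.naturality ((Over.mapId S).hom.app T).op
  rw [compMap_app, NatTrans.comp_app, NatTrans.comp_app, idMap_app, idMap_app, idMap_app]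
  simp only [Category.assoc]
  rw [reassoc_of% h1]
  refine ((Category.assoc _ _ _).symm.trans
    ((congrArg (· ≫ _) h0).trans (Category.id_comp _))).trans ?_
  simp only [← Functor.map_comp]
  refine congrArg A.map (Quiver.Hom.unop_inj ?_)
  ext
  simp

/-- An equivariant map of torsors over the same base, as a morphism of the classifying stack. -/
def BG.homOfEquivariant {P Q : SheafTorsor J G S} (m : P.sheaf ⟶ Q.sheaf)
    (hm : ∀ (T : Over S) (x : P.sheaf.obj (op T)) (g : G.obj (op T.left)),
      m.app (op T) (P.act T x g) = Q.act T (m.app (op T) x) g) :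
    (⟨S, P⟩ : BG J G) ⟶ ⟨S, Q⟩ :=
  BG.Hom.mk (X := ⟨S, P⟩) (Y := ⟨S, Q⟩) (𝟙 S) (m ≫ SlicePresheaf.idMap Q.sheaf) fun T x g => by
    have h1 := Q.map_act ((Over.mapId S).hom.app T) (m.app (op T) x) g
    have h2 : G.map ((Over.mapId S).hom.app T).left.op g = g := by simp
    rw [h2] at h1
    refine Eq.trans ?_ h1
    exact congrArg (Q.sheaf.map _) (hm T x g)

lemma BG.homOfEquivariant_comp {P Q : SheafTorsor J G S} (m : P.sheaf ⟶ Q.sheaf)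
    (n : Q.sheaf ⟶ P.sheaf) (hm) (hn) (h : m ≫ n = 𝟙 _) :
    BG.homOfEquivariant m hm ≫ BG.homOfEquivariant n hn = 𝟙 (⟨S, P⟩ : BG J G) :=
  BG.Hom.ext (Category.comp_id (𝟙 S)) (SlicePresheaf.compMap_comp_idMap m n h)

lemma BG.exists_iso_of_equivariant {P Q : SheafTorsor J G S} (m : P.sheaf ⟶ Q.sheaf)
    (hm : ∀ (T : Over S) (x : P.sheaf.obj (op T)) (g : G.obj (op T.left)),
      m.app (op T) (P.act T x g) = Q.act T (m.app (op T) x) g) :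
    ∃ e : (⟨S, P⟩ : BG J G) ≅ ⟨S, Q⟩, e.hom.base = 𝟙 S := by
  have := SheafTorsor.isIso_of_equivariant m hm
  have hinv (T : Over S) (x : Q.sheaf.obj (op T)) (g : G.obj (op T.left)) :
      (inv m).app (op T) (Q.act T x g) = P.act T ((inv m).app (op T) x) g := by
    have h1 (y : Q.sheaf.obj (op T)) : m.app (op T) ((inv m).app (op T) y) = y := by
      rw [← ConcreteCategory.comp_apply, ← NatTrans.comp_app, IsIso.inv_hom_id]
      rfl
    have h2 (y : P.sheaf.obj (op T)) : (inv m).app (op T) (m.app (op T) y) = y := by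
      rw [← ConcreteCategory.comp_apply, ← NatTrans.comp_app, IsIso.hom_inv_id]
      rfl
    conv_lhs => rw [← h1 x, ← hm, h2]
  exact ⟨⟨homOfEquivariant m hm, homOfEquivariant (inv m) hinv,
    homOfEquivariant_comp _ _ _ _ (by simp), homOfEquivariant_comp _ _ _ _ (by simp)⟩, rfl⟩

end

end

noncomputable section

/-! ### Evaluation of power series at nilpotent elements -/

namespace MvPowerSeries

variable {σ τ : Type*} {A R R' : Type*} [CommRing A] [CommRing R] [CommRing R']

/-- The value of a power series at a point with nilpotent coordinates. -/
def nilEval (φ : A →+* R) (F : MvPowerSeries σ A) (a : σ → R) : R :=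
  ∑ᶠ d : σ →₀ ℕ, φ (coeff d F) * d.prod fun s k => a s ^ k

lemma nilEval_map (ψ : A →+* R) (φ : R →+* R') (F : MvPowerSeries σ A) (a : σ → R') :
    nilEval φ (map ψ F) a = nilEval (φ.comp ψ) F a := by
  simp [nilEval]

lemma hasSubst_C [Finite σ] {a : σ → R} (ha : ∀ s, IsNilpotent (a s)) :
    HasSubst (fun s => C (a s) : σ → MvPowerSeries τ R) :=
  hasSubst_of_constantCoeff_nilpotent fun s => by simpa using ha s

lemma nilEval_eq_subst [Finite σ] (φ : A →+* R) (F : MvPowerSeries σ A) {a : σ → R}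
    (ha : ∀ s, IsNilpotent (a s)) : nilEval φ F a =
      constantCoeff (subst (fun s => C (a s) : σ → MvPowerSeries PEmpty.{1} R) (map φ F)) := by
  rw [constantCoeff_subst (hasSubst_C ha), nilEval]
  refine finsum_congr fun d => ?_
  rw [smul_eq_mul, Finsupp.prod, Finsupp.prod, map_prod]
  simp

/-- The value of power series at a point with nilpotent coordinates, as a ring homomorphism. -/
def nilEvalHom [Finite σ] (φ : A →+* R) {a : σ → R} (ha : ∀ s, IsNilpotent (a s)) :
    MvPowerSeries σ A →+* R :=
  (constantCoeff (σ := PEmpty.{1})).comp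
    ((substAlgHom (R := R) (hasSubst_C ha)).toRingHom.comp (map φ))

lemma nilEvalHom_apply [Finite σ] (φ : A →+* R) {a : σ → R} (ha : ∀ s, IsNilpotent (a s))
    (F : MvPowerSeries σ A) : nilEvalHom φ ha F = nilEval φ F a := by
  rw [nilEval_eq_subst φ F ha, ← coe_substAlgHom (hasSubst_C ha)]
  rfl

lemma hasFiniteSupport_nilEval [Finite σ] (φ : A →+* R) (F : MvPowerSeries σ A) {a : σ → R}
    (ha : ∀ s, IsNilpotent (a s)) :
    (fun d : σ →₀ ℕ => φ (coeff d F) * d.prod fun s k => a s ^ k).HasFiniteSupport := by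
  have h := coeff_subst_finite (hasSubst_C (τ := PEmpty.{1}) ha) (map φ F) 0
  convert! h using 2 with d
  rw [smul_eq_mul, Finsupp.prod, Finsupp.prod, coeff_zero_eq_constantCoeff_apply, map_prod]
  simp

lemma map_nilEval [Finite σ] (χ : R →+* R') (φ : A →+* R) (F : MvPowerSeries σ A) {a : σ → R}
    (ha : ∀ s, IsNilpotent (a s)) :
    χ (nilEval φ F a) = nilEval (χ.comp φ) F fun s => χ (a s) := by
  rw [nilEval, nilEval]
  refine (AddMonoidHom.map_finsum χ.toAddMonoidHom (hasFiniteSupport_nilEval φ F ha)).trans ?_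
  refine finsum_congr fun d => ?_
  simp [Finsupp.prod]

section

variable [Finite σ] (φ : A →+* R) {a : σ → R} (ha : ∀ s, IsNilpotent (a s))

include ha

lemma nilEval_add (F G : MvPowerSeries σ A) :
    nilEval φ (F + G) a = nilEval φ F a + nilEval φ G a := by
  simp only [← nilEvalHom_apply φ ha, map_add]

lemma nilEval_sub (F G : MvPowerSeries σ A) :
    nilEval φ (F - G) a = nilEval φ F a - nilEval φ G a := by
  simp only [← nilEvalHom_apply φ ha, map_sub]

lemma nilEval_mul (F G : MvPowerSeries σ A) :
    nilEval φ (F * G) a = nilEval φ F a * nilEval φ G a := by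
  simp only [← nilEvalHom_apply φ ha, map_mul]

lemma nilEval_pow (F : MvPowerSeries σ A) (n : ℕ) :
    nilEval φ (F ^ n) a = nilEval φ F a ^ n := by
  simp only [← nilEvalHom_apply φ ha, map_pow]

lemma nilEval_X (s : σ) : nilEval φ (X s) a = a s := by
  rw [nilEval_eq_subst φ _ ha, map_X, subst_X (hasSubst_C ha), constantCoeff_C]

lemma nilEval_subst [Finite τ] {G : τ → MvPowerSeries σ A}
    (hG : ∀ t, IsNilpotent (constantCoeff (G t))) (F : MvPowerSeries τ A) :
    nilEval φ (subst G F) a = nilEval φ F fun t => nilEval φ (G t) a := by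
  have hG' : HasSubst G := hasSubst_of_constantCoeff_nilpotent hG
  have hG'' : HasSubst fun t => map φ (G t) := hG'.map φ
  have hn (t : τ) : IsNilpotent (nilEval φ (G t) a) := by
    rw [nilEval_eq_subst φ _ ha]
    refine IsNilpotent_subst (hasSubst_C ha) ?_
    rw [constantCoeff_map]
    exact (hG t).map φ
  rw [nilEval_eq_subst φ _ ha, map_subst hG', subst_comp_subst_apply hG'' (hasSubst_C ha),
    nilEval_eq_subst φ F hn]
  congr 3
  funext t
  rw [nilEval_eq_subst φ _ ha]
  ext d
  rw [Subsingleton.elim d 0, coeff_zero_eq_constantCoeff_apply, coeff_zero_eq_constantCoeff_apply,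
    constantCoeff_C]

lemma isNilpotent_nilEval {F : MvPowerSeries σ A} (hF : IsNilpotent (constantCoeff F)) :
    IsNilpotent (nilEval φ F a) := by
  rw [nilEval_eq_subst φ _ ha]
  refine IsNilpotent_subst (hasSubst_C ha) ?_
  rw [constantCoeff_map]
  exact hF.map φ

end

lemma nilEval_zero (φ : A →+* R) (F : MvPowerSeries σ A) :
    nilEval φ F (fun _ => 0) = φ (constantCoeff F) := by
  rw [nilEval, finsum_eq_single _ 0]
  · simp
  · intro d hd
    obtain ⟨s, hs⟩ := Finsupp.support_nonempty_iff.2 hd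
    rw [Finsupp.prod, Finset.prod_eq_zero hs, mul_zero]
    exact zero_pow (Finsupp.mem_support_iff.1 hs)

lemma nilEval_C (φ : A →+* R) (x : A) (a : σ → R) :
    nilEval φ (C x : MvPowerSeries σ A) a = φ x := by
  classical
  rw [nilEval, finsum_eq_single _ 0]
  · simp
  · intro d hd
    rw [coeff_C, if_neg hd, map_zero, zero_mul]

/-- Values at congruent points are congruent. -/
lemma nilEval_sub_mem [Finite σ] (φ : A →+* R) (F : MvPowerSeries σ A) {a b : σ → R}
    (ha : ∀ s, IsNilpotent (a s)) (hb : ∀ s, IsNilpotent (b s)) {I : Ideal R}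
    (h : ∀ s, a s - b s ∈ I) : nilEval φ F a - nilEval φ F b ∈ I := by
  rw [← Ideal.Quotient.eq, map_nilEval _ φ F ha, map_nilEval _ φ F hb]
  congr 1
  funext s
  exact Ideal.Quotient.eq.2 (h s)

lemma nilEval_mem [Finite σ] (φ : A →+* R) {F : MvPowerSeries σ A} (hF : constantCoeff F = 0)
    {a : σ → R} (ha : ∀ s, IsNilpotent (a s)) {I : Ideal R} (h : ∀ s, a s ∈ I) :
    nilEval φ F a ∈ I := by
  have h1 := nilEval_sub_mem φ F ha (fun _ => IsNilpotent.zero) (I := I)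
    (b := fun _ => 0) (by simpa using h)
  rwa [nilEval_zero, hF, map_zero, sub_zero] at h1

/-! ### The universal point with nilpotent coordinates -/

variable (σ A) in
/-- The ideal of the power series of order at least `n`. -/
def orderIdeal (n : ℕ) : Ideal (MvPowerSeries σ A) where
  carrier := {F | ∀ d : σ →₀ ℕ, d.degree < n → coeff d F = 0}
  add_mem' {F G} hF hG d hd := by rw [map_add, hF d hd, hG d hd, add_zero]
  zero_mem' d _ := by simp
  smul_mem' F G hG d hd := by
    classical
    rw [smul_eq_mul, coeff_mul]
    refine Finset.sum_eq_zero fun x hx => ?_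
    have hx := Finset.HasAntidiagonal.mem_antidiagonal.1 hx
    rw [hG, mul_zero]
    rw [← hx, map_add] at hd
    omega

lemma X_pow_mem_orderIdeal (n : ℕ) (s : σ) : (X s : MvPowerSeries σ A) ^ n ∈ orderIdeal σ A n := by
  classical
  intro d hd
  rw [coeff_X_pow, if_neg]
  rintro rfl
  simp at hd

variable (σ A) in
/-- The ring of power series modulo the power series of order at least `n`. -/
abbrev TruncRing (n : ℕ) : Type _ := MvPowerSeries σ A ⧸ orderIdeal σ A n

lemma isNilpotent_mk_X (n : ℕ) (s : σ) :
    IsNilpotent (Ideal.Quotient.mk (orderIdeal σ A n) (X s)) :=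
  ⟨n, by
    rw [← map_pow, Ideal.Quotient.eq_zero_iff_mem]
    exact X_pow_mem_orderIdeal n s⟩

lemma isNilpotent_mk {n : ℕ} {F : MvPowerSeries σ A} (hF : constantCoeff F = 0) :
    Ideal.Quotient.mk (orderIdeal σ A n) F ^ n = 0 := by
  rw [← map_pow, Ideal.Quotient.eq_zero_iff_mem]
  intro d hd
  refine coeff_of_lt_order (lt_of_lt_of_le ?_ (le_order_pow_of_constantCoeff_eq_zero n hF))
  exact_mod_cast hd

lemma coeff_nilEval_X [Finite σ] (n : ℕ) (F : MvPowerSeries σ A) :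
    nilEval ((Ideal.Quotient.mk (orderIdeal σ A n)).comp C) F
      (fun s => Ideal.Quotient.mk (orderIdeal σ A n) (X s)) = Ideal.Quotient.mk _ F := by
  classical
  have hterm (d : σ →₀ ℕ) : ((Ideal.Quotient.mk (orderIdeal σ A n)).comp C) (coeff d F) *
      (d.prod fun s k => (Ideal.Quotient.mk (orderIdeal σ A n) (X s)) ^ k) =
        Ideal.Quotient.mk (orderIdeal σ A n) (monomial d (coeff d F)) := by
    rw [monomial_eq']
    simp [Finsupp.prod]
  have hz (d : σ →₀ ℕ) (hd : n ≤ d.degree) (a : A) :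
      Ideal.Quotient.mk (orderIdeal σ A n) (monomial d a) = 0 := by
    rw [Ideal.Quotient.eq_zero_iff_mem]
    intro e he
    rw [coeff_monomial, if_neg]
    rintro rfl
    omega
  have hfin : {d : σ →₀ ℕ | d.degree < n}.Finite := Finsupp.finite_of_degree_lt n
  rw [nilEval]
  simp only [hterm]
  rw [finsum_eq_sum_of_support_subset _ (s := hfin.toFinset) (by
    intro d hd
    simp only [Set.Finite.coe_toFinset, Set.mem_ofPred_eq]
    by_contra h
    exact hd (hz d (not_lt.1 h) _)), ← map_sum, Ideal.Quotient.eq]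
  intro d hd
  rw [map_sub, map_sum]
  simp only [coeff_monomial]
  rw [Finset.sum_ite_eq, if_pos (by simpa using hd), sub_self]


lemma exists_prod_pow_eq_zero [Finite σ] {a : σ → R} (ha : ∀ s, IsNilpotent (a s)) :
    ∃ n : ℕ, ∀ d : σ →₀ ℕ, n ≤ d.degree → (d.prod fun s k => a s ^ k) = 0 := by
  have := Fintype.ofFinite σ
  choose N hN using ha
  refine ⟨∑ s, N s + 1, fun d hd => ?_⟩
  by_cases h : ∃ s, N s ≤ d s
  · obtain ⟨s, hs⟩ := h
    rw [Finsupp.prod_fintype _ _ (by simp), Finset.prod_eq_zero (Finset.mem_univ s)]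
    exact pow_eq_zero_of_le hs (hN s)
  · push Not at h
    rw [Finsupp.degree_eq_sum] at hd
    have := Finset.sum_le_sum fun s (_ : s ∈ Finset.univ) => (h s).le
    omega

/-- A point whose coordinates are nilpotent comes from the universal point. -/
lemma exists_lift [Finite σ] (φ : A →+* R) {a : σ → R} (ha : ∀ s, IsNilpotent (a s)) :
    ∃ (n : ℕ) (χ : TruncRing σ A n →+* R),
      ∀ F, χ (Ideal.Quotient.mk _ F) = nilEval φ F a := by
  obtain ⟨n, hn⟩ := exists_prod_pow_eq_zero ha
  refine ⟨n, Ideal.Quotient.lift _ (nilEvalHom φ ha) fun F hF => ?_, fun F => ?_⟩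
  · rw [nilEvalHom_apply, nilEval]
    refine finsum_eq_zero_of_forall_eq_zero fun d => ?_
    rcases lt_or_ge d.degree n with h | h
    · rw [hF d h, map_zero, zero_mul]
    · rw [hn d h, mul_zero]
  · rw [Ideal.Quotient.lift_mk, nilEvalHom_apply]

lemma eq_of_mk_eq {F G : MvPowerSeries σ A} (h : ∀ n,
    Ideal.Quotient.mk (orderIdeal σ A n) F = Ideal.Quotient.mk (orderIdeal σ A n) G) : F = G := by
  ext d
  have := Ideal.Quotient.eq.1 (h (d.degree + 1)) d (Nat.lt_succ_self _)
  rwa [map_sub, sub_eq_zero] at this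

end MvPowerSeries

namespace MvPowerSeries

variable {σ : Type} [Finite σ] {A : Type u} [CommRing A]

lemma eq_of_nilEval_eq {F G : MvPowerSeries σ A}
    (h : ∀ (R : Type u) [CommRing R] (φ : A →+* R) (a : σ → R), (∀ s, IsNilpotent (a s)) →
      nilEval φ F a = nilEval φ G a) : F = G := by
  refine eq_of_mk_eq fun n => ?_
  rw [← coeff_nilEval_X, ← coeff_nilEval_X]
  exact h _ _ _ (isNilpotent_mk_X n)

/-- A natural function on the points with nilpotent coordinates is given by a power series. -/
lemma exists_nilEval (η : ∀ (R : Type u) [CommRing R] (_ : A →+* R) (a : σ → R),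
      (∀ s, IsNilpotent (a s)) → R)
    (hη : ∀ (R R' : Type u) [CommRing R] [CommRing R'] (χ : R →+* R') (φ : A →+* R) (a : σ → R)
      (ha : ∀ s, IsNilpotent (a s)), χ (η R φ a ha) =
        η R' (χ.comp φ) (fun s => χ (a s)) fun s => (ha s).map χ) :
    ∃ F : MvPowerSeries σ A, ∀ (R : Type u) [CommRing R] (φ : A →+* R) (a : σ → R)
      (ha : ∀ s, IsNilpotent (a s)), η R φ a ha = nilEval φ F a := by
  have hex (n : ℕ) := Ideal.Quotient.mk_surjective (η (TruncRing σ A n)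
    ((Ideal.Quotient.mk (orderIdeal σ A n)).comp C) _ (isNilpotent_mk_X n))
  choose f hf using hex
  have hle {m n : ℕ} (h : n ≤ m) : orderIdeal σ A m ≤ orderIdeal σ A n :=
    fun F hF d hd => hF d (hd.trans_le h)
  have hcompat {m n : ℕ} (h : n ≤ m) : f m - f n ∈ orderIdeal σ A n := by
    rw [← Ideal.Quotient.eq, hf n]
    have h1 := hη _ _ (Ideal.Quotient.factor (hle h)) ((Ideal.Quotient.mk _).comp C) _
      (isNilpotent_mk_X m)
    rw [← hf m, Ideal.Quotient.factor_mk] at h1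
    exact h1
  let F : MvPowerSeries σ A := fun d => coeff d (f (d.degree + 1))
  have hF (n : ℕ) : Ideal.Quotient.mk (orderIdeal σ A n) F = Ideal.Quotient.mk _ (f n) := by
    rw [Ideal.Quotient.eq]
    intro d hd
    have h1 := hcompat (show d.degree + 1 ≤ n by omega) d (Nat.lt_succ_self _)
    rw [map_sub, sub_eq_zero] at h1 ⊢
    exact h1.symm
  refine ⟨F, fun R _ φ a ha => ?_⟩
  obtain ⟨n, χ, hχ⟩ := exists_lift φ ha
  rw [← hχ, hF, hf, hη]
  congr 1
  · ext x
    exact ((hχ (C x)).trans (nilEval_C φ x a)).symm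
  · funext s
    rw [hχ, nilEval_X φ ha]

end MvPowerSeries

namespace PowerSeries

variable {σ : Type*} {A R R' : Type*} [CommRing A] [CommRing R] [CommRing R']

/-- The value of a power series in one variable at a nilpotent element. -/
def nilEval (φ : A →+* R) (f : PowerSeries A) (x : R) : R :=
  MvPowerSeries.nilEval φ f fun _ => x

lemma nilEval_eq_sum (φ : A →+* R) (f : PowerSeries A) {x : R} {n : ℕ} (hx : x ^ n = 0) :
    nilEval φ f x = ∑ i ∈ Finset.range n, φ (coeff i f) * x ^ i := by
  have h1 : nilEval φ f x = ∑ᶠ i : ℕ, φ (coeff i f) * x ^ i := by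
    rw [nilEval, MvPowerSeries.nilEval]
    refine (finsum_eq_of_bijective (fun i : ℕ => Finsupp.single () i)
      (Finsupp.uniqueEquiv ()).symm.bijective fun i => ?_).symm
    simp [coeff]
  rw [h1]
  refine finsum_eq_sum_of_support_subset _ fun i hi => ?_
  by_contra h
  refine hi ?_
  simp only [Finset.coe_range, Set.mem_Iio, not_lt] at h
  simp only
  rw [pow_eq_zero_of_le h hx, mul_zero]

lemma nilEval_map (ψ : A →+* R) (φ : R →+* R') (f : PowerSeries A) (x : R') :
    nilEval φ (map ψ f) x = nilEval (φ.comp ψ) f x :=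
  MvPowerSeries.nilEval_map ψ φ f _

lemma map_nilEval (χ : R →+* R') (φ : A →+* R) (f : PowerSeries A) {x : R} (hx : IsNilpotent x) :
    χ (nilEval φ f x) = nilEval (χ.comp φ) f (χ x) :=
  MvPowerSeries.map_nilEval χ φ f fun _ => hx

section

variable (φ : A →+* R) {x : R} (hx : IsNilpotent x)

include hx

lemma nilEval_mul (f g : PowerSeries A) :
    nilEval φ (f * g) x = nilEval φ f x * nilEval φ g x :=
  MvPowerSeries.nilEval_mul φ (fun _ => hx) f g

lemma nilEval_pow (f : PowerSeries A) (n : ℕ) : nilEval φ (f ^ n) x = nilEval φ f x ^ n :=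
  MvPowerSeries.nilEval_pow φ (fun _ => hx) f n

lemma nilEval_X : nilEval φ X x = x :=
  MvPowerSeries.nilEval_X φ (fun _ => hx) ()

lemma isNilpotent_nilEval {f : PowerSeries A} (hf : constantCoeff f = 0) :
    IsNilpotent (nilEval φ f x) :=
  MvPowerSeries.isNilpotent_nilEval φ (fun _ => hx) (hf ▸ IsNilpotent.zero)

lemma nilEval_subst {g : PowerSeries A} (hg : constantCoeff g = 0) (f : PowerSeries A) :
    nilEval φ (subst g f) x = nilEval φ f (nilEval φ g x) :=
  MvPowerSeries.nilEval_subst φ (fun _ => hx) (fun _ => hg ▸ IsNilpotent.zero) f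

end

lemma nilEval_subst_mv [Finite σ] (φ : A →+* R) {a : σ → R} (ha : ∀ s, IsNilpotent (a s))
    {g : MvPowerSeries σ A} (hg : MvPowerSeries.constantCoeff g = 0) (f : PowerSeries A) :
    MvPowerSeries.nilEval φ (subst g f) a = nilEval φ f (MvPowerSeries.nilEval φ g a) :=
  MvPowerSeries.nilEval_subst φ ha (fun _ => hg ▸ IsNilpotent.zero) f

lemma nilEval_subst_pair (φ : A →+* R) {x : R} (hx : IsNilpotent x) {f g : PowerSeries A}
    (hf : constantCoeff f = 0) (hg : constantCoeff g = 0) (F : MvPowerSeries (Fin 2) A) :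
    nilEval φ (MvPowerSeries.subst ![f, g] F) x =
      MvPowerSeries.nilEval φ F ![nilEval φ f x, nilEval φ g x] := by
  refine (MvPowerSeries.nilEval_subst φ (fun _ => hx) (G := ![f, g]) (fun t => ?_) F).trans ?_
  · fin_cases t
    · exact hf ▸ IsNilpotent.zero
    · exact hg ▸ IsNilpotent.zero
  · congr 1
    funext t
    fin_cases t <;> rfl

lemma nilEval_mem (φ : A →+* R) {f : PowerSeries A} (hf : constantCoeff f = 0) {x : R}
    (hx : IsNilpotent x) {I : Ideal R} (h : x ∈ I) : nilEval φ f x ∈ I :=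
  MvPowerSeries.nilEval_mem φ hf (fun _ => hx) fun _ => h

lemma nilEval_zero (φ : A →+* R) (f : PowerSeries A) : nilEval φ f 0 = φ (constantCoeff f) :=
  MvPowerSeries.nilEval_zero φ f

end PowerSeries

namespace PowerSeries

variable {A : Type u} [CommRing A]

lemma eq_of_nilEval_eq {f g : PowerSeries A} (h : ∀ (R : Type u) [CommRing R] (φ : A →+* R) (x : R),
    IsNilpotent x → nilEval φ f x = nilEval φ g x) : f = g :=
  MvPowerSeries.eq_of_nilEval_eq fun R _ φ a ha => h R φ (a ()) (ha ())

lemma exists_nilEval (η : ∀ (R : Type u) [CommRing R] (_ : A →+* R) (x : R), IsNilpotent x → R)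
    (hη : ∀ (R R' : Type u) [CommRing R] [CommRing R'] (χ : R →+* R') (φ : A →+* R) (x : R)
      (hx : IsNilpotent x), χ (η R φ x hx) = η R' (χ.comp φ) (χ x) (hx.map χ)) :
    ∃ f : PowerSeries A, ∀ (R : Type u) [CommRing R] (φ : A →+* R) (x : R) (hx : IsNilpotent x),
      η R φ x hx = nilEval φ f x := by
  obtain ⟨F, hF⟩ := MvPowerSeries.exists_nilEval (σ := Unit)
    (fun R _ φ a ha => η R φ (a ()) (ha ())) fun R R' _ _ χ φ a ha => hη R R' χ φ (a ()) (ha ())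
  exact ⟨F, fun R _ φ x hx => hF R φ (fun _ => x) fun _ => hx⟩

end PowerSeries

end

noncomputable section

/-! ### The points of a formal group law in nilpotent elements -/

lemma isNilpotent_pair {R : Type*} [CommRing R] {x y : R} (hx : IsNilpotent x)
    (hy : IsNilpotent y) (s : Fin 2) : IsNilpotent (![x, y] s) := by
  fin_cases s
  · exact hx
  · exact hy

lemma isNilpotent_pair_constantCoeff {σ R : Type*} [CommRing R] {f g : MvPowerSeries σ R}
    (hf : MvPowerSeries.constantCoeff f = 0) (hg : MvPowerSeries.constantCoeff g = 0) (s : Fin 2) :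
    IsNilpotent (MvPowerSeries.constantCoeff (![f, g] s)) := by
  fin_cases s
  · exact hf ▸ IsNilpotent.zero
  · exact hg ▸ IsNilpotent.zero

namespace FormalGroup

section

variable {A R R' : Type*} [CommRing A] [CommRing R] [CommRing R'] (F : FormalGroup A)
  (φ : A →+* R)

/-- The sum of two nilpotent elements with respect to a formal group law. -/
def nilAdd (x y : R) : R := MvPowerSeries.nilEval φ F.toPowerSeries ![x, y]

lemma nilAdd_map (ψ : A →+* R) (φ : R →+* R') (x y : R') :
    (F.map ψ).nilAdd φ x y = F.nilAdd (φ.comp ψ) x y :=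
  MvPowerSeries.nilEval_map ψ φ _ _

variable {x y z : R}

lemma isNilpotent_nilAdd (hx : IsNilpotent x) (hy : IsNilpotent y) :
    IsNilpotent (F.nilAdd φ x y) :=
  MvPowerSeries.isNilpotent_nilEval φ (isNilpotent_pair hx hy)
    (F.zero_constantCoeff ▸ IsNilpotent.zero)

lemma map_nilAdd (χ : R →+* R') (hx : IsNilpotent x) (hy : IsNilpotent y) :
    χ (F.nilAdd φ x y) = F.nilAdd (χ.comp φ) (χ x) (χ y) := by
  refine (MvPowerSeries.map_nilEval χ φ _ (isNilpotent_pair hx hy)).trans ?_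
  rw [nilAdd]
  congr 1
  funext s
  fin_cases s <;> rfl

lemma nilEval_subst_pair {σ : Type*} [Finite σ] {a : σ → R} (ha : ∀ s, IsNilpotent (a s))
    {f g : MvPowerSeries σ A} (hf : MvPowerSeries.constantCoeff f = 0)
    (hg : MvPowerSeries.constantCoeff g = 0) :
    MvPowerSeries.nilEval φ (MvPowerSeries.subst ![f, g] F.toPowerSeries) a =
      F.nilAdd φ (MvPowerSeries.nilEval φ f a) (MvPowerSeries.nilEval φ g a) := by
  rw [nilAdd, MvPowerSeries.nilEval_subst φ ha (isNilpotent_pair_constantCoeff hf hg)]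
  congr 1
  funext s
  fin_cases s <;> rfl

lemma nilAdd_assoc (hx : IsNilpotent x) (hy : IsNilpotent y) (hz : IsNilpotent z) :
    F.nilAdd φ (F.nilAdd φ x y) z = F.nilAdd φ x (F.nilAdd φ y z) := by
  have ha (s : Fin 3) : IsNilpotent (![x, y, z] s) := by
    fin_cases s
    exacts [hx, hy, hz]
  have h := congrArg (fun G => MvPowerSeries.nilEval φ G ![x, y, z]) F.assoc
  have hc (i j : Fin 3) : MvPowerSeries.constantCoeff (MvPowerSeries.subst
      ![(MvPowerSeries.X i : MvPowerSeries (Fin 3) A), MvPowerSeries.X j] F.toPowerSeries) = 0 :=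
    MvPowerSeries.constantCoeff_subst_eq_zero MvPowerSeries.HasSubst.X_X (by
      intro i; fin_cases i <;> simp) F.zero_constantCoeff
  rw [F.nilEval_subst_pair φ ha (hc 0 1) (by simp), F.nilEval_subst_pair φ ha (by simp) (hc 1 2),
    F.nilEval_subst_pair φ ha (by simp) (by simp), F.nilEval_subst_pair φ ha (by simp) (by simp),
    MvPowerSeries.nilEval_X φ ha, MvPowerSeries.nilEval_X φ ha, MvPowerSeries.nilEval_X φ ha] at h
  exact h

lemma nilAdd_comm [F.IsComm] (hx : IsNilpotent x) (hy : IsNilpotent y) :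
    F.nilAdd φ x y = F.nilAdd φ y x := by
  have ha := isNilpotent_pair hx hy
  have h := congrArg (fun G => MvPowerSeries.nilEval φ G ![x, y]) (IsComm.comm (F := F))
  rw [F.nilEval_subst_pair φ ha (by simp) (by simp), MvPowerSeries.nilEval_X φ ha,
    MvPowerSeries.nilEval_X φ ha] at h
  exact h

lemma nilAdd_zero (hx : IsNilpotent x) : F.nilAdd φ x 0 = x := by
  have h := congrArg (fun G => PowerSeries.nilEval φ G x) F.Xzero_eq_X
  rw [PowerSeries.nilEval_X φ hx, Xzero,
    PowerSeries.nilEval_subst_pair φ hx (by simp) (by simp), PowerSeries.nilEval_X φ hx] at h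
  have h0 : PowerSeries.nilEval φ 0 x = 0 := by
    rw [PowerSeries.nilEval, ← MvPowerSeries.nilEvalHom_apply φ (fun _ => hx)]
    exact map_zero _
  rw [h0] at h
  exact h

lemma zero_nilAdd (hx : IsNilpotent x) : F.nilAdd φ 0 x = x := by
  have h := congrArg (fun G => PowerSeries.nilEval φ G x) F.zeroX_eq_X
  rw [PowerSeries.nilEval_X φ hx, zeroX,
    PowerSeries.nilEval_subst_pair φ hx (by simp) (by simp), PowerSeries.nilEval_X φ hx] at h
  have h0 : PowerSeries.nilEval φ 0 x = 0 := by
    rw [PowerSeries.nilEval, ← MvPowerSeries.nilEvalHom_apply φ (fun _ => hx)]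
    exact map_zero _
  rw [h0] at h
  exact h

lemma coeff_single_zero (n : ℕ) : MvPowerSeries.coeff (Finsupp.single 0 n) F.toPowerSeries =
    if n = 1 then 1 else 0 := by
  have h := congrArg (PowerSeries.coeff n) F.Xzero_eq_X
  rw [PowerSeries.coeff_X, Xzero, PowerSeries.coeff,
    MvPowerSeries.coeff_subst (a := ![PowerSeries.X, 0]) MvPowerSeries.HasSubst.X_zero,
    finsum_eq_single _ (Finsupp.single 0 n)] at h
  · rw [← h]
    simp [← PowerSeries.coeff_def rfl, PowerSeries.coeff_X_pow]
  · intro d hd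
    by_cases h1 : d 1 = 0
    · have hd0 : d 0 ≠ n := by
        rintro rfl
        apply hd
        ext i
        fin_cases i
        · simp
        · simpa using h1
      simp [h1, ← PowerSeries.coeff_def rfl, PowerSeries.coeff_X_pow, hd0.symm]
    · simp [h1]

lemma coeff_single_one (n : ℕ) : MvPowerSeries.coeff (Finsupp.single 1 n) F.toPowerSeries =
    if n = 1 then 1 else 0 := by
  have h := congrArg (PowerSeries.coeff n) F.zeroX_eq_X
  rw [PowerSeries.coeff_X, zeroX, PowerSeries.coeff,
    MvPowerSeries.coeff_subst (a := ![0, PowerSeries.X]) MvPowerSeries.HasSubst.zero_X,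
    finsum_eq_single _ (Finsupp.single 1 n)] at h
  · rw [← h]
    simp [← PowerSeries.coeff_def rfl, PowerSeries.coeff_X_pow]
  · intro d hd
    by_cases h1 : d 0 = 0
    · have hd0 : d 1 ≠ n := by
        rintro rfl
        apply hd
        ext i
        fin_cases i
        · simpa using h1
        · simp
      simp [h1, ← PowerSeries.coeff_def rfl, PowerSeries.coeff_X_pow, hd0.symm]
    · simp [h1]

/-- `F(X, Y) = X + Y + X Y G(X, Y)`. -/
lemma exists_eq_add_mul : ∃ G : MvPowerSeries (Fin 2) A, F.toPowerSeries =
    MvPowerSeries.X 0 + MvPowerSeries.X 1 + MvPowerSeries.X 0 * (MvPowerSeries.X 1 * G) := by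
  classical
  have h0 (d : Fin 2 →₀ ℕ) (hd : d 0 = 0) : d = Finsupp.single 1 (d 1) := by
    ext i
    fin_cases i
    · simpa using hd
    · simp
  have h1 (d : Fin 2 →₀ ℕ) (hd : d 1 = 0) : d = Finsupp.single 0 (d 0) := by
    ext i
    fin_cases i
    · simp
    · simpa using hd
  have hX : (MvPowerSeries.X 0 : MvPowerSeries (Fin 2) A) ∣
      F.toPowerSeries - MvPowerSeries.X 0 - MvPowerSeries.X 1 := by
    rw [MvPowerSeries.X_dvd_iff]
    intro d hd
    rw [h0 d hd, map_sub, map_sub, coeff_single_one, MvPowerSeries.coeff_X, MvPowerSeries.coeff_X]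
    by_cases h : d 1 = 1
    · simp [h, Finsupp.single_eq_single_iff]
    · simp [h, Finsupp.single_eq_single_iff]
  obtain ⟨g, hg⟩ := hX
  have hY : (MvPowerSeries.X 1 : MvPowerSeries (Fin 2) A) ∣ g := by
    rw [MvPowerSeries.X_dvd_iff]
    intro d hd
    have h2 := congrArg (MvPowerSeries.coeff (Finsupp.single 0 1 + d)) hg
    rw [MvPowerSeries.X, MvPowerSeries.coeff_add_monomial_mul, one_mul] at h2
    rw [← h2, h1 (Finsupp.single 0 1 + d) (by simpa using hd)]
    generalize (Finsupp.single 0 1 + d : Fin 2 →₀ ℕ) 0 = m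
    rw [map_sub, map_sub, coeff_single_zero, ← MvPowerSeries.X, MvPowerSeries.coeff_X,
      MvPowerSeries.coeff_X]
    by_cases h : m = 1
    · simp [h, Finsupp.single_eq_single_iff]
    · simp [h, Finsupp.single_eq_single_iff]
  obtain ⟨G, rfl⟩ := hY
  exact ⟨G, by rw [← hg]; ring⟩

lemma nilAdd_sub_mem (hx : IsNilpotent x) (hy : IsNilpotent y) :
    F.nilAdd φ x y - x - y ∈ Ideal.span {x * y} := by
  obtain ⟨G, hG⟩ := F.exists_eq_add_mul
  have ha := isNilpotent_pair hx hy
  rw [nilAdd, hG]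
  simp only [MvPowerSeries.nilEval_add φ ha, MvPowerSeries.nilEval_mul φ ha,
    MvPowerSeries.nilEval_X φ ha, Matrix.cons_val_zero, Matrix.cons_val_one]
  rw [Ideal.mem_span_singleton]
  exact ⟨MvPowerSeries.nilEval φ G ![x, y], by ring⟩

/-- The sum with a small perturbation. -/
lemma nilAdd_add_left {e : R} (hx : IsNilpotent x) (hy : IsNilpotent y) (he : IsNilpotent e)
    (hey : e * y = 0) : F.nilAdd φ (x + e) y = F.nilAdd φ x y + e := by
  obtain ⟨G, hG⟩ := F.exists_eq_add_mul
  have hxe : IsNilpotent (x + e) := Commute.isNilpotent_add (Commute.all _ _) hx he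
  have ha := isNilpotent_pair hx hy
  have hb := isNilpotent_pair hxe hy
  have h := MvPowerSeries.nilEval_sub_mem φ G hb ha (I := Ideal.span {e}) fun s => by
    fin_cases s
    · simp
    · simp
  obtain ⟨c, hc⟩ := Ideal.mem_span_singleton.1 h
  rw [sub_eq_iff_eq_add] at hc
  rw [nilAdd, nilAdd, hG]
  simp only [MvPowerSeries.nilEval_add φ ha, MvPowerSeries.nilEval_mul φ ha,
    MvPowerSeries.nilEval_X φ ha, MvPowerSeries.nilEval_add φ hb, MvPowerSeries.nilEval_mul φ hb,
    MvPowerSeries.nilEval_X φ hb, Matrix.cons_val_zero, Matrix.cons_val_one, hc]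
  linear_combination ((x + e) * c + MvPowerSeries.nilEval φ G ![x, y]) * hey

lemma nilAdd_add_right {e : R} (hx : IsNilpotent x) (hy : IsNilpotent y) (he : IsNilpotent e)
    (hxe : x * e = 0) : F.nilAdd φ x (y + e) = F.nilAdd φ x y + e := by
  obtain ⟨G, hG⟩ := F.exists_eq_add_mul
  have hye : IsNilpotent (y + e) := Commute.isNilpotent_add (Commute.all _ _) hy he
  have ha := isNilpotent_pair hx hy
  have hb := isNilpotent_pair hx hye
  have h := MvPowerSeries.nilEval_sub_mem φ G hb ha (I := Ideal.span {e}) fun s => by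
    fin_cases s
    · simp
    · simp
  obtain ⟨c, hc⟩ := Ideal.mem_span_singleton.1 h
  rw [sub_eq_iff_eq_add] at hc
  rw [nilAdd, nilAdd, hG]
  simp only [MvPowerSeries.nilEval_add φ ha, MvPowerSeries.nilEval_mul φ ha,
    MvPowerSeries.nilEval_X φ ha, MvPowerSeries.nilEval_add φ hb, MvPowerSeries.nilEval_mul φ hb,
    MvPowerSeries.nilEval_X φ hb, Matrix.cons_val_zero, Matrix.cons_val_one, hc]
  linear_combination ((y + e) * c + MvPowerSeries.nilEval φ G ![x, y]) * hxe

lemma exists_nilAdd_eq_zero (n : ℕ) : ∀ x : R, x ^ n = 0 →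
    ∃ y, IsNilpotent y ∧ F.nilAdd φ x y = 0 := by
  induction n using Nat.strong_induction_on with
  | _ n ih =>
    intro x hx
    have hxn : IsNilpotent x := ⟨n, hx⟩
    by_cases hn : n ≤ 1
    · have : x = 0 := by simpa using pow_eq_zero_of_le hn hx
      exact ⟨0, IsNilpotent.zero, by rw [F.nilAdd_zero φ hxn, this]⟩
    · have h1 := F.nilAdd_sub_mem φ hxn hxn.neg
      obtain ⟨c, hc⟩ := Ideal.mem_span_singleton.1 h1
      have h2 : F.nilAdd φ x (-x) = x ^ 2 * (-c) := by linear_combination hc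
      obtain ⟨y, hy, hy'⟩ := ih (n - 1) (by omega) (F.nilAdd φ x (-x)) (by
        rw [h2, mul_pow, ← pow_mul, pow_eq_zero_of_le (by omega) hx, zero_mul])
      rw [F.nilAdd_assoc φ hxn hxn.neg hy] at hy'
      exact ⟨_, F.isNilpotent_nilAdd φ hxn.neg hy, hy'⟩

lemma nilAdd_left_cancel [F.IsComm] (hx : IsNilpotent x) (hy : IsNilpotent y) (hz : IsNilpotent z)
    (h : F.nilAdd φ x y = F.nilAdd φ x z) : y = z := by
  obtain ⟨n, hn⟩ := hx
  obtain ⟨w, hw, hw'⟩ := F.exists_nilAdd_eq_zero φ n x hn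
  have hx : IsNilpotent x := ⟨n, hn⟩
  rw [F.nilAdd_comm φ hx hw] at hw'
  have h' := congrArg (F.nilAdd φ w) h
  rwa [← F.nilAdd_assoc φ hw hx hy, ← F.nilAdd_assoc φ hw hx hz, hw', F.zero_nilAdd φ hy,
    F.zero_nilAdd φ hz] at h'

lemma constantCoeff_mulSeries (m : ℕ) : PowerSeries.constantCoeff (F.mulSeries m) = 0 := by
  induction m with
  | zero => exact map_zero _
  | succ m ih =>
    exact MvPowerSeries.constantCoeff_subst_eq_zero
      (MvPowerSeries.hasSubst_of_constantCoeff_zero fun s => by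
        fin_cases s
        · exact ih
        · exact PowerSeries.constantCoeff_X) (fun s => by
        fin_cases s
        · exact ih
        · exact PowerSeries.constantCoeff_X) F.zero_constantCoeff

lemma nilEval_mulSeries_succ (m : ℕ) (hx : IsNilpotent x) :
    PowerSeries.nilEval φ (F.mulSeries (m + 1)) x =
      F.nilAdd φ (PowerSeries.nilEval φ (F.mulSeries m) x) x := by
  rw [mulSeries, PowerSeries.nilEval_subst_pair φ hx (F.constantCoeff_mulSeries m) (by simp),
    PowerSeries.nilEval_X φ hx]
  rfl

end

section

variable {A : Type u} [CommRing A] (F : FormalGroup A) [F.IsComm]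

lemma exists_negSeries : ∃ i : PowerSeries A, PowerSeries.constantCoeff i = 0 ∧
    ∀ (R : Type u) [CommRing R] (φ : A →+* R) (x : R), IsNilpotent x →
      F.nilAdd φ x (PowerSeries.nilEval φ i x) = 0 := by
  have hex (R : Type u) [CommRing R] (φ : A →+* R) (x : R) (hx : IsNilpotent x) :
      ∃ y, IsNilpotent y ∧ F.nilAdd φ x y = 0 := F.exists_nilAdd_eq_zero φ _ x hx.choose_spec
  choose η hη using hex
  obtain ⟨i, hi⟩ := PowerSeries.exists_nilEval η fun R R' _ _ χ φ x hx => by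
    refine F.nilAdd_left_cancel (χ.comp φ) (hx.map χ) ((hη R φ x hx).1.map χ) (hη R' _ _ _).1 ?_
    rw [(hη R' _ _ _).2, ← F.map_nilAdd φ χ hx (hη R φ x hx).1, (hη R φ x hx).2, map_zero]
  refine ⟨i, ?_, fun R _ φ x hx => hi R φ x hx ▸ (hη R φ x hx).2⟩
  have h1 := hη A (RingHom.id A) 0 IsNilpotent.zero
  rw [hi, F.zero_nilAdd _ (hi A (RingHom.id A) 0 IsNilpotent.zero ▸ h1.1),
    PowerSeries.nilEval_zero] at h1
  exact h1.2

/-- The series of the inverse. -/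
def negSeries : PowerSeries A := F.exists_negSeries.choose

lemma constantCoeff_negSeries : PowerSeries.constantCoeff F.negSeries = 0 :=
  F.exists_negSeries.choose_spec.1

lemma nilAdd_negSeries {R : Type u} [CommRing R] (φ : A →+* R) {x : R} (hx : IsNilpotent x) :
    F.nilAdd φ x (PowerSeries.nilEval φ F.negSeries x) = 0 :=
  F.exists_negSeries.choose_spec.2 R φ x hx

end

end FormalGroup

end

open Algebra.TensorProduct (includeLeft includeRight)
open PowerSeries (coeff coeff_C_mul coeff_X_pow coeff_X_pow_mul' coeff_derivative coeff_expand
  coeff_expand_mul coeff_map coeff_mk coeff_succ_X_mul coeff_zero_eq_constantCoeff_apply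
  constantCoeff constantCoeff_X constantCoeff_substInvOfIsUnit constantCoeff_subst_eq_zero
  eq_of_nilEval_eq isNilpotent_nilEval nilEval nilEval_X nilEval_eq_sum nilEval_map nilEval_mem
  nilEval_mul nilEval_pow nilEval_subst nilEval_subst_mv nilEval_zero)

noncomputable section

/-! ### Symmetric two-cocycles in characteristic `p` -/

/-- The coefficients of a homogeneous symmetric two-cocycle of degree `n`. -/
structure IsSymmCocycle {A : Type*} [CommRing A] (n : ℕ) (γ : ℕ → A) : Prop where
  symm (i : ℕ) (hi : 0 < i) (hin : i < n) : γ i = γ (n - i)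
  cocycle (i j : ℕ) (hi : 0 < i) (hj : 0 < j) (hij : i + j < n) :
    (Nat.choose (i + j) i : A) * γ (i + j) = (Nat.choose (n - i) j : A) * γ i

namespace IsSymmCocycle

variable {A : Type*} [CommRing A] {p : ℕ} [Fact p.Prime] [CharP A p] {n : ℕ} {γ : ℕ → A}

omit [Fact p.Prime] in
lemma natCast_choose_congr {a b : ℕ} (h : a ≡ b [MOD p]) : (a : A) = b :=
  CharP.natCast_eq_natCast' A p h

variable (A) in
lemma isUnit_natCast {m : ℕ} (h : ¬ p ∣ m) : IsUnit (m : A) := by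
  have h1 : IsCoprime (m : ℤ) (p : ℤ) :=
    Nat.isCoprime_iff_coprime.2 ((Nat.Prime.coprime_iff_not_dvd Fact.out).2 h).symm
  have h2 := h1.map (Int.castRingHom A)
  simpa [isCoprime_zero_right] using h2

lemma mul_eq (h : IsSymmCocycle n γ) {m : ℕ} (hm : 0 < m) (hmn : m < n) :
    (m : A) * γ m = (Nat.choose (n - 1) (m - 1) : A) * γ 1 := by
  obtain rfl | hm1 := eq_or_ne m 1
  · simp
  · have h1 := h.cocycle 1 (m - 1) one_pos (by omega) (by omega)
    rwa [show 1 + (m - 1) = m by omega, Nat.choose_one_right] at h1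

lemma eq_zero_of_not_dvd (h : IsSymmCocycle n γ) (h1 : γ 1 = 0) {m : ℕ} (hm : 0 < m) (hmn : m < n)
    (hpm : ¬ p ∣ m) : γ m = 0 := by
  have h2 := h.mul_eq hm hmn
  rw [h1, mul_zero] at h2
  exact (isUnit_natCast A hpm).mul_right_eq_zero.1 h2

omit [CharP A p] in
lemma choose_prime_pow_modEq (m r : ℕ) : Nat.choose m (p ^ r) ≡ m / p ^ r [MOD p] := by
  induction r generalizing m with
  | zero => simp [Nat.ModEq.refl]
  | succ r ih =>
    have h := Choose.choose_modEq_choose_mod_mul_choose_div_nat (p := p) (n := m) (k := p ^ (r + 1))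
    have hp : 0 < p := (Fact.out : p.Prime).pos
    rw [pow_succ, Nat.mul_mod_left, Nat.choose_zero_right, one_mul, Nat.mul_div_cancel _ hp] at h
    rw [pow_succ]
    refine h.trans ((ih _).trans ?_)
    rw [Nat.div_div_eq_div_mul, mul_comm p]

omit [CharP A p] in
lemma choose_mul_modEq (m k : ℕ) : Nat.choose (p * m) (p * k) ≡ Nat.choose m k [MOD p] := by
  have h := Choose.choose_modEq_choose_mod_mul_choose_div_nat (p := p) (n := p * m) (k := p * k)
  have hp : 0 < p := (Fact.out : p.Prime).pos
  rwa [Nat.mul_mod_right, Nat.mul_mod_right, Nat.choose_self, one_mul, Nat.mul_div_cancel_left _ hp,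
    Nat.mul_div_cancel_left _ hp] at h

lemma coeff_one_eq_zero (h : IsSymmCocycle n γ) (hpn : p ∣ n) (hn : p < n) : γ 1 = 0 := by
  have hp : p.Prime := Fact.out
  have hp0 := hp.pos
  set r := Nat.log p (n - 1) with hr
  have hr1 : 1 ≤ r := Nat.log_pos hp.one_lt (by omega)
  have hle : p ^ r ≤ n - 1 := Nat.pow_log_le_self p (by omega)
  have hlt : n - 1 < p ^ (r + 1) := Nat.lt_pow_succ_log_self hp.one_lt _
  have hpr : p ∣ p ^ r := dvd_pow_self p (by omega)
  have hne : p ^ r ≠ n - 1 := fun he => by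
    rw [he] at hpr
    have := (Nat.dvd_sub hpn hpr)
    rw [show n - (n - 1) = 1 by omega] at this
    exact hp.one_lt.not_ge (Nat.le_of_dvd one_pos this)
  have hpos : 0 < p ^ r := pow_pos hp.pos r
  have h1 := h.cocycle (p ^ r) 1 hpos one_pos (by omega)
  have h2 := h.mul_eq (m := p ^ r + 1) (by omega) (by omega)
  rw [Nat.choose_one_right, (CharP.cast_eq_zero_iff A p _).2 (Nat.dvd_sub hpn hpr), zero_mul,
    Nat.choose_succ_self_right] at h1
  rw [h1, add_tsub_cancel_right] at h2
  have h3 : (Nat.choose (n - 1) (p ^ r) : A) = ((n - 1) / p ^ r : ℕ) :=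
    natCast_choose_congr (choose_prime_pow_modEq _ _)
  refine (isUnit_natCast A (m := (n - 1) / p ^ r) (p := p) ?_).mul_right_eq_zero.1
    (h3 ▸ h2.symm)
  refine Nat.not_dvd_of_pos_of_lt (Nat.div_pos hle hpos) ?_
  rw [Nat.div_lt_iff_lt_mul hpos, mul_comm, ← pow_succ]
  exact hlt

lemma sum_natCast_pow (m : ℕ) (hm : 0 < m) (hmp : m < p - 1) :
    ∑ j ∈ Finset.range p, (j : A) ^ m = 0 := by
  have hp : p.Prime := Fact.out
  have h1 : ∑ x : ZMod p, x ^ m = 0 :=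
    FiniteField.sum_pow_lt_card_sub_one (ZMod p) m (by rwa [ZMod.card])
  have h2 := congrArg (ZMod.castHom (dvd_refl p) A) h1
  rw [map_zero, map_sum] at h2
  rw [← h2]
  refine Finset.sum_bij (fun j _ => (j : ZMod p)) (fun _ _ => Finset.mem_univ _)
    (fun i hi j hj hij => ?_) (fun x _ => ⟨x.val, ?_, ?_⟩) fun j _ => ?_
  · rw [ZMod.natCast_eq_natCast_iff'] at hij
    rwa [Nat.mod_eq_of_lt (Finset.mem_range.1 hi), Nat.mod_eq_of_lt (Finset.mem_range.1 hj)] at hij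
  · exact Finset.mem_range.2 (ZMod.val_lt x)
  · exact ZMod.natCast_zmod_val x
  · rw [map_pow, map_natCast]

lemma natCast_pow_sub_one {j : ℕ} (hj : j ∈ Finset.Ico 1 p) : (j : A) ^ (p - 1) = 1 := by
  have hp : p.Prime := Fact.out
  rw [Finset.mem_Ico] at hj
  have h1 : ((j : ZMod p)) ^ (p - 1) = 1 := ZMod.pow_card_sub_one_eq_one (by
    rw [Ne, ZMod.natCast_eq_zero_iff]
    exact Nat.not_dvd_of_pos_of_lt hj.1 hj.2)
  have h2 := congrArg (ZMod.castHom (dvd_refl p) A) h1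
  rwa [map_pow, map_natCast, map_one] at h2

lemma natCast_pow_mul (j i : ℕ) : (j : A) ^ (p * i) = (j : A) ^ i := by
  have h1 : ((j : ZMod p)) ^ p = j := ZMod.pow_card _
  have h2 := congrArg (ZMod.castHom (dvd_refl p) A) h1
  rw [map_pow, map_natCast] at h2
  rw [pow_mul, h2]

/-- A symmetric two-cocycle with vanishing sum is a coboundary. -/
theorem exists_eq_choose (n : ℕ) : ∀ γ : ℕ → A, 2 ≤ n → IsSymmCocycle n γ →
    (∑ j ∈ Finset.Ico 1 p, ∑ i ∈ Finset.Ico 1 n, γ i * (j : A) ^ i) = 0 →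
    ∃ k i : ℕ, 0 < i ∧ i < n ∧ ∀ m, 0 < m → m < n → γ m = k * γ i * Nat.choose n m := by
  have hp : p.Prime := Fact.out
  induction n using Nat.strong_induction_on with
  | _ n ih =>
  intro γ hn h hs
  by_cases hpn : p ∣ n
  swap
  · obtain ⟨c, hc⟩ := (isUnit_natCast A hpn).exists_right_inv
    obtain ⟨k, hk⟩ : ∃ k : ℕ, (n : A) * k = 1 := by
      obtain ⟨k, hk⟩ := Nat.exists_mul_mod_eq_one_of_coprime
        ((Nat.Prime.coprime_iff_not_dvd hp).2 hpn).symm hp.one_lt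
      refine ⟨k, ?_⟩
      rw [← Nat.cast_mul, ← Nat.cast_one]
      refine CharP.natCast_eq_natCast' A p ?_
      rw [Nat.ModEq, hk.2, Nat.mod_eq_of_lt hp.one_lt]
    have key (m : ℕ) (hm : 0 < m) (hmn : m < n) (hpm : ¬ p ∣ m) :
        γ m = k * γ 1 * Nat.choose n m := by
      have h1 := h.mul_eq hm hmn
      have h2 : (m : A) * Nat.choose n m = n * Nat.choose (n - 1) (m - 1) := by
        have := Nat.add_one_mul_choose_eq (n - 1) (m - 1)
        rw [show n - 1 + 1 = n by omega, show m - 1 + 1 = m by omega] at this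
        rw [← Nat.cast_mul, ← Nat.cast_mul, this, mul_comm]
      refine (isUnit_natCast A hpm).mul_left_cancel ?_
      linear_combination h1 - k * γ 1 * h2 - Nat.choose (n - 1) (m - 1) * γ 1 * hk
    refine ⟨k, 1, one_pos, by omega, fun m hm hmn => ?_⟩
    by_cases hpm : p ∣ m
    · rw [h.symm m hm hmn, ← Nat.choose_symm hmn.le]
      refine key (n - m) (by omega) (by omega) fun hd => hpn ?_
      have := Nat.dvd_add hd hpm
      rwa [Nat.sub_add_cancel hmn.le] at this
    · exact key m hm hmn hpm
  have hple : p ≤ n := Nat.le_of_dvd (by omega) hpn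
  obtain rfl | hlt := hple.eq_or_lt
  · have h1 : γ (p - 1) = 0 := by
      rw [Finset.sum_comm] at hs
      have hz : ∀ i ∈ Finset.Ico 1 p, i ≠ p - 1 → ∑ j ∈ Finset.Ico 1 p, γ i * (j : A) ^ i = 0 := by
        intro i hi hip
        rw [Finset.mem_Ico] at hi
        have := sum_natCast_pow (A := A) (p := p) i (by omega) (by omega)
        rw [Finset.range_eq_Ico, Finset.sum_eq_sum_Ico_succ_bot hp.pos, Nat.cast_zero,
          zero_pow (by omega), zero_add, zero_add] at this
        rw [← Finset.mul_sum, this, mul_zero]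
      rw [Finset.sum_eq_single_of_mem (p - 1) (by rw [Finset.mem_Ico]; omega) hz, ← Finset.mul_sum,
        Finset.sum_congr rfl fun j hj => natCast_pow_sub_one hj, Finset.sum_const, Nat.card_Ico,
        nsmul_eq_mul, mul_one] at hs
      exact (isUnit_natCast A (p := p) (m := p - 1)
        (Nat.not_dvd_of_pos_of_lt (by omega) (by omega))).mul_left_eq_zero.1 hs
    have h2 : γ 1 = 0 := by rw [h.symm 1 one_pos (by omega), h1]
    refine ⟨0, 1, one_pos, by omega, fun m hm hmn => ?_⟩
    rw [h.eq_zero_of_not_dvd h2 hm hmn (Nat.not_dvd_of_pos_of_lt hm hmn)]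
    simp
  · have h1 := h.coeff_one_eq_zero hpn hlt
    obtain ⟨n', rfl⟩ := hpn
    have hn' : 2 ≤ n' := by
      by_contra hc
      have : p * n' ≤ p * 1 := Nat.mul_le_mul_left p (by omega)
      omega
    have hlt' {i : ℕ} (hi : i < n') : p * i < p * n' := Nat.mul_lt_mul_of_pos_left hi hp.pos
    have hpos' {i : ℕ} (hi : 0 < i) : 0 < p * i := Nat.mul_pos hp.pos hi
    obtain ⟨k, i, hi, hin, hk⟩ := ih n' (by nlinarith [hp.two_le]) (fun i => γ (p * i)) hn'
      ⟨fun i hi hin => by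
        rw [h.symm (p * i) (hpos' hi) (hlt' hin), Nat.mul_sub],
      fun i j hi hj hij => by
        have h2 := h.cocycle (p * i) (p * j) (hpos' hi) (hpos' hj) (by
          rw [← mul_add]; exact hlt' hij)
        rw [← mul_add, natCast_choose_congr (A := A) (choose_mul_modEq (p := p) (i + j) i),
          ← Nat.mul_sub, natCast_choose_congr (A := A) (choose_mul_modEq (p := p) (n' - i) j)] at h2
        exact h2⟩ (by
        rw [← hs]
        refine Finset.sum_congr rfl fun j _ => ?_
        refine Eq.trans ?_ (Finset.sum_subset (s₁ := (Finset.Ico 1 n').image (p * ·)) ?_ ?_)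
        · rw [Finset.sum_image fun a _ b _ hab => Nat.eq_of_mul_eq_mul_left hp.pos hab]
          exact Finset.sum_congr rfl fun i _ => by rw [natCast_pow_mul]
        · intro x hx
          rw [Finset.mem_image] at hx
          obtain ⟨i, hi, rfl⟩ := hx
          rw [Finset.mem_Ico] at hi ⊢
          exact ⟨hpos' hi.1, hlt' hi.2⟩
        · intro x hx hx'
          rw [Finset.mem_Ico] at hx
          rw [h.eq_zero_of_not_dvd h1 hx.1 hx.2 fun hd => hx' ?_, zero_mul]
          obtain ⟨i, rfl⟩ := hd
          rw [Finset.mem_image]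
          refine ⟨i, ?_, rfl⟩
          rw [Finset.mem_Ico]
          exact ⟨Nat.pos_of_mul_pos_left hx.1, Nat.lt_of_mul_lt_mul_left hx.2⟩)
    refine ⟨k, p * i, hpos' hi, hlt' hin, fun m hm hmn => ?_⟩
    by_cases hpm : p ∣ m
    · obtain ⟨m', rfl⟩ := hpm
      rw [natCast_choose_congr (A := A) (choose_mul_modEq (p := p) n' m')]
      exact hk m' (Nat.pos_of_mul_pos_left hm) (Nat.lt_of_mul_lt_mul_left hmn)
    · rw [h.eq_zero_of_not_dvd h1 hm hmn hpm]
      have h2 : (Nat.choose (p * n') m : A) = 0 := by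
        have h3 : (m : A) * Nat.choose (p * n') m = 0 := by
          have := Nat.add_one_mul_choose_eq (p * n' - 1) (m - 1)
          rw [show p * n' - 1 + 1 = p * n' by omega, show m - 1 + 1 = m by omega] at this
          rw [← Nat.cast_mul, mul_comm m, ← this]
          simp
        exact (isUnit_natCast A hpm).mul_right_eq_zero.1 h3
      rw [h2, mul_zero]

end IsSymmCocycle

end

noncomputable section

/-! ### Homomorphisms of formal group laws in characteristic `p` -/

/-- The `p`-th power map of a ring in which `p = 0`. -/
def powHom (R : Type*) [CommRing R] {p : ℕ} [Fact p.Prime] (hp : (p : R) = 0) : R →+* R where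
  toFun x := x ^ p
  map_one' := one_pow p
  map_mul' x y := mul_pow x y p
  map_zero' := zero_pow (Fact.out : p.Prime).ne_zero
  map_add' x y := by
    obtain ⟨r, hr⟩ := exists_add_pow_prime_eq (Fact.out : p.Prime) x y
    rw [hr, hp, zero_mul, zero_mul, zero_mul, add_zero]

lemma powHom_apply {R : Type*} [CommRing R] {p : ℕ} [Fact p.Prime] (hp : (p : R) = 0) (x : R) :
    powHom R hp x = x ^ p := rfl

lemma RingHom.natCast_eq_zero {R R' : Type*} [CommRing R] [CommRing R'] (φ : R →+* R') {p : ℕ}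
    (hp : (p : R) = 0) : (p : R') = 0 := by
  rw [← map_natCast φ, hp, map_zero]

lemma powHom_comp {R R' : Type*} [CommRing R] [CommRing R'] {p : ℕ} [Fact p.Prime]
    (hp : (p : R) = 0) (φ : R →+* R') :
    φ.comp (powHom R hp) = (powHom R' (φ.natCast_eq_zero hp)).comp φ := by
  ext x
  simp [powHom_apply]

/-- Roots of nilpotent elements exist in a faithful extension. -/
lemma exists_pow_eq_of_isNilpotent {R : Type u} [CommRing R] {n : ℕ} (hn : 0 < n) (x : R)
    (hx : IsNilpotent x) : ∃ (R' : Type u) (_ : CommRing R') (χ : R →+* R') (y : R'),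
      Function.Injective χ ∧ y ^ n = χ x ∧ IsNilpotent y := by
  have hm : (Polynomial.X ^ n - Polynomial.C x : Polynomial R).Monic :=
    Polynomial.monic_X_pow_sub_C x hn.ne'
  refine ⟨AdjoinRoot (Polynomial.X ^ n - Polynomial.C x : Polynomial R), inferInstance,
    AdjoinRoot.of _, AdjoinRoot.root _, ?_, ?_, ?_⟩
  · nontriviality R
    have := hm.free_adjoinRoot
    refine (injective_iff_map_eq_zero _).2 fun a ha => ?_
    have h1 : (Polynomial.X ^ n - Polynomial.C x : Polynomial R) ∣ Polynomial.C a :=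
      AdjoinRoot.mk_eq_zero.1 ha
    by_contra h0
    have h2 := Polynomial.Monic.not_dvd_of_natDegree_lt hm (q := Polynomial.C a) (by simpa using h0)
      (by rw [Polynomial.natDegree_X_pow_sub_C, Polynomial.natDegree_C]; exact hn)
    exact h2 h1
  · have h := AdjoinRoot.eval₂_root (Polynomial.X ^ n - Polynomial.C x : Polynomial R)
    rwa [Polynomial.eval₂_sub, Polynomial.eval₂_X_pow, Polynomial.eval₂_C, sub_eq_zero] at h
  · have h := AdjoinRoot.eval₂_root (Polynomial.X ^ n - Polynomial.C x : Polynomial R)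
    rw [Polynomial.eval₂_sub, Polynomial.eval₂_X_pow, Polynomial.eval₂_C, sub_eq_zero] at h
    rw [← IsNilpotent.pow_iff_pos hn.ne', h]
    exact hx.map _

lemma PowerSeries.nilEval_add_of_sq_eq_zero {A R : Type*} [CommRing A] [CommRing R] (φ : A →+* R)
    (f : PowerSeries A) {x e : R} (hx : IsNilpotent x) (he : e * e = 0) :
    nilEval φ f (x + e) = nilEval φ f x +
      e * nilEval φ (PowerSeries.derivative A f) x := by
  obtain ⟨n, hn⟩ := hx
  have hpow (i : ℕ) : (x + e) ^ (i + 1) = x ^ (i + 1) + (i + 1) * x ^ i * e := by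
    induction i with
    | zero => simp
    | succ i ih =>
      rw [pow_succ, ih]
      push_cast
      linear_combination (i + 1) * x ^ i * he
  rw [nilEval_eq_sum φ f (x := x + e) (n := n + 1) (by rw [hpow, pow_succ, hn]; simp),
    nilEval_eq_sum φ f (x := x) (n := n + 1) (by rw [pow_succ, hn]; simp),
    nilEval_eq_sum φ _ hn, Finset.sum_range_succ', Finset.sum_range_succ']
  simp only [hpow, pow_zero, mul_add, Finset.sum_add_distrib, coeff_derivative,
    Finset.mul_sum, map_mul, map_add, map_natCast, map_one]
  rw [add_right_comm]
  congr 1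
  refine Finset.sum_congr rfl fun i _ => ?_
  ring

lemma exists_dualNumber (B : Type u) [CommRing B] :
    ∃ (R : Type u) (_ : CommRing R) (ι : B →+* R) (e : R), e * e = 0 ∧
      ∀ b, e * ι b = 0 → b = 0 := by
  refine ⟨DualNumber B, inferInstance, TrivSqZeroExt.inlHom B B, DualNumber.eps,
    DualNumber.eps_mul_eps, fun b hb => ?_⟩
  simpa using congrArg TrivSqZeroExt.snd hb

namespace FormalGroup

/-- The nilpotent elements of an algebra, with the addition of a formal group law. -/
def NilPoint {A R : Type*} [CommRing A] [CommRing R] (_ : FormalGroup A) (_ : A →+* R) : Type _ :=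
  {x : R // IsNilpotent x}

section

variable {A R R' : Type*} [CommRing A] [CommRing R] [CommRing R'] (F : FormalGroup A) [F.IsComm]
  (φ : A →+* R)

instance : Zero (F.NilPoint φ) := ⟨⟨0, IsNilpotent.zero⟩⟩

instance : Add (F.NilPoint φ) :=
  ⟨fun x y => ⟨F.nilAdd φ x.1 y.1, F.isNilpotent_nilAdd φ x.2 y.2⟩⟩

instance : AddCommMonoid (F.NilPoint φ) where
  add_assoc x y z := Subtype.ext (F.nilAdd_assoc φ x.2 y.2 z.2)
  zero_add x := Subtype.ext (F.zero_nilAdd φ x.2)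
  add_zero x := Subtype.ext (F.nilAdd_zero φ x.2)
  add_comm x y := Subtype.ext (F.nilAdd_comm φ x.2 y.2)
  nsmul := nsmulRec

omit [F.IsComm] in
variable {F φ} in
lemma NilPoint.coe_add (x y : F.NilPoint φ) : (x + y).1 = F.nilAdd φ x.1 y.1 := rfl

variable {F φ} in
lemma NilPoint.coe_nsmul (m : ℕ) (x : F.NilPoint φ) :
    (m • x).1 = nilEval φ (F.mulSeries m) x.1 := by
  induction m with
  | zero =>
    rw [zero_nsmul, mulSeries, nilEval,
      ← MvPowerSeries.nilEvalHom_apply φ (fun _ => x.2)]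
    exact (map_zero _).symm
  | succ m ih => rw [succ_nsmul, coe_add, ih, F.nilEval_mulSeries_succ φ m x.2]

lemma nilEval_mulSeries_nilAdd (m : ℕ) {x y : R} (hx : IsNilpotent x) (hy : IsNilpotent y) :
    nilEval φ (F.mulSeries m) (F.nilAdd φ x y) =
      F.nilAdd φ (nilEval φ (F.mulSeries m) x)
        (nilEval φ (F.mulSeries m) y) := by
  let x' : F.NilPoint φ := ⟨x, hx⟩
  let y' : F.NilPoint φ := ⟨y, hy⟩
  have h := congrArg Subtype.val (nsmul_add x' y' m)
  rw [NilPoint.coe_nsmul] at h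
  refine h.trans ?_
  rw [NilPoint.coe_add, NilPoint.coe_nsmul, NilPoint.coe_nsmul]

end

section

variable {A : Type u} [CommRing A]

/-- A homomorphism of formal group laws. -/
structure IsHom (F G : FormalGroup A) (f : PowerSeries A) : Prop where
  constantCoeff : constantCoeff f = 0
  nilEval_nilAdd (R : Type u) [CommRing R] (φ : A →+* R) (x y : R) (hx : IsNilpotent x)
    (hy : IsNilpotent y) : nilEval φ f (F.nilAdd φ x y) =
      G.nilAdd φ (nilEval φ f x) (nilEval φ f y)

lemma isHom_mulSeries (F : FormalGroup A) [F.IsComm] (m : ℕ) : IsHom F F (F.mulSeries m) :=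
  ⟨F.constantCoeff_mulSeries m, fun _ _ φ _ _ hx hy => F.nilEval_mulSeries_nilAdd φ m hx hy⟩

variable {p : ℕ} [Fact p.Prime]

lemma isUnit_natCast_of_not_dvd (hp : (p : A) = 0) {m : ℕ} (h : ¬ p ∣ m) : IsUnit (m : A) := by
  rcases subsingleton_or_nontrivial A with hA | hA
  · exact isUnit_of_subsingleton _
  · have := (CharP.charP_iff_prime_eq_zero (R := A) (Fact.out : p.Prime)).2 hp
    exact IsSymmCocycle.isUnit_natCast A h

/-- A homomorphism whose linear coefficient is zero has derivative zero. -/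
lemma IsHom.derivative_eq_zero {F G : FormalGroup A} {f : PowerSeries A} (h : IsHom F G f)
    (h1 : coeff 1 f = 0) : PowerSeries.derivative A f = 0 := by
  refine MvPowerSeries.eq_of_mk_eq fun n => ?_
  rw [map_zero, ← MvPowerSeries.coeff_nilEval_X]
  set B := MvPowerSeries.TruncRing Unit A n
  set x : B := Ideal.Quotient.mk _ (MvPowerSeries.X ())
  have hx : IsNilpotent x := MvPowerSeries.isNilpotent_mk_X n ()
  set ψ : A →+* B := (Ideal.Quotient.mk _).comp MvPowerSeries.C
  change nilEval ψ (PowerSeries.derivative A f) x = 0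
  obtain ⟨D, _, ι, e, hε2, hinj⟩ := exists_dualNumber B
  have hx' : IsNilpotent (ι x) := hx.map ι
  have hε : IsNilpotent e := ⟨2, by rw [pow_two, hε2]⟩
  have h2 := h.nilEval_nilAdd D (ι.comp ψ) (ι x) e hx' hε
  have h3 : nilEval (ι.comp ψ) f e = 0 := by
    rw [nilEval_eq_sum (ι.comp ψ) f (n := 2) (by rw [pow_two, hε2]),
      Finset.sum_range_succ, Finset.sum_range_one, h1,
      coeff_zero_eq_constantCoeff_apply, h.constantCoeff]
    simp
  rw [h3, G.nilAdd_zero _ (isNilpotent_nilEval _ hx' h.constantCoeff)] at h2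
  obtain ⟨c, hc⟩ := Ideal.mem_span_singleton.1 (F.nilAdd_sub_mem (ι.comp ψ) hx' hε)
  have h4 : F.nilAdd (ι.comp ψ) (ι x) e =
      ι x + e * (1 + ι x * c) := by linear_combination hc
  have hu : IsUnit (1 + ι x * c) := (IsNilpotent.isUnit_one_add
    (Commute.isNilpotent_mul_right (Commute.all _ _) hx'))
  rw [h4, PowerSeries.nilEval_add_of_sq_eq_zero _ _ hx' (by
    linear_combination (1 + ι x * c) * (1 + ι x * c) * hε2), add_eq_left,
    mul_comm e, mul_assoc, hu.mul_right_eq_zero,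
    ← PowerSeries.map_nilEval ι ψ _ hx] at h2
  exact hinj _ h2

lemma IsHom.coeff_eq_zero_of_not_dvd {F G : FormalGroup A} {f : PowerSeries A} (h : IsHom F G f)
    (hp : (p : A) = 0) (h1 : coeff 1 f = 0) (i : ℕ) (hi : ¬ p ∣ i) :
    coeff i f = 0 := by
  obtain _ | i := i
  · simp at hi
  · have h2 := congrArg (coeff i) (h.derivative_eq_zero h1)
    rw [coeff_derivative, map_zero] at h2
    have h3 : IsUnit ((i + 1 : ℕ) : A) := isUnit_natCast_of_not_dvd hp hi
    rw [Nat.cast_succ] at h3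
    exact h3.mul_left_eq_zero.1 h2

lemma nilAdd_pow (hp : (p : A) = 0) (F : FormalGroup A) {R : Type*} [CommRing R] (φ : A →+* R)
    {x y : R} (hx : IsNilpotent x) (hy : IsNilpotent y) :
    F.nilAdd φ x y ^ p = (F.map (powHom A hp)).nilAdd φ (x ^ p) (y ^ p) := by
  rw [nilAdd_map, powHom_comp hp φ]
  exact F.map_nilAdd φ (powHom R (φ.natCast_eq_zero hp)) hx hy

/-- A homomorphism whose linear coefficient is zero factors through the Frobenius map. -/
lemma IsHom.exists_expand {F G : FormalGroup A} {f : PowerSeries A} (h : IsHom F G f)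
    (hp : (p : A) = 0) (h1 : coeff 1 f = 0) :
    IsHom (F.map (powHom A hp)) G (PowerSeries.mk fun i => coeff (p * i) f) := by
  have hp0 : p ≠ 0 := (Fact.out : p.Prime).ne_zero
  set g := PowerSeries.mk fun i => coeff (p * i) f with hg
  have hfg : f = PowerSeries.subst (PowerSeries.X ^ p) g := by
    rw [← PowerSeries.expand_apply p hp0]
    ext i
    rw [coeff_expand]
    split_ifs with hi
    · rw [hg, coeff_mk, Nat.mul_div_cancel' hi]
    · exact h.coeff_eq_zero_of_not_dvd hp h1 i hi
  have hg0 : PowerSeries.constantCoeff g = 0 := by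
    rw [← coeff_zero_eq_constantCoeff_apply, hg, coeff_mk, mul_zero,
      coeff_zero_eq_constantCoeff_apply, h.constantCoeff]
  have hev {R : Type u} [CommRing R] (φ : A →+* R) (x : R) (hx : IsNilpotent x) :
      nilEval φ f x = nilEval φ g (x ^ p) := by
    rw [hfg, nilEval_subst φ hx (by simp [hp0]), nilEval_pow φ hx,
      nilEval_X φ hx]
  refine ⟨hg0, fun R _ φ a b ha hb => ?_⟩
  obtain ⟨R₁, _, χ₁, x, hχ₁, hxa, hx⟩ :=
    exists_pow_eq_of_isNilpotent (Fact.out : p.Prime).pos a ha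
  obtain ⟨R₂, _, χ₂, y, hχ₂, hyb, hy⟩ :=
    exists_pow_eq_of_isNilpotent (Fact.out : p.Prime).pos (χ₁ b) (hb.map χ₁)
  let χ := χ₂.comp χ₁
  have hx2 : χ₂ x ^ p = χ a := by rw [← map_pow, hxa]; rfl
  have hy2 : y ^ p = χ b := hyb
  have hnx := hx.map χ₂
  have hχ : Function.Injective χ := hχ₂.comp hχ₁
  apply hχ
  rw [PowerSeries.map_nilEval χ φ g ((F.map _).isNilpotent_nilAdd φ ha hb),
    (F.map _).map_nilAdd φ χ ha hb, G.map_nilAdd φ χ (isNilpotent_nilEval φ ha hg0)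
    (isNilpotent_nilEval φ hb hg0), PowerSeries.map_nilEval χ φ g ha,
    PowerSeries.map_nilEval χ φ g hb, ← hx2, ← hy2, ← F.nilAdd_pow hp (χ.comp φ) hnx hy,
    ← hev _ _ hnx, ← hev _ _ hy, ← hev _ _ (F.isNilpotent_nilAdd _ hnx hy)]
  exact h.nilEval_nilAdd R₂ (χ.comp φ) _ _ hnx hy

/-- The order of a homomorphism jumps to a power of `p`. -/
lemma IsHom.coeff_eq_zero {G : FormalGroup A} (hp : (p : A) = 0) (k : ℕ) :
    ∀ {F : FormalGroup A} {f : PowerSeries A}, IsHom F G f →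
      (∀ i ≤ p ^ k, coeff i f = 0) → ∀ i, ¬ p ^ (k + 1) ∣ i →
        coeff i f = 0 := by
  have hp1 : 0 < p := (Fact.out : p.Prime).pos
  induction k with
  | zero =>
    intro F f h hf i hi
    rw [_root_.zero_add, pow_one] at hi
    exact h.coeff_eq_zero_of_not_dvd hp (hf 1 (by simp)) i hi
  | succ k ih =>
    intro F f h hf i hi
    have h1 := hf 1 (Nat.one_le_pow _ _ hp1)
    by_cases hpi : p ∣ i
    · obtain ⟨j, rfl⟩ := hpi
      have h2 := ih (h.exists_expand hp h1) (fun i hi => by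
        rw [coeff_mk]
        refine hf _ ?_
        rw [pow_succ, mul_comm]
        exact Nat.mul_le_mul_right p hi) j fun hd => hi (by
          rw [pow_succ, mul_comm]
          exact Nat.mul_dvd_mul_left p hd)
      rwa [coeff_mk] at h2
    · exact h.coeff_eq_zero_of_not_dvd hp h1 i hpi

end

end FormalGroup

end

noncomputable section

/-! ### The homogeneous part of lowest degree of a power series in two variables -/

namespace MvPowerSeries

variable {A R : Type*} [CommRing A] [CommRing R]

/-- The coefficients of the homogeneous part of degree `n` of a power series in two variables. -/
def homCoeff (n : ℕ) (D : MvPowerSeries (Fin 2) A) (i : ℕ) : A :=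
  coeff (Finsupp.single 0 i + Finsupp.single 1 (n - i)) D

lemma eq_single_add_single (d : Fin 2 →₀ ℕ) :
    d = Finsupp.single 0 (d 0) + Finsupp.single 1 (d 1) := by
  ext i
  fin_cases i <;> simp

lemma degree_fin_two (d : Fin 2 →₀ ℕ) : d.degree = d 0 + d 1 := by
  rw [Finsupp.degree_eq_sum, Fin.sum_univ_two]

lemma mem_orderIdeal_succ {n : ℕ} {D : MvPowerSeries (Fin 2) A}
    (hD : D ∈ orderIdeal (Fin 2) A n) (h : ∀ i ≤ n, homCoeff n D i = 0) :
    D ∈ orderIdeal (Fin 2) A (n + 1) := by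
  intro d hd
  obtain hlt | heq := (Nat.lt_succ_iff.1 hd).lt_or_eq
  · exact hD d hlt
  · rw [degree_fin_two] at heq
    have := h (d 0) (by omega)
    rwa [homCoeff, show n - d 0 = d 1 by omega, ← eq_single_add_single] at this

/-- The value of a power series of order `n` at a point of the line `(s e, t e)`, where
`e ^ (n + 1) = 0`. -/
lemma nilEval_smul {n : ℕ} {D : MvPowerSeries (Fin 2) A} (hD : D ∈ orderIdeal (Fin 2) A n)
    (φ : A →+* R) {e : R} (he : e ^ (n + 1) = 0) (s t : R) :
    nilEval φ D ![s * e, t * e] =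
      e ^ n * ∑ i ∈ Finset.range (n + 1), φ (homCoeff n D i) * s ^ i * t ^ (n - i) := by
  classical
  have hterm (d : Fin 2 →₀ ℕ) : (d.prod fun j k => (![s * e, t * e] : Fin 2 → R) j ^ k) =
      s ^ d 0 * t ^ d 1 * e ^ (d 0 + d 1) := by
    rw [Finsupp.prod_fintype _ _ (by simp), Fin.prod_univ_two]
    simp only [Matrix.cons_val_zero, Matrix.cons_val_one]
    ring
  let g : ℕ → Fin 2 →₀ ℕ := fun i => Finsupp.single 0 i + Finsupp.single 1 (n - i)
  have hg0 (i : ℕ) : g i 0 = i := by simp [g]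
  have hg1 (i : ℕ) : g i 1 = n - i := by simp [g]
  have hginj : Function.Injective g := fun i j hij => by rw [← hg0 i, hij, hg0]
  rw [nilEval]
  simp only [hterm]
  rw [finsum_eq_sum_of_support_subset _ (s := (Finset.range (n + 1)).image g), Finset.sum_image
    fun a _ b _ hab => hginj hab, Finset.mul_sum]
  · refine Finset.sum_congr rfl fun i hi => ?_
    rw [Finset.mem_range] at hi
    rw [hg0, hg1, show i + (n - i) = n by omega, homCoeff]
    ring
  · intro d hd
    rw [Function.mem_support] at hd
    have h1 : n ≤ d.degree := by
      by_contra h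
      exact hd (by rw [hD d (by omega), map_zero, zero_mul])
    have h2 : d.degree ≤ n := by
      by_contra h
      rw [degree_fin_two] at h
      exact hd (by rw [pow_eq_zero_of_le (by omega) he, mul_zero, mul_zero])
    rw [degree_fin_two] at h1 h2
    rw [Finset.coe_image]
    refine ⟨d 0, by simp; omega, ?_⟩
    rw [eq_single_add_single d]
    simp only [g]
    congr 2
    · simp
    · simp
      omega

end MvPowerSeries

/-- The universal element with `e ^ (n + 1) = 0`. -/
lemma exists_pow_succ_eq_zero (B : Type u) [CommRing B] (n : ℕ) :
    ∃ (R : Type u) (_ : CommRing R) (ι : B →+* R) (e : R), e ^ (n + 1) = 0 ∧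
      ∀ b, e ^ n * ι b = 0 → b = 0 := by
  refine ⟨MvPowerSeries.TruncRing Unit B (n + 1), inferInstance,
    (Ideal.Quotient.mk _).comp MvPowerSeries.C, Ideal.Quotient.mk _ (MvPowerSeries.X ()),
    MvPowerSeries.isNilpotent_mk (by simp), fun b hb => ?_⟩
  rw [RingHom.comp_apply, ← map_pow, ← map_mul, Ideal.Quotient.eq_zero_iff_mem] at hb
  have := hb (Finsupp.single () n) (by simp)
  rwa [mul_comm, MvPowerSeries.coeff_C_mul, MvPowerSeries.coeff_X_pow, if_pos rfl, mul_one] at this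

/-- The `p ^ k`-th power map of a ring in which `p = 0`. -/
def powPowHom (R : Type*) [CommRing R] {p : ℕ} [Fact p.Prime] (hp : (p : R) = 0) (k : ℕ) :
    R →+* R where
  toFun x := x ^ p ^ k
  map_one' := one_pow _
  map_mul' x y := mul_pow x y _
  map_zero' := zero_pow (pow_pos (Fact.out : p.Prime).pos k).ne'
  map_add' x y := by
    induction k with
    | zero => simp
    | succ k ih =>
      rw [pow_succ, pow_mul, pow_mul, pow_mul, ih]
      exact map_add (powHom R hp) _ _

lemma powPowHom_apply {R : Type*} [CommRing R] {p : ℕ} [Fact p.Prime] (hp : (p : R) = 0) (k : ℕ)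
    (x : R) : powPowHom R hp k x = x ^ p ^ k := rfl

lemma powPowHom_comp {R R' : Type*} [CommRing R] [CommRing R'] {p : ℕ} [Fact p.Prime]
    (hp : (p : R) = 0) (k : ℕ) (φ : R →+* R') :
    φ.comp (powPowHom R hp k) = (powPowHom R' (φ.natCast_eq_zero hp) k).comp φ := by
  ext x
  simp [powPowHom_apply]

namespace FormalGroup

section

variable {A R : Type*} [CommRing A] [CommRing R] (H F : FormalGroup A) (u : PowerSeries A)

/-- The difference `u(H(X, Y)) - F(u(X), u(Y))`. -/
def defect : MvPowerSeries (Fin 2) A :=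
  PowerSeries.subst H.toPowerSeries u - MvPowerSeries.subst
    ![PowerSeries.subst (MvPowerSeries.X 0 : MvPowerSeries (Fin 2) A) u,
      PowerSeries.subst (MvPowerSeries.X 1 : MvPowerSeries (Fin 2) A) u] F.toPowerSeries

variable {H F u} (hu : constantCoeff u = 0) (φ : A →+* R) {x y : R}

include hu in
lemma nilEval_defect (hx : IsNilpotent x) (hy : IsNilpotent y) :
    MvPowerSeries.nilEval φ (defect H F u) ![x, y] = nilEval φ u (H.nilAdd φ x y) -
      F.nilAdd φ (nilEval φ u x) (nilEval φ u y) := by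
  have ha := isNilpotent_pair hx hy
  have hc (i : Fin 2) : MvPowerSeries.constantCoeff
      (PowerSeries.subst (MvPowerSeries.X i : MvPowerSeries (Fin 2) A) u) = 0 :=
    constantCoeff_subst_eq_zero (by simp) _ hu
  rw [defect, MvPowerSeries.nilEval_sub φ ha, nilEval_subst_mv φ ha
    H.zero_constantCoeff, F.nilEval_subst_pair φ ha (hc 0) (hc 1),
    nilEval_subst_mv φ ha (by simp), nilEval_subst_mv φ ha (by simp),
    MvPowerSeries.nilEval_X φ ha, MvPowerSeries.nilEval_X φ ha]
  rfl

end

section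

variable {A : Type u} [CommRing A] {H F : FormalGroup A} {u : PowerSeries A}
  (hu : constantCoeff u = 0) {n : ℕ}

include hu in
lemma isHom_of_defect_eq_zero (h : defect H F u = 0) : IsHom H F u :=
  ⟨hu, fun R _ φ x y hx hy => by
    have h1 := nilEval_defect (H := H) (F := F) hu φ hx hy
    have ha := isNilpotent_pair hx hy
    rw [h, ← MvPowerSeries.nilEvalHom_apply φ ha, map_zero] at h1
    exact (sub_eq_zero.1 h1.symm)⟩

/-- The homogeneous part of degree `n` of the defect, as a polynomial function. -/
def defectForm (n : ℕ) (H F : FormalGroup A) (u : PowerSeries A) {R : Type*} [CommRing R]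
    (φ : A →+* R) (s t : R) : R :=
  ∑ i ∈ Finset.range (n + 1), φ (MvPowerSeries.homCoeff n (defect H F u) i) * s ^ i * t ^ (n - i)

lemma map_defectForm {R R' : Type*} [CommRing R] [CommRing R'] (χ : R →+* R') (φ : A →+* R)
    (s t : R) : χ (defectForm n H F u φ s t) = defectForm n H F u (χ.comp φ) (χ s) (χ t) := by
  simp [defectForm]

lemma mul_defectForm_congr {R : Type*} [CommRing R] (φ : A →+* R) {e : R} (he : e ^ (n + 1) = 0)
    (s t k l : R) : e ^ n * defectForm n H F u φ (s + e * k) (t + e * l) =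
      e ^ n * defectForm n H F u φ s t := by
  have h : Ideal.Quotient.mk (Ideal.span {e}) (defectForm n H F u φ (s + e * k) (t + e * l)) =
      Ideal.Quotient.mk (Ideal.span {e}) (defectForm n H F u φ s t) := by
    have h0 : Ideal.Quotient.mk (Ideal.span {e}) e = 0 :=
      Ideal.Quotient.eq_zero_iff_mem.2 (Ideal.mem_span_singleton_self e)
    rw [map_defectForm, map_defectForm]
    simp [h0]
  obtain ⟨c, hc⟩ := Ideal.mem_span_singleton.1 (Ideal.Quotient.eq.1 h)
  rw [sub_eq_iff_eq_add.1 hc, mul_add, ← mul_assoc, ← pow_succ, he, zero_mul, _root_.zero_add]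

variable (hD : defect H F u ∈ MvPowerSeries.orderIdeal (Fin 2) A n)

section

variable {R : Type u} [CommRing R] (φ : A →+* R) {e : R} (he : e ^ (n + 1) = 0)

include hu hD he in
lemma nilEval_nilAdd_eq (s t : R) : nilEval φ u (H.nilAdd φ (s * e) (t * e)) =
    F.nilAdd φ (nilEval φ u (s * e)) (nilEval φ u (t * e)) +
      e ^ n * defectForm n H F u φ s t := by
  have hn (s : R) : IsNilpotent (s * e) := ⟨n + 1, by rw [mul_pow, he, mul_zero]⟩
  have h := MvPowerSeries.nilEval_smul hD φ he s t
  rw [nilEval_defect hu φ (hn s) (hn t), sub_eq_iff_eq_add'] at h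
  exact h

omit [CommRing A] in
lemma isNilpotent_mul_of_pow_eq_zero (he : e ^ (n + 1) = 0) (s : R) : IsNilpotent (s * e) :=
  ⟨n + 1, by rw [mul_pow, he, mul_zero]⟩

include he in
lemma exists_nilAdd_eq (H : FormalGroup A) (s t : R) :
    ∃ k, H.nilAdd φ (s * e) (t * e) = (s + t + e * k) * e := by
  obtain ⟨c, hc⟩ := Ideal.mem_span_singleton.1 (H.nilAdd_sub_mem φ
    (isNilpotent_mul_of_pow_eq_zero he s) (isNilpotent_mul_of_pow_eq_zero he t))
  exact ⟨s * t * c, by linear_combination hc⟩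

include hu he in
lemma nilEval_mul_pow (hn : 0 < n) (s x : R) : e ^ n * x * nilEval φ u (s * e) = 0 := by
  have h := nilEval_mem φ hu (isNilpotent_mul_of_pow_eq_zero he s)
    (I := Ideal.span {e}) (Ideal.mem_span_singleton.2 ⟨s, mul_comm _ _⟩)
  obtain ⟨c, hc⟩ := Ideal.mem_span_singleton.1 h
  rw [hc]
  linear_combination x * c * he

include he in
lemma isNilpotent_pow_mul (hn : 0 < n) (x : R) : IsNilpotent (e ^ n * x) :=
  Commute.isNilpotent_mul_right (Commute.all _ _)
    ((IsNilpotent.pow_iff_pos hn.ne').2 ⟨n + 1, he⟩)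

include hu hD he in
lemma defectForm_cocycle (hn : 0 < n) (s t r : R) :
    e ^ n * (defectForm n H F u φ s t + defectForm n H F u φ (s + t) r) =
      e ^ n * (defectForm n H F u φ t r + defectForm n H F u φ s (t + r)) := by
  have hnil := isNilpotent_mul_of_pow_eq_zero (R := R) he
  have hev (s : R) := isNilpotent_nilEval φ (hnil s) hu
  obtain ⟨k, hk⟩ := exists_nilAdd_eq φ he H s t
  obtain ⟨l, hl⟩ := exists_nilAdd_eq φ he H t r
  have h1 := nilEval_nilAdd_eq hu hD φ he (s + t + e * k) r
  have h2 := nilEval_nilAdd_eq hu hD φ he s (t + r + e * l)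
  rw [← hk, nilEval_nilAdd_eq hu hD φ he s t, F.nilAdd_add_left φ
    (F.isNilpotent_nilAdd φ (hev s) (hev t)) (hev r) (isNilpotent_pow_mul he hn _)
    (nilEval_mul_pow hu φ he hn r _), F.nilAdd_assoc φ (hev s) (hev t) (hev r),
    H.nilAdd_assoc φ (hnil s) (hnil t) (hnil r)] at h1
  rw [← hl, nilEval_nilAdd_eq hu hD φ he t r, F.nilAdd_add_right φ (hev s)
    (F.isNilpotent_nilAdd φ (hev t) (hev r)) (isNilpotent_pow_mul he hn _)
    (by rw [mul_comm]; exact nilEval_mul_pow hu φ he hn s _)] at h2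
  have h3 := mul_defectForm_congr (H := H) (F := F) (u := u) φ he (s + t) r k 0
  have h4 := mul_defectForm_congr (H := H) (F := F) (u := u) φ he s (t + r) 0 l
  rw [mul_zero, _root_.add_zero] at h3 h4
  linear_combination h2 - h1 + h4 - h3

include hu hD he in
lemma nilEval_mulSeries_eq [H.IsComm] [F.IsComm] (hn : 0 < n) (m : ℕ) :
    nilEval φ u (nilEval φ (H.mulSeries m) e) =
      nilEval φ (F.mulSeries m) (nilEval φ u e) +
        e ^ n * ∑ j ∈ Finset.range m, defectForm n H F u φ j 1 := by
  have hnil := isNilpotent_mul_of_pow_eq_zero (R := R) he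
  have hen : IsNilpotent e := ⟨n + 1, he⟩
  have hue := isNilpotent_nilEval φ hen hu
  have key (m : ℕ) : ∃ k, nilEval φ (H.mulSeries m) e = (m + e * k) * e := by
    induction m with
    | zero =>
      refine ⟨0, ?_⟩
      rw [mulSeries, nilEval, ← MvPowerSeries.nilEvalHom_apply φ (fun _ => hen)]
      refine (map_zero _).trans ?_
      simp
    | succ m ih =>
      obtain ⟨k, hk⟩ := ih
      obtain ⟨l, hl⟩ := exists_nilAdd_eq φ he H (m + e * k) 1
      refine ⟨k + l, ?_⟩
      rw [one_mul] at hl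
      rw [H.nilEval_mulSeries_succ φ m hen, hk, hl]
      push_cast
      ring
  induction m with
  | zero =>
    have h0 (x : R) (hx : IsNilpotent x) : nilEval φ 0 x = 0 := by
      rw [nilEval, ← MvPowerSeries.nilEvalHom_apply φ (fun _ => hx)]
      exact map_zero _
    rw [mulSeries, mulSeries, h0 _ hen, h0 _ hue, nilEval_zero, hu]
    simp
  | succ m ih =>
    obtain ⟨k, hk⟩ := key m
    have h1 := nilEval_nilAdd_eq hu hD φ he (m + e * k) 1
    rw [one_mul, ← hk, ← H.nilEval_mulSeries_succ φ m hen, ih, F.nilAdd_add_left φ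
      (isNilpotent_nilEval φ hue (F.constantCoeff_mulSeries m)) hue
      (isNilpotent_pow_mul he hn _)
      (by simpa using nilEval_mul_pow hu φ he hn 1 _)] at h1
    have h2 := mul_defectForm_congr (H := H) (F := F) (u := u) φ he (m : R) 1 k 0
    rw [mul_zero, _root_.add_zero] at h2
    rw [h1, F.nilEval_mulSeries_succ φ m hue, Finset.sum_range_succ]
    linear_combination h2

end

include hu hD in
lemma isSymmCocycle_defect [H.IsComm] [F.IsComm] (hn : 0 < n) :
    IsSymmCocycle n (MvPowerSeries.homCoeff n (defect H F u)) where
  symm i hi hin := by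
    obtain ⟨R, _, ι, e, he, hinj⟩ := exists_pow_succ_eq_zero (Polynomial A) n
    have hnil := isNilpotent_mul_of_pow_eq_zero (R := R) he
    have h1 := nilEval_nilAdd_eq hu hD (ι.comp Polynomial.C) he (ι Polynomial.X) (ι 1)
    have h2 := nilEval_nilAdd_eq hu hD (ι.comp Polynomial.C) he (ι 1) (ι Polynomial.X)
    rw [H.nilAdd_comm _ (hnil _) (hnil _), F.nilAdd_comm _
      (isNilpotent_nilEval _ (hnil _) hu)
      (isNilpotent_nilEval _ (hnil _) hu), h2, add_right_inj, ← map_defectForm,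
      ← map_defectForm, ← sub_eq_zero, ← mul_sub, ← map_sub] at h1
    have h3 := congrArg (Polynomial.coeff · i) (sub_eq_zero.1 (hinj _ h1))
    simp only [defectForm, one_pow, mul_one, Polynomial.finsetSum_coeff,
      Polynomial.coeff_C_mul_X_pow] at h3
    rw [Finset.sum_eq_single_of_mem (n - i) (by rw [Finset.mem_range]; omega),
      Finset.sum_eq_single_of_mem i (by rw [Finset.mem_range]; omega),
      if_pos (by omega), if_pos rfl] at h3
    · exact h3.symm
    · intro j _ hj
      rw [if_neg (by omega)]
    · intro j hj hji
      rw [Finset.mem_range] at hj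
      rw [if_neg (by omega)]
  cocycle i j hi hj hij := by
    obtain ⟨R, _, ι, e, he, hinj⟩ := exists_pow_succ_eq_zero (Polynomial (Polynomial A)) n
    have h1 := defectForm_cocycle hu hD (ι.comp (Polynomial.C.comp Polynomial.C)) he hn
      (ι (Polynomial.C Polynomial.X)) (ι Polynomial.X) (ι 1)
    rw [← map_add, ← map_add, ← map_defectForm, ← map_defectForm, ← map_defectForm,
      ← map_defectForm, ← map_add, ← map_add, ← sub_eq_zero, ← mul_sub, ← map_sub] at h1
    have h2 := congrArg (fun P => (Polynomial.coeff P j).coeff i) (sub_eq_zero.1 (hinj _ h1))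
    simp only [defectForm, RingHom.comp_apply, one_pow, mul_one, Polynomial.finsetSum_coeff,
      Polynomial.coeff_add] at h2
    have e1 (b : ℕ) (hb : b ∈ Finset.range (n + 1)) : ((Polynomial.C (Polynomial.C
        (MvPowerSeries.homCoeff n (H.defect F u) b)) * Polynomial.C Polynomial.X ^ b *
          Polynomial.X ^ (n - b)).coeff j).coeff i = 0 := by
      rw [Finset.mem_range] at hb
      rw [← Polynomial.C_pow, ← Polynomial.C_mul, Polynomial.coeff_C_mul_X_pow]
      split_ifs
      · rw [Polynomial.coeff_C_mul_X_pow, if_neg (by omega)]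
      · rfl
    have e2 (b : ℕ) : ((Polynomial.C (Polynomial.C (MvPowerSeries.homCoeff n (H.defect F u) b)) *
        (Polynomial.C Polynomial.X + Polynomial.X) ^ b).coeff j).coeff i =
          if b = i + j then ((i + j).choose i : A) * MvPowerSeries.homCoeff n (H.defect F u) b
            else 0 := by
      rw [add_comm (Polynomial.C Polynomial.X), Polynomial.coeff_C_mul,
        Polynomial.coeff_X_add_C_pow, Polynomial.coeff_C_mul, ← Polynomial.C_eq_natCast,
        Polynomial.coeff_mul_C, Polynomial.coeff_X_pow]
      split_ifs with h3 h4 h4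
      · rw [h4, ← Nat.choose_symm_add, one_mul, mul_comm]
      · rw [Nat.choose_eq_zero_of_lt (by omega)]
        simp
      · omega
      · simp
    have e3 (b : ℕ) : ((Polynomial.C (Polynomial.C (MvPowerSeries.homCoeff n (H.defect F u) b)) *
        Polynomial.X ^ b).coeff j).coeff i = 0 := by
      rw [Polynomial.coeff_C_mul_X_pow]
      split_ifs
      · rw [Polynomial.coeff_C, if_neg hi.ne']
      · rfl
    have e4 (b : ℕ) : ((Polynomial.C (Polynomial.C (MvPowerSeries.homCoeff n (H.defect F u) b)) *
        Polynomial.C Polynomial.X ^ b * (Polynomial.X + 1) ^ (n - b)).coeff j).coeff i =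
          if b = i then ((n - i).choose j : A) * MvPowerSeries.homCoeff n (H.defect F u) b
            else 0 := by
      rw [← Polynomial.C_pow, ← Polynomial.C_mul, Polynomial.coeff_C_mul,
        Polynomial.coeff_X_add_one_pow, ← Polynomial.C_eq_natCast, Polynomial.coeff_mul_C,
        Polynomial.coeff_C_mul_X_pow]
      split_ifs with h3 h4 h4
      · rw [h4, mul_comm]
      · omega
      · omega
      · simp
    rw [Finset.sum_eq_zero e1, Finset.sum_congr rfl fun b _ => e2 b,
      Finset.sum_congr rfl fun b _ => e3 b, Finset.sum_congr rfl fun b _ => e4 b,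
      Finset.sum_const_zero, _root_.zero_add, _root_.zero_add, Finset.sum_ite_eq',
      Finset.sum_ite_eq', if_pos (by rw [Finset.mem_range]; omega),
      if_pos (by rw [Finset.mem_range]; omega)] at h2
    exact h2

include hu hD in
lemma homCoeff_defect_zero (hn : 0 < n) : MvPowerSeries.homCoeff n (defect H F u) 0 = 0 := by
  obtain ⟨R, _, ι, e, he, hinj⟩ := exists_pow_succ_eq_zero A n
  have hnil := isNilpotent_mul_of_pow_eq_zero (R := R) he
  have h1 := nilEval_nilAdd_eq hu hD ι he 0 1
  rw [zero_mul, H.zero_nilAdd ι (hnil 1), nilEval_zero, hu, map_zero,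
    F.zero_nilAdd ι (isNilpotent_nilEval _ (hnil 1) hu), left_eq_add] at h1
  refine hinj _ (Eq.trans ?_ h1)
  rw [defectForm, Finset.sum_eq_single_of_mem 0 (by simp)]
  · simp
  · intro j _ hj
    rw [zero_pow hj]
    simp

end

end FormalGroup

end

noncomputable section

/-! ### Formal group laws with `[p](T) = T ^ (p ^ h)` -/

lemma PowerSeries.nilEval_congr {A R : Type*} [CommRing A] [CommRing R] (φ : A →+* R)
    {u v : PowerSeries A} {N : ℕ} (h : ∀ k < N, coeff k u = coeff k v) {x : R} (hx : x ^ N = 0) :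
    nilEval φ u x = nilEval φ v x := by
  rw [nilEval_eq_sum φ u hx, nilEval_eq_sum φ v hx]
  refine Finset.sum_congr rfl fun i hi => ?_
  rw [h i (Finset.mem_range.1 hi)]

lemma PowerSeries.nilEval_sub_C_mul_X_pow {A R : Type*} [CommRing A] [CommRing R] (φ : A →+* R)
    (u : PowerSeries A) (a : A) (N : ℕ) {x : R} (hx : IsNilpotent x) :
    nilEval φ (u - C a * X ^ N) x = nilEval φ u x - φ a * x ^ N := by
  have h1 := MvPowerSeries.nilEval_sub φ (fun _ : Unit => hx) u (C a * X ^ N)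
  rw [nilEval, h1]
  change _ - nilEval φ (C a * X ^ N) x = _
  rw [nilEval_mul φ hx, nilEval_pow φ hx, nilEval_X φ hx]
  congr 2
  exact MvPowerSeries.nilEval_C φ a _

namespace FormalGroup

section

variable {A : Type u} [CommRing A] {H F : FormalGroup A} {u v : PowerSeries A}

lemma mem_orderIdeal_iff {D : MvPowerSeries (Fin 2) A} {N : ℕ} :
    D ∈ MvPowerSeries.orderIdeal (Fin 2) A N ↔
      MvPowerSeries.nilEval ((Ideal.Quotient.mk (MvPowerSeries.orderIdeal (Fin 2) A N)).comp
        MvPowerSeries.C) D ![Ideal.Quotient.mk _ (MvPowerSeries.X 0),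
          Ideal.Quotient.mk _ (MvPowerSeries.X 1)] = 0 := by
  rw [← Ideal.Quotient.eq_zero_iff_mem, ← MvPowerSeries.coeff_nilEval_X]
  have : (fun s => Ideal.Quotient.mk (MvPowerSeries.orderIdeal (Fin 2) A N) (MvPowerSeries.X s)) =
      ![Ideal.Quotient.mk _ (MvPowerSeries.X 0), Ideal.Quotient.mk _ (MvPowerSeries.X 1)] := by
    funext s
    fin_cases s <;> rfl
  rw [this]

lemma defect_mem_congr {N : ℕ} (hu : constantCoeff u = 0)
    (hv : constantCoeff v = 0)
    (h : ∀ k < N, coeff k u = coeff k v)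
    (hD : defect H F u ∈ MvPowerSeries.orderIdeal (Fin 2) A N) :
    defect H F v ∈ MvPowerSeries.orderIdeal (Fin 2) A N := by
  have hX (i : Fin 2) : Ideal.Quotient.mk (MvPowerSeries.orderIdeal (Fin 2) A N)
      (MvPowerSeries.X i) ^ N = 0 := MvPowerSeries.isNilpotent_mk (by simp)
  have hn (i : Fin 2) : IsNilpotent (Ideal.Quotient.mk (MvPowerSeries.orderIdeal (Fin 2) A N)
      (MvPowerSeries.X i)) := ⟨N, hX i⟩
  have hH : H.nilAdd ((Ideal.Quotient.mk (MvPowerSeries.orderIdeal (Fin 2) A N)).comp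
      MvPowerSeries.C) (Ideal.Quotient.mk _ (MvPowerSeries.X 0))
        (Ideal.Quotient.mk _ (MvPowerSeries.X 1)) ^ N = 0 := by
    have h1 := MvPowerSeries.coeff_nilEval_X N H.toPowerSeries
    rw [nilAdd, ← MvPowerSeries.isNilpotent_mk H.zero_constantCoeff, ← h1]
    congr 2
    funext s
    fin_cases s <;> rfl
  rw [mem_orderIdeal_iff, nilEval_defect hu _ (hn 0) (hn 1)] at hD
  rw [mem_orderIdeal_iff, nilEval_defect hv _ (hn 0) (hn 1), ← PowerSeries.nilEval_congr _ h hH,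
    ← PowerSeries.nilEval_congr _ h (hX 0), ← PowerSeries.nilEval_congr _ h (hX 1), hD]

lemma homCoeff_defect_self {n : ℕ} (hu : constantCoeff u = 0)
    (hD : defect H F u ∈ MvPowerSeries.orderIdeal (Fin 2) A n) (hn : 0 < n) :
    MvPowerSeries.homCoeff n (defect H F u) n = 0 := by
  obtain ⟨R, _, ι, e, he, hinj⟩ := exists_pow_succ_eq_zero A n
  have hnil := isNilpotent_mul_of_pow_eq_zero (R := R) he
  have h1 := nilEval_nilAdd_eq hu hD ι he 1 0
  rw [zero_mul, H.nilAdd_zero ι (hnil 1), nilEval_zero, hu, map_zero,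
    F.nilAdd_zero ι (isNilpotent_nilEval _ (hnil 1) hu), left_eq_add] at h1
  refine hinj _ (Eq.trans ?_ h1)
  rw [defectForm, Finset.sum_eq_single_of_mem n (by simp)]
  · simp
  · intro j hj hjn
    rw [Finset.mem_range] at hj
    rw [zero_pow (n := n - j) (by omega)]
    simp

/-- The defect of `u - a T ^ n`. -/
lemma homCoeff_defect_sub {n : ℕ} (hn : 2 ≤ n) (hu : constantCoeff u = 0)
    (hD : defect H F u ∈ MvPowerSeries.orderIdeal (Fin 2) A n) (a : A)
    (hD' : defect H F (u - PowerSeries.C a * PowerSeries.X ^ n) ∈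
      MvPowerSeries.orderIdeal (Fin 2) A n) (m : ℕ) (hm : 0 < m) (hmn : m < n) :
    MvPowerSeries.homCoeff n (defect H F (u - PowerSeries.C a * PowerSeries.X ^ n)) m =
      MvPowerSeries.homCoeff n (defect H F u) m - a * n.choose m := by
  have hn0 : n ≠ 0 := by omega
  have hu' : constantCoeff (u - PowerSeries.C a * PowerSeries.X ^ n) = 0 := by
    simp [hu, hn0]
  obtain ⟨R, _, ι, e, he, hinj⟩ := exists_pow_succ_eq_zero (Polynomial A) n
  have hnil := isNilpotent_mul_of_pow_eq_zero (R := R) he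
  set φ := ι.comp Polynomial.C
  set s := ι Polynomial.X
  have h1 := nilEval_nilAdd_eq hu hD φ he s (ι 1)
  have h2 := nilEval_nilAdd_eq hu' hD' φ he s (ι 1)
  have hadd := H.isNilpotent_nilAdd φ (hnil s) (hnil (ι 1))
  have hev (s : R) := isNilpotent_nilEval φ (hnil s) hu
  have hsub (s : R) : nilEval φ (u - PowerSeries.C a * PowerSeries.X ^ n) (s * e) =
      nilEval φ u (s * e) + e ^ n * (- φ a * s ^ n) := by
    rw [PowerSeries.nilEval_sub_C_mul_X_pow φ u a n (hnil s)]
    ring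
  have hsmall (x : R) := isNilpotent_pow_mul he (by omega : 0 < n) x
  obtain ⟨k, hk⟩ := exists_nilAdd_eq φ he H s (ι 1)
  have hpow : (H.nilAdd φ (s * e) (ι 1 * e)) ^ n = e ^ n * (s + ι 1) ^ n := by
    have h3 : (Ideal.Quotient.mk (Ideal.span {e})) ((s + ι 1 + e * k) ^ n) =
        Ideal.Quotient.mk (Ideal.span {e}) ((s + ι 1) ^ n) := by
      have h0 : Ideal.Quotient.mk (Ideal.span {e}) e = 0 :=
        Ideal.Quotient.eq_zero_iff_mem.2 (Ideal.mem_span_singleton_self e)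
      rw [map_pow, map_add, map_mul, h0, zero_mul, _root_.add_zero, map_pow]
    obtain ⟨c, hc⟩ := Ideal.mem_span_singleton.1 (Ideal.Quotient.eq.1 h3)
    rw [hk, mul_pow]
    linear_combination e ^ n * hc + c * he
  have hee : e ^ n * e ^ n = 0 := by
    rw [← pow_add]
    exact pow_eq_zero_of_le (by omega) he
  rw [PowerSeries.nilEval_sub_C_mul_X_pow φ u a n hadd, hpow, hsub, hsub,
    F.nilAdd_add_left φ (hev s) (Commute.isNilpotent_add (Commute.all _ _) (hev _) (hsmall _))
      (hsmall _) (by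
        rw [mul_add, nilEval_mul_pow hu φ he (by omega)]
        linear_combination (-φ a * s ^ n * (- φ a * ι 1 ^ n)) * hee),
    F.nilAdd_add_right φ (hev s) (hev _) (hsmall _) (by
      rw [mul_comm]
      exact nilEval_mul_pow hu φ he (by omega) _ _), h1, ← map_defectForm, ← map_defectForm] at h2
  have h3 : e ^ n * ι (defectForm n H F u Polynomial.C Polynomial.X 1 -
      Polynomial.C a * ((Polynomial.X + 1) ^ n - Polynomial.X ^ n - 1) -
      defectForm n H F (u - PowerSeries.C a * PowerSeries.X ^ n) Polynomial.C Polynomial.X 1)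
      = 0 := by
    simp only [map_sub, map_mul, map_pow, map_add, map_one]
    rw [map_one] at h2
    have : φ a = ι (Polynomial.C a) := rfl
    rw [this] at h2
    linear_combination h2
  have h4 := congrArg (Polynomial.coeff · m) (hinj _ h3)
  have hc (v : PowerSeries A) : (defectForm n H F v Polynomial.C Polynomial.X 1).coeff m =
      MvPowerSeries.homCoeff n (defect H F v) m := by
    simp only [defectForm, one_pow, mul_one, Polynomial.finsetSum_coeff,
      Polynomial.coeff_C_mul_X_pow]
    rw [Finset.sum_eq_single_of_mem m (by rw [Finset.mem_range]; omega), if_pos rfl]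
    intro j _ hj
    rw [if_neg hj.symm]
  simp only [Polynomial.coeff_sub, hc, Polynomial.coeff_C_mul, Polynomial.coeff_X_add_one_pow,
    Polynomial.coeff_X_pow, Polynomial.coeff_one, if_neg hm.ne', if_neg hmn.ne,
    Polynomial.coeff_zero, sub_zero] at h4
  exact (sub_eq_zero.1 h4).symm

lemma map_defect {B : Type*} [CommRing B] (φ : A →+* B) (hu : constantCoeff u = 0) :
    MvPowerSeries.map φ (defect H F u) = defect (H.map φ) (F.map φ) (PowerSeries.map φ u) := by
  have h (i : Fin 2) : PowerSeries.HasSubst (MvPowerSeries.X i : MvPowerSeries (Fin 2) A) :=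
    PowerSeries.HasSubst.X i
  have h' : MvPowerSeries.HasSubst
      ![PowerSeries.subst (MvPowerSeries.X 0 : MvPowerSeries (Fin 2) A) u,
        PowerSeries.subst (MvPowerSeries.X 1 : MvPowerSeries (Fin 2) A) u] :=
    MvPowerSeries.hasSubst_of_constantCoeff_zero fun s => by
      fin_cases s
      · exact constantCoeff_subst_eq_zero (by simp) _ hu
      · exact constantCoeff_subst_eq_zero (by simp) _ hu
  rw [defect, defect, map_sub, PowerSeries.map_subst (Endo.hasSubst_law H),
    MvPowerSeries.map_subst h']
  congr 2
  funext i
  fin_cases i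
  · simpa using PowerSeries.map_subst (h 0) u
  · simpa using PowerSeries.map_subst (h 1) u

end

section

variable {A : Type u} [CommRing A] {p : ℕ} [Fact p.Prime] (hp : (p : A) = 0) {h : ℕ}

/-- The law commutes with the `p ^ h`-th power map. -/
lemma map_powPowHom_eq {F : FormalGroup A} [F.IsComm]
    (hF : F.mulSeries p = PowerSeries.X ^ p ^ h) : F.map (powPowHom A hp h) = F := by
  have hq : 0 < p ^ h := pow_pos (Fact.out : p.Prime).pos h
  refine FormalGroup.ext (MvPowerSeries.eq_of_nilEval_eq fun R _ φ a ha => ?_)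
  obtain ⟨R₁, _, χ₁, x, hχ₁, hxa, hx⟩ := exists_pow_eq_of_isNilpotent hq (a 0) (ha 0)
  obtain ⟨R₂, _, χ₂, y, hχ₂, hyb, hy⟩ :=
    exists_pow_eq_of_isNilpotent hq (χ₁ (a 1)) ((ha 1).map χ₁)
  let χ := χ₂.comp χ₁
  have hx2 : χ₂ x ^ p ^ h = χ (a 0) := by rw [← map_pow, hxa]; rfl
  have hy2 : y ^ p ^ h = χ (a 1) := hyb
  have hnx := hx.map χ₂
  have hχ : Function.Injective χ := hχ₂.comp hχ₁
  apply hχ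
  have hpair : (fun s => χ (a s)) = ![χ₂ x ^ p ^ h, y ^ p ^ h] := by
    funext s
    fin_cases s
    · exact hx2.symm
    · exact hy2.symm
  rw [MvPowerSeries.map_nilEval χ φ _ ha, MvPowerSeries.map_nilEval χ φ _ ha, hpair]
  change (F.map (powPowHom A hp h)).nilAdd (χ.comp φ) _ _ = F.nilAdd (χ.comp φ) _ _
  have h1 := F.nilEval_mulSeries_nilAdd (χ.comp φ) p hnx hy
  simp only [hF, nilEval_pow _ hnx, nilEval_pow _ hy,
    nilEval_pow _ (F.isNilpotent_nilAdd (χ.comp φ) hnx hy),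
    nilEval_X _ hnx, nilEval_X _ hy,
    nilEval_X _ (F.isNilpotent_nilAdd (χ.comp φ) hnx hy)] at h1
  rw [← h1, nilAdd_map, powPowHom_comp hp h (χ.comp φ)]
  exact (F.map_nilAdd (χ.comp φ) (powPowHom R₂ ((χ.comp φ).natCast_eq_zero hp) h) hnx hy).symm

variable {H F : FormalGroup A} [H.IsComm] [F.IsComm]

/-- An approximate isomorphism can be improved by one degree. -/
lemma exists_defect_mem_succ [CharP A p] (hH : H.mulSeries p = PowerSeries.X ^ p ^ h)
    (hF : F.mulSeries p = PowerSeries.X ^ p ^ h) {n : ℕ} (hn : 2 ≤ n) {u : PowerSeries A}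
    (hu : constantCoeff u = 0) (huψ : PowerSeries.map (powPowHom A hp h) u = u)
    (hD : defect H F u ∈ MvPowerSeries.orderIdeal (Fin 2) A n) :
    ∃ a : A, powPowHom A hp h a = a ∧ defect H F (u - PowerSeries.C a * PowerSeries.X ^ n) ∈
      MvPowerSeries.orderIdeal (Fin 2) A (n + 1) := by
  have hn0 : 0 < n := by omega
  set γ := MvPowerSeries.homCoeff n (defect H F u) with hγ
  have hfix (i : ℕ) : powPowHom A hp h (γ i) = γ i := by
    have h1 := map_defect (H := H) (F := F) (powPowHom A hp h) hu
    rw [map_powPowHom_eq hp hH, map_powPowHom_eq hp hF, huψ] at h1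
    rw [hγ, MvPowerSeries.homCoeff]
    conv_rhs => rw [← h1, MvPowerSeries.coeff_map]
  have h0 : γ 0 = 0 := homCoeff_defect_zero hu hD hn0
  have hnn : γ n = 0 := homCoeff_defect_self hu hD hn0
  have hsum : ∑ j ∈ Finset.range p, defectForm n H F u (RingHom.id A) j 1 = 0 := by
    obtain ⟨R, _, ι, e, he, hinj⟩ := exists_pow_succ_eq_zero A n
    have hen : IsNilpotent e := ⟨n + 1, he⟩
    have hue := isNilpotent_nilEval ι hen hu
    have h1 := nilEval_mulSeries_eq hu hD ι he hn0 p
    rw [hH, hF, nilEval_pow _ hen, nilEval_pow _ hue,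
      nilEval_X _ hen, nilEval_X _ hue] at h1
    have h2 : nilEval ι u e ^ p ^ h = nilEval ι u (e ^ p ^ h) := by
      have h3 := PowerSeries.map_nilEval (powPowHom R (ι.natCast_eq_zero hp) h) ι u hen
      rw [← powPowHom_comp hp, ← nilEval_map, huψ] at h3
      exact h3
    rw [h2, left_eq_add] at h1
    refine hinj _ (Eq.trans ?_ h1)
    rw [map_sum]
    congr 1
    refine Finset.sum_congr rfl fun j _ => ?_
    rw [map_defectForm, RingHom.comp_id, map_natCast, map_one]
  have hform (j : ℕ) : defectForm n H F u (RingHom.id A) j 1 =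
      ∑ i ∈ Finset.Ico 1 n, γ i * (j : A) ^ i := by
    simp only [defectForm, one_pow, mul_one, RingHom.id_apply]
    rw [Finset.sum_range_succ, ← hγ, hnn, zero_mul, _root_.add_zero, Finset.range_eq_Ico,
      Finset.sum_eq_sum_Ico_succ_bot hn0, h0, zero_mul, _root_.zero_add]
  simp only [hform] at hsum
  rw [Finset.range_eq_Ico, Finset.sum_eq_sum_Ico_succ_bot (Fact.out : p.Prime).pos,
    Finset.sum_eq_zero (s := Finset.Ico 1 n) fun i hi => by
      rw [Finset.mem_Ico] at hi
      rw [Nat.cast_zero, zero_pow (by omega), mul_zero], _root_.zero_add] at hsum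
  obtain ⟨k, i, _, _, hki⟩ := IsSymmCocycle.exists_eq_choose n γ hn
    (isSymmCocycle_defect hu hD hn0) hsum
  have hu' : constantCoeff (u - PowerSeries.C (k * γ i) * PowerSeries.X ^ n) = 0 := by
    simp [hu, hn0.ne']
  have hD' : defect H F (u - PowerSeries.C (k * γ i) * PowerSeries.X ^ n) ∈
      MvPowerSeries.orderIdeal (Fin 2) A n := by
    refine defect_mem_congr hu hu' (fun l hl => ?_) hD
    rw [map_sub, coeff_C_mul, coeff_X_pow, if_neg hl.ne, mul_zero, sub_zero]
  refine ⟨k * γ i, by rw [map_mul, map_natCast, hfix], MvPowerSeries.mem_orderIdeal_succ hD'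
    fun m hm => ?_⟩
  rcases Nat.eq_zero_or_pos m with rfl | hm0
  · exact homCoeff_defect_zero hu' hD' hn0
  rcases hm.lt_or_eq with hmn | rfl
  · rw [homCoeff_defect_sub hn hu hD _ hD' m hm0 hmn, sub_eq_zero]
    exact hki m hm0 hmn
  · exact homCoeff_defect_self hu' hD' hn0

include hp in
/-- Two formal group laws with `[p](T) = T ^ (p ^ h)` are strictly isomorphic. -/
theorem exists_isHom_of_mulSeries_eq (hH : H.mulSeries p = PowerSeries.X ^ p ^ h)
    (hF : F.mulSeries p = PowerSeries.X ^ p ^ h) :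
    ∃ u : PowerSeries A, coeff 1 u = 1 ∧ IsHom H F u := by
  rcases subsingleton_or_nontrivial A with hA | hA
  · have hs {R : Type u} [CommRing R] (φ : A →+* R) : Subsingleton R :=
      subsingleton_of_zero_eq_one (by
        rw [← map_zero φ, ← map_one φ, Subsingleton.elim (0 : A) 1])
    exact ⟨0, Subsingleton.elim _ _, Subsingleton.elim _ _, fun R _ φ x y _ _ =>
      @Subsingleton.elim _ (hs φ) _ _⟩
  have := (CharP.charP_iff_prime_eq_zero (R := A) (Fact.out : p.Prime)).2 hp
  let S (n : ℕ) : Set (PowerSeries A) := {u | constantCoeff u = 0 ∧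
    coeff 1 u = 1 ∧ PowerSeries.map (powPowHom A hp h) u = u ∧
      defect H F u ∈ MvPowerSeries.orderIdeal (Fin 2) A (n + 2)}
  have hstep (n : ℕ) (u : S n) : ∃ v : S (n + 1), ∀ k < n + 2,
      coeff k v.1 = coeff k u.1 := by
    obtain ⟨u, hu, hu1, huψ, hD⟩ := u
    obtain ⟨a, ha, hD'⟩ := exists_defect_mem_succ hp hH hF (by omega) hu huψ hD
    have hc (k : ℕ) (hk : k < n + 2) : coeff k
        (u - PowerSeries.C a * PowerSeries.X ^ (n + 2)) = coeff k u := by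
      rw [map_sub, coeff_C_mul, coeff_X_pow, if_neg hk.ne, mul_zero,
        sub_zero]
    exact ⟨⟨_, by simp [hu], (hc 1 (by omega)).trans hu1, by simp [huψ, ha], hD'⟩, hc⟩
  choose next hnext using hstep
  have h0 : (PowerSeries.X : PowerSeries A) ∈ S 0 := by
    refine ⟨by simp, by simp, by simp, ?_⟩
    rw [mem_orderIdeal_iff]
    have hX (i : Fin 2) : Ideal.Quotient.mk (MvPowerSeries.orderIdeal (Fin 2) A (0 + 2))
        (MvPowerSeries.X i) ^ 2 = 0 := MvPowerSeries.isNilpotent_mk (by simp)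
    have hn (i : Fin 2) : IsNilpotent (Ideal.Quotient.mk (MvPowerSeries.orderIdeal (Fin 2) A (0 + 2))
        (MvPowerSeries.X i)) := ⟨_, hX i⟩
    have h2 : Ideal.Quotient.mk (MvPowerSeries.orderIdeal (Fin 2) A (0 + 2))
        (MvPowerSeries.X 0) * Ideal.Quotient.mk _ (MvPowerSeries.X 1) = 0 := by
      have h3 : Ideal.Quotient.mk (MvPowerSeries.orderIdeal (Fin 2) A (0 + 2))
        (MvPowerSeries.X 0 * MvPowerSeries.X 1) = 0 := by
        rw [Ideal.Quotient.eq_zero_iff_mem]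
        intro d hd
        rw [MvPowerSeries.X, MvPowerSeries.X, MvPowerSeries.monomial_mul_monomial,
          MvPowerSeries.coeff_monomial, if_neg]
        rintro rfl
        simp at hd
      rwa [map_mul] at h3
    have hadd (G : FormalGroup A) := G.nilAdd_sub_mem
      ((Ideal.Quotient.mk (MvPowerSeries.orderIdeal (Fin 2) A (0 + 2))).comp MvPowerSeries.C)
      (hn 0) (hn 1)
    simp only [h2, Ideal.mem_span_singleton, zero_dvd_iff] at hadd
    rw [nilEval_defect (by simp) _ (hn 0) (hn 1), nilEval_X _ (hn 0),
      nilEval_X _ (hn 1), nilEval_X _ (H.isNilpotent_nilAdd _ (hn 0) (hn 1))]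
    linear_combination hadd H - hadd F
  let s : ∀ n, S n := fun n => Nat.rec ⟨_, h0⟩ (fun n u => next n u) n
  have hs (n k : ℕ) (hk : k < n + 2) : coeff k (s (n + 1)).1 =
    coeff k (s n).1 := hnext n (s n) k hk
  have hst (k m : ℕ) : coeff k (s (k + m)).1 = coeff k (s k).1 := by
    induction m with
    | zero => rfl
    | succ m ih => rw [← ih]; exact hs (k + m) k (by omega)
  have hst' (k n : ℕ) (hk : k < n + 2) :
      coeff k (s n).1 = coeff k (s k).1 := by
    obtain hkn | hkn := le_or_gt k n
    · obtain ⟨m, rfl⟩ := Nat.exists_eq_add_of_le hkn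
      exact hst k m
    · obtain rfl : k = n + 1 := by omega
      exact (hs n (n + 1) (by omega)).symm
  let u : PowerSeries A := PowerSeries.mk fun k => coeff k (s k).1
  have hu0 : constantCoeff u = 0 := by
    rw [← coeff_zero_eq_constantCoeff_apply, coeff_mk,
      coeff_zero_eq_constantCoeff_apply]
    exact (s 0).2.1
  refine ⟨u, ?_, isHom_of_defect_eq_zero hu0 ?_⟩
  · rw [coeff_mk]
    exact (s 1).2.2.1
  · ext d
    have h1 := defect_mem_congr (s d.degree).2.1 hu0 (fun k hk => by
      rw [coeff_mk]
      exact hst' k _ hk) (s d.degree).2.2.2.2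
    rw [map_zero]
    exact h1 d (by omega)

end

end FormalGroup

end

noncomputable section

/-! ### Towers of faithfully flat extensions -/

/-- An algebra whose linear equations can be lifted to faithfully flat algebras is faithfully
flat. -/
lemma Module.FaithfullyFlat.of_forall_exists_lift {A B : Type u} [CommRing A] [CommRing B]
    [Algebra A B] (h : ∀ (l : ℕ) (f : Fin l → A) (x : Fin l → B) (r : A),
      ∑ i, f i • x i = algebraMap A B r → ∃ (R : Type u) (_ : CommRing R) (_ : Algebra A R)
        (_ : Module.FaithfullyFlat A R) (ψ : R →ₐ[A] B) (y : Fin l → R), (∀ i, ψ (y i) = x i) ∧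
          ∑ i, f i • y i = algebraMap A R r) : Module.FaithfullyFlat A B := by
  rw [Module.FaithfullyFlat.iff_flat_and_proper_ideal]
  refine ⟨Module.Flat.iff_forall_isTrivialRelation.2 fun {l f x} hfx => ?_, fun I hI hIB => hI ?_⟩
  · obtain ⟨R, _, _, _, ψ, y, hy, hfy⟩ := h l f x 0 (by rw [hfx, map_zero])
    rw [map_zero] at hfy
    obtain ⟨κ, a, z, hz, ha⟩ := Module.Flat.isTrivialRelation_of_sum_smul_eq_zero (R := A) (M := R)
      hfy
    refine ⟨κ, a, fun j => ψ (z j), fun i => ?_, ha⟩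
    rw [← hy, hz, map_sum]
    simp only [map_smul]
  · have h1 : (1 : B) ∈ I.map (algebraMap A B) := by
      have h2 : (1 : B) ∈ I • (⊤ : Submodule A B) := Submodule.eq_top_iff'.1 hIB 1
      rw [Ideal.smul_top_eq_map] at h2
      exact h2
    rw [Ideal.map, Ideal.span, Submodule.mem_span_set'] at h1
    obtain ⟨n, x, g, hg⟩ := h1
    choose f hf hfg using fun i => (g i).2
    obtain ⟨R, _, _, _, ψ, y, hy, hfy⟩ := h n f x 1 (by
      rw [map_one, ← hg]
      refine Finset.sum_congr rfl fun i _ => ?_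
      rw [Algebra.smul_def, hfg, smul_eq_mul, mul_comm])
    by_contra hne
    refine (Module.FaithfullyFlat.iff_flat_and_proper_ideal A R).1 inferInstance |>.2 I hne ?_
    rw [Ideal.smul_top_eq_map, Submodule.restrictScalars_eq_top_iff, Ideal.eq_top_iff_one,
      ← map_one (algebraMap A R), ← hfy]
    refine Ideal.sum_mem _ fun i _ => ?_
    rw [Algebra.smul_def]
    exact Ideal.mul_mem_right _ _ (Ideal.mem_map_of_mem _ (hf i))

open Limits in
lemma RingHom.FaithfullyFlat.colimit_ι (F : ℕ ⥤ CommRingCat.{u})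
    (h : ∀ n, (F.map (homOfLE (Nat.zero_le n))).hom.FaithfullyFlat) :
    (colimit.ι F 0).hom.FaithfullyFlat := by
  have : PreservesFilteredColimitsOfSize.{0, 0} (forget CommRingCat.{u}) :=
    preservesFilteredColimitsOfSize_shrink.{0, u, 0, u} _
  algebraize [(colimit.ι F 0).hom]
  change Module.FaithfullyFlat (F.obj 0) (colimit F :)
  refine Module.FaithfullyFlat.of_forall_exists_lift fun l f x r hfx => ?_
  have hrep : ∃ (n : ℕ) (y : Fin l → F.obj n), ∀ i, colimit.ι F n (y i) = x i := by
    choose n y hy using fun i => Concrete.colimit_exists_rep F (x i)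
    refine ⟨Finset.univ.sup n, fun i => F.map (homOfLE (Finset.le_sup (Finset.mem_univ i))) (y i),
      fun i => ?_⟩
    rw [← hy i, ← ConcreteCategory.comp_apply, colimit.w]
  obtain ⟨n, y, hy⟩ := hrep
  have hw (m : ℕ) (a : F.obj 0) : colimit.ι F m (F.map (homOfLE (Nat.zero_le m)) a) =
      colimit.ι F 0 a := by
    rw [← ConcreteCategory.comp_apply, colimit.w]
  have h1 : colimit.ι F n (∑ i, F.map (homOfLE (Nat.zero_le n)) (f i) * y i) =
      colimit.ι F n (F.map (homOfLE (Nat.zero_le n)) r) := by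
    rw [map_sum, hw]
    refine Eq.trans ?_ hfx
    refine Finset.sum_congr rfl fun i _ => ?_
    rw [map_mul, hw, hy, Algebra.smul_def]
    rfl
  obtain ⟨m, g, g', hm⟩ := (Concrete.colimit_rep_eq_iff_exists F _ _).1 h1
  obtain rfl : g = g' := Subsingleton.elim _ _
  have hg (a : F.obj 0) : F.map g (F.map (homOfLE (Nat.zero_le n)) a) =
      F.map (homOfLE (Nat.zero_le m)) a := by
    rw [← ConcreteCategory.comp_apply, ← Functor.map_comp]
    rfl
  let _ := (F.map (homOfLE (Nat.zero_le m))).hom.toAlgebra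
  refine ⟨F.obj m, inferInstance, inferInstance, h m, ⟨(colimit.ι F m).hom, hw m⟩,
    fun i => F.map g (y i), fun i => ?_, ?_⟩
  · refine Eq.trans ?_ (hy i)
    change colimit.ι F m (F.map g (y i)) = _
    rw [← ConcreteCategory.comp_apply, colimit.w]
  · rw [hg, map_sum] at hm
    refine Eq.trans (Finset.sum_congr rfl fun i _ => ?_) hm
    rw [map_mul, hg, Algebra.smul_def]
    rfl

lemma exists_colimit_of_sequence (R : ℕ → CommRingCat.{u}) (f : ∀ n, R n ⟶ R (n + 1))
    (hf : ∀ n, (f n).hom.FaithfullyFlat) : ∃ (B : CommRingCat.{u}) (j : ∀ n, R n ⟶ B),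
      (∀ n, f n ≫ j (n + 1) = j n) ∧ (j 0).hom.FaithfullyFlat := by
  have hF (n : ℕ) : (Functor.ofSequence f).map (homOfLE (Nat.le_succ n)) = f n :=
    Functor.ofSequence_map_homOfLE_succ f n
  have hflat (n : ℕ) :
      ((Functor.ofSequence f).map (homOfLE (Nat.zero_le n))).hom.FaithfullyFlat := by
    induction n with
    | zero =>
      have : (Functor.ofSequence f).map (homOfLE (Nat.zero_le 0)) = 𝟙 _ :=
        (Functor.ofSequence f).map_id 0
      rw [this]
      exact RingHom.FaithfullyFlat.of_bijective Function.bijective_id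
    | succ n ih =>
      have h1 : (Functor.ofSequence f).map (homOfLE (Nat.zero_le (n + 1))) =
          (Functor.ofSequence f).map (homOfLE (Nat.zero_le n)) ≫
            (Functor.ofSequence f).map (homOfLE (Nat.le_succ n)) := by
        rw [← Functor.map_comp]
        rfl
      rw [h1, CommRingCat.hom_comp]
      refine RingHom.FaithfullyFlat.stableUnderComposition _ _ ih ?_
      rw [hF]
      exact hf n
  refine ⟨Limits.colimit (Functor.ofSequence f), Limits.colimit.ι (Functor.ofSequence f),
    fun n => ?_, RingHom.FaithfullyFlat.colimit_ι _ hflat⟩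
  refine Eq.trans ?_ (Limits.colimit.w (Functor.ofSequence f) (homOfLE (Nat.le_succ n)))
  rw [hF]
  rfl

lemma AdjoinRoot.faithfullyFlat_of {R : Type u} [CommRing R] {P : Polynomial R} (hP : P.Monic)
    (hd : P.natDegree ≠ 0) : (AdjoinRoot.of P).FaithfullyFlat := by
  rw [← AdjoinRoot.algebraMap_eq, RingHom.faithfullyFlat_algebraMap_iff]
  have := hP.free_adjoinRoot
  rcases subsingleton_or_nontrivial R with hR | hR
  · exact { submodule_ne_top := fun m hm => (hm.ne_top (Subsingleton.elim _ _)).elim }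
  · have : Nontrivial (AdjoinRoot P) := by
      refine Ideal.Quotient.nontrivial_iff.2 fun h => hd ?_
      rw [Ideal.span_singleton_eq_top] at h
      rw [hP.eq_one_of_isUnit h, Polynomial.natDegree_one]
    infer_instance

/-- Successive adjunction of roots: if the polynomials `P n` are monic, natural in the ring, and
depend only on the elements `a k` with `k < n`, they have roots `a n` over a faithfully flat
extension. -/
theorem exists_faithfullyFlat_roots {A : Type u} [CommRing A]
    (P : ∀ (_ : ℕ) (R : Type u) [CommRing R] (_ : A →+* R) (_ : ℕ → R), Polynomial R)
    (hmonic : ∀ (n : ℕ) (R : Type u) [CommRing R] (φ : A →+* R) (a : ℕ → R), (P n R φ a).Monic)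
    (hdeg : ∀ (n : ℕ) (R : Type u) [CommRing R] (φ : A →+* R) (a : ℕ → R), Nontrivial R →
      (P n R φ a).natDegree ≠ 0)
    (hmap : ∀ (n : ℕ) (R R' : Type u) [CommRing R] [CommRing R'] (χ : R →+* R') (φ : A →+* R)
      (a : ℕ → R) (b : ℕ → R'), (∀ k < n, b k = χ (a k)) →
        (P n R φ a).map χ = P n R' (χ.comp φ) b) :
    ∃ (B : Type u) (_ : CommRing B) (φ : A →+* B), φ.FaithfullyFlat ∧
      ∃ a : ℕ → B, ∀ n, (P n B φ a).eval (a n) = 0 := by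
  let St : ℕ → Σ R : CommRingCat.{u}, (A →+* R) × (ℕ → R) := fun n =>
    Nat.rec ⟨.of A, RingHom.id A, 0⟩ (fun n s => ⟨.of (AdjoinRoot (P n s.1 s.2.1 s.2.2)),
      (AdjoinRoot.of _).comp s.2.1,
      Function.update (fun k => AdjoinRoot.of _ (s.2.2 k)) n (AdjoinRoot.root _)⟩) n
  let f (n : ℕ) : (St n).1 ⟶ (St (n + 1)).1 :=
    CommRingCat.ofHom (AdjoinRoot.of (P n (St n).1 (St n).2.1 (St n).2.2))
  have hne (n k : ℕ) (h : k ≠ n) : (St (n + 1)).2.2 k = f n ((St n).2.2 k) :=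
    Function.update_of_ne h (AdjoinRoot.root (P n (St n).1 (St n).2.1 (St n).2.2))
      (fun k => AdjoinRoot.of (P n (St n).1 (St n).2.1 (St n).2.2) ((St n).2.2 k))
  have hself (n : ℕ) : (St (n + 1)).2.2 n =
      AdjoinRoot.root (P n (St n).1 (St n).2.1 (St n).2.2) :=
    Function.update_self n (AdjoinRoot.root (P n (St n).1 (St n).2.1 (St n).2.2))
      (fun k => AdjoinRoot.of (P n (St n).1 (St n).2.1 (St n).2.2) ((St n).2.2 k))
  have hff (n : ℕ) : (f n).hom.FaithfullyFlat := by
    rcases subsingleton_or_nontrivial (St n).1 with hs | hs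
    · have : Subsingleton (St (n + 1)).1 := (f n).hom.codomain_trivial
      exact RingHom.FaithfullyFlat.of_bijective ⟨fun _ _ _ => Subsingleton.elim _ _,
        fun x => ⟨0, Subsingleton.elim _ _⟩⟩
    · exact AdjoinRoot.faithfullyFlat_of (hmonic _ _ _ _) (hdeg _ _ _ _ hs)
  obtain ⟨B, j, hj, hj0⟩ := exists_colimit_of_sequence (fun n => (St n).1) f hff
  have hj' (n : ℕ) : (j (n + 1)).hom.comp (f n).hom = (j n).hom := by
    rw [← hj n]
    rfl
  have hφ (n : ℕ) : (j n).hom.comp (St n).2.1 = (j 0).hom := by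
    induction n with
    | zero => exact RingHom.comp_id _
    | succ n ih =>
      rw [← ih, ← hj' n]
      rfl
  let b (k : ℕ) : B := j (k + 1) ((St (k + 1)).2.2 k)
  have hb (k m : ℕ) : b k = j (k + 1 + m) ((St (k + 1 + m)).2.2 k) := by
    induction m with
    | zero => rfl
    | succ m ih =>
      rw [ih, ← hj (k + 1 + m), ConcreteCategory.comp_apply]
      refine congrArg (j (k + 1 + m + 1)) ?_
      exact (hne (k + 1 + m) k (by omega)).symm
  refine ⟨B, inferInstance, (j 0).hom, hj0, b, fun n => ?_⟩
  have hP := hmap n _ _ (j n).hom (St n).2.1 (St n).2.2 b fun k hk => by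
    obtain ⟨m, rfl⟩ := Nat.exists_eq_add_of_le (show k + 1 ≤ n by omega)
    exact hb k m
  have hroot : b n = (j (n + 1)).hom (AdjoinRoot.root _) :=
    congrArg (j (n + 1)) (hself n)
  rw [hφ n] at hP
  rw [← hP, Polynomial.eval_map, ← hj' n, hroot]
  refine (Polynomial.hom_eval₂ _ _ (j (n + 1)).hom _).symm.trans ?_
  exact (congrArg (j (n + 1)).hom (AdjoinRoot.eval₂_root _)).trans (map_zero _)

end

noncomputable section

/-! ### Formal group laws from their points -/

lemma MvPowerSeries.nilEval_subst_two {σ A R : Type*} [CommRing A] [CommRing R] [Finite σ]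
    (φ : A →+* R) {a : σ → R} (ha : ∀ s, IsNilpotent (a s)) (F : MvPowerSeries (Fin 2) A)
    {f g : MvPowerSeries σ A} (hf : constantCoeff f = 0) (hg : constantCoeff g = 0) :
    nilEval φ (subst ![f, g] F) a = nilEval φ F ![nilEval φ f a, nilEval φ g a] := by
  rw [nilEval_subst φ ha (isNilpotent_pair_constantCoeff hf hg)]
  congr 1
  funext s
  fin_cases s <;> rfl

namespace FormalGroup

variable {A : Type u} [CommRing A]

/-- A natural commutative monoid structure with neutral element zero on the nilpotent elements of
algebras is given by a formal group law. -/
theorem exists_nilAdd (η : ∀ (R : Type u) [CommRing R] (_ : A →+* R) (x y : R),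
      IsNilpotent x → IsNilpotent y → R)
    (hη : ∀ (R R' : Type u) [CommRing R] [CommRing R'] (χ : R →+* R') (φ : A →+* R) (x y : R)
      (hx : IsNilpotent x) (hy : IsNilpotent y), χ (η R φ x y hx hy) =
        η R' (χ.comp φ) (χ x) (χ y) (hx.map χ) (hy.map χ))
    (hnil : ∀ (R : Type u) [CommRing R] (φ : A →+* R) (x y : R) (hx : IsNilpotent x)
      (hy : IsNilpotent y), IsNilpotent (η R φ x y hx hy))
    (hassoc : ∀ (R : Type u) [CommRing R] (φ : A →+* R) (x y z : R) (hx : IsNilpotent x)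
      (hy : IsNilpotent y) (hz : IsNilpotent z),
        η R φ (η R φ x y hx hy) z (hnil R φ x y hx hy) hz =
          η R φ x (η R φ y z hy hz) hx (hnil R φ y z hy hz))
    (hcomm : ∀ (R : Type u) [CommRing R] (φ : A →+* R) (x y : R) (hx : IsNilpotent x)
      (hy : IsNilpotent y), η R φ x y hx hy = η R φ y x hy hx)
    (hzero : ∀ (R : Type u) [CommRing R] (φ : A →+* R) (x : R) (hx : IsNilpotent x),
      η R φ x 0 hx IsNilpotent.zero = x) :
    ∃ F : FormalGroup A, F.IsComm ∧ ∀ (R : Type u) [CommRing R] (φ : A →+* R) (x y : R)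
      (hx : IsNilpotent x) (hy : IsNilpotent y), η R φ x y hx hy = F.nilAdd φ x y := by
  obtain ⟨F, hF⟩ := MvPowerSeries.exists_nilEval (σ := Fin 2)
    (fun R _ φ a ha => η R φ (a 0) (a 1) (ha 0) (ha 1))
    (fun R R' _ _ χ φ a ha => hη R R' χ φ (a 0) (a 1) (ha 0) (ha 1))
  replace hF (R : Type u) [CommRing R] (φ : A →+* R) (x y : R) (hx : IsNilpotent x)
      (hy : IsNilpotent y) : η R φ x y hx hy = MvPowerSeries.nilEval φ F ![x, y] :=
    hF R φ ![x, y] (isNilpotent_pair hx hy)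
  have h0 : MvPowerSeries.constantCoeff F = 0 := by
    have h1 := hF A (RingHom.id A) 0 0 IsNilpotent.zero IsNilpotent.zero
    rw [hzero] at h1
    have h2 : (![0, 0] : Fin 2 → A) = fun _ => 0 := by funext s; fin_cases s <;> rfl
    rw [h2, MvPowerSeries.nilEval_zero] at h1
    exact h1.symm
  have hord : F ∈ MvPowerSeries.orderIdeal (Fin 2) A 1 := by
    intro d hd
    rw [Nat.lt_one_iff, Finsupp.degree_eq_zero_iff] at hd
    rw [hd, MvPowerSeries.coeff_zero_eq_constantCoeff_apply, h0]
  obtain ⟨R, _, ι, e, he, hinj⟩ := exists_pow_succ_eq_zero A 1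
  have hen : IsNilpotent e := ⟨2, he⟩
  have hlin (i : ℕ) (s t : R) (hi : MvPowerSeries.nilEval ι F ![s * e, t * e] = e)
      (hs : ∑ i ∈ Finset.range (1 + 1), ι (MvPowerSeries.homCoeff 1 F i) * s ^ i * t ^ (1 - i) =
        ι (MvPowerSeries.homCoeff 1 F i)) : MvPowerSeries.homCoeff 1 F i = 1 := by
    rw [MvPowerSeries.nilEval_smul hord ι he, hs, pow_one] at hi
    refine sub_eq_zero.1 (hinj _ ?_)
    rw [map_sub, map_one]
    linear_combination hi
  have hX : MvPowerSeries.coeff (Finsupp.single 0 1) F = 1 := by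
    have h1 := hlin 1 1 0 (by
      rw [zero_mul, one_mul, ← hF R ι e 0 hen IsNilpotent.zero, hzero]) (by
      rw [Finset.sum_range_succ, Finset.sum_range_one]
      simp)
    simpa [MvPowerSeries.homCoeff] using h1
  have hY : MvPowerSeries.coeff (Finsupp.single 1 1) F = 1 := by
    have h1 := hlin 0 0 1 (by
      rw [zero_mul, one_mul, ← hF R ι 0 e IsNilpotent.zero hen, hcomm, hzero]) (by
      rw [Finset.sum_range_succ, Finset.sum_range_one]
      simp)
    simpa [MvPowerSeries.homCoeff] using h1
  refine ⟨⟨F, h0, hX, hY, ?_⟩, ⟨?_⟩, hF⟩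
  · refine MvPowerSeries.eq_of_nilEval_eq fun R _ φ a ha => ?_
    have hc (i j : Fin 3) : MvPowerSeries.constantCoeff (MvPowerSeries.subst
        ![(MvPowerSeries.X i : MvPowerSeries (Fin 3) A), MvPowerSeries.X j] F) = 0 :=
      MvPowerSeries.constantCoeff_subst_eq_zero MvPowerSeries.HasSubst.X_X (by
        intro i; fin_cases i <;> simp) h0
    have h1 := hassoc R φ (a 0) (a 1) (a 2) (ha 0) (ha 1) (ha 2)
    rw [MvPowerSeries.nilEval_subst_two φ ha F (hc 0 1) (by simp),
      MvPowerSeries.nilEval_subst_two φ ha F (by simp) (hc 1 2),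
      MvPowerSeries.nilEval_subst_two φ ha F (by simp) (by simp),
      MvPowerSeries.nilEval_subst_two φ ha F (by simp) (by simp)]
    simp only [MvPowerSeries.nilEval_X φ ha]
    simpa only [hF] using h1
  · refine MvPowerSeries.eq_of_nilEval_eq fun R _ φ a ha => ?_
    rw [MvPowerSeries.nilEval_subst_two φ ha F (by simp) (by simp)]
    simp only [MvPowerSeries.nilEval_X φ ha]
    have h1 := hcomm R φ (a 0) (a 1) (ha 0) (ha 1)
    rw [hF, hF] at h1
    rw [← h1]
    congr 1
    funext s
    fin_cases s <;> rfl

instance {B : Type*} [CommRing B] (F : FormalGroup A) [F.IsComm] (φ : A →+* B) :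
    (F.map φ).IsComm where
  comm := by
    have h := congrArg (MvPowerSeries.map φ) (IsComm.comm (F := F))
    rw [MvPowerSeries.map_subst MvPowerSeries.HasSubst.X_X] at h
    refine h.trans ?_
    rw [map_toPowerSeries]
    congr 1
    funext s
    fin_cases s <;> simp

/-- A pair of mutually inverse changes of coordinates. -/
structure IsInvPair (u v : PowerSeries A) : Prop where
  constantCoeff_left : constantCoeff u = 0
  constantCoeff_right : constantCoeff v = 0
  left (R : Type u) [CommRing R] (φ : A →+* R) (x : R) (hx : IsNilpotent x) :
    nilEval φ v (nilEval φ u x) = x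
  right (R : Type u) [CommRing R] (φ : A →+* R) (x : R) (hx : IsNilpotent x) :
    nilEval φ u (nilEval φ v x) = x

lemma IsInvPair.symm {u v : PowerSeries A} (h : IsInvPair u v) : IsInvPair v u :=
  ⟨h.2, h.1, h.4, h.3⟩

lemma exists_isInvPair {u : PowerSeries A} (h0 : constantCoeff u = 0)
    (h1 : IsUnit (coeff 1 u)) : ∃ v, IsInvPair u v := by
  have hv := constantCoeff_substInvOfIsUnit u h1
  refine ⟨PowerSeries.substInvOfIsUnit u h1, h0, hv, fun R _ φ x hx => ?_, fun R _ φ x hx => ?_⟩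
  · rw [← nilEval_subst φ hx h0, PowerSeries.subst_substInvOfIsUnit_left u h0 h1,
      nilEval_X φ hx]
  · rw [← nilEval_subst φ hx hv, PowerSeries.subst_substInvOfIsUnit_right u h0 h1,
      nilEval_X φ hx]

lemma IsInvPair.comp {u v u' v' : PowerSeries A} (h : IsInvPair u v) (h' : IsInvPair u' v') :
    IsInvPair (PowerSeries.subst u u') (PowerSeries.subst v' v) where
  constantCoeff_left := constantCoeff_subst_eq_zero h.1 _ h'.1
  constantCoeff_right := constantCoeff_subst_eq_zero h'.2 _ h.2
  left R _ φ x hx := by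
    rw [nilEval_subst φ hx h.1, nilEval_subst φ
      (isNilpotent_nilEval φ (isNilpotent_nilEval φ hx h.1) h'.1) h'.2,
      h'.3 R φ _ (isNilpotent_nilEval φ hx h.1), h.3 R φ x hx]
  right R _ φ x hx := by
    rw [nilEval_subst φ hx h'.2, nilEval_subst φ
      (isNilpotent_nilEval φ (isNilpotent_nilEval φ hx h'.2) h.2) h.1,
      h.4 R φ _ (isNilpotent_nilEval φ hx h'.2), h'.4 R φ x hx]

lemma IsHom.comp {F G K : FormalGroup A} {f g : PowerSeries A} (hf : IsHom F G f)
    (hg : IsHom G K g) : IsHom F K (PowerSeries.subst f g) where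
  constantCoeff := constantCoeff_subst_eq_zero hf.1 _ hg.1
  nilEval_nilAdd R _ φ x y hx hy := by
    rw [nilEval_subst φ hx hf.1, nilEval_subst φ hy hf.1,
      nilEval_subst φ (F.isNilpotent_nilAdd φ hx hy) hf.1, hf.2 R φ x y hx hy,
      hg.2 R φ _ _ (isNilpotent_nilEval φ hx hf.1)
        (isNilpotent_nilEval φ hy hf.1)]

lemma IsHom.symm {F G : FormalGroup A} {u v : PowerSeries A} (h : IsHom F G u)
    (huv : IsInvPair u v) : IsHom G F v where
  constantCoeff := huv.2
  nilEval_nilAdd R _ φ x y hx hy := by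
    have hx' := isNilpotent_nilEval φ hx huv.2
    have hy' := isNilpotent_nilEval φ hy huv.2
    rw [← huv.3 R φ _ (F.isNilpotent_nilAdd φ hx' hy'), h.2 R φ _ _ hx' hy', huv.4 R φ x hx,
      huv.4 R φ y hy]

lemma IsHom.nilEval_mulSeries {F G : FormalGroup A} {f : PowerSeries A} (h : IsHom F G f) (m : ℕ)
    {R : Type u} [CommRing R] (φ : A →+* R) {x : R} (hx : IsNilpotent x) :
    nilEval φ f (nilEval φ (F.mulSeries m) x) =
      nilEval φ (G.mulSeries m) (nilEval φ f x) := by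
  have hz (y : R) (hy : IsNilpotent y) : nilEval φ 0 y = 0 := by
    rw [nilEval, ← MvPowerSeries.nilEvalHom_apply φ (fun _ => hy)]
    exact map_zero _
  have hfx := isNilpotent_nilEval φ hx h.1
  induction m with
  | zero =>
    rw [mulSeries, mulSeries, hz _ hx, hz _ hfx, nilEval_zero, h.1, map_zero]
  | succ m ih =>
    rw [F.nilEval_mulSeries_succ φ m hx, G.nilEval_mulSeries_succ φ m hfx, h.2 R φ _ _
      (isNilpotent_nilEval φ hx (F.constantCoeff_mulSeries m)) hx, ih]

lemma map_mulSeries {A : Type*} {B : Type*} [CommRing A] [CommRing B] (F : FormalGroup A)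
    (φ : A →+* B) (m : ℕ) : (F.map φ).mulSeries m = PowerSeries.map φ (F.mulSeries m) := by
  induction m with
  | zero => exact (map_zero _).symm
  | succ m ih =>
    have hs : MvPowerSeries.HasSubst ![F.mulSeries m, PowerSeries.X] :=
      MvPowerSeries.hasSubst_of_constantCoeff_zero fun i => by
        fin_cases i
        exacts [F.constantCoeff_mulSeries m, constantCoeff_X]
    rw [mulSeries, mulSeries, ih]
    refine Eq.trans ?_ (MvPowerSeries.map_subst hs F.toPowerSeries).symm
    refine congrArg (fun a => MvPowerSeries.subst a (F.map φ).toPowerSeries) (funext fun i => ?_)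
    fin_cases i
    exacts [rfl, (PowerSeries.map_X φ).symm]

/-- Transport of a formal group law along a change of coordinates. -/
lemma exists_isHom_of_isInvPair (F : FormalGroup A) [F.IsComm] {u v : PowerSeries A}
    (h : IsInvPair u v) : ∃ G : FormalGroup A, G.IsComm ∧ IsHom F G u := by
  have hv {R : Type u} [CommRing R] (φ : A →+* R) {x : R} (hx : IsNilpotent x) :=
    isNilpotent_nilEval φ hx h.2
  have hadd {R : Type u} [CommRing R] (φ : A →+* R) {x y : R} (hx : IsNilpotent x)
    (hy : IsNilpotent y) := F.isNilpotent_nilAdd φ (hv φ hx) (hv φ hy)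
  obtain ⟨G, hG, hη⟩ := exists_nilAdd (A := A)
    (fun R _ φ x y _ _ => nilEval φ u (F.nilAdd φ (nilEval φ v x)
      (nilEval φ v y)))
    (fun R R' _ _ χ φ x y hx hy => by
      rw [PowerSeries.map_nilEval χ φ u (hadd φ hx hy), F.map_nilAdd φ χ (hv φ hx) (hv φ hy),
        PowerSeries.map_nilEval χ φ v hx, PowerSeries.map_nilEval χ φ v hy])
    (fun R _ φ x y hx hy => isNilpotent_nilEval φ (hadd φ hx hy) h.1)
    (fun R _ φ x y z hx hy hz => by
      rw [h.3 R φ _ (hadd φ hx hy), h.3 R φ _ (hadd φ hy hz), F.nilAdd_assoc φ (hv φ hx)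
        (hv φ hy) (hv φ hz)])
    (fun R _ φ x y hx hy => by
      rw [F.nilAdd_comm φ (hv φ hx) (hv φ hy)])
    (fun R _ φ x hx => by
      rw [nilEval_zero, h.2, map_zero, F.nilAdd_zero φ (hv φ hx), h.4 R φ x hx])
  refine ⟨G, hG, h.1, fun R _ φ x y hx hy => ?_⟩
  rw [← hη R φ _ _ (isNilpotent_nilEval φ hx h.1)
    (isNilpotent_nilEval φ hy h.1), h.3 R φ x hx, h.3 R φ y hy]

end FormalGroup

end

noncomputable section

/-! ### Formal group laws of height `h` become isomorphic over a faithfully flat extension -/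

lemma PowerSeries.coeff_pow_eq_zero {A : Type*} [CommRing A] {g : PowerSeries A}
    (hg : constantCoeff g = 0) {n k : ℕ} (hk : n < k) : coeff n (g ^ k) = 0 := by
  obtain ⟨c, rfl⟩ := X_dvd_iff.2 hg
  rw [mul_pow, coeff_X_pow_mul', if_neg (by omega)]

lemma PowerSeries.coeff_subst_eq_sum {A : Type*} [CommRing A] {g : PowerSeries A}
    (hg : constantCoeff g = 0) (u : PowerSeries A) (n : ℕ) :
    coeff n (subst g u) = ∑ k ∈ Finset.range (n + 1), coeff k u * coeff n (g ^ k) := by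
  rw [coeff_subst' (HasSubst.of_constantCoeff_zero' hg)]
  refine finsum_eq_sum_of_support_subset _ fun k hk => ?_
  by_contra h
  simp only [Finset.coe_range, Set.mem_Iio, not_lt] at h
  exact hk (by simp [coeff_pow_eq_zero hg (show n < k by omega)])

namespace FormalGroup

variable {A : Type u} [CommRing A] {p : ℕ} [Fact p.Prime]

/-- A series with invertible linear coefficient becomes conjugate to the `q`-th power map. -/
lemma exists_faithfullyFlat_subst_eq (q : ℕ) (hq : 2 ≤ q) (g : PowerSeries A)
    (hg0 : constantCoeff g = 0) (hg1 : IsUnit (coeff 1 g)) :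
    ∃ (B : Type u) (_ : CommRing B) (φ : A →+* B), φ.FaithfullyFlat ∧ ∃ u : PowerSeries B,
      constantCoeff u = 0 ∧ IsUnit (coeff 1 u) ∧
        ∀ n, coeff n (PowerSeries.subst (PowerSeries.map φ g) u) =
          coeff n u ^ q := by
  let P (n : ℕ) (R : Type u) [CommRing R] (φ : A →+* R) (a : ℕ → R) : Polynomial R :=
    if n = 0 then Polynomial.X
    else if n = 1 then Polynomial.X ^ (q - 1) - Polynomial.C (φ (coeff 1 g))
    else Polynomial.X ^ q - (Polynomial.C (φ (coeff n (g ^ n))) * Polynomial.X +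
      Polynomial.C (∑ k ∈ Finset.range n, a k * φ (coeff n (g ^ k))))
  have hlow {R : Type u} [CommRing R] [Nontrivial R] (x y : R) :
      (Polynomial.C x * Polynomial.X + Polynomial.C y).degree < (q : WithBot ℕ) :=
    lt_of_le_of_lt Polynomial.degree_linear_le (by exact_mod_cast hq)
  obtain ⟨B, _, φ, hφ, a, ha⟩ := exists_faithfullyFlat_roots P
    (fun n R _ φ a => by
      nontriviality R
      dsimp only [P]
      split_ifs
      · exact Polynomial.monic_X
      · exact Polynomial.monic_X_pow_sub_C _ (by omega)
      · exact Polynomial.monic_X_pow_sub (hlow _ _))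
    (fun n R _ φ a _ => by
      dsimp only [P]
      split_ifs
      · simp
      · rw [Polynomial.natDegree_X_pow_sub_C]
        omega
      · rw [Polynomial.natDegree_sub_eq_left_of_natDegree_lt, Polynomial.natDegree_X_pow]
        · omega
        · rw [Polynomial.natDegree_X_pow]
          exact lt_of_le_of_lt Polynomial.natDegree_linear_le hq)
    (fun n R R' _ _ χ φ a b hab => by
      dsimp only [P]
      split_ifs
      · simp
      · simp
      · rw [Polynomial.map_sub, Polynomial.map_add, Polynomial.map_mul, Polynomial.map_pow,
          Polynomial.map_X, Polynomial.map_C, Polynomial.map_C, map_sum]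
        refine congrArg (fun r => _ - (_ + Polynomial.C r)) (Finset.sum_congr rfl fun k hk => ?_)
        rw [hab k (Finset.mem_range.1 hk), map_mul, RingHom.comp_apply])
  have h0 : a 0 = 0 := by simpa [P] using ha 0
  have h1 : a 1 ^ (q - 1) = φ (coeff 1 g) := by simpa [P, sub_eq_zero] using ha 1
  refine ⟨B, inferInstance, φ, hφ, PowerSeries.mk a, by simpa using h0, ?_, fun n => ?_⟩
  · rw [coeff_mk, ← isUnit_pow_iff (n := q - 1) (by omega), h1]
    exact hg1.map φ
  · rw [PowerSeries.coeff_subst_eq_sum (by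
      rw [← coeff_zero_eq_constantCoeff_apply, coeff_map,
        coeff_zero_eq_constantCoeff_apply, hg0, map_zero])]
    simp only [coeff_mk, ← map_pow, coeff_map]
    obtain _ | _ | n := n
    · simp [h0, zero_pow (show q ≠ 0 by omega)]
    · rw [Finset.sum_range_succ, Finset.sum_range_one, h0, zero_mul, _root_.zero_add,
        _root_.zero_add, pow_one, ← h1, ← pow_succ']
      congr 1
      omega
    · have h2 := ha (n + 2)
      simp only [P, Nat.add_eq_zero_iff, OfNat.ofNat_ne_zero, and_false, if_false,
        Nat.reduceEqDiff, Polynomial.eval_sub, Polynomial.eval_add, Polynomial.eval_mul,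
        Polynomial.eval_pow, Polynomial.eval_X, Polynomial.eval_C] at h2
      rw [Finset.sum_range_succ]
      linear_combination -h2

/-- A formal group law of height `h` becomes isomorphic to any formal group law with
`[p](T) = T ^ (p ^ h)` over a faithfully flat extension. -/
theorem exists_faithfullyFlat_isHom (hp : (p : A) = 0) {h : ℕ} (hh : 1 ≤ h) (F H : FormalGroup A)
    [F.IsComm] [H.IsComm] (hH : H.mulSeries p = PowerSeries.X ^ p ^ h)
    (hF : ∀ i < p ^ h, coeff i (F.mulSeries p) = 0)
    (hF1 : IsUnit (coeff (p ^ h) (F.mulSeries p))) :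
    ∃ (B : Type u) (_ : CommRing B) (φ : A →+* B), φ.FaithfullyFlat ∧ ∃ w w' : PowerSeries B,
      IsInvPair w w' ∧ IsHom (H.map φ) (F.map φ) w := by
  have hp1 : 1 < p := (Fact.out : p.Prime).one_lt
  have hq : 2 ≤ p ^ h := le_trans hp1 (Nat.le_self_pow (by omega) p)
  set f := F.mulSeries p with hf
  let g : PowerSeries A := PowerSeries.mk fun i => coeff (p ^ h * i) f
  have hdvd (i : ℕ) (hi : ¬ p ^ h ∣ i) : coeff i f = 0 := by
    obtain ⟨k, rfl⟩ := Nat.exists_eq_add_of_le' hh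
    exact (isHom_mulSeries F p).coeff_eq_zero hp k
      (fun i hi => hF i (lt_of_le_of_lt hi (Nat.pow_lt_pow_right hp1 (by omega)))) i hi
  have hfg : f = PowerSeries.subst (PowerSeries.X ^ p ^ h) g := by
    rw [← PowerSeries.expand_apply (p ^ h) (by omega)]
    ext i
    rw [coeff_expand]
    split_ifs with hi
    · rw [coeff_mk, Nat.mul_div_cancel' hi]
    · exact hdvd i hi
  have hg0 : constantCoeff g = 0 := by
    rw [← coeff_zero_eq_constantCoeff_apply, coeff_mk, mul_zero,
      hF 0 (by omega)]
  obtain ⟨B, _, φ, hφ, u, hu0, hu1, hu⟩ := exists_faithfullyFlat_subst_eq (p ^ h) hq g hg0 (by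
    rwa [coeff_mk, mul_one])
  have hpB : (p : B) = 0 := φ.natCast_eq_zero hp
  obtain ⟨v, huv⟩ := exists_isInvPair hu0 hu1
  obtain ⟨G, _, hG⟩ := exists_isHom_of_isInvPair (F.map φ) huv
  have hsub : PowerSeries.subst (PowerSeries.map φ g) u =
      PowerSeries.map (powPowHom B hpB h) u := by
    ext n
    rw [hu, coeff_map, powPowHom_apply]
  have hφg0 : constantCoeff (PowerSeries.map φ g) = 0 := by
    rw [← coeff_zero_eq_constantCoeff_apply, coeff_map,
      coeff_zero_eq_constantCoeff_apply, hg0, map_zero]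
  have hGp : G.mulSeries p = PowerSeries.X ^ p ^ h := by
    refine eq_of_nilEval_eq fun R _ χ x hx => ?_
    have hvx := isNilpotent_nilEval χ hx huv.2
    have hvxq : IsNilpotent (nilEval χ v x ^ p ^ h) :=
      (IsNilpotent.pow_iff_pos (by omega)).2 hvx
    have h1 := hG.nilEval_mulSeries p χ hvx
    rw [huv.4 R χ x hx] at h1
    have h2 : nilEval χ ((F.map φ).mulSeries p) (nilEval χ v x) =
        nilEval χ (PowerSeries.map φ g) (nilEval χ v x ^ p ^ h) := by
      rw [map_mulSeries, ← hf, hfg, nilEval_map, nilEval_map,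
        nilEval_subst _ hvx (by rw [map_pow, constantCoeff_X, zero_pow (by omega)]),
        nilEval_pow _ hvx, nilEval_X _ hvx]
    rw [← h1, h2, ← nilEval_subst χ hvxq hφg0, hsub, nilEval_pow χ hx,
      nilEval_X χ hx, nilEval_map, powPowHom_comp hpB h χ]
    refine (PowerSeries.map_nilEval (powPowHom R (χ.natCast_eq_zero hpB) h) χ u hvx).symm.trans ?_
    rw [huv.4 R χ x hx, powPowHom_apply]
  have hHp : (H.map φ).mulSeries p = PowerSeries.X ^ p ^ h := by
    rw [map_mulSeries, hH]
    simp
  obtain ⟨w, hw1, hw⟩ := exists_isHom_of_mulSeries_eq hpB hHp hGp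
  obtain ⟨w', hww'⟩ := exists_isInvPair hw.1 (hw1 ▸ isUnit_one)
  exact ⟨B, inferInstance, φ, hφ, _, _, hww'.comp huv.symm, hw.comp (hG.symm huv)⟩

end FormalGroup

end

noncomputable section

/-! ### Functions on schemes and their values at affine points -/

namespace AlgebraicGeometry.Scheme

variable {T T' : Scheme.{u}}

/-- A sieve that contains all maps from affine schemes is a Zariski covering. -/
lemma mem_zariskiTopology_of_affine (R : Sieve T)
    (hR : ∀ (A : CommRingCat.{u}) (f : Spec A ⟶ T), R f) : R ∈ zariskiTopology T := by
  refine zariskiTopology.superset_covering ?_ T.affineCover.mem_grothendieckTopology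
  rw [Sieve.generate_le_iff]
  rintro _ _ ⟨i⟩
  exact hR _ _

lemma mem_fpqcTopology_of_affine (R : Sieve T)
    (hR : ∀ (A : CommRingCat.{u}) (f : Spec A ⟶ T), R f) : R ∈ fpqcTopology T :=
  zariskiTopology_le_fpqcTopology T (mem_zariskiTopology_of_affine R hR)

/-- The value of a global function at a point with values in a ring. -/
def evalPt {A : CommRingCat.{u}} (f : Spec A ⟶ T) : Γ(T, ⊤) →+* A :=
  (f.appTop ≫ (ΓSpecIso A).hom).hom

lemma evalPt_comp {A : CommRingCat.{u}} (f : Spec A ⟶ T') (g : T' ⟶ T) (a : Γ(T, ⊤)) :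
    evalPt (f ≫ g) a = evalPt f (g.appTop a) := by
  rw [evalPt, Scheme.Hom.comp_appTop]
  rfl

lemma evalPt_specMap {A B : CommRingCat.{u}} (f : Spec A ⟶ T) (φ : A ⟶ B) (a : Γ(T, ⊤)) :
    evalPt (Spec.map φ ≫ f) a = φ (evalPt f a) := by
  rw [evalPt, evalPt, Scheme.Hom.comp_appTop, Category.assoc, ΓSpecIso_naturality]
  rfl

lemma specMap_surjective {A B : CommRingCat.{u}} (f : Spec B ⟶ Spec A) : ∃ φ, Spec.map φ = f :=
  ⟨Spec.preimage f, Spec.map_preimage f⟩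

/-- The presheaf of global functions. -/
def functions : Scheme.{u}ᵒᵖ ⥤ Type u := Scheme.Γ ⋙ CategoryTheory.forget _

lemma isSheaf_functions : Presieve.IsSheaf fpqcTopology functions.{u} :=
  Presieve.isSheaf_of_nat_equiv
    (P₁ := yoneda.obj (Spec (.of (MvPolynomial PUnit.{u + 1} (ULift.{u} ℤ)))))
    (fun T => (AffineSpace.toSpecMvPolyIntEquiv (X := T) PUnit.{u + 1}).trans
      (Equiv.funUnique _ _))
    (fun T T' f g => AffineSpace.toSpecMvPolyIntEquiv_comp (n := PUnit.{u + 1}) f g PUnit.unit)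
    (GrothendieckTopology.Subcanonical.isSheaf_of_isRepresentable _)

lemma ext_evalPt {a b : Γ(T, ⊤)}
    (h : ∀ (A : CommRingCat.{u}) (f : Spec A ⟶ T), evalPt f a = evalPt f b) : a = b := by
  let R : Sieve T :=
    { arrows := fun V v => v.appTop a = v.appTop b
      downward_closed := fun {V W} v hv w => by
        rw [Scheme.Hom.comp_appTop, ConcreteCategory.comp_apply, ConcreteCategory.comp_apply, hv] }
  refine Presieve'.ext_of_cover isSheaf_functions
    (mem_fpqcTopology_of_affine R fun A f => ?_) fun V f hf => hf
  exact (ConcreteCategory.bijective_of_isIso (ΓSpecIso A).hom).1 (h A f)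

lemma exists_evalPt (r : ∀ ⦃A : CommRingCat.{u}⦄ (_ : Spec A ⟶ T), A)
    (hr : ∀ ⦃A B : CommRingCat.{u}⦄ (f : Spec A ⟶ T) (φ : A ⟶ B),
      r (Spec.map φ ≫ f) = φ (r f)) :
    ∃ a : Γ(T, ⊤), ∀ (A : CommRingCat.{u}) (f : Spec A ⟶ T), evalPt f a = r f := by
  let K ⦃V : Scheme.{u}⦄ (v : V ⟶ T) (a : Γ(V, ⊤)) : Prop :=
    ∀ (A : CommRingCat.{u}) (f : Spec A ⟶ V), evalPt f a = r (f ≫ v)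
  have hres ⦃V W : Scheme.{u}⦄ (v : V ⟶ T) (w : W ⟶ V) (a : Γ(V, ⊤)) (ha : K v a) :
      K (w ≫ v) (w.appTop a) := fun A f => by
    rw [← evalPt_comp, ha, Category.assoc]
  let R : Sieve T :=
    { arrows := fun V v => ∃ a, K v a
      downward_closed := fun {V W} v ⟨a, ha⟩ w => ⟨w.appTop a, hres v w a ha⟩ }
  have hR (A : CommRingCat.{u}) (f : Spec A ⟶ T) : R f := by
    refine ⟨(ΓSpecIso A).inv (r f), fun B g => ?_⟩
    obtain ⟨φ, rfl⟩ := specMap_surjective g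
    rw [hr, ← Category.comp_id (Spec.map φ), evalPt_specMap]
    congr 1
    rw [evalPt, Scheme.Hom.id_appTop, Category.id_comp]
    exact (ΓSpecIso A).inv_hom_id_apply (r f)
  obtain ⟨t, ht⟩ := Presieve'.exists_glue isSheaf_functions (mem_fpqcTopology_of_affine R hR)
    (fun V f hf => hf.choose) fun V W f hf g => ext_evalPt fun A k =>
      (hres f g _ hf.choose_spec A k).trans
        ((R.downward_closed hf g).choose_spec A k).symm
  refine ⟨t, fun A f => ?_⟩
  have h1 := (hR A f).choose_spec A (𝟙 _)
  rw [Category.id_comp] at h1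
  have h2 := evalPt_comp (𝟙 _) f t
  rw [Category.id_comp] at h2
  exact h2.trans ((congrArg (evalPt (𝟙 _)) (ht f (hR A f))).trans h1)

/-! ### The formal line -/

/-- A function is locally nilpotent. -/
def LocallyNilpotent (a : Γ(T, ⊤)) : Prop :=
  ∀ x : T, ∃ U : T.Opens, x ∈ U ∧ IsNilpotent (T.presheaf.map (homOfLE le_top : U ⟶ ⊤).op a)

lemma locallyNilpotent_iff_basicOpen (a : Γ(T, ⊤)) : LocallyNilpotent a ↔ T.basicOpen a = ⊥ := by
  constructor
  · refine fun h => eq_bot_iff.2 fun x hx => ?_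
    obtain ⟨U, hU, hn⟩ := h x
    have := (T.basicOpen_res a (homOfLE le_top : U ⟶ ⊤).op).symm.trans
      (T.basicOpen_eq_bot_of_isNilpotent U _ hn)
    exact this.le ⟨hU, hx⟩
  · intro h x
    obtain ⟨U, hU, hx, -⟩ := exists_isAffineOpen_mem_and_subset (X := T) (x := x) (U := ⊤) trivial
    refine ⟨U, hx, (Scheme.isNilpotent_iff_basicOpen_eq_bot_of_isCompact hU.isCompact _).2 ?_⟩
    rw [Scheme.basicOpen_res, h, inf_bot_eq]

lemma locallyNilpotent_iff (a : Γ(T, ⊤)) : LocallyNilpotent a ↔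
    ∀ (A : CommRingCat.{u}) (f : Spec A ⟶ T), IsNilpotent (evalPt f a) := by
  rw [locallyNilpotent_iff_basicOpen]
  constructor
  · intro h A f
    refine IsNilpotent.map (f := (ΓSpecIso A).hom.hom) (r := f.appTop a) ?_
    rw [Scheme.isNilpotent_iff_basicOpen_eq_bot, ← Scheme.preimage_basicOpen_top, h]
    rfl
  · refine fun h => eq_bot_iff.2 fun x hx => ?_
    obtain ⟨i, y, rfl⟩ := T.affineCover.exists_eq x
    have h' : IsNilpotent ((T.affineCover.f i).appTop a) :=
      (IsNilpotent.map_iff (ConcreteCategory.bijective_of_isIso (ΓSpecIso _).hom).1).1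
        (h _ (T.affineCover.f i))
    rw [Scheme.isNilpotent_iff_basicOpen_eq_bot, ← Scheme.preimage_basicOpen_top] at h'
    exact h'.le hx

/-- The value of a point of the formal line at a point with values in a ring. -/
def lineVal {A : CommRingCat.{u}} (f : Spec A ⟶ T) (a : formalLine.obj (op T)) : A :=
  evalPt f a.1

lemma isNilpotent_lineVal {A : CommRingCat.{u}} (f : Spec A ⟶ T) (a : formalLine.obj (op T)) :
    IsNilpotent (lineVal f a) :=
  (locallyNilpotent_iff a.1).1 a.2 A f

lemma lineVal_comp {A : CommRingCat.{u}} (f : Spec A ⟶ T') (g : T' ⟶ T)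
    (a : formalLine.obj (op T)) : lineVal (f ≫ g) a = lineVal f (formalLine.map g.op a) :=
  evalPt_comp f g a.1

lemma lineVal_specMap {A B : CommRingCat.{u}} (f : Spec A ⟶ T) (φ : A ⟶ B)
    (a : formalLine.obj (op T)) : lineVal (Spec.map φ ≫ f) a = φ (lineVal f a) :=
  evalPt_specMap f φ a.1

lemma ext_lineVal {a b : formalLine.obj (op T)}
    (h : ∀ (A : CommRingCat.{u}) (f : Spec A ⟶ T), lineVal f a = lineVal f b) : a = b :=
  Subtype.ext (ext_evalPt h)

lemma exists_lineVal (r : ∀ ⦃A : CommRingCat.{u}⦄ (_ : Spec A ⟶ T), A)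
    (hr : ∀ ⦃A B : CommRingCat.{u}⦄ (f : Spec A ⟶ T) (φ : A ⟶ B),
      r (Spec.map φ ≫ f) = φ (r f)) (hn : ∀ ⦃A : CommRingCat.{u}⦄ (f : Spec A ⟶ T),
      IsNilpotent (r f)) :
    ∃ a : formalLine.obj (op T), ∀ (A : CommRingCat.{u}) (f : Spec A ⟶ T), lineVal f a = r f := by
  obtain ⟨a, ha⟩ := exists_evalPt r hr
  exact ⟨⟨a, (locallyNilpotent_iff a).2 fun A f => ha A f ▸ hn f⟩, ha⟩

/-- The point of the formal line over an affine scheme with a given coordinate. -/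
def specPt {A : CommRingCat.{u}} (a : A) (ha : IsNilpotent a) : formalLine.obj (op (Spec A)) :=
  ⟨(ΓSpecIso A).inv a, fun _ => ⟨⊤, trivial, IsNilpotent.map (IsNilpotent.map ha _) _⟩⟩

lemma lineVal_specPt {A B : CommRingCat.{u}} (φ : A ⟶ B) (a : A) (ha : IsNilpotent a) :
    lineVal (Spec.map φ) (specPt a ha) = φ a := by
  rw [← Category.comp_id (Spec.map φ), lineVal_specMap]
  congr 1
  rw [lineVal, evalPt, Scheme.Hom.id_appTop, Category.id_comp]
  exact (ΓSpecIso A).inv_hom_id_apply a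

lemma lineVal_id_specPt {A : CommRingCat.{u}} (a : A) (ha : IsNilpotent a) :
    lineVal (𝟙 _) (specPt a ha) = a := by
  simpa using lineVal_specPt (𝟙 A) a ha

lemma ext_lineVal_id {A : CommRingCat.{u}} {a b : formalLine.obj (op (Spec A))}
    (h : lineVal (𝟙 _) a = lineVal (𝟙 _) b) : a = b := by
  refine ext_lineVal fun B f => ?_
  obtain ⟨φ, rfl⟩ := specMap_surjective f
  rw [← Category.comp_id (Spec.map φ), lineVal_specMap, lineVal_specMap, h]

lemma specPt_lineVal {A : CommRingCat.{u}} (a : formalLine.obj (op (Spec A))) :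
    specPt (lineVal (𝟙 _) a) (isNilpotent_lineVal _ a) = a :=
  ext_lineVal_id (lineVal_id_specPt _ _)

lemma exists_mem_of_mem_fpqcTopology {R : Sieve T} (hR : R ∈ fpqcTopology T) (x : T) :
    ∃ (V : Scheme.{u}) (v : V ⟶ T) (y : V), R v ∧ v y = x := by
  obtain ⟨K, hK, hKR⟩ := Precoverage.mem_toGrothendieck_iff_of_isStableUnderComposition.1 hR
  have hK' : K ∈ jointlySurjectivePrecoverage T := hK.2.1
  rw [jointlySurjectivePrecoverage, Presieve.mem_comap_jointlySurjectivePrecoverage_iff] at hK'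
  obtain ⟨V, v, hv, y, hy⟩ := hK' x
  exact ⟨V, v, y, hKR _ _ hv, hy⟩

lemma isSheaf_formalLine : Presieve.IsSheaf fpqcTopology formalLine.{u} := by
  intro T R hR x hx
  obtain ⟨t, ht⟩ := Presieve'.exists_glue isSheaf_functions hR (fun V f hf => (x f hf).1)
    fun V W f hf g => congrArg Subtype.val
      (((Presieve.compatible_iff_sieveCompatible x).1 hx f g hf).symm)
  refine ⟨⟨t, (locallyNilpotent_iff_basicOpen t).2 (eq_bot_iff.2 fun z hz => ?_)⟩,
    fun V f hf => Subtype.ext (ht f hf), fun s hs => Subtype.ext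
      (Presieve'.ext_of_cover isSheaf_functions hR fun V f hf =>
        (congrArg Subtype.val (hs f hf)).trans (ht f hf).symm)⟩
  obtain ⟨V, v, y, hv, rfl⟩ := exists_mem_of_mem_fpqcTopology hR z
  have h := (locallyNilpotent_iff_basicOpen _).1 (x v hv).2
  have h' : V.basicOpen (v.appTop (t : Γ(T, ⊤))) = ⊥ := (congrArg V.basicOpen (ht v hv)).trans h
  exact ((Scheme.preimage_basicOpen_top v t).trans h').le hz

end AlgebraicGeometry.Scheme

end

noncomputable section

set_option linter.unusedSectionVars false

namespace AlgebraicGeometry.Scheme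

variable {T : Scheme.{u}}

lemma ext_mvSeries {σ : Type} [Finite σ] {F G : MvPowerSeries σ Γ(T, ⊤)}
    (h : ∀ (A : CommRingCat.{u}) (f : Spec A ⟶ T) (a : σ → A), (∀ s, IsNilpotent (a s)) →
      MvPowerSeries.nilEval (evalPt f) F a = MvPowerSeries.nilEval (evalPt f) G a) : F = G := by
  ext d
  refine ext_evalPt fun A f => ?_
  rw [← MvPowerSeries.coeff_map, ← MvPowerSeries.coeff_map]
  congr 1
  refine MvPowerSeries.eq_of_nilEval_eq fun R _ φ a ha => ?_
  have hφ : φ.comp (evalPt f) = evalPt (Spec.map (CommRingCat.ofHom φ) ≫ f) :=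
    RingHom.ext fun x => (evalPt_specMap f (CommRingCat.ofHom φ) x).symm
  rw [MvPowerSeries.nilEval_map, MvPowerSeries.nilEval_map, hφ]
  exact h (.of R) _ a ha

lemma ext_series {F G : PowerSeries Γ(T, ⊤)}
    (h : ∀ (A : CommRingCat.{u}) (f : Spec A ⟶ T) (a : A), IsNilpotent a →
      nilEval (evalPt f) F a = nilEval (evalPt f) G a) : F = G :=
  ext_mvSeries fun A f a ha => h A f (a ()) (ha ())

/-- A natural function on the points of the formal line over `T` is a power series. -/
lemma exists_series (η : ∀ ⦃A : CommRingCat.{u}⦄ (_ : Spec A ⟶ T) (x : A), IsNilpotent x → A)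
    (hη : ∀ ⦃A B : CommRingCat.{u}⦄ (f : Spec A ⟶ T) (φ : A ⟶ B) (x : A) (hx : IsNilpotent x),
      φ (η f x hx) = η (Spec.map φ ≫ f) (φ x) (hx.map φ.hom)) :
    ∃ s : PowerSeries Γ(T, ⊤), ∀ ⦃A : CommRingCat.{u}⦄ (f : Spec A ⟶ T) (x : A)
      (hx : IsNilpotent x), η f x hx = nilEval (evalPt f) s x := by
  have hex (A : CommRingCat.{u}) (f : Spec A ⟶ T) := PowerSeries.exists_nilEval (A := A)
    (fun R _ φ x hx => η (Spec.map (CommRingCat.ofHom φ) ≫ f) (show CommRingCat.of R from x) hx)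
    fun R R' _ _ χ φ x hx => by
      refine (hη _ (CommRingCat.ofHom χ) x hx).trans ?_
      rw [← Category.assoc, ← Spec.map_comp]
      rfl
  choose s hs using hex
  have hs' (A : CommRingCat.{u}) (f : Spec A ⟶ T) (x : A) (hx : IsNilpotent x) :
      η f x hx = nilEval (RingHom.id A) (s A f) x := by
    refine Eq.trans ?_ (hs A f A (RingHom.id A) x hx)
    congr 1
    exact (by simp : f = Spec.map (𝟙 A) ≫ f)
  have hmap (A B : CommRingCat.{u}) (f : Spec A ⟶ T) (φ : A ⟶ B) :
      s B (Spec.map φ ≫ f) = PowerSeries.map φ.hom (s A f) := by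
    refine eq_of_nilEval_eq fun R _ ψ x hx => ?_
    rw [nilEval_map, ← hs _ _ R ψ x hx, ← hs _ _ R (ψ.comp φ.hom) x hx]
    congr 1
    rw [← Category.assoc, ← Spec.map_comp]
    rfl
  have hco (n : ℕ) := exists_evalPt (T := T) (fun A f => coeff n (s A f))
    fun A B f φ => by rw [hmap, coeff_map]
  choose c hc using hco
  refine ⟨PowerSeries.mk c, fun A f x hx => ?_⟩
  rw [hs', ← RingHomCompTriple.comp_eq (σ₁₂ := evalPt f) (σ₂₃ := RingHom.id A),
    ← nilEval_map]
  congr 1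
  ext n
  rw [coeff_map, coeff_mk, hc]

end AlgebraicGeometry.Scheme

namespace FormalGroup

open AlgebraicGeometry.Scheme

variable {k : Type u} [CommRing k]

section

variable {T T' : Over (Spec (.of k))}

/-- The structure map of the value ring of a point of a scheme over `k`. -/
def baseVal (T : Over (Spec (.of k))) {A : CommRingCat.{u}} (f : Spec A ⟶ T.left) : k →+* A :=
  (evalPt f).comp (sectionsHom k T)

lemma baseVal_specMap {A B : CommRingCat.{u}} (f : Spec A ⟶ T.left) (φ : A ⟶ B) :
    baseVal T (Spec.map φ ≫ f) = φ.hom.comp (baseVal T f) :=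
  RingHom.ext fun x => evalPt_specMap f φ (sectionsHom k T x)

lemma baseVal_comp {A : CommRingCat.{u}} (f : Spec A ⟶ T'.left) (g : T' ⟶ T) :
    baseVal T (f ≫ g.left) = baseVal T' f := by
  rw [baseVal, baseVal, sectionsHom_comp g]
  exact RingHom.ext fun x => evalPt_comp f g.left (sectionsHom k T x)

/-- The points of the formal group of `H` with values in a scheme over `k`. -/
@[ext]
structure Points (H : FormalGroup k) (T : Over (Spec (.of k))) : Type u where
  pt : formalLine.obj (op T.left)

variable {H : FormalGroup k}

/-- The coordinate of a point at a point with values in a ring. -/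
def Points.val {A : CommRingCat.{u}} (f : Spec A ⟶ T.left) (x : Points H T) : A := lineVal f x.pt

lemma Points.isNilpotent_val {A : CommRingCat.{u}} (f : Spec A ⟶ T.left) (x : Points H T) :
    IsNilpotent (x.val f) :=
  isNilpotent_lineVal f x.pt

lemma Points.val_specMap {A B : CommRingCat.{u}} (f : Spec A ⟶ T.left) (φ : A ⟶ B)
    (x : Points H T) : x.val (Spec.map φ ≫ f) = φ (x.val f) :=
  lineVal_specMap f φ x.pt

lemma Points.ext_val {x y : Points H T}
    (h : ∀ (A : CommRingCat.{u}) (f : Spec A ⟶ T.left), x.val f = y.val f) : x = y :=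
  Points.ext (ext_lineVal h)

lemma Points.exists_val (H : FormalGroup k) (r : ∀ ⦃A : CommRingCat.{u}⦄ (_ : Spec A ⟶ T.left), A)
    (hr : ∀ ⦃A B : CommRingCat.{u}⦄ (f : Spec A ⟶ T.left) (φ : A ⟶ B),
      r (Spec.map φ ≫ f) = φ (r f)) (hn : ∀ ⦃A : CommRingCat.{u}⦄ (f : Spec A ⟶ T.left),
      IsNilpotent (r f)) :
    ∃ x : Points H T, ∀ (A : CommRingCat.{u}) (f : Spec A ⟶ T.left), x.val f = r f := by
  obtain ⟨a, ha⟩ := exists_lineVal r hr hn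
  exact ⟨⟨a⟩, ha⟩

lemma exists_add (x y : Points H T) : ∃ z : Points H T, ∀ (A : CommRingCat.{u})
    (f : Spec A ⟶ T.left), z.val f = H.nilAdd (baseVal T f) (x.val f) (y.val f) :=
  Points.exists_val H (fun A f => H.nilAdd (baseVal T f) (x.val f) (y.val f))
    (fun A B f φ => by
      rw [baseVal_specMap, Points.val_specMap, Points.val_specMap]
      exact (H.map_nilAdd _ φ.hom (x.isNilpotent_val f) (y.isNilpotent_val f)).symm)
    fun A f => H.isNilpotent_nilAdd _ (x.isNilpotent_val f) (y.isNilpotent_val f)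

/-- The effect of a power series on the points. -/
lemma exists_nilEval {T : Over (Spec (.of k))} (s : PowerSeries Γ(T.left, ⊤))
    (hs : constantCoeff s = 0) (x : Points H T) : ∃ z : Points H T,
      ∀ (A : CommRingCat.{u}) (f : Spec A ⟶ T.left),
        z.val f = nilEval (evalPt f) s (x.val f) :=
  Points.exists_val H (fun A f => nilEval (evalPt f) s (x.val f))
    (fun A B f φ => by
      have h : evalPt (Spec.map φ ≫ f) = φ.hom.comp (evalPt f) :=
        RingHom.ext fun a => evalPt_specMap f φ a
      rw [h, Points.val_specMap]
      exact (PowerSeries.map_nilEval φ.hom _ _ (x.isNilpotent_val f)).symm)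
    fun A f => isNilpotent_nilEval _ (x.isNilpotent_val f) hs

variable [H.IsComm]

lemma exists_neg (x : Points H T) : ∃ z : Points H T, ∀ (A : CommRingCat.{u})
    (f : Spec A ⟶ T.left), z.val f = nilEval (baseVal T f) H.negSeries (x.val f) := by
  obtain ⟨z, hz⟩ := exists_nilEval (PowerSeries.map (sectionsHom k T) H.negSeries)
    (by simp [← coeff_zero_eq_constantCoeff_apply, H.constantCoeff_negSeries]) x
  exact ⟨z, fun A f => (hz A f).trans (nilEval_map _ _ _ _)⟩

instance : Add (Points H T) := ⟨fun x y => (exists_add x y).choose⟩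

instance : Neg (Points H T) := ⟨fun x => (exists_neg x).choose⟩

instance : Zero (Points H T) := ⟨⟨formalLineZero _⟩⟩

lemma Points.val_add (x y : Points H T) {A : CommRingCat.{u}} (f : Spec A ⟶ T.left) :
    (x + y).val f = H.nilAdd (baseVal T f) (x.val f) (y.val f) :=
  (exists_add x y).choose_spec A f

lemma Points.val_neg (x : Points H T) {A : CommRingCat.{u}} (f : Spec A ⟶ T.left) :
    (-x).val f = nilEval (baseVal T f) H.negSeries (x.val f) :=
  (exists_neg x).choose_spec A f

lemma Points.val_zero {A : CommRingCat.{u}} (f : Spec A ⟶ T.left) : (0 : Points H T).val f = 0 :=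
  map_zero (evalPt f)

instance : AddCommGroup (Points H T) where
  add_assoc x y z := Points.ext_val fun A f => by
    rw [Points.val_add, Points.val_add, Points.val_add, Points.val_add]
    exact H.nilAdd_assoc _ (x.isNilpotent_val f) (y.isNilpotent_val f) (z.isNilpotent_val f)
  zero_add x := Points.ext_val fun A f => by
    rw [Points.val_add, Points.val_zero, H.zero_nilAdd _ (x.isNilpotent_val f)]
  add_zero x := Points.ext_val fun A f => by
    rw [Points.val_add, Points.val_zero, H.nilAdd_zero _ (x.isNilpotent_val f)]
  nsmul := nsmulRec
  zsmul := zsmulRec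
  neg_add_cancel x := Points.ext_val fun A f => by
    rw [Points.val_add, Points.val_zero, H.nilAdd_comm _ ((-x).isNilpotent_val f)
      (x.isNilpotent_val f), Points.val_neg, H.nilAdd_negSeries _ (x.isNilpotent_val f)]
  add_comm x y := Points.ext_val fun A f => by
    rw [Points.val_add, Points.val_add, H.nilAdd_comm _ (x.isNilpotent_val f)
      (y.isNilpotent_val f)]

/-- The restriction of points along a morphism. -/
def Points.res (g : T' ⟶ T) : Points H T →+ Points H T' where
  toFun x := ⟨formalLine.map g.left.op x.pt⟩
  map_zero' := Points.ext_val fun A f =>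
    (lineVal_comp f g.left _).symm.trans ((Points.val_zero (H := H) (f ≫ g.left)).trans
      (Points.val_zero f).symm)
  map_add' x y := Points.ext_val fun A f => by
    rw [Points.val_add]
    refine (lineVal_comp f g.left _).symm.trans ((Points.val_add x y (f ≫ g.left)).trans ?_)
    rw [baseVal_comp, Points.val, Points.val, lineVal_comp, lineVal_comp]
    rfl

lemma Points.val_res (g : T' ⟶ T) {A : CommRingCat.{u}} (f : Spec A ⟶ T'.left) (x : Points H T) :
    (Points.res g x).val f = x.val (f ≫ g.left) :=
  (lineVal_comp f g.left x.pt).symm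

variable (H)

/-- The formal group of `H` as a presheaf of groups on schemes over `k`. -/
def points : (Over (Spec (.of k)))ᵒᵖ ⥤ AddCommGrpCat.{u} where
  obj T := .of (Points H T.unop)
  map g := AddCommGrpCat.ofHom (Points.res g.unop)
  map_id T := by
    ext x
    exact congrArg Points.pt (Points.ext_val fun A f => (Points.val_res (𝟙 T.unop) f x).trans
      (congrArg (fun g => Points.val g x) (Category.comp_id f)))
  map_comp g g' := by
    ext x
    refine congrArg Points.pt (Points.ext_val fun A f => (Points.val_res _ f x).trans ?_)
    refine Eq.trans ?_ ((Points.val_res g'.unop f _).trans (Points.val_res g.unop _ x)).symm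
    exact congrArg (fun g => Points.val g x) (Category.assoc f _ _).symm

lemma isSheaf_points :
    Presieve.IsSheaf (fpqcTopology.over (Spec (.of k))) (H.points ⋙ CategoryTheory.forget _) :=
  Presieve.isSheaf_of_nat_equiv (P₁ := (Over.forget (Spec (.of k))).op ⋙ formalLine)
    (fun T => ⟨fun x => (⟨x⟩ : Points H T), fun x => Points.pt x, fun _ => rfl, fun _ => rfl⟩)
    (fun _ _ _ _ => rfl)
    ((Over.forget (Spec (.of k))).op_comp_isSheaf_of_isSheaf_type (J := fpqcTopology.over _)
      isSheaf_formalLine)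

end

section

variable {A : Type u} [CommRing A] {F : FormalGroup A}

lemma Endo.isHom (g : Endo F) : IsHom F F g.series where
  constantCoeff := g.constantCoeff_series
  nilEval_nilAdd R _ φ x y hx hy := by
    have ha := isNilpotent_pair hx hy
    have h := congrArg (fun G => MvPowerSeries.nilEval φ G ![x, y]) g.map_law
    have hX (i : Fin 2) : MvPowerSeries.constantCoeff
        (PowerSeries.subst (MvPowerSeries.X i : MvPowerSeries (Fin 2) A) g.series) = 0 :=
      constantCoeff_subst_eq_zero (by simp) _ g.constantCoeff_series
    rw [nilEval_subst_mv φ ha F.zero_constantCoeff,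
      F.nilEval_subst_pair φ ha (hX 0) (hX 1), nilEval_subst_mv φ ha (by simp),
      nilEval_subst_mv φ ha (by simp), MvPowerSeries.nilEval_X φ ha,
      MvPowerSeries.nilEval_X φ ha] at h
    exact h

/-- An endomorphism is a power series whose effect on the points is additive. -/
lemma exists_endo {T : Scheme.{u}} {F : FormalGroup Γ(T, ⊤)} (s : PowerSeries Γ(T, ⊤))
    (hs : constantCoeff s = 0)
    (h : ∀ (A : CommRingCat.{u}) (f : Spec A ⟶ T) (x y : A), IsNilpotent x → IsNilpotent y →
      nilEval (evalPt f) s (F.nilAdd (evalPt f) x y) =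
        F.nilAdd (evalPt f) (nilEval (evalPt f) s x)
          (nilEval (evalPt f) s y)) : ∃ g : Endo F, g.series = s := by
  refine ⟨⟨s, hs, ext_mvSeries fun A f a ha => ?_⟩, rfl⟩
  have hX (i : Fin 2) : MvPowerSeries.constantCoeff
      (PowerSeries.subst (MvPowerSeries.X i : MvPowerSeries (Fin 2) Γ(T, ⊤)) s) = 0 :=
    constantCoeff_subst_eq_zero (by simp) _ hs
  rw [nilEval_subst_mv _ ha F.zero_constantCoeff,
    F.nilEval_subst_pair _ ha (hX 0) (hX 1), nilEval_subst_mv _ ha (by simp),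
    nilEval_subst_mv _ ha (by simp), MvPowerSeries.nilEval_X _ ha,
    MvPowerSeries.nilEval_X _ ha, ← h A f _ _ (ha 0) (ha 1)]
  congr 1
  rw [nilAdd]
  congr 1
  funext i
  fin_cases i <;> rfl

end

section

variable {H : FormalGroup k} [H.IsComm] {T T' : Over (Spec (.of k))}

lemma nilAdd_sectionsHom {A : CommRingCat.{u}} (f : Spec A ⟶ T.left) (x y : A) :
    (H.map (sectionsHom k T)).nilAdd (evalPt f) x y = H.nilAdd (baseVal T f) x y :=
  H.nilAdd_map _ _ x y

/-- The effect of an endomorphism on the points. -/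
def endoAct (T : Over (Spec (.of k))) (g : Endo (H.map (sectionsHom k T))) :
    Points H T →+ Points H T :=
  have hv (x : Points H T) := (exists_nilEval g.series g.constantCoeff_series x).choose_spec
  { toFun := fun x => (exists_nilEval g.series g.constantCoeff_series x).choose
    map_zero' := Points.ext_val fun A f => by
      rw [hv, Points.val_zero, nilEval_zero, g.constantCoeff_series, map_zero]
    map_add' := fun x y => Points.ext_val fun A f => by
      rw [hv, Points.val_add, Points.val_add, hv, hv, ← nilAdd_sectionsHom, ← nilAdd_sectionsHom]
      exact g.isHom.nilEval_nilAdd A _ _ _ (x.isNilpotent_val f) (y.isNilpotent_val f) }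

lemma val_endoAct (g : Endo (H.map (sectionsHom k T))) (x : Points H T) {A : CommRingCat.{u}}
    (f : Spec A ⟶ T.left) :
    (endoAct T g x).val f = nilEval (evalPt f) g.series (x.val f) :=
  (exists_nilEval g.series g.constantCoeff_series x).choose_spec A f

/-- The point over an affine scheme with a given coordinate. -/
def Points.spec {A : CommRingCat.{u}} (f : Spec A ⟶ Spec (.of k)) (a : A) (ha : IsNilpotent a) :
    Points H (Over.mk f) :=
  ⟨specPt a ha⟩

lemma Points.val_id_spec {A : CommRingCat.{u}} (f : Spec A ⟶ Spec (.of k)) (a : A)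
    (ha : IsNilpotent a) : (Points.spec (H := H) f a ha).val (𝟙 (Spec A)) = a :=
  lineVal_id_specPt a ha

lemma Points.eq_spec {A : CommRingCat.{u}} (f : Spec A ⟶ Spec (.of k)) (x : Points H (Over.mk f))
    {a : A} (ha : IsNilpotent a) (h : x.val (𝟙 (Spec A)) = a) : x = Points.spec f a ha := by
  subst h
  exact Points.ext (specPt_lineVal x.pt).symm

lemma Points.val_specMap_id {A B : CommRingCat.{u}} (f : Spec A ⟶ Spec (.of k)) (φ : A ⟶ B)
    (x : Points H (Over.mk f)) : x.val (Spec.map φ : Spec B ⟶ Spec A) = φ (x.val (𝟙 (Spec A))) :=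
  (congrArg (fun g : Spec B ⟶ Spec A => lineVal g x.pt) (Category.comp_id (Spec.map φ)).symm).trans
    (lineVal_specMap (𝟙 (Spec A)) φ x.pt)

/-- Additive natural transformations of the points are given by endomorphisms. -/
lemma exists_endoAct (α : ∀ ⦃W : Over (Spec (.of k))⦄ (_ : W ⟶ T), Points H W →+ Points H W)
    (hα : ∀ ⦃W W' : Over (Spec (.of k))⦄ (f : W' ⟶ W) (w : W ⟶ T) (e : Points H W),
      Points.res f (α w e) = α (f ≫ w) (Points.res f e)) :
    ∃ g : Endo (H.map (sectionsHom k T)), ∀ ⦃W : Over (Spec (.of k))⦄ (w : W ⟶ T)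
      (e : Points H W) {A : CommRingCat.{u}} (f : Spec A ⟶ W.left),
      (α w e).val f = nilEval (evalPt (f ≫ w.left)) g.series (e.val f) := by
  let η ⦃A : CommRingCat.{u}⦄ (f : Spec A ⟶ T.left) (x : A) (hx : IsNilpotent x) : A :=
    (α (Over.homMk f : Over.mk (f ≫ T.hom) ⟶ T) (Points.spec _ x hx)).val (𝟙 (Spec A))
  have hval ⦃W : Over (Spec (.of k))⦄ (w : W ⟶ T) (e : Points H W) {A : CommRingCat.{u}}
      (f : Spec A ⟶ W.left) : (α w e).val f = η (f ≫ w.left) (e.val f) (e.isNilpotent_val f) := by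
    have hw : (f ≫ w.left) ≫ T.hom = f ≫ W.hom := by simp
    let i : Over.mk ((f ≫ w.left) ≫ T.hom) ⟶ W := Over.homMk f hw.symm
    have h1 : i ≫ w = Over.homMk (f ≫ w.left) := by ext; simp [i]
    have h2 := congrArg (Points.val (𝟙 (Spec A))) (hα i w e)
    rw [h1, Points.eq_spec _ (Points.res i e) (e.isNilpotent_val f)
      ((Points.val_res i (𝟙 _) e).trans (congrArg (Points.val · e) (Category.id_comp f)))] at h2
    exact ((congrArg (Points.val · (α w e)) (Category.id_comp f)).symm.trans
      (Points.val_res i (𝟙 _) _).symm).trans h2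
  obtain ⟨s, hs⟩ := exists_series η fun A B f φ x hx => by
    have h := hval (Over.homMk f : Over.mk (f ≫ T.hom) ⟶ T) (.spec _ x hx) (Spec.map φ)
    have hx' := (Points.val_specMap_id (f ≫ T.hom) φ (.spec (H := H) _ x hx)).trans
      (congrArg φ (Points.val_id_spec _ x hx))
    have hη (g : Spec B ⟶ T.left) (y : B) (hy : IsNilpotent y) (hyx : y = φ x) :
        η g y hy = η g (φ x) (hx.map φ.hom) := by
      subst hyx
      rfl
    exact (Points.val_specMap_id (f ≫ T.hom) φ _).symm.trans (h.trans (hη _ _ _ hx'))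
  have hs' ⦃W : Over (Spec (.of k))⦄ (w : W ⟶ T) (e : Points H W) {A : CommRingCat.{u}}
      (f : Spec A ⟶ W.left) := (hval w e f).trans (hs _ _ _)
  have hs0 : constantCoeff s = 0 := ext_evalPt fun A f => by
    have h := hs' (𝟙 T) 0 f
    rw [map_zero, Points.val_zero, nilEval_zero, Over.id_left, Category.comp_id] at h
    rw [← h, map_zero]
  obtain ⟨g, rfl⟩ := exists_endo (F := H.map (sectionsHom k T)) s hs0 fun A f x y hx hy => by
    let W : Over (Spec (.of k)) := Over.mk (f ≫ T.hom)
    let w : W ⟶ T := Over.homMk f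
    have hk (e : Points H W) := hs' w e (𝟙 (Spec A))
    have hf : 𝟙 (Spec A) ≫ w.left = f := Category.id_comp f
    have hb : baseVal W (𝟙 (Spec A)) = baseVal T f := by rw [← baseVal_comp _ w, hf]
    rw [hf] at hk
    have h := (congrArg (Points.val (𝟙 (Spec A))) (map_add (α w) (.spec _ x hx)
      (.spec _ y hy))).trans (Points.val_add _ _ _)
    rw [hk, hk, hk, Points.val_add, hb, Points.val_id_spec, Points.val_id_spec] at h
    rw [nilAdd_sectionsHom, nilAdd_sectionsHom]
    exact h
  exact ⟨g, fun W w e A f => hs' w e f⟩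

/-- The automorphisms of `H` are the automorphisms of its formal group. -/
def autAction (H : FormalGroup k) [H.IsComm] :
    AutAction (fpqcTopology.over (Spec (.of k))) (autPresheaf H) H.points where
  isSheaf := H.isSheaf_points
  act T g := endoAct T (Units.val g)
  act_one {T} e := Points.ext_val fun A f => (val_endoAct _ _ f).trans
    (nilEval_X _ (Points.isNilpotent_val f e))
  act_mul {T} g g' e := Points.ext_val fun A f => by
    refine (val_endoAct _ _ f).trans (Eq.trans ?_ (val_endoAct _ _ f).symm)
    exact (nilEval_subst _ (Points.isNilpotent_val f e)
      (Units.val g').constantCoeff_series _).trans (congrArg _ (val_endoAct _ _ f).symm)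
  map_act {T T'} i g e := Points.ext_val fun A f => by
    refine (Points.val_res i f _).trans ((val_endoAct _ _ _).trans
      (Eq.trans ?_ (val_endoAct _ _ f).symm))
    refine Eq.trans ?_ (nilEval_map i.left.appTop.hom (evalPt f) _ _).symm
    rw [show (evalPt f).comp i.left.appTop.hom = evalPt (f ≫ i.left) from
      RingHom.ext fun a => (evalPt_comp f i.left a).symm]
    exact congrArg _ (Points.val_res i f e).symm
  existsUnique T α hα hb := by
    obtain ⟨g, hg⟩ := exists_endoAct α hα
    let β ⦃W : Over (Spec (.of k))⦄ (w : W ⟶ T) : Points H W →+ Points H W :=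
      (AddEquiv.ofBijective (α w) (hb w)).symm.toAddMonoidHom
    have hαβ ⦃W : Over (Spec (.of k))⦄ (w : W ⟶ T) (e : Points H W) : α w (β w e) = e :=
      (AddEquiv.ofBijective (α w) (hb w)).apply_symm_apply e
    have hβα ⦃W : Over (Spec (.of k))⦄ (w : W ⟶ T) (e : Points H W) : β w (α w e) = e :=
      (AddEquiv.ofBijective (α w) (hb w)).symm_apply_apply e
    obtain ⟨g', hg'⟩ := exists_endoAct β fun W W' f w e => (hb _).1
      (((hα f w (β w e)).symm.trans (congrArg (Points.res f) (hαβ w e))).trans (hαβ _ _).symm)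
    have hcomp (g₁ g₂ : Endo (H.map (sectionsHom k T)))
        (h : ∀ (A : CommRingCat.{u}) (f : Spec A ⟶ T.left) (x : A), IsNilpotent x →
          nilEval (evalPt f) g₁.series (nilEval (evalPt f) g₂.series x) =
            x) : g₁ * g₂ = 1 :=
      Endo.ext (ext_series fun A f x hx => (nilEval_subst _ hx
        g₂.constantCoeff_series _).trans ((h A f x hx).trans (nilEval_X _ hx).symm))
    have hpt (A : CommRingCat.{u}) (f : Spec A ⟶ T.left) (x : A) (hx : IsNilpotent x) :
        ∃ (W : Over (Spec (.of k))) (w : W ⟶ T) (e : Points H W) (i : Spec A ⟶ W.left),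
          i ≫ w.left = f ∧ e.val i = x :=
      ⟨Over.mk (f ≫ T.hom), Over.homMk f, .spec _ x hx, 𝟙 _, Category.id_comp f,
        Points.val_id_spec _ _ _⟩
    let u : (Endo (H.map (sectionsHom k T)))ˣ := ⟨g, g', hcomp _ _ fun A f x hx => by
      obtain ⟨W, w, e, i, rfl, rfl⟩ := hpt A f x hx
      rw [← hg', ← hg]
      exact congrArg (Points.val i) (hαβ w e), hcomp _ _ fun A f x hx => by
      obtain ⟨W, w, e, i, rfl, rfl⟩ := hpt A f x hx
      rw [← hg, ← hg']
      exact congrArg (Points.val i) (hβα w e)⟩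
    have hmap (g : (Endo (H.map (sectionsHom k T)))ˣ) ⦃W : Over (Spec (.of k))⦄ (w : W ⟶ T)
        (e : Points H W) {A : CommRingCat.{u}} (f : Spec A ⟶ W.left) :
        (endoAct W (Units.val ((autPresheaf H).map w.op g)) e).val f =
          nilEval (evalPt (f ≫ w.left)) g.val.series (e.val f) := by
      refine (val_endoAct _ _ f).trans
        ((nilEval_map w.left.appTop.hom (evalPt f) _ _).trans ?_)
      rw [show (evalPt f).comp w.left.appTop.hom = evalPt (f ≫ w.left) from
        RingHom.ext fun a => (evalPt_comp f w.left a).symm]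
    refine ⟨u, fun W w e => Points.ext_val fun A f => (hg w e f).trans (hmap u w e f).symm,
      fun u' hu' => Units.ext (Endo.ext (ext_series fun A f x hx => ?_))⟩
    obtain ⟨W, w, e, i, rfl, rfl⟩ := hpt A f x hx
    exact ((hmap u' w e i).symm.trans (congrArg (Points.val i) (hu' w e).symm)).trans (hg w e i)
  small T R hR := by
    rw [GrothendieckTopology.mem_over_iff] at hR
    obtain ⟨K, hK, hKR⟩ := Precoverage.mem_toGrothendieck_iff_of_isStableUnderComposition.1 hR
    obtain ⟨𝒰, rfl⟩ := Precoverage.mem_iff_exists_zeroHypercover.1 hK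
    have : Precoverage.Small.{u} fpqcPrecoverage.{u} :=
      instSmallPropQCPrecoverage (P := @Flat)
    let 𝒱 := Precoverage.ZeroHypercover.restrictIndexOfSmall.{u} 𝒰
    refine ⟨𝒱.I₀, fun i => Over.mk (𝒱.f i ≫ T.hom), fun i => Over.homMk (𝒱.f i), fun i => ?_, ?_⟩
    · exact (Sieve.overEquiv_iff R _).1 (hKR _ _ ⟨_⟩)
    · rw [GrothendieckTopology.mem_over_iff, Sieve.overEquiv_ofArrows]
      exact Precoverage.generate_mem_toGrothendieck 𝒱.mem₀

end

end FormalGroup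

end

noncomputable section

/-! ### Faithfully flat descent of coordinates -/

open TensorProduct

/-- A sequence whose terms are chosen one after the other. -/
lemma Nat.exists_seq_of_forall_exists {X : Type u} [Nonempty X] (P : ℕ → (ℕ → X) → X → Prop)
    (hP : ∀ n a a' b, (∀ k < n, a k = a' k) → P n a b → P n a' b)
    (h : ∀ n a, (∀ k < n, P k a (a k)) → ∃ b, P n a b) : ∃ a, ∀ n, P n a (a n) := by
  let step (n : ℕ) (ih : ∀ k, k < n → X) : X :=
    Classical.epsilon (P n fun k => if hk : k < n then ih k hk else Classical.arbitrary X)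
  let a : ℕ → X := Nat.lt_wfRel.wf.fix step
  have ha (n : ℕ) : a n = Classical.epsilon (P n fun k => if k < n then a k else Classical.arbitrary X) :=
    (Nat.lt_wfRel.wf.fix_eq step n).trans rfl
  refine ⟨a, fun n => ?_⟩
  induction n using Nat.strong_induction_on with
  | _ n ih =>
    rw [ha]
    have hlow (k : ℕ) (hk : k < n) : (if k < n then a k else Classical.arbitrary X) = a k := if_pos hk
    refine hP n _ _ _ hlow (Classical.epsilon_spec (h n _ fun k hk => ?_))
    rw [hlow k hk]
    exact hP k _ _ _ (fun j hj => (hlow j (hj.trans hk)).symm) (ih k hk)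

namespace FlatDescent

variable {A : Type u} [CommRing A]

lemma mem_range_of_one_tmul {B M N : Type u} [CommRing B] [Algebra A B] [Module.FaithfullyFlat A B]
    [AddCommGroup M] [AddCommGroup N] [Module A M] [Module A N] (d : M →ₗ[A] N) (e : N)
    (h : (1 : B) ⊗ₜ[A] e ∈ LinearMap.range (d.lTensor B)) : e ∈ LinearMap.range d := by
  rw [← Submodule.Quotient.mk_eq_zero]
  refine (Module.FaithfullyFlat.one_tmul_eq_zero_iff A _ (A := B) _).1 ?_
  obtain ⟨x, hx⟩ := h
  have h2 : (LinearMap.range d).mkQ ∘ₗ d = 0 := by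
    ext
    simp
  have := congrArg ((LinearMap.range d).mkQ.lTensor B) hx
  rw [LinearMap.lTensor_tmul, ← LinearMap.comp_apply, ← LinearMap.lTensor_comp, h2] at this
  simpa using this.symm

variable {B : Type u} [CommRing B] [Algebra A B]

/-- The twisted coboundary of a cochain of degree `0`. -/
def coboundary (v : B ⊗[A] B) : B →ₗ[A] B ⊗[A] B :=
  (includeRight (R := A) (A := B) (B := B)).toLinearMap -
    (LinearMap.mulRight A v) ∘ₗ
      (includeLeft (R := A) (S := A) (A := B) (B := B)).toLinearMap

lemma coboundary_apply (v : B ⊗[A] B) (b : B) :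
    coboundary v b = 1 ⊗ₜ b - (b ⊗ₜ 1) * v := rfl

/-- The map on `B ⊗ B` with given components. -/
abbrev pair {R : Type u} [CommRing R] [Algebra A R] (r s : B →ₐ[A] R) : B ⊗[A] B →ₐ[A] R :=
  Algebra.TensorProduct.productMap r s

variable (A B) in
/-- The three inclusions of `B` into `B ⊗ B ⊗ B`. -/
def incl : Fin 3 → B →ₐ[A] B ⊗[A] (B ⊗[A] B) :=
  ![includeLeft,
    includeRight.comp includeLeft,
    includeRight.comp includeRight]

lemma lTensor_coboundary (v e : B ⊗[A] B) : (coboundary v).lTensor B e =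
    pair (incl A B 0) (incl A B 2) e - pair (incl A B 0) (incl A B 1) e *
      pair (incl A B 1) (incl A B 2) v := by
  have hv : pair (incl A B 1) (incl A B 2) v = 1 ⊗ₜ v := by
    have : pair (incl A B 1) (incl A B 2) = includeRight := by
      ext <;> simp [incl]
    rw [this]
    rfl
  rw [hv]
  induction e with
  | zero => simp
  | add x y hx hy => rw [map_add, hx, hy, map_add, map_add]; ring
  | tmul x y => simp [coboundary_apply, incl, TensorProduct.tmul_sub]

variable [Module.FaithfullyFlat A B]

lemma exists_eq_coboundary (v e : B ⊗[A] B) (he : pair (incl A B 0) (incl A B 2) e =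
    pair (incl A B 0) (incl A B 1) e * pair (incl A B 1) (incl A B 2) v +
      pair (incl A B 1) (incl A B 2) e) : ∃ b : B, e = 1 ⊗ₜ b - (b ⊗ₜ 1) * v := by
  have h1 : pair (incl A B 1) (incl A B 2) e = 1 ⊗ₜ e := by
    have : pair (incl A B 1) (incl A B 2) = includeRight := by
      ext <;> simp [incl]
    rw [this]
    rfl
  obtain ⟨b, hb⟩ := mem_range_of_one_tmul (B := B) (coboundary v) e ⟨e, by
    rw [lTensor_coboundary, he, h1, add_sub_cancel_left]⟩
  exact ⟨b, hb.symm⟩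

lemma exists_algebraMap_eq (b : B) (hb : b ⊗ₜ[A] (1 : B) = 1 ⊗ₜ b) : ∃ a, algebraMap A B a = b := by
  obtain ⟨a, ha⟩ := mem_range_of_one_tmul (B := B) (Algebra.linearMap A B) b
    ⟨b ⊗ₜ 1, by simpa using hb⟩
  exact ⟨a, ha⟩

/-- A cocycle `w` is a combination of the elements of `B` that it identifies with the trivial
cocycle. -/
lemma exists_sum_eq_one (w : (B ⊗[A] B)ˣ) (hw : pair (incl A B 0) (incl A B 2) w.val =
    pair (incl A B 0) (incl A B 1) w.val * pair (incl A B 1) (incl A B 2) w.val) :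
    ∃ (n : ℕ) (b m : Fin n → B), (∀ i, (m i ⊗ₜ[A] (1 : B)) * w.val = 1 ⊗ₜ m i) ∧
      ∑ i, b i * m i = 1 := by
  let M := LinearMap.ker (coboundary w.val)
  have hex : Function.Exact M.subtype (coboundary w.val) := fun x => by simp [M]
  obtain ⟨z, hz⟩ := (Module.Flat.lTensor_exact B hex w.val).1 (by
    rw [lTensor_coboundary, hw, sub_self])
  have hdiag : Algebra.TensorProduct.lmul' A (S := B) w.val = 1 := by
    let δ : B ⊗[A] (B ⊗[A] B) →ₐ[A] B := Algebra.TensorProduct.productMap (AlgHom.id A B)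
      (Algebra.TensorProduct.lmul' A)
    have hδ (i j : Fin 3) : δ.comp (pair (incl A B i) (incl A B j)) =
        Algebra.TensorProduct.lmul' A := by
      ext b <;> fin_cases i <;> fin_cases j <;> simp [δ, incl]
    have h := congrArg δ hw
    rw [map_mul] at h
    simp only [← AlgHom.comp_apply, hδ] at h
    exact ((w.isUnit.map (Algebra.TensorProduct.lmul' A (S := B))).mul_eq_left.1 h.symm)
  obtain ⟨s, hs⟩ := TensorProduct.exists_finset z
  refine ⟨s.card, fun i => (s.equivFin.symm i).1.1, fun i => (s.equivFin.symm i).1.2.1,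
    fun i => ?_, ?_⟩
  · have := (s.equivFin.symm i).1.2.2
    rw [LinearMap.mem_ker, coboundary_apply, sub_eq_zero] at this
    exact this.symm
  · rw [← hdiag, ← hz, hs, map_sum, map_sum]
    rw [Equiv.sum_comp s.equivFin.symm (fun x => x.1.1 * (x.1.2.1 : B)),
      Finset.sum_coe_sort s (fun x => x.1 * (x.2.1 : B))]
    exact Finset.sum_congr rfl fun x _ => by simp

/-- The elements identified with the trivial cocycle by a cocycle and by its inverse generate the
unit ideal. -/
lemma exists_local_generators (w : (B ⊗[A] B)ˣ) (hw : pair (incl A B 0) (incl A B 2) w.val =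
    pair (incl A B 0) (incl A B 1) w.val * pair (incl A B 1) (incl A B 2) w.val) :
    ∃ (ι : Type) (_ : Fintype ι) (m m' : ι → B) (a c : ι → A),
      (∀ i, (m i ⊗ₜ[A] (1 : B)) * w.val = 1 ⊗ₜ m i) ∧
      (∀ i, m' i ⊗ₜ[A] (1 : B) = (1 ⊗ₜ m' i) * w.val) ∧
      (∀ i, algebraMap A B (a i) = m i * m' i) ∧ ∑ i, c i * a i = 1 := by
  obtain ⟨n, b, m, hm, hs⟩ := exists_sum_eq_one w hw
  obtain ⟨n', b', m', hm', hs'⟩ := exists_sum_eq_one w⁻¹ (by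
    have h (i j : Fin 3) : pair (incl A B i) (incl A B j) (w⁻¹).val =
        ((Units.map (pair (incl A B i) (incl A B j)).toMonoidHom w)⁻¹).val := by
      rw [← map_inv]
      rfl
    rw [h, h, h, mul_comm, ← Units.val_mul, ← mul_inv_rev]
    exact congrArg (fun x => Units.val x⁻¹) (Units.ext hw))
  have hm'' (j : Fin n') : m' j ⊗ₜ[A] (1 : B) = (1 ⊗ₜ m' j) * w.val := by
    rw [← hm', mul_assoc, Units.inv_mul, mul_one]
  have ha (i : Fin n × Fin n') : ∃ a, algebraMap A B a = m i.1 * m' i.2 := by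
    refine exists_algebraMap_eq _ ?_
    have h1 : (m i.1 * m' i.2) ⊗ₜ[A] (1 : B) = (m i.1 ⊗ₜ 1) * (m' i.2 ⊗ₜ 1) := by simp
    rw [h1, hm'', mul_left_comm, hm, mul_comm]
    simp
  choose a ha using ha
  have hI : Ideal.span (Set.range a) = ⊤ := by
    refine Ideal.comap_map_eq_self_of_faithfullyFlat (B := B) (Ideal.span (Set.range a)) ▸ ?_
    rw [Ideal.comap_eq_top_iff, Ideal.eq_top_iff_one, 
      ← (congrArg₂ (· * ·) hs hs').trans (one_mul 1), Finset.sum_mul_sum]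
    refine Ideal.sum_mem _ fun i _ => Ideal.sum_mem _ fun j _ => ?_
    rw [mul_mul_mul_comm, ← ha (i, j)]
    exact Ideal.mul_mem_left _ _ (Ideal.mem_map_of_mem _ (Ideal.subset_span ⟨_, rfl⟩))
  obtain ⟨c, hc⟩ := (Ideal.mem_span_range_iff_exists_fun (R := A)).1
    ((Ideal.eq_top_iff_one _).1 hI)
  exact ⟨Fin n × Fin n', inferInstance, fun i => m i.1, fun i => m' i.2, a, c, fun i => hm i.1,
    fun i => hm'' i.2, ha, hc⟩

section

variable (g : PowerSeries (B ⊗[A] B)) (hg0 : constantCoeff g = 0)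
  (hg : PowerSeries.map (pair (incl A B 0) (incl A B 2)).toRingHom g =
    PowerSeries.subst (PowerSeries.map (pair (incl A B 1) (incl A B 2)).toRingHom g)
      (PowerSeries.map (pair (incl A B 0) (incl A B 1)).toRingHom g))

include hg0 hg

/-- A coordinate change given to finite order over `B` that is compatible with the gluing `g` can be
extended by one order. -/
lemma exists_next_coeff (n : ℕ) (u : PowerSeries B)
    (hu : ∀ k < n, coeff k (PowerSeries.subst g (PowerSeries.map
      (includeLeft : B →ₐ[A] B ⊗[A] B).toRingHom u)) =
        1 ⊗ₜ coeff k u) :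
    ∃ b : B, coeff n (PowerSeries.subst g (PowerSeries.map
      (includeLeft : B →ₐ[A] B ⊗[A] B).toRingHom u)) +
        (b ⊗ₜ 1) * coeff 1 g ^ n = 1 ⊗ₜ (coeff n u + b) := by
  let i₀ : B →ₐ[A] B ⊗[A] B := includeLeft
  let i₁ : B →ₐ[A] B ⊗[A] B := includeRight
  let P (i j : Fin 3) : B ⊗[A] B →+* B ⊗[A] (B ⊗[A] B) := (pair (incl A B i) (incl A B j)).toRingHom
  let D := PowerSeries.subst g (PowerSeries.map i₀.toRingHom u) - PowerSeries.map i₁.toRingHom u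
  have h0 (φ : B ⊗[A] B →+* B ⊗[A] (B ⊗[A] B)) :
      constantCoeff (PowerSeries.map φ g) = 0 := by
    simp [← coeff_zero_eq_constantCoeff_apply, hg0]
  have hs (φ : B ⊗[A] B →+* B ⊗[A] (B ⊗[A] B)) := PowerSeries.HasSubst.of_constantCoeff_zero' (h0 φ)
  have hl (i j : Fin 3) : (P i j).comp i₀.toRingHom = (incl A B i).toRingHom :=
    RingHom.ext fun b => by simp [P, i₀]
  have hr (i j : Fin 3) : (P i j).comp i₁.toRingHom = (incl A B j).toRingHom :=
    RingHom.ext fun b => by simp [P, i₁]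
  have hD (i j : Fin 3) : PowerSeries.map (P i j) D =
      PowerSeries.subst (PowerSeries.map (P i j) g)
        (PowerSeries.map (incl A B i).toRingHom u) - PowerSeries.map (incl A B j).toRingHom u := by
    rw [map_sub, ← hl i j, ← hr i j, PowerSeries.map_comp, PowerSeries.map_comp]
    refine congrArg (· - _) ?_
    exact PowerSeries.map_subst (PowerSeries.HasSubst.of_constantCoeff_zero' hg0) _
  have hDD : PowerSeries.map (P 0 2) D = PowerSeries.subst (PowerSeries.map (P 1 2) g)
      (PowerSeries.map (P 0 1) D) + PowerSeries.map (P 1 2) D := by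
    rw [hD, hD, hD, hg, ← PowerSeries.coe_substAlgHom (hs _), map_sub,
      PowerSeries.coe_substAlgHom (hs _), PowerSeries.subst_comp_subst_apply (hs _) (hs _)]
    ring
  have hlow (k : ℕ) (hk : k < n) : coeff k D = 0 := by
    rw [map_sub, hu k hk, coeff_map]
    exact sub_self _
  have hc := congrArg (coeff n) hDD
  rw [map_add, PowerSeries.coeff_subst_eq_sum (h0 _), Finset.sum_eq_single_of_mem n (by simp)
    fun k hk hkn => by
      rw [coeff_map, hlow k (by simp at hk; omega), map_zero, zero_mul]] at hc
  simp only [← map_pow, coeff_map] at hc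
  obtain ⟨b, hb⟩ := exists_eq_coboundary _ _ hc
  refine ⟨b, ?_⟩
  rw [show coeff n (g ^ n) = coeff 1 g ^ n by
    obtain ⟨c, rfl⟩ := PowerSeries.X_dvd_iff.2 hg0
    simp [mul_pow, coeff_X_pow_mul', coeff_succ_X_mul]] at hb
  rw [map_sub, coeff_map, sub_eq_iff_eq_add] at hb
  refine (congrArg (· + _) hb).trans ?_
  rw [TensorProduct.tmul_add]
  change _ + 1 ⊗ₜ coeff n u + _ = _
  ring

/-- A coordinate change to first order extends to a series that is compatible with the gluing. -/
lemma exists_series (m : B) (hm : (m ⊗ₜ[A] (1 : B)) * coeff 1 g = 1 ⊗ₜ m) :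
    ∃ u : PowerSeries B, constantCoeff u = 0 ∧ coeff 1 u = m ∧
      PowerSeries.subst g (PowerSeries.map
        (includeLeft : B →ₐ[A] B ⊗[A] B).toRingHom u) =
          PowerSeries.map (includeRight : B →ₐ[A] B ⊗[A] B).toRingHom u := by
  have hn (n : ℕ) : coeff n (g ^ n) = coeff 1 g ^ n := by
    obtain ⟨c, rfl⟩ := PowerSeries.X_dvd_iff.2 hg0
    simp [mul_pow, coeff_X_pow_mul', coeff_succ_X_mul]
  obtain ⟨a, ha⟩ := Nat.exists_seq_of_forall_exists (X := B) (fun n a b => (n = 0 → b = 0) ∧ (n = 1 → b = m) ∧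
    ∑ k ∈ Finset.range n, (a k ⊗ₜ[A] (1 : B)) * coeff n (g ^ k) +
      (b ⊗ₜ 1) * coeff 1 g ^ n = 1 ⊗ₜ b)
    (fun n a a' b h => by
      rw [Finset.sum_congr rfl fun k hk => by rw [h k (Finset.mem_range.1 hk)]]
      exact id)
    (fun n a h => by
      obtain _ | _ | n := n
      · exact ⟨0, by simp⟩
      · refine ⟨m, by simp, by simp, ?_⟩
        rw [Finset.sum_range_one, (h 0 (by simp)).1 rfl, pow_one, hm]
        simp
      · obtain ⟨b, hb⟩ := exists_next_coeff g hg0 hg (n + 2)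
          (PowerSeries.mk fun k => if k < n + 2 then a k else 0) fun k hk => by
            rw [PowerSeries.coeff_subst_eq_sum hg0, coeff_mk, if_pos hk,
              ← (h k hk).2.2, Finset.sum_range_succ, hn]
            simp only [coeff_map, coeff_mk, if_pos hk]
            refine congrArg (· + _) (Finset.sum_congr rfl fun j hj => ?_)
            rw [if_pos ((Finset.mem_range.1 hj).trans hk)]
            rfl
        refine ⟨b, by simp, by simp, ?_⟩
        rw [PowerSeries.coeff_subst_eq_sum hg0, coeff_mk, if_neg (lt_irrefl _),
          zero_add, Finset.sum_range_succ] at hb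
        rw [← hb]
        refine congrArg (· + _) (Eq.trans (Finset.sum_congr rfl fun j hj => ?_) (add_zero _).symm
          |>.trans (congrArg (_ + ·) ?_))
        · rw [coeff_map, coeff_mk, if_pos (Finset.mem_range.1 hj)]
          rfl
        · simp)
  refine ⟨PowerSeries.mk a, ?_, ?_, ?_⟩
  · simpa using (ha 0).1 rfl
  · simpa using (ha 1).2.1 rfl
  · ext n
    rw [PowerSeries.coeff_subst_eq_sum hg0, coeff_map, Finset.sum_range_succ, hn]
    simp only [coeff_map, coeff_mk]
    exact (ha n).2.2

end

end FlatDescent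

end

noncomputable section

/-! ### Charts of formal Lie groups -/

namespace AlgebraicGeometry.Scheme

variable {T : Scheme.{u}}

lemma eq_zero_of_locally_eq_zero {ι : Type*} (U : ι → T.Opens) (hU : ⊤ ≤ iSup U) (a : Γ(T, ⊤))
    (h : ∀ i, T.presheaf.map (homOfLE le_top : U i ⟶ ⊤).op a = 0) : a = 0 :=
  T.sheaf.eq_of_locally_eq' U ⊤ (fun _ => homOfLE le_top) hU a 0 fun i =>
    (h i).trans (map_zero _).symm

lemma iSup_affineOpens_top : ⊤ ≤ ⨆ U : T.affineOpens, (U : T.Opens) := by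
  rw [iSup_affineOpens_eq_top]

lemma map_top_appTop {T' : Scheme.{u}} (f : T' ⟶ T) (U : T.Opens) (a : Γ(T, ⊤)) :
    T'.presheaf.map (homOfLE le_top : f ⁻¹ᵁ U ⟶ ⊤).op (f.appTop a) =
      f.app U (T.presheaf.map (homOfLE le_top : U ⟶ ⊤).op a) :=
  (ConcreteCategory.congr_hom (f.naturality (homOfLE le_top : U ⟶ ⊤).op) a).symm

lemma IdealSheafData.subschemeι_appTop_eq_zero_iff (I : T.IdealSheafData) (a : Γ(T, ⊤)) :
    I.subschemeι.appTop a = 0 ↔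
      ∀ U : T.affineOpens, T.presheaf.map (homOfLE le_top : U.1 ⟶ ⊤).op a ∈ I.ideal U := by
  have h (U : T.affineOpens) : T.presheaf.map (homOfLE le_top : U.1 ⟶ ⊤).op a ∈ I.ideal U ↔
      I.subscheme.presheaf.map (homOfLE le_top : I.subschemeι ⁻¹ᵁ U.1 ⟶ ⊤).op
        (I.subschemeι.appTop a) = 0 := by
    rw [map_top_appTop, ← I.ker_subschemeι_app U, RingHom.mem_ker]
  simp only [h]
  refine ⟨fun ha U => by rw [ha, map_zero], fun ha =>
    eq_zero_of_locally_eq_zero (fun U : T.affineOpens => I.subschemeι ⁻¹ᵁ U.1) ?_ _ ha⟩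
  rw [← Scheme.Hom.preimage_iSup, iSup_affineOpens_eq_top]
  exact le_rfl

/-- A function vanishes on a closed subscheme whose ideal has vanishing `n`-th power if and only if
its `n`-th power vanishes. -/
lemma exists_idealSheafData_iff (n : ℕ) (a : Γ(T, ⊤)) : (∃ I : T.IdealSheafData, I ^ n = ⊥ ∧
    I.subschemeι.appTop a = 0) ↔ a ^ n = 0 := by
  constructor
  · rintro ⟨I, hI, ha⟩
    refine eq_zero_of_locally_eq_zero _ iSup_affineOpens_top _ fun U => ?_
    have h := Ideal.pow_mem_pow ((I.subschemeι_appTop_eq_zero_iff a).1 ha U) n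
    rw [← Pi.pow_apply, ← IdealSheafData.ideal_pow, hI] at h
    rw [map_pow]
    exact h
  · intro ha
    refine ⟨IdealSheafData.ofIdealTop (Ideal.span {a}), ?_,
      (IdealSheafData.subschemeι_appTop_eq_zero_iff _ a).2 fun U =>
        Ideal.mem_map_of_mem _ (Ideal.mem_span_singleton_self a)⟩
    refine IdealSheafData.ext (funext fun U => ?_)
    rw [IdealSheafData.ideal_pow, Pi.pow_apply]
    refine (Ideal.map_pow _ _ _).symm.trans ?_
    rw [Ideal.span_singleton_pow, ha, Ideal.span_singleton_zero, Ideal.map_bot]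
    rfl

end AlgebraicGeometry.Scheme

open AlgebraicGeometry.Scheme

/-- A chart of `X` over `T`: a coordinate on the restriction of `X` to `T`. -/
structure Chart {S : Scheme.{u}} (X : (Over S)ᵒᵖ ⥤ AddCommGrpCat.{u}) (T : Over S) where
  coord ⦃V : Over S⦄ (v : V ⟶ T) : X.obj (op V) → formalLine.obj (op V.left)
  map_coord ⦃V V' : Over S⦄ (f : V' ⟶ V) (v : V ⟶ T) (x : X.obj (op V)) :
    formalLine.map f.left.op (coord v x) = coord (f ≫ v) (X.map f.op x)
  bijective ⦃V : Over S⦄ (v : V ⟶ T) : Function.Bijective (coord v)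
  coord_zero ⦃V : Over S⦄ (v : V ⟶ T) : coord v 0 = formalLineZero _

namespace Chart

variable {S S' : Scheme.{u}} {X : (Over S)ᵒᵖ ⥤ AddCommGrpCat.{u}} {T T' : Over S}

/-- The restriction of a chart. -/
def restrict (c : Chart X T) (f : T' ⟶ T) : Chart X T' where
  coord V v := c.coord (v ≫ f)
  map_coord V V' g v x := by rw [c.map_coord, Category.assoc]
  bijective V v := c.bijective _
  coord_zero V v := c.coord_zero _

/-- The chart of a pullback. -/
def pullback (f : S' ⟶ S) {T : Over S'} (c : Chart X ((Over.map f).obj T)) :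
    Chart ((Over.map f).op ⋙ X) T where
  coord V v := c.coord ((Over.map f).map v)
  map_coord V V' g v x := by
    rw [(Over.map f).map_comp]
    exact c.map_coord ((Over.map f).map g) _ x
  bijective V v := c.bijective ((Over.map f).map v)
  coord_zero V v := c.coord_zero ((Over.map f).map v)

lemma coord_eq_zero_iff (c : Chart X T) {V : Over S} (v : V ⟶ T) (x : X.obj (op V)) :
    (c.coord v x).1 = 0 ↔ x = 0 := by
  refine ⟨fun h => (c.bijective v).1 ((Subtype.ext h).trans (c.coord_zero v).symm), ?_⟩
  rintro rfl
  rw [c.coord_zero]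
  rfl

lemma isInfinitesimalPoint_iff (c : Chart X T) (n : ℕ) {V : Over S} (v : V ⟶ T)
    (x : X.obj (op V)) : IsInfinitesimalPoint X n x ↔ (c.coord v x).1 ^ (n + 1) = 0 := by
  rw [← exists_idealSheafData_iff]
  refine exists_congr fun I => and_congr_right fun _ => ?_
  rw [← c.coord_eq_zero_iff (Over.homMk I.subschemeι ≫ v), ← c.map_coord]
  rfl

/-- The infinitesimal neighbourhoods of the zero section in terms of a coordinate. -/
lemma mem_infNeighbourhood_iff (c : Chart X T) (n : ℕ) {V : Over S} (v : V ⟶ T)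
    (x : X.obj (op V)) : x ∈ (infNeighbourhood X n).obj (op V) ↔
      (c.coord v x).1 ^ (n + 1) = 0 := by
  have hc {V' : Over S} (g : V' ⟶ V) :
      (c.coord (g ≫ v) (X.map g.op x)).1 = g.left.appTop (c.coord v x).1 :=
    congrArg Subtype.val (c.map_coord g v x).symm
  constructor
  · rintro ⟨R, hR, h⟩
    rw [GrothendieckTopology.mem_over_iff] at hR
    refine Presieve'.ext_of_cover isSheaf_functions (fppfTopology_le_fpqcTopology _ hR)
      fun V' f hf => ?_
    have h1 := (c.isInfinitesimalPoint_iff n (Over.homMk f ≫ v) _).1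
      (h _ ((Sieve.overEquiv_iff R f).1 hf))
    rw [hc, ← map_pow] at h1
    exact h1.trans (map_zero f.appTop.hom).symm
  · intro h
    refine ⟨⊤, GrothendieckTopology.top_mem _ _, fun V' g _ =>
      (c.isInfinitesimalPoint_iff n (g ≫ v) _).2 ?_⟩
    rw [hc, ← map_pow, h, map_zero]

/-- The point with a given coordinate. -/
def pt (c : Chart X T) {V : Over S} (v : V ⟶ T) (a : formalLine.obj (op V.left)) : X.obj (op V) :=
  (Equiv.ofBijective _ (c.bijective v)).symm a

lemma coord_pt (c : Chart X T) {V : Over S} (v : V ⟶ T) (a : formalLine.obj (op V.left)) :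
    c.coord v (c.pt v a) = a :=
  (Equiv.ofBijective _ (c.bijective v)).apply_symm_apply a

lemma map_pt (c : Chart X T) {V V' : Over S} (f : V' ⟶ V) (v : V ⟶ T)
    (a : formalLine.obj (op V.left)) :
    X.map f.op (c.pt v a) = c.pt (f ≫ v) (formalLine.map f.left.op a) :=
  (c.bijective (f ≫ v)).1 (by rw [← c.map_coord, coord_pt, coord_pt])

/-- A chart over an open subscheme from a trivialization. -/
def ofIso {U : Scheme.{u}} (j : U ⟶ S)
    (e : (Over.map j).op ⋙ X ⋙ CategoryTheory.forget _ ≅ (Over.forget U).op ⋙ formalLine)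
    (he : ∀ T, e.hom.app T (0 : X.obj (op ((Over.map j).obj T.unop))) = formalLineZero _) :
    Chart X (Over.mk j) :=
  let i ⦃V : Over S⦄ (v : V ⟶ Over.mk j) : (Over.map j).obj (Over.mk v.left) ⟶ V :=
    Over.homMk (𝟙 _) (by simpa using (Over.w v).symm)
  have hi ⦃V : Over S⦄ (v : V ⟶ Over.mk j) : IsIso (i v) :=
    (Over.isoMk (Iso.refl _) (by simpa using (Over.w v).symm) :
      (Over.map j).obj (Over.mk v.left) ≅ V).isIso_hom
  { coord := fun V v x => e.hom.app (op (Over.mk v.left)) (X.map (i v).op x)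
    map_coord := fun V V' f v x => by
      have h := NatTrans.naturality_apply e.hom
        (Over.homMk f.left : Over.mk (f ≫ v).left ⟶ Over.mk v.left).op (X.map (i v).op x)
      refine h.symm.trans (congrArg (e.hom.app _) ?_)
      refine (Functor.map_comp_apply X _ _ x).symm.trans
        (Eq.trans ?_ (Functor.map_comp_apply X _ _ x))
      refine congrArg (fun k => X.map k x) (Quiver.Hom.unop_inj ?_)
      ext
      simp [i]
    bijective := fun V v => by
      have := hi v
      refine Function.Bijective.comp (f := X.map (i v).op)
        (ConcreteCategory.bijective_of_isIso (e.hom.app (op (Over.mk v.left)))) ?_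
      exact ConcreteCategory.bijective_of_isIso (X.map (i v).op)
    coord_zero := fun V v => by
      rw [map_zero]
      exact he _ }

end Chart

end

noncomputable section

open AlgebraicGeometry.Scheme

/-! ### The formal group law of a chart over an affine scheme -/

namespace AlgebraicGeometry.Scheme

/-- The ring homomorphism of a morphism of affine schemes. -/
def ptHom {A R : CommRingCat.{u}} (g : Spec R ⟶ Spec A) : A →+* R := (Spec.preimage g).hom

lemma ptHom_specMap {A R : CommRingCat.{u}} (φ : A ⟶ R) : ptHom (Spec.map φ) = φ.hom := by
  rw [ptHom, Spec.preimage_map]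

lemma ptHom_comp {A R R' : CommRingCat.{u}} (g : Spec R ⟶ Spec A) (f : Spec R' ⟶ Spec R) :
    ptHom (f ≫ g) = (ptHom f).comp (ptHom g) := by
  obtain ⟨φ, rfl⟩ := specMap_surjective g
  obtain ⟨ψ, rfl⟩ := specMap_surjective f
  rw [← Spec.map_comp, ptHom_specMap, ptHom_specMap, ptHom_specMap]
  rfl

lemma ptHom_specMap_comp {A R R' : CommRingCat.{u}} (g : Spec R ⟶ Spec A) (φ : R ⟶ R') :
    ptHom (Spec.map φ ≫ g) = φ.hom.comp (ptHom g) := by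
  rw [ptHom_comp, ptHom_specMap]

end AlgebraicGeometry.Scheme

namespace Chart

variable {S : Scheme.{u}} {X : (Over S)ᵒᵖ ⥤ AddCommGrpCat.{u}} {T : Over S}

/-- The coordinate of a point at a point with values in a ring. -/
def val (c : Chart X T) {V : Over S} (v : V ⟶ T) {R : CommRingCat.{u}} (g : Spec R ⟶ V.left)
    (x : X.obj (op V)) : R :=
  lineVal g (c.coord v x)

lemma isNilpotent_val (c : Chart X T) {V : Over S} (v : V ⟶ T) {R : CommRingCat.{u}}
    (g : Spec R ⟶ V.left) (x : X.obj (op V)) : IsNilpotent (c.val v g x) :=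
  isNilpotent_lineVal _ _

lemma val_specMap (c : Chart X T) {V : Over S} (v : V ⟶ T) {R R' : CommRingCat.{u}}
    (g : Spec R ⟶ V.left) (φ : R ⟶ R') (x : X.obj (op V)) :
    c.val v (Spec.map φ ≫ g) x = φ (c.val v g x) :=
  lineVal_specMap _ _ _

lemma val_map (c : Chart X T) {V V' : Over S} (f : V' ⟶ V) (v : V ⟶ T) {R : CommRingCat.{u}}
    (g : Spec R ⟶ V'.left) (x : X.obj (op V)) :
    c.val (f ≫ v) g (X.map f.op x) = c.val v (g ≫ f.left) x := by
  rw [val, val, ← c.map_coord, lineVal_comp]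

lemma ext_val (c : Chart X T) {V : Over S} (v : V ⟶ T) {x y : X.obj (op V)}
    (h : ∀ (R : CommRingCat.{u}) (g : Spec R ⟶ V.left), c.val v g x = c.val v g y) : x = y :=
  (c.bijective v).1 (ext_lineVal h)

lemma val_zero (c : Chart X T) {V : Over S} (v : V ⟶ T) {R : CommRingCat.{u}}
    (g : Spec R ⟶ V.left) : c.val v g 0 = 0 := by
  rw [val, c.coord_zero]
  exact map_zero (evalPt g)

/-- The point over an affine scheme with a given coordinate. -/
def specPt (c : Chart X T) {R : CommRingCat.{u}} (g : Spec R ⟶ T.left) (a : R)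
    (ha : IsNilpotent a) : X.obj (op (Over.mk (g ≫ T.hom))) :=
  c.pt (Over.homMk g) (Scheme.specPt a ha)

lemma val_specPt (c : Chart X T) {R R' : CommRingCat.{u}} (g : Spec R ⟶ T.left) (a : R)
    (ha : IsNilpotent a) (φ : R ⟶ R') :
    c.val (V := Over.mk (g ≫ T.hom)) (Over.homMk g) (Spec.map φ)
      (c.specPt g a ha) = φ a := by
  rw [val, specPt, coord_pt]
  exact lineVal_specPt φ a ha

lemma val_id_specPt (c : Chart X T) {R : CommRingCat.{u}} (g : Spec R ⟶ T.left) (a : R)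
    (ha : IsNilpotent a) :
    c.val (V := Over.mk (g ≫ T.hom)) (Over.homMk g) (𝟙 (Spec R))
      (c.specPt g a ha) = a := by
  rw [val, specPt, coord_pt]
  exact lineVal_id_specPt a ha

/-- Every value of a point is the value of its pullback to an affine scheme. -/
lemma map_eq_specPt (c : Chart X T) {V : Over S} (v : V ⟶ T) {R : CommRingCat.{u}}
    (g : Spec R ⟶ V.left) (x : X.obj (op V)) :
    X.map (Over.homMk g (by simp) : Over.mk ((g ≫ v.left) ≫ T.hom) ⟶ V).op x =
      c.specPt (g ≫ v.left) (c.val v g x) (c.isNilpotent_val v g x) := by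
  let i : Over.mk ((g ≫ v.left) ≫ T.hom) ⟶ V := Over.homMk g (by simp)
  have hi : i ≫ v = Over.homMk (g ≫ v.left) := by ext; simp [i]
  refine (c.bijective (Over.homMk (g ≫ v.left))).1 ?_
  rw [specPt, coord_pt, ← hi, ← c.map_coord]
  refine ext_lineVal_id ?_
  refine (lineVal_comp (𝟙 (Spec R)) g (c.coord v x)).symm.trans
    ((congrArg (fun k => lineVal k (c.coord v x)) (Category.id_comp g)).trans ?_)
  exact (lineVal_id_specPt _ _).symm

lemma specPt_val_id (c : Chart X T) {R : CommRingCat.{u}} (g : Spec R ⟶ T.left)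
    (x : X.obj (op (Over.mk (g ≫ T.hom)))) (a : R) (ha : IsNilpotent a)
    (h : c.val (V := Over.mk (g ≫ T.hom)) (Over.homMk g) (𝟙 (Spec R)) x = a) :
    c.specPt g a ha = x :=
  (c.bijective (Over.homMk g : Over.mk (g ≫ T.hom) ⟶ T)).1
    (ext_lineVal_id ((c.val_id_specPt g a ha).trans h.symm))

/-- The addition of `X` in terms of coordinates. -/
def addVal (c : Chart X T) {R : CommRingCat.{u}} (g : Spec R ⟶ T.left) (a b : R)
    (ha : IsNilpotent a) (hb : IsNilpotent b) : R :=
  c.val (V := Over.mk (g ≫ T.hom)) (Over.homMk g) (𝟙 (Spec R))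
    (c.specPt g a ha + c.specPt g b hb)

lemma addVal_congr (c : Chart X T) {R : CommRingCat.{u}} {g g' : Spec R ⟶ T.left} {a a' b b' : R}
    (ha : IsNilpotent a) (hb : IsNilpotent b) (hg : g = g') (haa : a = a') (hbb : b = b') :
    c.addVal g a b ha hb = c.addVal g' a' b' (haa ▸ ha) (hbb ▸ hb) := by
  subst hg haa hbb
  rfl

lemma val_add (c : Chart X T) {V : Over S} (v : V ⟶ T) (x y : X.obj (op V)) {R : CommRingCat.{u}}
    (g : Spec R ⟶ V.left) : c.val v g (x + y) = c.addVal (g ≫ v.left) (c.val v g x) (c.val v g y)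
      (c.isNilpotent_val v g x) (c.isNilpotent_val v g y) := by
  let i : Over.mk ((g ≫ v.left) ≫ T.hom) ⟶ V := Over.homMk g (by simp)
  have hi : i ≫ v = Over.homMk (g ≫ v.left) := by ext; simp [i]
  have h := c.val_map i v (𝟙 (Spec R)) (x + y)
  rw [map_add, hi] at h
  rw [addVal, ← c.map_eq_specPt, ← c.map_eq_specPt]
  exact ((congrArg (c.val v · (x + y)) (Category.id_comp g)).symm.trans h.symm)

lemma map_addVal (c : Chart X T) {R R' : CommRingCat.{u}} (g : Spec R ⟶ T.left) (φ : R ⟶ R')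
    (a b : R) (ha : IsNilpotent a) (hb : IsNilpotent b) : φ (c.addVal g a b ha hb) =
      c.addVal (Spec.map φ ≫ g) (φ a) (φ b) (ha.map φ.hom) (hb.map φ.hom) := by
  have h1 := c.val_add (Over.homMk g : Over.mk (g ≫ T.hom) ⟶ T) (c.specPt g a ha) (c.specPt g b hb)
    (Spec.map φ)
  refine Eq.trans ?_ (h1.trans (c.addVal_congr _ _ rfl (c.val_specPt g a ha φ)
    (c.val_specPt g b hb φ)))
  have h2 := c.val_specMap (Over.homMk g : Over.mk (g ≫ T.hom) ⟶ T) (𝟙 (Spec R)) φ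
    (c.specPt g a ha + c.specPt g b hb)
  exact h2.symm.trans (congrArg (c.val _ · _) (Category.comp_id (Spec.map φ)))

lemma isNilpotent_addVal (c : Chart X T) {R : CommRingCat.{u}} (g : Spec R ⟶ T.left) (a b : R)
    (ha : IsNilpotent a) (hb : IsNilpotent b) : IsNilpotent (c.addVal g a b ha hb) :=
  c.isNilpotent_val _ _ _

lemma specPt_addVal (c : Chart X T) {R : CommRingCat.{u}} (g : Spec R ⟶ T.left) (a b : R)
    (ha : IsNilpotent a) (hb : IsNilpotent b) :
    c.specPt g (c.addVal g a b ha hb) (c.isNilpotent_addVal g a b ha hb) =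
      c.specPt g a ha + c.specPt g b hb :=
  c.specPt_val_id g _ _ _ rfl

lemma addVal_assoc (c : Chart X T) {R : CommRingCat.{u}} (g : Spec R ⟶ T.left) (a b d : R)
    (ha : IsNilpotent a) (hb : IsNilpotent b) (hd : IsNilpotent d) :
    c.addVal g (c.addVal g a b ha hb) d (c.isNilpotent_addVal g a b ha hb) hd =
      c.addVal g a (c.addVal g b d hb hd) ha (c.isNilpotent_addVal g b d hb hd) := by
  rw [addVal, specPt_addVal, add_assoc, ← specPt_addVal]
  rfl

lemma addVal_comm (c : Chart X T) {R : CommRingCat.{u}} (g : Spec R ⟶ T.left) (a b : R)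
    (ha : IsNilpotent a) (hb : IsNilpotent b) : c.addVal g a b ha hb = c.addVal g b a hb ha := by
  rw [addVal, add_comm]
  rfl

lemma addVal_zero (c : Chart X T) {R : CommRingCat.{u}} (g : Spec R ⟶ T.left) (a : R)
    (ha : IsNilpotent a) : c.addVal g a 0 ha IsNilpotent.zero = a := by
  rw [addVal, c.specPt_val_id g 0 0 IsNilpotent.zero (c.val_zero _ _), add_zero, val_id_specPt]

variable {A : CommRingCat.{u}} {j : Spec A ⟶ S}

/-- A formal group law describes the addition of `X` in terms of the coordinate. -/
def IsLaw (c : Chart X (Over.mk j)) (F : FormalGroup A) : Prop :=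
  ∀ ⦃V : Over S⦄ (v : V ⟶ Over.mk j) (x y : X.obj (op V)) (R : CommRingCat.{u})
    (g : Spec R ⟶ V.left), c.val v g (x + y) =
      F.nilAdd (ptHom (g ≫ v.left)) (c.val v g x) (c.val v g y)

lemma exists_isLaw (c : Chart X (Over.mk j)) : ∃ F : FormalGroup A, F.IsComm ∧ c.IsLaw F := by
  obtain ⟨F, hF, h⟩ := FormalGroup.exists_nilAdd (A := A)
    (fun R _ φ x y hx hy => c.addVal (R := .of R) (Spec.map (CommRingCat.ofHom φ)) x y hx hy)
    (fun R R' _ _ χ φ x y hx hy => (c.map_addVal (R := .of R) (R' := .of R')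
      (Spec.map (CommRingCat.ofHom φ)) (CommRingCat.ofHom χ) x y hx hy).trans
        (c.addVal_congr _ _ (Spec.map_comp _ _).symm rfl rfl))
    (fun R _ φ x y hx hy => c.isNilpotent_addVal _ _ _ _ _)
    (fun R _ φ x y z hx hy hz => c.addVal_assoc _ _ _ _ _ _ _)
    (fun R _ φ x y hx hy => c.addVal_comm _ _ _ _ _)
    (fun R _ φ x hx => c.addVal_zero _ _ _)
  refine ⟨F, hF, fun V v x y R g => ?_⟩
  rw [c.val_add]
  refine Eq.trans (c.addVal_congr _ _ (Spec.map_preimage (g ≫ v.left)).symm rfl rfl) ?_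
  exact h R (ptHom (g ≫ v.left)) _ _ (c.isNilpotent_val v g x) (c.isNilpotent_val v g y)

lemma IsLaw.val_nsmul {c : Chart X (Over.mk j)} {F : FormalGroup A} (h : c.IsLaw F) (m : ℕ)
    {V : Over S} (v : V ⟶ Over.mk j) (x : X.obj (op V)) {R : CommRingCat.{u}}
    (g : Spec R ⟶ V.left) : c.val v g (m • x) =
      nilEval (ptHom (g ≫ v.left)) (F.mulSeries m) (c.val v g x) := by
  induction m with
  | zero =>
    rw [zero_smul, c.val_zero, FormalGroup.mulSeries]
    exact (map_zero (MvPowerSeries.nilEvalHom _ fun _ => c.isNilpotent_val v g x)).symm.trans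
      (MvPowerSeries.nilEvalHom_apply _ _ _)
  | succ m ih =>
    rw [succ_nsmul, h, ih, F.nilEval_mulSeries_succ _ _ (c.isNilpotent_val v g x)]

end Chart

end

noncomputable section

open AlgebraicGeometry.Scheme

/-! ### Functions on infinitesimal neighbourhoods in terms of coordinates -/

lemma PowerSeries.nilEval_coe_polynomial {A R : Type*} [CommRing A] [CommRing R] (φ : A →+* R)
    (q : Polynomial A) {x : R} {n : ℕ} (hx : x ^ n = 0) :
    nilEval φ (q : PowerSeries A) x = q.eval₂ φ x := by
  have hx' : x ^ (max n (q.natDegree + 1)) = 0 :=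
    pow_eq_zero_of_le (le_max_left _ _) hx
  rw [nilEval_eq_sum φ _ hx', Polynomial.eval₂_eq_sum_range' φ
    (lt_of_lt_of_le (Nat.lt_succ_self _) (le_max_right n (q.natDegree + 1)))]
  simp

section

variable {S : Scheme.{u}} {X : (Over S)ᵒᵖ ⥤ AddCommGrpCat.{u}} {n : ℕ} {U : S.Opens}

/-- The value of a function on `X⁽ⁿ⁾` at a point, as a ring homomorphism. -/
def infEval {T : Over (U : Scheme.{u})} (x : (infNeighbourhood X n).obj (op ((Over.map U.ι).obj T)))
    {R : CommRingCat.{u}} (g : Spec R ⟶ T.left) : infFunctions X n U →+* R where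
  toFun f := evalPt g (f.1 T x)
  map_one' := map_one _
  map_mul' _ _ := map_mul _ _ _
  map_zero' := map_zero _
  map_add' _ _ := map_add _ _ _

lemma infFunctions_ext {f f' : infFunctions X n U}
    (h : ∀ (T : Over (U : Scheme.{u})) (x : (infNeighbourhood X n).obj (op ((Over.map U.ι).obj T)))
      (R : CommRingCat.{u}) (g : Spec R ⟶ T.left), infEval x g f = infEval x g f') : f = f' :=
  Subtype.ext (funext fun T => funext fun x => ext_evalPt fun R g => h T x R g)

/-- A constant function. -/
def infConst (a : Γ(U, ⊤)) : infFunctions X n U :=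
  ⟨fun T _ => T.hom.appTop a, fun T T' g x => by
    rw [← ConcreteCategory.comp_apply, ← Scheme.Hom.comp_appTop, Over.w]⟩

/-- The function given by a map from `X` to the formal line. -/
def infLine (α : ∀ ⦃V : Over S⦄ (_ : V ⟶ Over.mk U.ι), X.obj (op V) → formalLine.obj (op V.left))
    (hα : ∀ ⦃V V' : Over S⦄ (f : V' ⟶ V) (v : V ⟶ Over.mk U.ι) (x : X.obj (op V)),
      formalLine.map f.left.op (α v x) = α (f ≫ v) (X.map f.op x)) : infFunctions X n U :=
  ⟨fun T x => (α (Over.homMk T.hom : (Over.map U.ι).obj T ⟶ Over.mk U.ι) x.1).1,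
    fun T T' g x => by
      have h := hα ((Over.map U.ι).map g)
        (Over.homMk T.hom : (Over.map U.ι).obj T ⟶ Over.mk U.ι) x.1
      have hg : (Over.map U.ι).map g ≫ (Over.homMk T.hom : (Over.map U.ι).obj T ⟶ Over.mk U.ι) =
          Over.homMk T'.hom := by
        ext
        simp
      rw [hg] at h
      exact congrArg Subtype.val h.symm⟩

lemma infLine_mem (α : ∀ ⦃V : Over S⦄ (_ : V ⟶ Over.mk U.ι), X.obj (op V) →
      formalLine.obj (op V.left))
    (hα : ∀ ⦃V V' : Over S⦄ (f : V' ⟶ V) (v : V ⟶ Over.mk U.ι) (x : X.obj (op V)),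
      formalLine.map f.left.op (α v x) = α (f ≫ v) (X.map f.op x))
    (h0 : ∀ ⦃V : Over S⦄ (v : V ⟶ Over.mk U.ι), α v 0 = formalLineZero _) :
    infLine α hα ∈ augIdeal X n U := fun T x hx => by
  have := congrArg Subtype.val (h0 (Over.homMk T.hom : (Over.map U.ι).obj T ⟶ Over.mk U.ι))
  rw [← hx] at this
  exact this

variable {A : CommRingCat.{u}} {j : Spec A ⟶ (U : Scheme.{u})}

/-- The morphism to the base of a chart over an affine scheme over `U`. -/
def overPt {T : Over (U : Scheme.{u})} (t : T.left ⟶ Spec A) (ht : t ≫ j = T.hom) :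
    (Over.map U.ι).obj T ⟶ Over.mk (j ≫ U.ι) :=
  Over.homMk t (by simp [← ht])

/-- A function on `X⁽ⁿ⁾` is a truncated power series in the coordinate. -/
lemma Chart.exists_infEval_eq (c : Chart X (Over.mk (j ≫ U.ι))) (f : infFunctions X n U) :
    ∃ s : PowerSeries A, ∀ (T : Over (U : Scheme.{u}))
      (x : (infNeighbourhood X n).obj (op ((Over.map U.ι).obj T))) (t : T.left ⟶ Spec A)
      (ht : t ≫ j = T.hom) (R : CommRingCat.{u}) (g : Spec R ⟶ T.left),
      infEval x g f = nilEval (ptHom (g ≫ t)) s (c.val (overPt t ht) g x.1) := by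
  let Q : Polynomial A := Polynomial.X ^ (n + 1)
  let B : CommRingCat.{u} := .of (AdjoinRoot Q)
  let k : A ⟶ B := CommRingCat.ofHom (AdjoinRoot.of Q)
  let r : B := AdjoinRoot.root Q
  have hr : r ^ (n + 1) = 0 := by
    have := AdjoinRoot.mk_self (f := Q)
    rwa [map_pow, AdjoinRoot.mk_X] at this
  let T₀ : Over (U : Scheme.{u}) := Over.mk (Spec.map k ≫ j)
  let v₀ : (Over.map U.ι).obj T₀ ⟶ Over.mk (j ≫ U.ι) := overPt (T := T₀) (Spec.map k) rfl
  let a₀ : formalLine.obj (op (Spec B)) := Scheme.specPt r ⟨_, hr⟩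
  have hx₀ : c.pt v₀ a₀ ∈ (infNeighbourhood X n).obj (op ((Over.map U.ι).obj T₀)) := by
    rw [c.mem_infNeighbourhood_iff n v₀, c.coord_pt]
    exact (map_pow (ΓSpecIso B).inv.hom r (n + 1)).symm.trans ((congrArg _ hr).trans (map_zero _))
  obtain ⟨s, hs⟩ := AdjoinRoot.mk_surjective (g := Q)
    (infEval (T := T₀) ⟨_, hx₀⟩ (𝟙 (Spec B)) f)
  refine ⟨s, fun T x t ht R g => ?_⟩
  let a : R := c.val (overPt t ht) g x.1
  have ha : a ^ (n + 1) = 0 := by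
    have h := (c.mem_infNeighbourhood_iff n (overPt t ht) x.1).1 x.2
    exact (map_pow (evalPt g) _ _).symm.trans ((congrArg _ h).trans (map_zero _))
  have hQ : Q.eval₂ (ptHom (g ≫ t)) a = 0 := by simpa [Q] using ha
  let ψ : B ⟶ R := CommRingCat.ofHom (AdjoinRoot.lift (ptHom (g ≫ t)) a hQ)
  have hψr : ψ r = a := AdjoinRoot.lift_root hQ
  have hψ : Spec.map ψ ≫ Spec.map k = g ≫ t := by
    rw [← Spec.map_comp, ← Spec.map_preimage (g ≫ t)]
    congr 1
    ext y
    exact AdjoinRoot.lift_of hQ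
  let T₁ : Over (U : Scheme.{u}) := Over.mk (g ≫ T.hom)
  let k₁ : T₁ ⟶ T := Over.homMk g
  let k₀ : T₁ ⟶ T₀ := Over.homMk (Spec.map ψ) (by
    change Spec.map ψ ≫ Spec.map k ≫ j = g ≫ T.hom
    rw [← Category.assoc, hψ, Category.assoc, ht])
  have h1 := f.2 k₁ x
  have h0 := f.2 k₀ ⟨_, hx₀⟩
  have hpt : X.map ((Over.map U.ι).map k₁).op x.1 =
      X.map ((Over.map U.ι).map k₀).op (c.pt v₀ a₀) := by
    have hv : (Over.map U.ι).map k₀ ≫ v₀ = (Over.map U.ι).map k₁ ≫ overPt t ht := by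
      ext
      exact hψ
    refine (c.bijective ((Over.map U.ι).map k₀ ≫ v₀)).1 ?_
    rw [← c.map_coord, coord_pt, hv, ← c.map_coord]
    refine ext_lineVal_id ?_
    refine (lineVal_comp (𝟙 (Spec R)) g (c.coord (overPt t ht) x.1)).symm.trans
      (Eq.trans ?_ (lineVal_comp (𝟙 (Spec R)) (Spec.map ψ) a₀))
    refine (congrArg (lineVal · (c.coord (overPt t ht) x.1)) (Category.id_comp g)).trans ?_
    refine Eq.trans ?_ (congrArg (lineVal · a₀) (Category.id_comp (Spec.map ψ))).symm
    exact (hψr.symm.trans (lineVal_specPt ψ r ⟨_, hr⟩).symm)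
  have hE : f.1 T₁ ⟨_, (infNeighbourhood X n).map _ x.2⟩ =
      f.1 T₁ ⟨_, (infNeighbourhood X n).map ((Over.map U.ι).map k₀).op hx₀⟩ :=
    congrArg (f.1 T₁) (Subtype.ext hpt)
  have hev : evalPt g (f.1 T x) = evalPt (Spec.map ψ) (f.1 T₀ ⟨_, hx₀⟩) := by
    have e1 := evalPt_comp (𝟙 (Spec R)) g (f.1 T x)
    have e0 := evalPt_comp (𝟙 (Spec R)) (Spec.map ψ) (f.1 T₀ ⟨_, hx₀⟩)
    rw [Category.id_comp] at e1 e0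
    exact e1.trans ((congrArg (evalPt (𝟙 (Spec R))) (h1.symm.trans (hE.trans h0))).trans e0.symm)
  refine hev.trans ?_
  have e2 := evalPt_specMap (𝟙 (Spec B)) ψ (f.1 T₀ ⟨_, hx₀⟩)
  rw [Category.comp_id] at e2
  refine e2.trans ((congrArg ψ hs.symm).trans ?_)
  rw [PowerSeries.nilEval_coe_polynomial _ _ ha]
  exact AdjoinRoot.lift_mk hQ s

lemma Chart.exists_infEval_eq_of_mem (c : Chart X (Over.mk (j ≫ U.ι))) {f : infFunctions X n U}
    (hf : f ∈ augIdeal X n U) : ∃ s : PowerSeries A, constantCoeff s = 0 ∧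
      ∀ (T : Over (U : Scheme.{u}))
      (x : (infNeighbourhood X n).obj (op ((Over.map U.ι).obj T))) (t : T.left ⟶ Spec A)
      (ht : t ≫ j = T.hom) (R : CommRingCat.{u}) (g : Spec R ⟶ T.left),
      infEval x g f = nilEval (ptHom (g ≫ t)) s (c.val (overPt t ht) g x.1) := by
  obtain ⟨s, hs⟩ := c.exists_infEval_eq f
  refine ⟨s, ?_, hs⟩
  let T₀ : Over (U : Scheme.{u}) := Over.mk j
  let v₀ : (Over.map U.ι).obj T₀ ⟶ Over.mk (j ≫ U.ι) := overPt (T := T₀) (𝟙 _) (Category.id_comp j)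
  have hx : (0 : X.obj (op ((Over.map U.ι).obj T₀))) ∈
      (infNeighbourhood X n).obj (op ((Over.map U.ι).obj T₀)) := by
    rw [c.mem_infNeighbourhood_iff n v₀, c.coord_zero]
    exact zero_pow (Nat.succ_ne_zero n)
  have h := hs T₀ ⟨0, hx⟩ (𝟙 _) (Category.id_comp j) A (𝟙 _)
  have hid : ptHom (𝟙 (Spec A) ≫ 𝟙 (Spec A)) = RingHom.id A := by
    rw [Category.comp_id, ← Spec.map_id, ptHom_specMap]
    rfl
  have h1 : nilEval (ptHom (𝟙 (Spec A) ≫ 𝟙 (Spec A))) s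
      (c.val v₀ (𝟙 (Spec A)) 0) = constantCoeff s := by
    rw [hid, c.val_zero, nilEval_zero]
    rfl
  have h0 : infEval (T := T₀) ⟨0, hx⟩ (𝟙 (Spec A)) f = 0 :=
    (congrArg (evalPt (𝟙 (Spec A))) (hf T₀ ⟨0, hx⟩ rfl)).trans (map_zero _)
  exact h1.symm.trans (h.symm.trans h0)

/-- Multiplication by `p` on `X⁽ⁿ⁾` when the first `n` coefficients of its series vanish. -/
lemma Chart.exists_infEval_pullbackMul (c : Chart X (Over.mk (j ≫ U.ι))) {F : FormalGroup A}
    (hF : c.IsLaw F) (p : ℕ) (hn : 1 ≤ n)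
    (hp : ∀ i < n, coeff i (F.mulSeries p) = 0) {f : infFunctions X n U}
    (hf : f ∈ augIdeal X n U) : ∃ s : A, (∀ (T : Over (U : Scheme.{u}))
      (x : (infNeighbourhood X n).obj (op ((Over.map U.ι).obj T))) (t : T.left ⟶ Spec A)
      (ht : t ≫ j = T.hom) (R : CommRingCat.{u}) (g : Spec R ⟶ T.left),
      infEval x g (pullbackMul p f) =
        ptHom (g ≫ t) (s * coeff n (F.mulSeries p)) *
          c.val (overPt t ht) g x.1 ^ n) ∧
      ∀ (T : Over (U : Scheme.{u}))
      (x : (infNeighbourhood X n).obj (op ((Over.map U.ι).obj T))) (t : T.left ⟶ Spec A)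
      (ht : t ≫ j = T.hom) (R : CommRingCat.{u}) (g : Spec R ⟶ T.left),
      c.val (overPt t ht) g x.1 ^ 2 = 0 →
        infEval x g f = ptHom (g ≫ t) s * c.val (overPt t ht) g x.1 := by
  obtain ⟨s, hs0, hs⟩ := c.exists_infEval_eq_of_mem hf
  have hs2 {R : CommRingCat.{u}} (φ : A →+* R) (y : R) (hy : y ^ 2 = 0) :
      nilEval φ s y = φ (coeff 1 s) * y := by
    rw [nilEval_eq_sum φ s hy, Finset.sum_range_succ, Finset.sum_range_one]
    simp [hs0]
  refine ⟨coeff 1 s, fun T x t ht R g => ?_, fun T x t ht R g h2 => ?_⟩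
  · have ha : c.val (overPt t ht) g x.1 ^ (n + 1) = 0 := by
      have h := (c.mem_infNeighbourhood_iff n (overPt t ht) x.1).1 x.2
      exact (map_pow (evalPt g) _ _).symm.trans ((congrArg _ h).trans (map_zero _))
    have h := hs T ⟨p • x.1, nsmul_mem_infNeighbourhood p x.2⟩ t ht R g
    have hm : c.val (overPt t ht) g (p • x.1) =
        ptHom (g ≫ t) (coeff n (F.mulSeries p)) * c.val (overPt t ht) g x.1 ^ n := by
      refine (hF.val_nsmul p (overPt t ht) x.1 g).trans ?_
      rw [nilEval_eq_sum _ _ ha, Finset.sum_range_succ,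
        Finset.sum_eq_zero fun i hi => by rw [hp i (Finset.mem_range.1 hi), map_zero, zero_mul],
        zero_add]
      rfl
    refine h.trans ?_
    rw [hm, hs2 _ _ ?_, map_mul, mul_assoc]
    rw [mul_pow, ← pow_mul, pow_eq_zero_of_le (by omega) ha, mul_zero]
  · rw [hs T x t ht R g, hs2 _ _ h2]

/-- If `X` has height at least `h`, the first `p ^ h` coefficients of the series of the pullback of a
function along multiplication by `p` vanish. -/
lemma Chart.coeff_subst_mulSeries_eq_zero {p h : ℕ} (hU : IsAffineOpen U)
    (hX : HasHeightGE X p h) (c : Chart X (Over.mk (j ≫ U.ι))) {F : FormalGroup A}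
    (hF : c.IsLaw F) {e : infFunctions X (p ^ h) U} (he : e ∈ augIdeal X (p ^ h) U)
    {s : PowerSeries A} (hs : ∀ (T : Over (U : Scheme.{u}))
      (x : (infNeighbourhood X (p ^ h)).obj (op ((Over.map U.ι).obj T))) (t : T.left ⟶ Spec A)
      (ht : t ≫ j = T.hom) (R : CommRingCat.{u}) (g : Spec R ⟶ T.left),
      infEval x g e = nilEval (ptHom (g ≫ t)) s (c.val (overPt t ht) g x.1)) (i : ℕ)
    (hi : i < p ^ h) : coeff i (PowerSeries.subst (F.mulSeries p) s) = 0 := by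
  let q := p ^ h
  let Q : Polynomial A := Polynomial.X ^ q
  let B : CommRingCat.{u} := .of (AdjoinRoot Q)
  let k : A ⟶ B := CommRingCat.ofHom (AdjoinRoot.of Q)
  let r : B := AdjoinRoot.root Q
  have hr : r ^ q = 0 := by
    have := AdjoinRoot.mk_self (f := Q)
    rwa [map_pow, AdjoinRoot.mk_X] at this
  let T₀ : Over (U : Scheme.{u}) := Over.mk (Spec.map k ≫ j)
  let v₀ : (Over.map U.ι).obj T₀ ⟶ Over.mk (j ≫ U.ι) := overPt (T := T₀) (Spec.map k) rfl
  let a₀ : formalLine.obj (op (Spec B)) := Scheme.specPt r ⟨_, hr⟩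
  have hx₀ : c.pt v₀ a₀ ∈ (infNeighbourhood X q).obj (op ((Over.map U.ι).obj T₀)) := by
    rw [c.mem_infNeighbourhood_iff q v₀, c.coord_pt]
    refine (map_pow (ΓSpecIso B).inv.hom r (q + 1)).symm.trans ((congrArg _ ?_).trans (map_zero _))
    rw [pow_succ, hr, zero_mul]
  have hval : c.val v₀ (𝟙 (Spec B)) (c.pt v₀ a₀) = r := by
    rw [Chart.val, c.coord_pt]
    exact lineVal_id_specPt _ _
  let ev := infEval (T := T₀) ⟨_, hx₀⟩ (𝟙 (Spec B))
  have hev (f : infFunctions X q U) (hf : f ∈ augIdeal X q U) : ev f ∈ Ideal.span {r} := by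
    obtain ⟨s, hs0, hs⟩ := c.exists_infEval_eq_of_mem hf
    refine (hs T₀ ⟨_, hx₀⟩ (Spec.map k) rfl B (𝟙 _)).symm ▸ ?_
    refine nilEval_mem _ hs0 (c.isNilpotent_val _ _ _) ?_
    change c.val v₀ (𝟙 (Spec B)) (c.pt v₀ a₀) ∈ _
    rw [hval]
    exact Ideal.mem_span_singleton_self r
  have h0 : ev (pullbackMul p e) = 0 := by
    have h1 := Ideal.mem_map_of_mem ev (hX ⟨U, hU⟩ e he)
    rw [Ideal.map_pow] at h1
    have h2 := Ideal.pow_right_mono (Ideal.map_le_iff_le_comap.2 fun f hf => hev f hf :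
      Ideal.map ev (augIdeal X q U) ≤ Ideal.span {r}) q h1
    rwa [Ideal.span_singleton_pow, hr, Ideal.span_singleton_zero, Ideal.mem_bot] at h2
  have h3 : ev (pullbackMul p e) =
      nilEval k.hom (PowerSeries.subst (F.mulSeries p) s) r := by
    have hk : ptHom (𝟙 (Spec B) ≫ Spec.map k) = k.hom :=
      (congrArg ptHom (Category.id_comp (Spec.map k))).trans (ptHom_specMap k)
    have h5 : c.val v₀ (𝟙 (Spec B)) (p • c.pt v₀ a₀) =
        nilEval k.hom (F.mulSeries p) r := by
      rw [hF.val_nsmul, hval]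
      exact congrArg (nilEval · (F.mulSeries p) r) hk
    refine (hs T₀ ⟨_, nsmul_mem_infNeighbourhood p hx₀⟩ (Spec.map k) rfl B (𝟙 _)).trans ?_
    rw [nilEval_subst k.hom ⟨_, hr⟩ (F.constantCoeff_mulSeries p), hk]
    exact congrArg (nilEval k.hom s) h5
  rw [h0, nilEval_eq_sum _ _ hr] at h3
  have h5 : AdjoinRoot.mk Q (∑ i ∈ Finset.range q, Polynomial.C (coeff i
      (PowerSeries.subst (F.mulSeries p) s)) * Polynomial.X ^ i) = 0 := by
    rw [h3, map_sum]
    refine Finset.sum_congr rfl fun i _ => ?_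
    rw [map_mul, map_pow, AdjoinRoot.mk_X]
    rfl
  rw [AdjoinRoot.mk_eq_zero, Polynomial.X_pow_dvd_iff] at h5
  have h6 := h5 i hi
  rw [Polynomial.finsetSum_coeff, Finset.sum_eq_single_of_mem i (Finset.mem_range.2 hi)
    fun b _ hb => by simp [Polynomial.coeff_X_pow, hb.symm]] at h6
  simpa using h6

/-- The series of multiplication by `p` for a formal Lie group of height at least `h`. -/
lemma Chart.coeff_mulSeries_eq_zero (c : Chart X (Over.mk U.ι)) {p h : ℕ} (hU : IsAffineOpen U)
    (hX : HasHeightGE X p h) {F : FormalGroup A}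
    (hF : (c.restrict (Over.homMk j : Over.mk (j ≫ U.ι) ⟶ Over.mk U.ι)).IsLaw F) (i : ℕ)
    (hi : i < p ^ h) : coeff i (F.mulSeries p) = 0 := by
  let c' := c.restrict (Over.homMk j : Over.mk (j ≫ U.ι) ⟶ Over.mk U.ι)
  have h1 := c'.coeff_subst_mulSeries_eq_zero hU hX hF (s := PowerSeries.X)
    (infLine_mem c.coord c.map_coord c.coord_zero) (fun T x t ht R g => ?_) i hi
  · rwa [PowerSeries.subst_X (PowerSeries.HasSubst.of_constantCoeff_zero'
      (F.constantCoeff_mulSeries p))] at h1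
  · rw [nilEval_X _ (c'.isNilpotent_val _ _ _)]
    have hv : overPt t ht ≫ (Over.homMk j : Over.mk (j ≫ U.ι) ⟶ Over.mk U.ι) =
        Over.homMk T.hom := by
      ext
      exact ht
    exact congrArg (fun v : (Over.map U.ι).obj T ⟶ Over.mk U.ι => lineVal g (c.coord v x.1)) hv.symm

end

end

noncomputable section

open AlgebraicGeometry.Scheme

/-! ### Heights and the coefficients of the multiplication series -/

lemma FormalGroup.coeff_one_mulSeries {A : Type*} [CommRing A] (F : FormalGroup A) (m : ℕ) :
    coeff 1 (F.mulSeries m) = m := by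
  let φ : A →+* DualNumber A := algebraMap A (DualNumber A)
  have he : (DualNumber.eps : DualNumber A) ^ 2 = 0 := by rw [pow_two, DualNumber.eps_mul_eps]
  have h (m : ℕ) : nilEval φ (F.mulSeries m) DualNumber.eps =
      m * (DualNumber.eps : DualNumber A) := by
    induction m with
    | zero =>
      rw [Nat.cast_zero, zero_mul, nilEval_eq_sum φ _ he]
      simp [FormalGroup.mulSeries]
    | succ m ih =>
      rw [F.nilEval_mulSeries_succ φ m ⟨2, he⟩, ih]
      have h1 := F.nilAdd_sub_mem φ (x := m * (DualNumber.eps : DualNumber A))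
        (y := DualNumber.eps) ⟨2, by rw [mul_pow, he, mul_zero]⟩ ⟨2, he⟩
      rw [mul_assoc, DualNumber.eps_mul_eps, mul_zero, Ideal.span_singleton_zero,
        Ideal.mem_bot] at h1
      push_cast
      linear_combination h1
  have h2 := h m
  rw [nilEval_eq_sum φ _ he, Finset.sum_range_succ, Finset.sum_range_one, pow_zero,
    pow_one, coeff_zero_eq_constantCoeff_apply, F.constantCoeff_mulSeries, map_zero,
    zero_mul, _root_.zero_add] at h2
  simpa [φ, TrivSqZeroExt.algebraMap_eq_inl] using congrArg TrivSqZeroExt.snd h2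

section

variable {S S' : Scheme.{u}} {X : (Over S)ᵒᵖ ⥤ AddCommGrpCat.{u}} {n : ℕ} {U : S.Opens}

lemma infEval_infConst {T : Over (U : Scheme.{u})}
    (x : (infNeighbourhood X n).obj (op ((Over.map U.ι).obj T))) {R : CommRingCat.{u}}
    (g : Spec R ⟶ T.left) {A : CommRingCat.{u}} (j : Spec A ⟶ (U : Scheme.{u})) [IsIso j]
    (t : T.left ⟶ Spec A) (ht : t ≫ j = T.hom) (b : A) :
    infEval x g (infConst ((inv j).appTop ((ΓSpecIso A).inv b))) = ptHom (g ≫ t) b := by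
  have h : T.hom ≫ inv j = t := by rw [← ht, Category.assoc, IsIso.hom_inv_id, Category.comp_id]
  have h1 : infEval x g (infConst ((inv j).appTop ((ΓSpecIso A).inv b))) =
      evalPt (g ≫ T.hom ≫ inv j) ((ΓSpecIso A).inv b) := by
    refine Eq.trans ?_ (evalPt_comp g (T.hom ≫ inv j) _).symm
    rw [Scheme.Hom.comp_appTop]
    rfl
  rw [h1, h]
  have h2 := evalPt_specMap (𝟙 (Spec A)) (Spec.preimage (g ≫ t)) ((ΓSpecIso A).inv b)
  rw [Category.comp_id, Spec.map_preimage] at h2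
  rw [h2]
  refine congrArg (Spec.preimage (g ≫ t)) ?_
  rw [evalPt, Scheme.Hom.id_appTop, Category.id_comp]
  exact (ΓSpecIso A).inv_hom_id_apply b

variable {A : CommRingCat.{u}}

/-- Multiplication by `p` when the first coefficients of its series vanish. -/
lemma Chart.pullbackMul_mem {j : Spec A ⟶ (U : Scheme.{u})} [IsIso j] (c : Chart X (Over.mk U.ι))
    {F : FormalGroup A}
    (hF : (c.restrict (Over.homMk j : Over.mk (j ≫ U.ι) ⟶ Over.mk U.ι)).IsLaw F) (p : ℕ)
    (hn : 1 ≤ n) (hp : ∀ i < n, coeff i (F.mulSeries p) = 0) {f : infFunctions X n U}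
    (hf : f ∈ augIdeal X n U) : pullbackMul p f ∈ augIdeal X n U ^ n := by
  obtain ⟨s, hs, -⟩ := Chart.exists_infEval_pullbackMul _ hF p hn hp hf
  have h : pullbackMul p f = infConst ((inv j).appTop ((ΓSpecIso A).inv
      (s * coeff n (F.mulSeries p)))) * infLine c.coord c.map_coord ^ n := by
    refine infFunctions_ext fun T x R g => ?_
    have ht : (T.hom ≫ inv j) ≫ j = T.hom := by simp
    rw [hs T x _ ht R g, map_mul (infEval x g), map_pow (infEval x g), infEval_infConst x g j _ ht]
    congr 2
    have hv : overPt _ ht ≫ (Over.homMk j : Over.mk (j ≫ U.ι) ⟶ Over.mk U.ι) =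
        Over.homMk T.hom := by
      ext
      exact ht
    exact congrArg (fun v : (Over.map U.ι).obj T ⟶ Over.mk U.ι => lineVal g (c.coord v x.1)) hv
  rw [h]
  exact Ideal.mul_mem_left _ _ (Ideal.pow_mem_pow (infLine_mem _ _ c.coord_zero) n)

lemma Chart.IsLaw.restrict {j : Spec A ⟶ S} {c : Chart X (Over.mk j)} {F : FormalGroup A}
    (h : c.IsLaw F) {B : CommRingCat.{u}} {i : Spec B ⟶ S} (f : Over.mk i ⟶ Over.mk j) :
    (c.restrict f).IsLaw (F.map (ptHom f.left)) := fun V v x y R g => by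
  rw [FormalGroup.nilAdd_map, ← ptHom_comp, Category.assoc]
  exact h (v ≫ f) x y R g

lemma Chart.IsLaw.pullback {f : S' ⟶ S} {j : Spec A ⟶ S'}
    {c : Chart X ((Over.map f).obj (Over.mk j))} {F : FormalGroup A}
    (h : Chart.IsLaw (j := j ≫ f) c F) : (c.pullback f).IsLaw F := fun _ v x y R g =>
  h ((Over.map f).map v) x y R g

/-- The series of multiplication by `p` for a formal Lie group of height `h`. -/
lemma Chart.isUnit_coeff_mulSeries {p h : ℕ} [Fact p.Prime] (hh : 1 ≤ h) (hX : HasHeight X p h)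
    {j : Spec A ⟶ S} (c : Chart X (Over.mk j)) {F : FormalGroup A} [F.IsComm] (hF : c.IsLaw F)
    (h0 : ∀ i < p ^ h, coeff i (F.mulSeries p) = 0) :
    IsUnit (coeff (p ^ h) (F.mulSeries p)) := by
  have hp1 : 1 < p := (Fact.out : p.Prime).one_lt
  set a := coeff (p ^ h) (F.mulSeries p)
  let B : CommRingCat.{u} := .of (A ⧸ Ideal.span {a})
  let π : A ⟶ B := CommRingCat.ofHom (Ideal.Quotient.mk _)
  let f : Spec B ⟶ S := Spec.map π ≫ j
  suffices hT : IsEmpty (Spec B) by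
    have : Subsingleton B := by
      rw [← not_nontrivial_iff_subsingleton]
      intro hB
      exact hT.elim (Classical.arbitrary (PrimeSpectrum B))
    rw [← Ideal.span_singleton_eq_top]
    exact Ideal.Quotient.subsingleton_iff.1 this
  refine hX.2 (Spec B) f fun W f' hf' => ?_
  obtain ⟨W, hW⟩ := W
  have : IsAffine (W : Scheme.{u}) := hW
  let c₁ : Chart X ((Over.map f).obj (Over.mk W.ι)) :=
    c.restrict (Over.homMk (W.ι ≫ Spec.map π) (by simp [f]))
  let i : Spec Γ(W, ⊤) ⟶ (W : Scheme.{u}) := (W : Scheme.{u}).isoSpec.inv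
  let F' := F.map (ptHom (i ≫ W.ι ≫ Spec.map π))
  have hF' : ((c₁.pullback f).restrict
      (Over.homMk i : Over.mk (i ≫ W.ι) ⟶ Over.mk W.ι)).IsLaw F' := fun V v x y R g => by
    have h1 := (hF.restrict (i := (i ≫ W.ι) ≫ f)
      (Over.homMk (i ≫ W.ι ≫ Spec.map π) (by simp [f]))) ((Over.map f).map v) x y R g
    have hv : (Over.map f).map v ≫ (Over.homMk (i ≫ W.ι ≫ Spec.map π) (by simp [f]) :
        Over.mk ((i ≫ W.ι) ≫ f) ⟶ Over.mk j) = (Over.map f).map (v ≫ (Over.homMk i : Over.mk (i ≫ W.ι) ⟶ Over.mk W.ι)) ≫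
          (Over.homMk (W.ι ≫ Spec.map π) (by simp [f])) := by
      ext
      simp
    dsimp only [Chart.restrict, Chart.val] at h1
    rw [hv] at h1
    exact h1
  refine (c₁.pullback f).pullbackMul_mem hF' p (Nat.one_le_pow _ _ hp1.le) ?_ hf'
  intro k hk
  have hm : PowerSeries.map π.hom (F.mulSeries p) = (F.map π.hom).mulSeries p :=
    (F.map_mulSeries π.hom p).symm
  have hpB : (p : B) = 0 := by
    have h1 : (p : A) = 0 := by
      rw [← F.coeff_one_mulSeries]
      exact h0 1 (Nat.one_lt_pow (by omega) hp1)
    have := congrArg π.hom h1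
    rwa [map_natCast, map_zero] at this
  have : (F.map π.hom).IsComm := inferInstance
  have hkB : coeff k ((F.map π.hom).mulSeries p) = 0 := by
    by_cases hk0 : k = 0
    · rw [hk0, coeff_zero_eq_constantCoeff_apply, FormalGroup.constantCoeff_mulSeries]
    · refine FormalGroup.IsHom.coeff_eq_zero hpB h
        (FormalGroup.isHom_mulSeries (F.map π.hom) p) (fun l hl => ?_) k
        fun hd => absurd (Nat.le_of_dvd (Nat.pos_of_ne_zero hk0) hd) (by omega)
      rw [← hm, coeff_map]
      rcases hl.lt_or_eq with hl | rfl
      · rw [h0 l hl, map_zero]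
      · exact Ideal.Quotient.eq_zero_iff_mem.2 (Ideal.mem_span_singleton_self a)
  rw [FormalGroup.map_mulSeries, ← Category.assoc, ptHom_comp, ptHom_specMap, coeff_map,
    RingHom.comp_apply, ← coeff_map, hm, hkB, map_zero]

end

end

noncomputable section

open AlgebraicGeometry.Scheme

/-! ### Gluing charts -/

lemma Presieve'.isSheaf_of_locally {C : Type u} [Category.{v} C] {J K : GrothendieckTopology C}
    {P : Cᵒᵖ ⥤ Type w} (hP : Presieve.IsSheaf K P) (h : ∀ V : C, ∃ Q ∈ K V, ∀ ⦃W : C⦄ (q : W ⟶ V),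
      Q q → ∀ R ∈ J W, Presieve.IsSheafFor P (R : Presieve W)) : Presieve.IsSheaf J P := by
  intro V R hR
  obtain ⟨Q, hQ, hQJ⟩ := h V
  have hmap {V₁ V₂ V₃ : C} (f : V₂ ⟶ V₁) (g : V₃ ⟶ V₂) (x : P.obj (op V₁)) :
      P.map g.op (P.map f.op x) = P.map (g ≫ f).op x := (Functor.map_comp_apply P f.op g.op x).symm
  rw [← Presieve.isSeparatedFor_and_exists_isAmalgamation_iff_isSheafFor]
  refine ⟨fun x t₁ t₂ h₁ h₂ => ext_of_cover hP hQ fun W q hq =>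
    (hQJ q hq _ (J.pullback_stable q hR)).isSeparatedFor.ext fun W' g hg => ?_, fun x hx => ?_⟩
  · rw [hmap, hmap, h₁ _ hg, h₂ _ hg]
  · rw [Presieve.compatible_iff_sieveCompatible] at hx
    have hx' {V₁ V₂ : C} (f : V₁ ⟶ V) (hf : R f) (g : V₂ ⟶ V₁) :
        P.map g.op (x f hf) = x (g ≫ f) (R.downward_closed hf g) := (hx f g hf).symm
    have hq {W : C} (q : W ⟶ V) (hq : Q q) : ∃ t : P.obj (op W), ∀ ⦃W' : C⦄ (g : W' ⟶ W)
        (hg : R (g ≫ q)), P.map g.op t = x (g ≫ q) hg := by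
      obtain ⟨t, ht, -⟩ := hQJ q hq _ (J.pullback_stable q hR) (fun W' g hg => x (g ≫ q) hg)
        ((Presieve.compatible_iff_sieveCompatible _).2 fun W₁ W₂ f g hf => by
          refine Eq.trans ?_ (hx' (f ≫ q) hf g).symm
          congr 1
          exact Category.assoc _ _ _)
      exact ⟨t, fun W' g hg => ht g hg⟩
    choose t ht using @hq
    obtain ⟨y, hy⟩ := exists_glue hP hQ (fun W q hq => t q hq) fun W W' q hq g =>
      (hQJ _ (Q.downward_closed hq g) _ (J.pullback_stable (g ≫ q) hR)).isSeparatedFor.ext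
        fun W'' k hk => by
          rw [hmap, ht _ _ _ hk, ht _ _ _ (by simpa using hk)]
          congr 1
          exact Category.assoc _ _ _
    refine ⟨y, fun W f hf => ext_of_cover hP (K.pullback_stable f hQ) fun W' g hg => ?_⟩
    have h1 := ht (g ≫ f) hg (𝟙 W') (by simpa using R.downward_closed hf g)
    rw [hmap, hy _ hg, hx' _ hf]
    rw [op_id, Functor.map_id_apply] at h1
    rw [h1]
    congr 1
    exact Category.id_comp _

namespace AlgebraicGeometry.Scheme

lemma mem_zariskiTopology_of_opens {T : Scheme.{u}} (R : Sieve T)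
    (hR : ∀ x : T, ∃ U : T.Opens, x ∈ U ∧ R U.ι) : R ∈ zariskiTopology T := by
  choose U hU hRU using hR
  refine zariskiTopology.superset_covering ?_ (T.openCoverOfIsOpenCover U
    (TopologicalSpace.IsOpenCover.mk
      (eq_top_iff.2 fun x _ => TopologicalSpace.Opens.mem_iSup.2
        ⟨x, hU x⟩))).mem_grothendieckTopology
  rw [Sieve.generate_le_iff]
  rintro _ _ ⟨i⟩
  exact hRU i

lemma zariskiTopology_le_fppfTopology : zariskiTopology.{u} ≤ fppfTopology :=
  Precoverage.toGrothendieck_mono zariskiPrecoverage_le_fppfPrecoverage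

lemma isSheaf_formalLine_over (S : Scheme.{u}) :
    Presieve.IsSheaf (fpqcTopology.over S) ((Over.forget S).op ⋙ formalLine) :=
  (Over.forget S).op_comp_isSheaf_of_isSheaf_type (J := fpqcTopology.over S) (K := fpqcTopology)
    isSheaf_formalLine

end AlgebraicGeometry.Scheme

section

variable {S : Scheme.{u}} {X : (Over S)ᵒᵖ ⥤ AddCommGrpCat.{u}} {T : Over S}

lemma Chart.isSheafFor (c : Chart X T) {R : Sieve T} (hR : R ∈ fpqcTopology.over S T) :
    Presieve.IsSheafFor (X ⋙ CategoryTheory.forget _) (R : Presieve T) := by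
  have hF := isSheaf_formalLine_over S
  rw [← Presieve.isSeparatedFor_and_exists_isAmalgamation_iff_isSheafFor]
  refine ⟨fun x t₁ t₂ h₁ h₂ => (c.bijective (𝟙 T)).1 ?_, fun x hx => ?_⟩
  · refine Presieve'.ext_of_cover hF hR fun V f hf => ?_
    refine (c.map_coord f (𝟙 T) t₁).trans (Eq.trans ?_ (c.map_coord f (𝟙 T) t₂).symm)
    exact congrArg (c.coord _) ((h₁ f hf).trans (h₂ f hf).symm)
  · rw [Presieve.compatible_iff_sieveCompatible] at hx
    obtain ⟨a, ha⟩ := Presieve'.exists_glue hF hR (fun V f hf => c.coord f (x f hf))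
      fun V W f hf g => (c.map_coord g f (x f hf)).trans (congrArg (c.coord _) (hx f g hf).symm)
    refine ⟨c.pt (𝟙 T) a, fun V f hf => (c.bijective f).1 ?_⟩
    refine Eq.trans ?_ (ha f hf)
    refine Eq.trans ?_ ((c.map_coord f (𝟙 T) (c.pt (𝟙 T) a)).symm.trans
      (congrArg (formalLine.map f.left.op) (c.coord_pt (𝟙 T) a)))
    rw [Category.comp_id]
    rfl

/-- An fppf sheaf with local charts is an fpqc sheaf. -/
lemma isSheaf_fpqc_of_charts
    (hX : Presieve.IsSheaf (fppfTopology.over S) (X ⋙ CategoryTheory.forget _))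
    (h : ∀ s : S, ∃ U : S.Opens, s ∈ U ∧ Nonempty (Chart X (Over.mk U.ι))) :
    Presieve.IsSheaf (fpqcTopology.over S) (X ⋙ CategoryTheory.forget _) := by
  refine Presieve'.isSheaf_of_locally hX fun V => ?_
  let Q : Sieve V :=
    { arrows := fun W _ => Nonempty (Chart X W)
      downward_closed := fun ⟨c⟩ g => ⟨c.restrict g⟩ }
  refine ⟨Q, ?_, fun W q ⟨c⟩ R hR => c.isSheafFor hR⟩
  rw [GrothendieckTopology.mem_over_iff]
  refine zariskiTopology_le_fppfTopology _ (mem_zariskiTopology_of_opens _ fun x => ?_)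
  obtain ⟨U, hU, ⟨c⟩⟩ := h (V.hom x)
  refine ⟨V.hom ⁻¹ᵁ U, hU, (Sieve.overEquiv_iff Q _).2 ?_⟩
  exact ⟨c.restrict (Over.homMk (V.hom ∣_ U) (by simp))⟩

/-- Descent of maps from `X` to the formal line. -/
lemma exists_glue_coord {R : Sieve T} (hR : R ∈ fpqcTopology.over S T)
    {A : ∀ ⦃V : Over S⦄, (V ⟶ T) → Type*}
    (res : ∀ ⦃V W : Over S⦄ (g : W ⟶ V) (v : V ⟶ T), A v → A (g ≫ v))
    (hA : ∀ ⦃V : Over S⦄ (v : V ⟶ T), R v → Nonempty (A v))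
    (K : ∀ ⦃V : Over S⦄ (v : V ⟶ T), A v → X.obj (op V) → formalLine.obj (op V.left))
    (hK : ∀ ⦃V : Over S⦄ (v : V ⟶ T) (a b : A v) (x : X.obj (op V)), K v a x = K v b x)
    (hres : ∀ ⦃V W : Over S⦄ (g : W ⟶ V) (v : V ⟶ T) (a : A v) (x : X.obj (op V)),
      formalLine.map g.left.op (K v a x) = K (g ≫ v) (res g v a) (X.map g.op x)) :
    ∃ β : ∀ ⦃V : Over S⦄ (_ : V ⟶ T), X.obj (op V) → formalLine.obj (op V.left),
      (∀ ⦃V V' : Over S⦄ (f : V' ⟶ V) (v : V ⟶ T) (x : X.obj (op V)),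
        formalLine.map f.left.op (β v x) = β (f ≫ v) (X.map f.op x)) ∧
      ∀ ⦃V : Over S⦄ (v : V ⟶ T) (a : A v) (x : X.obj (op V)), β v x = K v a x := by
  have hF := isSheaf_formalLine_over S
  have hJ ⦃V : Over S⦄ (v : V ⟶ T) := (fpqcTopology.over S).pullback_stable v hR
  have hc ⦃V : Over S⦄ {v v' : V ⟶ T} (h : v = v') (a : A v) (a' : A v') (x : X.obj (op V)) :
      K v a x = K v' a' x := by
    subst h
    exact hK v a a' x
  have hX ⦃V V' V'' : Over S⦄ (f : V' ⟶ V) (g : V'' ⟶ V') (x : X.obj (op V)) :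
      X.map g.op (X.map f.op x) = X.map (g ≫ f).op x := (Functor.map_comp_apply X f.op g.op x).symm
  have h ⦃V : Over S⦄ (v : V ⟶ T) (x : X.obj (op V)) :=
    Presieve'.exists_glue hF (hJ v) (fun W f hf => K (f ≫ v) (hA (f ≫ v) hf).some (X.map f.op x))
      fun W W' f hf g => (hres g _ _ _).trans
        ((congrArg _ (hX f g x)).trans (hc (Category.assoc _ _ _).symm _ _ _))
  choose β hβ using h
  have h1 ⦃V : Over S⦄ (v : V ⟶ T) (a : A v) (x : X.obj (op V)) : β v x = K v a x :=
    Presieve'.ext_of_cover hF (hJ v) fun W f hf =>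
      (hβ v x f hf).trans ((hK _ _ _ _).trans (hres f v a x).symm)
  refine ⟨β, fun V V' f v x => Presieve'.ext_of_cover hF (hJ (f ≫ v)) fun W g hg => ?_, h1⟩
  have hg' : R ((g ≫ f) ≫ v) := by
    rw [Category.assoc]
    exact hg
  refine Eq.trans ?_ (hβ (f ≫ v) (X.map f.op x) g hg).symm
  refine (Functor.map_comp_apply ((Over.forget S).op ⋙ formalLine) f.op g.op (β v x)).symm.trans
    ((hβ v x (g ≫ f) hg').trans ?_)
  rw [hX]
  exact hc (Category.assoc _ _ _) _ _ _

/-- A map to the formal line that is locally a coordinate is a coordinate. -/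
lemma bijective_of_cover (hX : Presieve.IsSheaf (fpqcTopology.over S)
      (X ⋙ CategoryTheory.forget _)) {R : Sieve T} (hR : R ∈ fpqcTopology.over S T)
    (β : ∀ ⦃V : Over S⦄ (_ : V ⟶ T), X.obj (op V) → formalLine.obj (op V.left))
    (hβ : ∀ ⦃V V' : Over S⦄ (f : V' ⟶ V) (v : V ⟶ T) (x : X.obj (op V)),
      formalLine.map f.left.op (β v x) = β (f ≫ v) (X.map f.op x))
    (h : ∀ ⦃V : Over S⦄ (f : V ⟶ T), R f → Function.Bijective (β f)) ⦃V : Over S⦄ (v : V ⟶ T) :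
    Function.Bijective (β v) := by
  have hF := isSheaf_formalLine_over S
  have hRv := (fpqcTopology.over S).pullback_stable v hR
  refine ⟨fun x y hxy => ?_, fun y => ?_⟩
  · refine Presieve'.ext_of_cover hX hRv fun W f hf => (h (f ≫ v) hf).1 ?_
    exact (hβ f v x).symm.trans ((congrArg _ hxy).trans (hβ f v y))
  · have h1 ⦃W : Over S⦄ (f : W ⟶ V) (hf : R (f ≫ v)) := (h (f ≫ v) hf).2
      (formalLine.map f.left.op y)
    choose x hx using h1
    obtain ⟨t, ht⟩ := Presieve'.exists_glue hX hRv (fun W f hf => x f hf)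
      fun W W' f hf g => by
        have hf' : R ((g ≫ f) ≫ v) := by
          rw [Category.assoc]
          exact R.downward_closed hf g
        refine (h ((g ≫ f) ≫ v) hf').1 ?_
        refine Eq.trans ?_ (hx (g ≫ f) hf').symm
        have h2 := hβ g (f ≫ v) (x f hf)
        rw [hx f hf, ← Category.assoc] at h2
        refine h2.symm.trans ?_
        exact (Functor.map_comp_apply ((Over.forget S).op ⋙ formalLine) f.op g.op y).symm
    refine ⟨t, Presieve'.ext_of_cover hF hRv fun W f hf => ?_⟩
    refine (hβ f v t).trans ((congrArg (β (f ≫ v)) (ht f hf)).trans (hx f hf))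

lemma Chart.exists_iso {U : S.Opens} (c : Chart X (Over.mk U.ι)) :
    ∃ e : (Over.map U.ι).op ⋙ X ⋙ CategoryTheory.forget _ ≅
      (Over.forget (U : Scheme.{u})).op ⋙ formalLine,
      ∀ T, e.hom.app T (0 : X.obj (op ((Over.map U.ι).obj T.unop))) = formalLineZero _ := by
  let o (T : (Over (U : Scheme.{u}))ᵒᵖ) : (Over.map U.ι).obj T.unop ⟶ Over.mk U.ι :=
    Over.homMk T.unop.hom
  refine ⟨NatIso.ofComponents
    (fun T => (Equiv.ofBijective _ (c.bijective (o T))).toIso) fun {T T'} f => ?_,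
    fun T => c.coord_zero (o T)⟩
  ext x
  have h := c.map_coord ((Over.map U.ι).map f.unop) (o T) x
  have ho : (Over.map U.ι).map f.unop ≫ o T = o T' := by
    ext
    simp [o]
  rw [ho] at h
  exact h.symm

end

end

noncomputable section

open AlgebraicGeometry.Scheme

/-! ### Charts with a given formal group law -/

namespace AlgebraicGeometry.Scheme

lemma generate_singleton_mem_fpqcTopology {A B : CommRingCat.{u}} {φ : A ⟶ B}
    (hφ : φ.hom.FaithfullyFlat) :
    Sieve.generate (Presieve.singleton (Spec.map φ)) ∈ fpqcTopology (Spec A) := by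
  obtain ⟨h1, h2⟩ := (flat_and_surjective_SpecMap_iff φ).2 hφ
  exact Precoverage.generate_mem_toGrothendieck (Spec.map φ).singleton_mem_fpqcPrecoverage

/-- A covering property can be checked locally for the Zariski topology. -/
lemma mem_fpqcTopology_of_opens {T : Scheme.{u}} (R : Sieve T)
    (hR : ∀ x : T, ∃ U : T.Opens, x ∈ U ∧ R.pullback U.ι ∈ fpqcTopology (U : Scheme.{u})) :
    R ∈ fpqcTopology T := by
  let Q : Sieve T :=
    { arrows := fun V f => R.pullback f ∈ fpqcTopology V
      downward_closed := fun {V W f} hf g => by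
        rw [Sieve.pullback_comp]
        exact fpqcTopology.pullback_stable g hf }
  exact fpqcTopology.transitive (zariskiTopology_le_fpqcTopology _
    (mem_zariskiTopology_of_opens Q hR)) R fun V f hf => hf

/-- The map from the formal line to itself given by a power series. -/
lemma exists_lineVal_eq_nilEval {T : Scheme.{u}} {B : CommRingCat.{u}} (t : T ⟶ Spec B)
    {f : PowerSeries B} (hf : constantCoeff f = 0) (a : formalLine.obj (op T)) :
    ∃ b : formalLine.obj (op T), ∀ (R : CommRingCat.{u}) (g : Spec R ⟶ T),
      lineVal g b = nilEval (ptHom (g ≫ t)) f (lineVal g a) :=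
  exists_lineVal _ (fun R R' g φ => by
    rw [PowerSeries.map_nilEval φ.hom _ _ (isNilpotent_lineVal g a), Category.assoc,
      ptHom_specMap_comp, lineVal_specMap])
    fun R g => isNilpotent_nilEval _ (isNilpotent_lineVal g a) hf

/-- The map from the formal line to itself given by a power series. -/
def lineEval {T : Scheme.{u}} {B : CommRingCat.{u}} (t : T ⟶ Spec B)
    {f : PowerSeries B} (hf : constantCoeff f = 0) (a : formalLine.obj (op T)) :
    formalLine.obj (op T) :=
  (exists_lineVal_eq_nilEval t hf a).choose

lemma lineVal_lineEval {T : Scheme.{u}} {B : CommRingCat.{u}} (t : T ⟶ Spec B)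
    {f : PowerSeries B} (hf : constantCoeff f = 0) (a : formalLine.obj (op T))
    {R : CommRingCat.{u}} (g : Spec R ⟶ T) :
    lineVal g (lineEval t hf a) = nilEval (ptHom (g ≫ t)) f (lineVal g a) :=
  (exists_lineVal_eq_nilEval t hf a).choose_spec R g

lemma map_lineEval {T T' : Scheme.{u}} {B : CommRingCat.{u}} (t : T ⟶ Spec B) (h : T' ⟶ T)
    {f : PowerSeries B} (hf : constantCoeff f = 0) (a : formalLine.obj (op T)) :
    formalLine.map h.op (lineEval t hf a) = lineEval (h ≫ t) hf (formalLine.map h.op a) :=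
  ext_lineVal fun R g => by
    rw [← lineVal_comp, lineVal_lineEval, lineVal_lineEval, ← lineVal_comp, Category.assoc]

lemma lineEval_zero {T : Scheme.{u}} {B : CommRingCat.{u}} (t : T ⟶ Spec B)
    {f : PowerSeries B} (hf : constantCoeff f = 0) :
    lineEval t hf (formalLineZero _) = formalLineZero _ :=
  ext_lineVal fun R g => by
    have h : lineVal g (formalLineZero (op T)) = 0 := map_zero (evalPt g)
    rw [lineVal_lineEval, h, nilEval_zero, hf, map_zero]

lemma lineEval_lineEval {T : Scheme.{u}} {B : CommRingCat.{u}} (t : T ⟶ Spec B)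
    {w w' : PowerSeries B} (h : FormalGroup.IsInvPair w w') (a : formalLine.obj (op T)) :
    lineEval t h.2 (lineEval t h.1 a) = a :=
  ext_lineVal fun R g => by
    rw [lineVal_lineEval, lineVal_lineEval, h.left R _ _ (isNilpotent_lineVal g a)]

end AlgebraicGeometry.Scheme

lemma ZMod.exists_ringHom {p : ℕ} {A : Type*} [CommRing A] (hp : (p : A) = 0) :
    Nonempty (ZMod p →+* A) := by
  obtain ⟨n, hn⟩ := CharP.exists A
  exact ⟨ZMod.castHom ((CharP.cast_eq_zero_iff A n p).1 hp) A⟩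

section

variable {S : Scheme.{u}} {X : (Over S)ᵒᵖ ⥤ AddCommGrpCat.{u}} {k : Type u} [CommRing k]

/-- A change of coordinates. -/
def Chart.change {B : CommRingCat.{u}} {j : Spec B ⟶ S} (c : Chart X (Over.mk j))
    {w w' : PowerSeries B} (h : FormalGroup.IsInvPair w w') : Chart X (Over.mk j) where
  coord V v x := lineEval v.left h.1 (c.coord v x)
  map_coord V V' f v x := by
    rw [map_lineEval, c.map_coord]
    rfl
  bijective V v := (Function.bijective_iff_has_inverse.2 ⟨lineEval v.left h.2,
    lineEval_lineEval v.left h, lineEval_lineEval v.left h.symm⟩).comp (c.bijective v)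
  coord_zero V v := by
    rw [c.coord_zero]
    exact lineEval_zero _ _

lemma Chart.IsLaw.change {B : CommRingCat.{u}} {j : Spec B ⟶ S} {c : Chart X (Over.mk j)}
    {w w' : PowerSeries B} {F G : FormalGroup B} (hF : c.IsLaw F)
    (h : FormalGroup.IsInvPair w w') (hw : FormalGroup.IsHom F G w) : (c.change h).IsLaw G := by
  intro V v x y R g
  have hv (x : X.obj (op V)) : (c.change h).val v g x =
      nilEval (ptHom (g ≫ v.left)) w (c.val v g x) := lineVal_lineEval _ h.1 _ _
  rw [hv, hv, hv, hF, hw.2 R _ _ _ (c.isNilpotent_val v g x) (c.isNilpotent_val v g y)]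

variable (X) in
/-- There is a chart over `j` in terms of which the addition of `X` is the formal group law `H`. -/
def HasLawChart (H : FormalGroup k) {B : CommRingCat.{u}} (j : Spec B ⟶ S) : Prop :=
  ∃ (φ : k →+* B) (c : Chart X (Over.mk j)), c.IsLaw (H.map φ)

lemma HasLawChart.comp {H : FormalGroup k} {B B' : CommRingCat.{u}} {j : Spec B ⟶ S}
    (h : HasLawChart X H j) (f : Spec B' ⟶ Spec B) : HasLawChart X H (f ≫ j) := by
  obtain ⟨φ, c, hc⟩ := h
  refine ⟨(ptHom f).comp φ, c.restrict (Over.homMk f), fun V v x y R g => ?_⟩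
  have := hc.restrict (Over.homMk f : Over.mk (f ≫ j) ⟶ Over.mk j) v x y R g
  rw [FormalGroup.nilAdd_map, FormalGroup.nilAdd_map] at this
  rw [FormalGroup.nilAdd_map]
  exact this

variable (X) in
/-- The sieve generated by the affine schemes over which `X` is isomorphic to `H`. -/
def lawSieve (H : FormalGroup k) : Sieve S where
  arrows V f := ∃ (B : CommRingCat.{u}) (j : Spec B ⟶ S) (t : V ⟶ Spec B), t ≫ j = f ∧
    HasLawChart X H j
  downward_closed := by
    rintro V W f ⟨B, j, t, rfl, h⟩ g
    exact ⟨B, j, g ≫ t, Category.assoc _ _ _, h⟩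

variable {p h : ℕ} [Fact p.Prime]

lemma exists_affine_chart (hX : ∀ s : S, ∃ U : S.Opens, s ∈ U ∧ Nonempty (Chart X (Over.mk U.ι)))
    (s : S) : ∃ U : S.Opens, s ∈ U ∧ IsAffineOpen U ∧ Nonempty (Chart X (Over.mk U.ι)) := by
  obtain ⟨U, hU, ⟨c⟩⟩ := hX s
  obtain ⟨V, hV, hsV, hVU⟩ := exists_isAffineOpen_mem_and_subset hU
  exact ⟨V, hsV, hV, ⟨c.restrict (Over.homMk (S.homOfLE hVU) (S.homOfLE_ι hVU))⟩⟩

/-- A formal Lie group of height `h` is fpqc locally isomorphic to a formal group law `H` with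
`[p](T) = T ^ (p ^ h)`. -/
lemma lawSieve_mem (hh : 1 ≤ h) (hX : ∀ s : S, ∃ U : S.Opens, s ∈ U ∧
      Nonempty (Chart X (Over.mk U.ι))) (hXh : HasHeight X p h)
    (H : FormalGroup (Fp.{u} p)) [H.IsComm] (hH : H.mulSeries p = PowerSeries.X ^ (p ^ h)) :
    (p : Γ(S, ⊤)) = 0 ∧ lawSieve X H ∈ fpqcTopology S := by
  have hp1 : 1 < p := (Fact.out : p.Prime).one_lt
  have key (s : S) : ∃ U : S.Opens, s ∈ U ∧ (p : Γ(U, ⊤)) = 0 ∧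
      (lawSieve X H).pullback U.ι ∈ fpqcTopology (U : Scheme.{u}) := by
    obtain ⟨U, hs, hU, ⟨c⟩⟩ := exists_affine_chart hX s
    have : IsAffine (U : Scheme.{u}) := hU
    let j : Spec Γ(U, ⊤) ⟶ (U : Scheme.{u}) := (U : Scheme.{u}).isoSpec.inv
    let c' := c.restrict (Over.homMk j : Over.mk (j ≫ U.ι) ⟶ Over.mk U.ι)
    obtain ⟨F, hFc, hF⟩ := c'.exists_isLaw
    have h0 := c.coeff_mulSeries_eq_zero hU hXh.1 hF
    have h1 := c'.isUnit_coeff_mulSeries hh hXh hF h0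
    have hp : (p : Γ(U, ⊤)) = 0 := by
      rw [← F.coeff_one_mulSeries]
      exact h0 1 (Nat.one_lt_pow (by omega) hp1)
    obtain ⟨φ₀⟩ := ZMod.exists_ringHom hp
    let φ : Fp.{u} p →+* Γ(U, ⊤) := φ₀.comp ULift.ringEquiv.toRingHom
    obtain ⟨B, _, ψ, hψ, w, w', hww, hw⟩ := FormalGroup.exists_faithfullyFlat_isHom hp hh F
      (H.map φ) (by rw [FormalGroup.map_mulSeries, hH, map_pow, PowerSeries.map_X]) h0 h1
    let ψ' : Γ(U, ⊤) ⟶ CommRingCat.of B := CommRingCat.ofHom ψ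
    refine ⟨U, hs, hp, ?_⟩
    have hlaw : HasLawChart X H (Spec.map ψ' ≫ j ≫ U.ι) := by
      let i : Over.mk (Spec.map ψ' ≫ j ≫ U.ι) ⟶ Over.mk (j ≫ U.ι) := Over.homMk (Spec.map ψ')
      have hB : (c'.restrict i).IsLaw (F.map ψ) := fun V v x y R g =>
        (hF.restrict i v x y R g).trans (congrArg (fun χ => (F.map χ).nilAdd _ _ _) (ptHom_specMap ψ'))
      refine ⟨ψ.comp φ, (c'.restrict i).change hww.symm, fun V v x y R g => ?_⟩
      have := hB.change hww.symm (hw.symm hww) v x y R g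
      rw [FormalGroup.nilAdd_map, FormalGroup.nilAdd_map] at this
      rw [FormalGroup.nilAdd_map]
      exact this
    have hcov := fpqcTopology.pullback_stable (U : Scheme.{u}).isoSpec.hom
      (generate_singleton_mem_fpqcTopology (φ := ψ') hψ)
    refine fpqcTopology.superset_covering ?_ hcov
    rintro V f ⟨W, t, _, ⟨⟩, ht⟩
    refine ⟨_, _, t, ?_, hlaw⟩
    rw [reassoc_of% ht]
    simp [j]
  refine ⟨?_, mem_fpqcTopology_of_opens _ fun s => ?_⟩
  · choose U hU hp _ using key
    refine eq_zero_of_locally_eq_zero U (fun s _ => TopologicalSpace.Opens.mem_iSup.2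
      ⟨s, hU s⟩) _ fun s => ?_
    have h1 := congrArg (U s).topIso.hom (hp s)
    rw [map_natCast, map_zero] at h1
    rw [map_natCast, h1]
  · obtain ⟨U, hs, -, hU⟩ := key s
    exact ⟨U, hs, hU⟩

end

end

noncomputable section

open AlgebraicGeometry.Scheme

/-! ### Forms of a formal group law over affine schemes -/

namespace AlgebraicGeometry.Scheme

/-- An fpqc covering of an affine scheme has a finite affine refinement. -/
lemma exists_faithfullyFlat_of_mem {A : CommRingCat.{u}} {R : Sieve (Spec A)}
    (hR : R ∈ fpqcTopology (Spec A)) : ∃ (ι : Type u) (_ : Finite ι) (B : ι → CommRingCat.{u})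
      (φ : ∀ i, A ⟶ B i), (∀ i, R (Spec.map (φ i))) ∧
        (RingHom.pi fun i => (φ i).hom).FaithfullyFlat := by
  obtain ⟨K, hK, hKR⟩ := Precoverage.mem_toGrothendieck_iff_of_isStableUnderComposition.1 hR
  obtain ⟨𝒰, hqc, rfl⟩ := mem_propQCPrecoverage_iff_exists_quasiCompactCover.1 hK
  have : MorphismProperty.RespectsLeft @Flat @IsOpenImmersion :=
    ⟨fun i hi f hf => by
      have : IsOpenImmersion i := hi
      have : Flat f := hf
      infer_instance⟩
  obtain ⟨𝒱, f, hfin, hf⟩ := QuasiCompactCover.exists_hom 𝒰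
  obtain ⟨n, ⟨e⟩⟩ := Finite.exists_equiv_fin 𝒱.I₀
  let F (i : ULift.{u} (Fin n)) : Spec (𝒱.X (e.symm i.down)) ⟶ Spec A := 𝒱.f (e.symm i.down)
  choose φ hφ using fun i => specMap_surjective (F i)
  refine ⟨ULift.{u} (Fin n), inferInstance, fun i => 𝒱.X (e.symm i.down), φ, fun i => ?_, ?_⟩
  · have h := R.downward_closed (hKR _ _ (Presieve.ofArrows.mk (f.s₀ (e.symm i.down))))
      (f.h₀ (e.symm i.down))
    have hc {V : Scheme.{u}} {a b : V ⟶ Spec A} (hab : a = b) (ha : R a) : R b := hab ▸ ha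
    exact hc ((f.w₀ (e.symm i.down)).trans (hφ i).symm) h
  · let B (i : ULift.{u} (Fin n)) := 𝒱.X (e.symm i.down)
    let ψ : A ⟶ .of (∀ i, B i) := CommRingCat.ofHom (RingHom.pi fun i => (φ i).hom)
    have h : sigmaSpec B ≫ Spec.map ψ = Limits.Sigma.desc F := by
      refine Limits.Sigma.hom_ext _ _ fun i => ?_
      rw [ι_sigmaSpec_assoc, Limits.Sigma.ι_desc, ← hφ, ← Spec.map_comp]
      rfl
    have h1 : Flat (Limits.Sigma.desc F) := by
      have (i : ULift.{u} (Fin n)) : Flat (F i) := 𝒱.map_prop _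
      infer_instance
    have h2 : Surjective (Limits.Sigma.desc F) := by
      refine Surjective.sigmaDesc_of_union_range_eq_univ (Set.eq_univ_of_forall fun x => ?_)
      have hx := 𝒱.covers x
      rw [← e.symm_apply_apply (𝒱.idx x)] at hx
      exact Set.mem_iUnion.2 ⟨⟨e (𝒱.idx x)⟩, hx⟩
    have h3 : Spec.map ψ = inv (sigmaSpec B) ≫ Limits.Sigma.desc F :=
      (IsIso.eq_inv_comp _).2 h
    refine (flat_and_surjective_SpecMap_iff ψ).1 ⟨?_, ?_⟩
    · rw [h3]
      infer_instance
    · rw [h3]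
      infer_instance

lemma ext_of_mem_fpqcTopology {A : CommRingCat.{u}} {R : Sieve (Spec A)}
    (hR : R ∈ fpqcTopology (Spec A)) {a b : A}
    (h : ∀ (B : CommRingCat.{u}) (φ : A ⟶ B), R (Spec.map φ) → φ a = φ b) : a = b := by
  obtain ⟨ι, _, B, φ, hφ, hff⟩ := exists_faithfullyFlat_of_mem hR
  exact hff.injective (funext fun i => h _ _ (hφ i))

end AlgebraicGeometry.Scheme

section

variable {S : Scheme.{u}} {X : (Over S)ᵒᵖ ⥤ AddCommGrpCat.{u}} {k : Type u} [CommRing k]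

lemma eq_of_isEmpty {T : Scheme.{u}} [IsEmpty T] (a b : formalLine.obj (op T)) : a = b :=
  Subtype.ext (Subsingleton.elim (α := Γ(T, ⊤)) _ _)

/-- A chart over a finite disjoint union of affine schemes. -/
lemma hasLawChart_pi (hX : Presieve.IsSheaf (fpqcTopology.over S) (X ⋙ CategoryTheory.forget _))
    {H : FormalGroup k} {ι : Type u} [Finite ι] (B : ι → CommRingCat.{u})
    (j : Spec (.of (∀ i, B i)) ⟶ S)
    (h : ∀ i, HasLawChart X H (Spec.map (CommRingCat.ofHom (Pi.evalRingHom (B ·) i)) ≫ j)) :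
    HasLawChart X H j := by
  classical
  let e (i : ι) : Spec (B i) ⟶ Spec (.of (∀ i, B i)) :=
    Spec.map (CommRingCat.ofHom (Pi.evalRingHom (B ·) i))
  let T (i : ι) : Over S := Over.mk (e i ≫ j)
  let ε (i : ι) : T i ⟶ Over.mk j := Over.homMk (e i)
  choose φ c hc using h
  let c' (i : ι) : Chart X (T i) := c i
  let R : Sieve (Over.mk j) := Sieve.ofArrows T ε
  have hR : R ∈ fpqcTopology.over S (Over.mk j) := by
    rw [GrothendieckTopology.mem_over_iff, Sieve.overEquiv_ofArrows]
    refine zariskiTopology_le_fpqcTopology _ (Precoverage.generate_mem_toGrothendieck ?_)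
    rw [Scheme.ofArrows_mem_precoverage_iff]
    refine ⟨fun x => ?_, fun i => ?_⟩
    · obtain ⟨y, rfl⟩ := (sigmaSpec B).surjective x
      obtain ⟨i, y, rfl⟩ := (sigmaOpenCover fun i => Spec (B i)).exists_eq y
      refine ⟨i, y, ?_⟩
      rw [← Scheme.Hom.comp_apply]
      exact congrArg (fun f => f y) (ι_sigmaSpec B i).symm
    · change IsOpenImmersion (e i)
      infer_instance
  obtain ⟨β, hβ, hβK⟩ := exists_glue_coord (X := X) hR
    (A := fun V v => { a : Σ i, V ⟶ T i // a.2 ≫ ε a.1 = v })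
    (fun V W g v a => ⟨⟨a.1.1, g ≫ a.1.2⟩, by rw [Category.assoc, a.2]⟩)
    (fun V v hv => by
      obtain ⟨i, a, ha⟩ := (Sieve.mem_ofArrows_iff _ _ _).1 hv
      exact ⟨⟨⟨i, a⟩, ha.symm⟩⟩)
    (fun V v a x => (c' a.1.1).coord a.1.2 x)
    (fun V v a b x => by
      obtain ⟨⟨i, a⟩, rfl⟩ := a
      obtain ⟨⟨i', b⟩, hb⟩ := b
      by_cases hi : i' = i
      · subst hi
        have hab : b = a := by
          ext1
          exact (cancel_mono (e i')).1 (congrArg Over.Hom.left hb)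
        exact congrArg (fun b => (c' i').coord b x) hab.symm
      · have : IsEmpty V.left := by
          refine ⟨fun y => ?_⟩
          let g := V.left.fromSpecResidueField y
          have h1 (i : ι) (a : V ⟶ T i) (s : ∀ i, B i) :
              ptHom (g ≫ (a ≫ ε i).left) s = ptHom (g ≫ a.left) (s i) := by
            have : g ≫ (a ≫ ε i).left = (g ≫ a.left) ≫ e i := by simp [ε]
            rw [this, ptHom_comp, ptHom_specMap]
            rfl
          have h2 := (h1 i' b (Pi.single i 1)).symm.trans ((congrArg (fun v : V ⟶ Over.mk j =>
            ptHom (g ≫ v.left) (Pi.single i 1)) hb).trans (h1 i a (Pi.single i 1)))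
          rw [Pi.single_eq_same, Pi.single_eq_of_ne hi, map_one, map_zero] at h2
          exact zero_ne_one h2
        exact eq_of_isEmpty _ _)
    (fun V W g v a x => (c' a.1.1).map_coord g a.1.2 x)
  have hβi (i : ι) ⦃V : Over S⦄ (v : V ⟶ T i) (x : X.obj (op V)) :
      β (v ≫ ε i) x = (c' i).coord v x := hβK (v ≫ ε i) ⟨⟨i, v⟩, rfl⟩ x
  let C : Chart X (Over.mk j) :=
    { coord := β
      map_coord := hβ
      bijective := bijective_of_cover hX hR β hβ fun V f hf => by
        obtain ⟨i, a, rfl⟩ := (Sieve.mem_ofArrows_iff _ _ _).1 hf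
        have : β (a ≫ ε i) = (c' i).coord a := funext (hβi i a)
        rw [this]
        exact (c' i).bijective a
      coord_zero := fun V v => by
        refine Presieve'.ext_of_cover (isSheaf_formalLine_over S)
          ((fpqcTopology.over S).pullback_stable v hR) fun W f hf => ?_
        obtain ⟨i, a, ha⟩ := (Sieve.mem_ofArrows_iff _ _ _).1 hf
        refine (hβ f v 0).trans ?_
        rw [map_zero, ha, hβi, (c' i).coord_zero]
        exact Subtype.ext (map_zero f.left.appTop.hom).symm }
  refine ⟨RingHom.pi φ, C, fun V v x y A g => ?_⟩
  rw [GrothendieckTopology.mem_over_iff] at hR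
  refine ext_of_mem_fpqcTopology (fpqcTopology.pullback_stable (g ≫ v.left) hR) fun A' ψ hψ => ?_
  obtain ⟨i, a, ha⟩ := (Sieve.mem_ofArrows_iff _ _ _).1 ((Sieve.overEquiv_iff R _).1 hψ)
  have ha' : Spec.map ψ ≫ g ≫ v.left = a.left ≫ e i := congrArg Over.Hom.left ha
  let f : Over.mk ((Spec.map ψ ≫ g ≫ v.left) ≫ j) ⟶ V :=
    Over.homMk (Spec.map ψ ≫ g) (by simpa using congrArg (fun t => Spec.map ψ ≫ g ≫ t) (Over.w v).symm)
  have hf : f ≫ v = a ≫ ε i := by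
    refine Eq.trans ?_ ha
    ext
    simp [f]
  have hval (z : X.obj (op V)) : ψ (C.val v g z) = (c' i).val a (𝟙 _) (X.map f.op z) := by
    have h1 := C.val_map f v (𝟙 (Spec A')) z
    rw [hf] at h1
    refine (C.val_specMap v g ψ z).symm.trans (Eq.trans ?_ (h1.symm.trans
      (congrArg (lineVal (𝟙 (Spec A'))) (hβi i a _))))
    exact congrArg (fun t => C.val v t z) (Category.id_comp (Spec.map ψ ≫ g)).symm
  have hi := hc i a (X.map f.op x) (X.map f.op y) A' (𝟙 _)
  rw [FormalGroup.nilAdd_map] at hi ⊢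
  rw [hval, map_add]
  refine hi.trans (Eq.trans ?_ (H.map_nilAdd _ ψ.hom (C.isNilpotent_val v g x)
    (C.isNilpotent_val v g y)).symm)
  refine Eq.trans ?_ (congrArg₂ (H.nilAdd _) (hval x) (hval y)).symm
  refine congrArg (fun χ => H.nilAdd χ _ _) ?_
  have h2 : ψ.hom.comp (ptHom (g ≫ v.left)) = (ptHom a.left).comp (Pi.evalRingHom (B ·) i) :=
    (ptHom_specMap_comp _ ψ).symm.trans ((congrArg ptHom ha').trans
      ((ptHom_comp _ _).trans (congrArg _ (ptHom_specMap _))))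
  rw [← RingHom.comp_assoc, h2]
  exact congrArg (fun t => (ptHom t).comp (φ i)) (Category.id_comp a.left)

end

end

noncomputable section

open AlgebraicGeometry.Scheme
open scoped TensorProduct

/-! ### Gluing data of forms -/

lemma PowerSeries.nilEval_of_sq_eq_zero {A R : Type*} [CommRing A] [CommRing R] (φ : A →+* R)
    {f : PowerSeries A} (hf : constantCoeff f = 0) {x : R} (hx : x ^ 2 = 0) :
    nilEval φ f x = φ (coeff 1 f) * x := by
  rw [nilEval_eq_sum φ f hx, Finset.sum_range_succ, Finset.sum_range_one]
  simp [hf]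

lemma DualNumber.eq_of_algebraMap_mul_eps {D : Type*} [CommRing D] {a b : D}
    (h : algebraMap D (DualNumber D) a * DualNumber.eps = algebraMap D (DualNumber D) b * DualNumber.eps) :
    a = b := by
  simpa [TrivSqZeroExt.algebraMap_eq_inl] using congrArg TrivSqZeroExt.snd h

section

variable {S : Scheme.{u}} {X : (Over S)ᵒᵖ ⥤ AddCommGrpCat.{u}}

/-- The power series that relates two charts. -/
lemma Chart.exists_transition {D : CommRingCat.{u}} {j : Spec D ⟶ S}
    (c₀ c₁ : Chart X (Over.mk j)) : ∃ g : PowerSeries D, constantCoeff g = 0 ∧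
      ∀ ⦃V : Over S⦄ (v : V ⟶ Over.mk j) (x : X.obj (op V)) (R : CommRingCat.{u})
        (f : Spec R ⟶ V.left),
        c₀.val v f x = nilEval (ptHom (f ≫ v.left)) g (c₁.val v f x) := by
  let η (R : CommRingCat.{u}) (χ : Spec R ⟶ Spec D) (y : R) (hy : IsNilpotent y) : R :=
    c₀.val (V := Over.mk (χ ≫ j)) (Over.homMk χ) (𝟙 _) (c₁.specPt χ y hy)
  have hη {V : Over S} (v : V ⟶ Over.mk j) (x : X.obj (op V)) (R : CommRingCat.{u})
      (f : Spec R ⟶ V.left) : c₀.val v f x =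
        η R (f ≫ v.left) (c₁.val v f x) (c₁.isNilpotent_val v f x) := by
    let i : Over.mk ((f ≫ v.left) ≫ j) ⟶ V := Over.homMk f
      ((congrArg (f ≫ ·) (Over.w v).symm).trans (Category.assoc _ _ _).symm)
    have hi : i ≫ v = Over.homMk (f ≫ v.left) := by ext; simp [i]
    have h := c₀.val_map i v (𝟙 (Spec R)) x
    rw [hi] at h
    refine Eq.trans ?_ (h.symm.trans ?_)
    · exact congrArg (fun t => c₀.val v t x) (Category.id_comp f).symm
    · exact congrArg (c₀.val _ _) (c₁.map_eq_specPt v f x)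
  have hnat (R R' : Type u) [CommRing R] [CommRing R'] (ψ : R →+* R') (χ : D →+* R) (y : R)
      (hy : IsNilpotent y) : ψ (η (.of R) (Spec.map (CommRingCat.ofHom χ)) y hy) =
        η (.of R') (Spec.map (CommRingCat.ofHom (ψ.comp χ))) (ψ y) (hy.map ψ) := by
    let ψ' : CommRingCat.of R ⟶ .of R' := CommRingCat.ofHom ψ
    have h := hη (Over.homMk (Spec.map (CommRingCat.ofHom χ)) :
      Over.mk (Spec.map (CommRingCat.ofHom χ) ≫ j) ⟶ Over.mk j)
      (c₁.specPt (Spec.map (CommRingCat.ofHom χ)) y hy) (.of R') (Spec.map ψ')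
    have h1 := c₀.val_specMap (Over.homMk (Spec.map (CommRingCat.ofHom χ)) :
      Over.mk (Spec.map (CommRingCat.ofHom χ) ≫ j) ⟶ Over.mk j) (𝟙 _) ψ'
      (c₁.specPt (Spec.map (CommRingCat.ofHom χ)) y hy)
    have h2 := c₁.val_specPt (Spec.map (CommRingCat.ofHom χ)) y hy ψ'
    refine h1.symm.trans ((congrArg (fun t => c₀.val _ t _) (Category.comp_id _)).trans
      (h.trans ?_))
    congr 1
    exact (Spec.map_comp _ _).symm
  obtain ⟨g, hg⟩ := PowerSeries.exists_nilEval (A := D)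
    (fun R _ χ y hy => η (.of R) (Spec.map (CommRingCat.ofHom χ)) y hy) hnat
  have key ⦃V : Over S⦄ (v : V ⟶ Over.mk j) (x : X.obj (op V)) (R : CommRingCat.{u})
      (f : Spec R ⟶ V.left) :
      c₀.val v f x = nilEval (ptHom (f ≫ v.left)) g (c₁.val v f x) := by
    rw [hη v x R f, ← hg _ _ _ (c₁.isNilpotent_val v f x)]
    congr 1
    exact (Spec.map_preimage (f ≫ v.left)).symm
  refine ⟨g, ?_, key⟩
  have h := key (𝟙 (Over.mk j)) 0 D (𝟙 _)
  rw [c₀.val_zero, c₁.val_zero, nilEval_zero] at h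
  have hid : ptHom (𝟙 (Spec D) ≫ 𝟙 (Spec D)) = RingHom.id D := by
    rw [Category.comp_id, ← Spec.map_id, ptHom_specMap]
    rfl
  exact ((congrArg (fun χ : D →+* D => χ (constantCoeff g)) hid).symm.trans
    h.symm)

variable {U : S.Opens} {A B : Type u} [CommRing A] [CommRing B] [Algebra A B]
  (j : Spec (.of A) ⟶ (U : Scheme.{u}))

/-- The affine scheme of an `A`-algebra as a scheme over `S`. -/
abbrev algOver (R : Type u) [CommRing R] [Algebra A R] : Over S :=
  Over.mk ((Spec.map (CommRingCat.ofHom (algebraMap A R)) ≫ j) ≫ U.ι)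

/-- The morphism of a homomorphism of `A`-algebras. -/
def algMap {R R' : Type u} [CommRing R] [CommRing R'] [Algebra A R] [Algebra A R']
    (b : R →ₐ[A] R') : algOver j R' ⟶ algOver j R :=
  Over.homMk (Spec.map (CommRingCat.ofHom b.toRingHom)) (by
    change Spec.map _ ≫ (Spec.map _ ≫ j) ≫ U.ι = (Spec.map _ ≫ j) ≫ U.ι
    rw [Category.assoc, Category.assoc, ← Spec.map_comp_assoc]
    congr 2
    ext a
    exact b.commutes a)

lemma algMap_comp {R R' R'' : Type u} [CommRing R] [CommRing R'] [CommRing R''] [Algebra A R]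
    [Algebra A R'] [Algebra A R''] (b : R →ₐ[A] R') (b' : R' →ₐ[A] R'') :
    algMap j b' ≫ algMap j b = algMap j (b'.comp b) := by
  ext1
  exact (Spec.map_comp _ _).symm

variable {j} (c : Chart X (algOver j B)) {R R' : Type u} [CommRing R] [Algebra A R]
  [CommRing R'] [Algebra A R']

namespace Chart

/-- The coordinate of a point with values in an `A`-algebra. -/
def algVal (b : B →ₐ[A] R) (x : X.obj (op (algOver j R))) : R :=
  c.val (R := .of R) (algMap j b) (𝟙 _) x

lemma isNilpotent_algVal (b : B →ₐ[A] R) (x : X.obj (op (algOver j R))) :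
    IsNilpotent (c.algVal b x) :=
  c.isNilpotent_val _ _ _

lemma exists_algVal (b : B →ₐ[A] R) {y : R} (hy : IsNilpotent y) :
    ∃ x : X.obj (op (algOver j R)), c.algVal b x = y :=
  ⟨c.pt (algMap j b) (Scheme.specPt (A := .of R) y hy), by
    rw [algVal, val, coord_pt]
    exact lineVal_id_specPt (A := .of R) y hy⟩

open FlatDescent

lemma comp_pair (f : R →ₐ[A] R') (r s : B →ₐ[A] R) :
    pair (f.comp r) (f.comp s) = f.comp (pair r s) := by ext <;> simp

lemma pair_include : pair includeLeft includeRight =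
    AlgHom.id A (B ⊗[A] B) := by ext <;> simp

/-- A chart over `B` amounts to a gluing datum. -/
lemma exists_gluing {p q : ℕ} (hq : 1 ≤ q)
    (hc : ∀ ⦃V : Over S⦄ (v : V ⟶ algOver j B) (x : X.obj (op V)) (R : CommRingCat.{u})
      (f : Spec R ⟶ V.left), c.val v f (p • x) = c.val v f x ^ q) :
    ∃ g : PowerSeries (B ⊗[A] B), constantCoeff g = 0 ∧
      IsUnit (coeff 1 g) ∧ coeff 1 g ^ q = coeff 1 g ∧
      PowerSeries.map (pair (incl A B 0) (incl A B 2)).toRingHom g =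
        PowerSeries.subst (PowerSeries.map (pair (incl A B 1) (incl A B 2)).toRingHom g)
          (PowerSeries.map (pair (incl A B 0) (incl A B 1)).toRingHom g) ∧
      ∀ (R : Type u) [CommRing R] [Algebra A R] (b₀ b₁ : B →ₐ[A] R)
        (x : X.obj (op (algOver j R))), c.algVal b₀ x =
          nilEval (pair b₀ b₁).toRingHom g (c.algVal b₁ x) := by
  obtain ⟨g, hg0, hg⟩ := exists_transition
    (c.restrict (algMap j (includeLeft : B →ₐ[A] B ⊗[A] B)))
    (c.restrict (algMap j (includeRight : B →ₐ[A] B ⊗[A] B)))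
  have key (R : Type u) [CommRing R] [Algebra A R] (b₀ b₁ : B →ₐ[A] R)
      (x : X.obj (op (algOver j R))) : c.algVal b₀ x =
        nilEval (pair b₀ b₁).toRingHom g (c.algVal b₁ x) := by
    have h := hg (algMap j (pair b₀ b₁)) x (.of R) (𝟙 _)
    have h0 : algMap j (pair b₀ b₁) ≫ algMap j includeLeft =
        algMap j b₀ := by
      rw [algMap_comp]
      congr 1
      ext b
      simp
    have h1 : algMap j (pair b₀ b₁) ≫ algMap j includeRight =
        algMap j b₁ := by
      rw [algMap_comp]
      congr 1
      ext b
      simp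
    have h2 : ptHom (𝟙 (Spec (.of R)) ≫ (algMap j (pair b₀ b₁)).left) =
        (pair b₀ b₁).toRingHom :=
      (congrArg ptHom (Category.id_comp _)).trans (ptHom_specMap _)
    dsimp only [Chart.restrict, Chart.val] at h
    rw [h0, h1] at h
    exact h.trans (congrArg (fun χ => nilEval χ g (c.algVal b₁ x)) h2)
  have hw : IsUnit (coeff 1 g) := by
    let R := DualNumber (B ⊗[A] B)
    let i : B ⊗[A] B →ₐ[A] R := IsScalarTower.toAlgHom A _ R
    let b₀ : B →ₐ[A] R := i.comp includeLeft
    let b₁ : B →ₐ[A] R := i.comp includeRight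
    let e : R := DualNumber.eps
    have he : e ^ 2 = 0 := by rw [pow_two, DualNumber.eps_mul_eps]
    obtain ⟨x, hx⟩ := c.exists_algVal b₁ (y := e) ⟨2, he⟩
    have h1 := key R b₀ b₁ x
    rw [hx, PowerSeries.nilEval_of_sq_eq_zero _ hg0 he] at h1
    have h2 := key R b₁ b₀ x
    rw [hx, PowerSeries.nilEval_of_sq_eq_zero _ hg0 (by rw [h1, mul_pow, he, mul_zero]), h1] at h2
    have h3 : pair b₀ b₁ = i := by
      rw [comp_pair, pair_include, AlgHom.comp_id]
    have h4 : pair b₁ b₀ = i.comp (pair includeRight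
      includeLeft) := comp_pair _ _ _
    rw [h3, h4] at h2
    refine isUnit_iff_exists_inv'.2 ⟨pair includeRight
      includeLeft (coeff 1 g), ?_⟩
    have h5 : e = algebraMap (B ⊗[A] B) R (pair includeRight
        includeLeft (coeff 1 g) * coeff 1 g) * e := by
      rw [map_mul, mul_assoc]
      exact h2
    exact DualNumber.eq_of_algebraMap_mul_eps (h5.symm.trans (by rw [map_one, one_mul]))
  refine ⟨g, hg0, hw, ?_, ?_, fun R _ _ => key R⟩
  · have h1 : PowerSeries.subst (PowerSeries.X ^ q) g = g ^ q := by
      refine eq_of_nilEval_eq fun R _ χ y hy => ?_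
      let _ := (χ.comp (algebraMap A (B ⊗[A] B))).toAlgebra
      let χ' : B ⊗[A] B →ₐ[A] R := { χ with commutes' := fun _ => rfl }
      have hχ : pair (χ'.comp includeLeft)
        (χ'.comp includeRight) = χ' := by
        rw [comp_pair, pair_include, AlgHom.comp_id]
      obtain ⟨x, hx⟩ := c.exists_algVal (χ'.comp includeRight) hy
      have h1 := key R (χ'.comp includeLeft)
        (χ'.comp includeRight) x
      have h2 := key R (χ'.comp includeLeft)
        (χ'.comp includeRight) (p • x)
      have h3 (b : B →ₐ[A] R) : c.algVal b (p • x) = c.algVal b x ^ q := hc _ _ _ _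
      rw [h3, h3, hx, h1, hx, hχ] at h2
      rw [nilEval_subst χ hy (by simp [Nat.one_le_iff_ne_zero.1 hq]),
        nilEval_pow χ hy, nilEval_pow χ hy, nilEval_X χ hy]
      exact h2.symm
    have h2 := congrArg (coeff q) h1
    rw [← PowerSeries.expand_apply q (by omega)] at h2
    have h3 := coeff_expand_mul q (by omega) g 1
    rw [mul_one] at h3
    refine Eq.trans ?_ (h2.symm.trans h3)
    obtain ⟨d, rfl⟩ := PowerSeries.X_dvd_iff.2 hg0
    simp [mul_pow, coeff_X_pow_mul', coeff_succ_X_mul]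
  · refine eq_of_nilEval_eq fun R _ χ y hy => ?_
    let _ := (χ.comp (algebraMap A (B ⊗[A] (B ⊗[A] B)))).toAlgebra
    let χ' : B ⊗[A] (B ⊗[A] B) →ₐ[A] R := { χ with commutes' := fun _ => rfl }
    have hχ (i j : Fin 3) : pair (χ'.comp (incl A B i)) (χ'.comp (incl A B j)) =
      χ'.comp (pair (incl A B i) (incl A B j)) := comp_pair _ _ _
    obtain ⟨x, hx⟩ := c.exists_algVal (χ'.comp (incl A B 2)) hy
    have h01 := key R (χ'.comp (incl A B 0)) (χ'.comp (incl A B 1)) x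
    have h12 := key R (χ'.comp (incl A B 1)) (χ'.comp (incl A B 2)) x
    have h02 := key R (χ'.comp (incl A B 0)) (χ'.comp (incl A B 2)) x
    rw [h01, h12, hx, hχ, hχ, hχ] at h02
    have h0 : constantCoeff (PowerSeries.map
        (pair (incl A B 1) (incl A B 2)).toRingHom g) = 0 := by
      rw [← coeff_zero_eq_constantCoeff_apply, coeff_map,
        coeff_zero_eq_constantCoeff_apply, hg0, map_zero]
    rw [nilEval_subst χ hy h0,
      nilEval_map, nilEval_map, nilEval_map]
    exact h02.symm

end Chart

end

end

noncomputable section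

open AlgebraicGeometry.Scheme
open scoped TensorProduct

/-! ### Local coordinates of forms -/

lemma PowerSeries.coeff_one_subst_of_constantCoeff {D : Type*} [CommRing D] {f g : PowerSeries D}
    (hf : constantCoeff f = 0) (hg : constantCoeff g = 0) :
    coeff 1 (subst g f) = coeff 1 f * coeff 1 g := by
  let φ := algebraMap D (DualNumber D)
  have he : (DualNumber.eps : DualNumber D) ^ 2 = 0 := by rw [pow_two, DualNumber.eps_mul_eps]
  have h := nilEval_subst φ (x := DualNumber.eps) ⟨2, he⟩ hg f
  have h0 : constantCoeff (subst g f) = 0 := constantCoeff_subst_eq_zero hg _ hf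
  rw [nilEval_of_sq_eq_zero φ h0 he, nilEval_of_sq_eq_zero φ hg he,
    nilEval_of_sq_eq_zero φ hf (by rw [mul_pow, he, mul_zero]), ← mul_assoc, ← map_mul] at h
  exact DualNumber.eq_of_algebraMap_mul_eps h

section

variable {S : Scheme.{u}} {X : (Over S)ᵒᵖ ⥤ AddCommGrpCat.{u}} {U : S.Opens}

lemma mem_over_of_faithfullyFlat {A B : CommRingCat.{u}} (j : Spec A ⟶ (U : Scheme.{u})) [IsIso j]
    {φ : A ⟶ B} (hφ : φ.hom.FaithfullyFlat) {R : Sieve (Over.mk U.ι)}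
    (hR : R (Over.homMk (Spec.map φ ≫ j) :
      Over.mk ((Spec.map φ ≫ j) ≫ U.ι) ⟶ Over.mk U.ι)) : R ∈ fpqcTopology.over S (Over.mk U.ι) := by
  rw [GrothendieckTopology.mem_over_iff]
  refine fpqcTopology.superset_covering ?_ (fpqcTopology.pullback_stable (inv j)
    (generate_singleton_mem_fpqcTopology hφ))
  rintro V f ⟨W, t, _, ⟨⟩, ht⟩
  have hf : f = t ≫ Spec.map φ ≫ j := by rw [reassoc_of% ht]; simp
  rw [hf]
  exact Sieve.downward_closed _ ((Sieve.overEquiv_iff R _).2 hR) t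

open FlatDescent

variable {A B : Type u} [CommRing A] [CommRing B] [Algebra A B]
  {j : Spec (.of A) ⟶ (U : Scheme.{u})}

/-- Maps from `X` to the formal line that generate the ideal of the zero section, given in terms of a
chart over a faithfully flat algebra. -/
structure LocalCoords (c : Chart X (algOver j B)) (q : ℕ) where
  ι : Type
  [fintype : Fintype ι]
  m : ι → B
  m' : ι → B
  a : ι → A
  e : ι → A
  w : B ⊗[A] B
  u : ι → PowerSeries B
  α : ι → ∀ ⦃V : Over S⦄ (_ : V ⟶ Over.mk U.ι), X.obj (op V) → formalLine.obj (op V.left)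
  w_pow : w ^ q = w
  m'_tmul (i : ι) : m' i ⊗ₜ[A] (1 : B) = (1 ⊗ₜ m' i) * w
  map_a (i : ι) : algebraMap A B (a i) = m i * m' i
  sum_eq_one : ∑ i, e i * a i = 1
  constantCoeff_u (i : ι) : constantCoeff (u i) = 0
  coeff_one_u (i : ι) : coeff 1 (u i) = m i
  map_α (i : ι) ⦃V V' : Over S⦄ (f : V' ⟶ V) (v : V ⟶ Over.mk U.ι) (x : X.obj (op V)) :
    formalLine.map f.left.op (α i v x) = α i (f ≫ v) (X.map f.op x)
  α_zero (i : ι) ⦃V : Over S⦄ (v : V ⟶ Over.mk U.ι) : α i v 0 = formalLineZero _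
  lineVal_α (i : ι) ⦃V : Over S⦄ (v : V ⟶ Over.mk U.ι) (t : V ⟶ algOver j B) (x : X.obj (op V))
    {R : CommRingCat.{u}} (f : Spec R ⟶ V.left) :
    lineVal f (α i v x) = nilEval (ptHom (f ≫ t.left)) (u i) (c.val t f x)
  algVal_eq {R : Type u} [CommRing R] [Algebra A R] (b₀ b₁ : B →ₐ[A] R)
    (x : X.obj (op (algOver j R))) (hx : c.algVal b₁ x ^ 2 = 0) :
    c.algVal b₀ x = pair b₀ b₁ w * c.algVal b₁ x

attribute [instance] LocalCoords.fintype

lemma Chart.val_eq_algVal (c : Chart X (algOver j B)) {V : Over S} (t : V ⟶ algOver j B)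
    {R : Type u} [CommRing R] [Algebra A R] (i : algOver j R ⟶ V) (b : B →ₐ[A] R)
    (hb : ptHom (i.left ≫ t.left) = b.toRingHom) (x : X.obj (op V)) :
    c.val (R := .of R) t i.left x = c.algVal b (X.map i.op x) := by
  have h := c.val_map (R := .of R) i t (𝟙 _) x
  have hi : i ≫ t = algMap j b := by
    ext1
    refine (Spec.map_preimage (i.left ≫ t.left)).symm.trans (congrArg Spec.map ?_)
    exact CommRingCat.hom_ext hb
  rw [hi] at h
  exact (congrArg (fun k => c.val (R := .of R) t k x) (Category.id_comp i.left)).symm.trans h.symm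

lemma Chart.exists_localCoords [IsIso j] [Module.FaithfullyFlat A B] (c : Chart X (algOver j B))
    {p q : ℕ} (hq : 1 ≤ q) (hc : ∀ ⦃V : Over S⦄ (v : V ⟶ algOver j B) (x : X.obj (op V))
      (R : CommRingCat.{u}) (f : Spec R ⟶ V.left), c.val v f (p • x) = c.val v f x ^ q) :
    Nonempty (LocalCoords c q) := by
  obtain ⟨g, hg0, hw1, hwq, hg, key⟩ := c.exists_gluing hq hc
  have h0 (φ : B ⊗[A] B →+* B ⊗[A] (B ⊗[A] B)) :
      constantCoeff (PowerSeries.map φ g) = 0 := by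
    rw [← coeff_zero_eq_constantCoeff_apply, coeff_map,
      coeff_zero_eq_constantCoeff_apply, hg0, map_zero]
  obtain ⟨ι, _, m, m', a, e, hm, hm', ha, he⟩ := exists_local_generators hw1.unit (by
    have h := congrArg (coeff 1) hg
    rw [PowerSeries.coeff_one_subst_of_constantCoeff (h0 _) (h0 _), coeff_map,
      coeff_map, coeff_map] at h
    exact h)
  choose u hu0 hu1 hu using fun i => exists_series g hg0 hg (m i) (hm i)
  let T₀ : Over S := algOver j B
  let Q : Sieve (Over.mk U.ι) :=
    { arrows := fun V _ => Nonempty (V ⟶ T₀)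
      downward_closed := fun ⟨t⟩ k => ⟨k ≫ t⟩ }
  have hQ : Q ∈ fpqcTopology.over S (Over.mk U.ι) :=
    mem_over_of_faithfullyFlat j (φ := CommRingCat.ofHom (algebraMap A B))
      ((RingHom.faithfullyFlat_algebraMap_iff).2 inferInstance) ⟨𝟙 _⟩
  have hK (i : ι) ⦃V : Over S⦄ (v : V ⟶ Over.mk U.ι) (t₀ t₁ : V ⟶ T₀) (x : X.obj (op V)) :
      lineEval t₀.left (hu0 i) (c.coord t₀ x) = lineEval t₁.left (hu0 i) (c.coord t₁ x) := by
    refine ext_lineVal fun R f => ?_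
    rw [lineVal_lineEval, lineVal_lineEval]
    let σ : Spec R ⟶ Spec (.of A) := (f ≫ t₀.left) ≫ Spec.map (CommRingCat.ofHom (algebraMap A B))
    let σ' : Spec R ⟶ Spec (.of A) := (f ≫ t₁.left) ≫ Spec.map (CommRingCat.ofHom (algebraMap A B))
    have hσ₀ : (σ ≫ j) ≫ U.ι = f ≫ V.hom := by
      rw [← Over.w t₀]
      simp [σ, T₀]
    have hσ₁ : (σ' ≫ j) ≫ U.ι = f ≫ V.hom := by
      rw [← Over.w t₁]
      simp [σ', T₀]
    have hσ : σ' = σ := by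
      rw [← cancel_mono j, ← cancel_mono U.ι, hσ₀, hσ₁]
    let _ : Algebra A R := (ptHom σ).toAlgebra
    have hs : Spec.map (CommRingCat.ofHom (algebraMap A R)) = σ := Spec.map_preimage σ
    let b₀ : B →ₐ[A] R := { ptHom (f ≫ t₀.left) with
      commutes' := fun r => by
        change ptHom (f ≫ t₀.left) (algebraMap A B r) = ptHom σ r
        rw [ptHom_comp _ (f ≫ t₀.left), ptHom_specMap]
        rfl }
    let b₁ : B →ₐ[A] R := { ptHom (f ≫ t₁.left) with
      commutes' := fun r => by
        change ptHom (f ≫ t₁.left) (algebraMap A B r) = ptHom σ r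
        rw [← hσ, ptHom_comp _ (f ≫ t₁.left), ptHom_specMap]
        rfl }
    let i' : algOver j R ⟶ V := Over.homMk f (by
      change f ≫ V.hom = (Spec.map _ ≫ j) ≫ U.ι
      rw [hs, hσ₀])
    have e₀ := c.val_eq_algVal t₀ i' b₀ rfl x
    have e₁ := c.val_eq_algVal t₁ i' b₁ rfl x
    have hy := c.isNilpotent_algVal b₁ (X.map i'.op x)
    have hk := key R b₀ b₁ (X.map i'.op x)
    have hu' := congrArg (fun s => nilEval (pair b₀ b₁).toRingHom s
      (c.algVal b₁ (X.map i'.op x))) (hu i)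
    dsimp only at hu'
    rw [nilEval_subst _ hy hg0, nilEval_map, nilEval_map,
      ← hk] at hu'
    have hl : (pair b₀ b₁).toRingHom.comp (includeLeft :
      B →ₐ[A] B ⊗[A] B).toRingHom = ptHom (f ≫ t₀.left) := by
      ext b
      exact (by simp : pair b₀ b₁ (b ⊗ₜ 1) = b₀ b)
    have hr : (pair b₀ b₁).toRingHom.comp (includeRight :
      B →ₐ[A] B ⊗[A] B).toRingHom = ptHom (f ≫ t₁.left) := by
      ext b
      exact (by simp : pair b₀ b₁ (1 ⊗ₜ b) = b₁ b)
    rw [hl, hr] at hu'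
    exact (congrArg _ e₀).trans (hu'.trans (congrArg _ e₁.symm))
  have hα (i : ι) := exists_glue_coord (X := X) hQ (A := fun V v => (V ⟶ T₀))
    (fun V W k v t => k ≫ t) (fun V v hv => hv)
    (fun V v t x => lineEval t.left (hu0 i) (c.coord t x)) (hK i)
    (fun V W k v t x => by
      rw [map_lineEval, c.map_coord]
      rfl)
  choose α hα1 hα2 using hα
  refine ⟨{ ι := ι, m := m, m' := m', a := a, e := e, w := coeff 1 g, u := u, α := α
            w_pow := hwq, m'_tmul := hm', map_a := ha, sum_eq_one := he, constantCoeff_u := hu0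
            coeff_one_u := hu1, map_α := hα1, α_zero := fun i V v => ?_
            lineVal_α := fun i V v t x R f => ?_, algVal_eq := fun b₀ b₁ x hx => ?_ }⟩
  · refine Presieve'.ext_of_cover (isSheaf_formalLine_over S)
      ((fpqcTopology.over S).pullback_stable v hQ) fun W k ⟨t⟩ => ?_
    refine (hα1 i k v 0).trans ?_
    rw [hα2 i (k ≫ v) t, map_zero, c.coord_zero]
    refine (lineEval_zero _ _).trans ?_
    exact Subtype.ext (map_zero k.left.appTop.hom).symm
  · rw [hα2 i v t x]
    exact lineVal_lineEval _ _ _ _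
  · rw [key _ b₀ b₁ x, PowerSeries.nilEval_of_sq_eq_zero _ hg0 hx]
    rfl

end

end

noncomputable section

open AlgebraicGeometry.Scheme
open scoped TensorProduct

/-! ### Forms are formal Lie groups -/

section

open FlatDescent

variable {S : Scheme.{u}} {X : (Over S)ᵒᵖ ⥤ AddCommGrpCat.{u}} {U : S.Opens}
  {A B : Type u} [CommRing A] [CommRing B] [Algebra A B]
  {j : Spec (.of A) ⟶ (U : Scheme.{u})} [IsIso j] [Module.FaithfullyFlat A B]
  {c : Chart X (algOver j B)} {q : ℕ}

namespace LocalCoords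

/-- The local coordinates are charts locally on the base. -/
lemma exists_chart (l : LocalCoords c q)
    (hX : Presieve.IsSheaf (fpqcTopology.over S) (X ⋙ CategoryTheory.forget _)) (s : S)
    (hs : s ∈ U) : ∃ V : S.Opens, s ∈ V ∧ Nonempty (Chart X (Over.mk V.ι)) := by
  obtain ⟨y, hy⟩ : ∃ y : Spec (.of A), U.ι (j y) = s :=
    (j.surjective (⟨s, hs⟩ : U)).imp fun y hy => congrArg U.ι hy
  obtain ⟨i, hi⟩ : ∃ i, l.a i ∉ y.asIdeal := by
    by_contra! h
    refine y.2.ne_top ((Ideal.eq_top_iff_one _).2 ?_)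
    rw [← l.sum_eq_one]
    exact Ideal.sum_mem _ fun i _ => Ideal.mul_mem_left _ _ (h i)
  let A' := Localization.Away (l.a i)
  let B' := A' ⊗[A] B
  let φ : CommRingCat.of A ⟶ .of A' := CommRingCat.ofHom (algebraMap A A')
  let φ' : CommRingCat.of A' ⟶ .of B' := CommRingCat.ofHom (algebraMap A' B')
  let ψ : CommRingCat.of B ⟶ .of B' :=
    CommRingCat.ofHom (includeRight : B →ₐ[A] B').toRingHom
  have hφ : IsOpenImmersion (Spec.map φ) :=
    inferInstanceAs (IsOpenImmersion (Spec.map (CommRingCat.ofHom (algebraMap A A'))))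
  let f' : Spec (.of A') ⟶ S := (Spec.map φ ≫ j) ≫ U.ι
  let V := f'.opensRange
  let j' : Spec (.of A') ⟶ (V : Scheme.{u}) := f'.isoOpensRange.hom
  have hj' : j' ≫ V.ι = f' := f'.isoOpensRange_hom_ι
  let k : Over.mk V.ι ⟶ Over.mk U.ι := Over.homMk (inv j' ≫ Spec.map φ ≫ j) (by
    change (inv j' ≫ Spec.map φ ≫ j) ≫ U.ι = V.ι
    rw [Category.assoc, IsIso.inv_comp_eq, hj'])
  let T' : Over S := Over.mk ((Spec.map φ' ≫ j') ≫ V.ι)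
  have hcomm : Spec.map ψ ≫ Spec.map (CommRingCat.ofHom (algebraMap A B)) =
      Spec.map φ' ≫ Spec.map φ := by
    rw [← Spec.map_comp, ← Spec.map_comp]
    congr 1
    ext r
    exact ((includeRight : B →ₐ[A] B').commutes r).trans
      (IsScalarTower.algebraMap_apply A A' B' r)
  let kB : T' ⟶ algOver j B := Over.homMk (Spec.map ψ) (by
    change Spec.map ψ ≫ (Spec.map _ ≫ j) ≫ U.ι = (Spec.map φ' ≫ j') ≫ V.ι
    rw [Category.assoc, Category.assoc, reassoc_of% hcomm, hj']
    simp [f'])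
  have hu0 : constantCoeff (PowerSeries.map ψ.hom (l.u i)) = 0 := by
    rw [← coeff_zero_eq_constantCoeff_apply, coeff_map,
      coeff_zero_eq_constantCoeff_apply, l.constantCoeff_u, map_zero]
  have hu1 : IsUnit (coeff 1 (PowerSeries.map ψ.hom (l.u i))) := by
    rw [coeff_map, l.coeff_one_u]
    have h1 : IsUnit (algebraMap A B' (l.a i)) := by
      rw [IsScalarTower.algebraMap_apply A A' B']
      exact (IsLocalization.Away.algebraMap_isUnit (l.a i)).map _
    have h2 : ψ.hom (l.m i) * ψ.hom (l.m' i) = algebraMap A B' (l.a i) := by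
      rw [← map_mul, ← l.map_a]
      exact (includeRight : B →ₐ[A] B').commutes _
    exact isUnit_of_mul_isUnit_left (h2 ▸ h1)
  obtain ⟨w', hw'⟩ := FormalGroup.exists_isInvPair hu0 hu1
  let c' : Chart X T' := Chart.change (j := (Spec.map φ' ≫ j') ≫ V.ι) (c.restrict kB) hw'
  let Q : Sieve (Over.mk V.ι) :=
    { arrows := fun W _ => Nonempty (W ⟶ T')
      downward_closed := fun ⟨t⟩ k => ⟨k ≫ t⟩ }
  have hQ : Q ∈ fpqcTopology.over S (Over.mk V.ι) :=
    mem_over_of_faithfullyFlat j' (φ := φ')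
      ((RingHom.faithfullyFlat_algebraMap_iff).2
        (inferInstance : Module.FaithfullyFlat A' (A' ⊗[A] B))) ⟨𝟙 _⟩
  have hQ' ⦃W : Over S⦄ (v : W ⟶ Over.mk V.ι) (t : W ⟶ T') : l.α i (v ≫ k) = c'.coord t := by
    funext x
    refine ext_lineVal fun R f => ?_
    refine (l.lineVal_α i (v ≫ k) (t ≫ kB) x f).trans (Eq.trans ?_
      (lineVal_lineEval t.left hw'.1 _ f).symm)
    rw [nilEval_map]
    congr 1
    exact (congrArg ptHom (Category.assoc f t.left (Spec.map ψ)).symm).trans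
      ((ptHom_comp _ _).trans (congrArg _ (ptHom_specMap ψ)))
  refine ⟨V, ?_, ⟨{ coord := fun W v => l.α i (v ≫ k)
                    map_coord := fun W W' f v x => ?_
                    bijective := fun W v => ?_
                    coord_zero := fun W v => l.α_zero i _ }⟩⟩
  · have : y ∈ Set.range (PrimeSpectrum.comap (algebraMap A A')) := by
      rw [PrimeSpectrum.localization_away_comap_range A' (l.a i)]
      exact hi
    obtain ⟨z, hz⟩ := this
    exact ⟨z, (congrArg (fun t => U.ι (j t)) hz).trans hy⟩
  · rw [l.map_α, Category.assoc]
  · refine bijective_of_cover hX hQ (fun W v => l.α i (v ≫ k)) (fun W W' f v x => ?_)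
      (fun W v ⟨t⟩ => ?_) v
    · rw [l.map_α, Category.assoc]
    · rw [hQ' v t]
      exact c'.bijective t

end LocalCoords

lemma infEval_comp {n : ℕ} {T T' : Over (U : Scheme.{u})} (k : T' ⟶ T)
    (x : (infNeighbourhood X n).obj (op ((Over.map U.ι).obj T))) {R : CommRingCat.{u}}
    (g : Spec R ⟶ T'.left) (f : infFunctions X n U) :
    infEval (T := T') ⟨X.map ((Over.map U.ι).map k).op x.1, (infNeighbourhood X n).map _ x.2⟩ g f =
      infEval x (g ≫ k.left) f :=
  (congrArg (evalPt g) (f.2 k x)).trans (evalPt_comp g k.left _).symm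

/-- Functions agree if they agree after a faithfully flat extension. -/
lemma infFunctions_ext_of_faithfullyFlat {n : ℕ} (j : Spec (.of A) ⟶ (U : Scheme.{u})) [IsIso j]
    (B : Type u) [CommRing B] [Algebra A B] [Module.FaithfullyFlat A B] {f f' : infFunctions X n U}
    (h : ∀ (T : Over (U : Scheme.{u})) (x : (infNeighbourhood X n).obj (op ((Over.map U.ι).obj T)))
      (t : T.left ⟶ Spec (.of B))
      (_ : t ≫ Spec.map (CommRingCat.ofHom (algebraMap A B)) ≫ j = T.hom) (R : CommRingCat.{u})
      (g : Spec R ⟶ T.left), infEval x g f = infEval x g f') : f = f' := by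
  refine infFunctions_ext fun T x R g => ?_
  let _ : Algebra A R := (ptHom (g ≫ T.hom ≫ inv j)).toAlgebra
  let R' := (R : Type u) ⊗[A] B
  let φ : R ⟶ CommRingCat.of R' := CommRingCat.ofHom (algebraMap R R')
  let ψ : CommRingCat.of B ⟶ .of R' :=
    CommRingCat.ofHom (includeRight : B →ₐ[A] R').toRingHom
  have hφ : Function.Injective φ := FaithfulSMul.algebraMap_injective R R'
  let T' : Over (U : Scheme.{u}) := Over.mk ((Spec.map φ ≫ g) ≫ T.hom)
  let k : T' ⟶ T := Over.homMk (Spec.map φ ≫ g)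
  have hcomm : Spec.map ψ ≫ Spec.map (CommRingCat.ofHom (algebraMap A B)) =
      Spec.map φ ≫ Spec.map (CommRingCat.ofHom (algebraMap A R)) := by
    rw [← Spec.map_comp, ← Spec.map_comp]
    congr 1
    ext r
    exact ((includeRight : B →ₐ[A] R').commutes r).trans
      (IsScalarTower.algebraMap_apply A R R' r)
  have hA : Spec.map (CommRingCat.ofHom (algebraMap A R)) = g ≫ T.hom ≫ inv j :=
    Spec.map_preimage _
  have h1 := h T' ⟨_, (infNeighbourhood X n).map ((Over.map U.ι).map k).op x.2⟩ (Spec.map ψ) (by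
    rw [reassoc_of% hcomm, hA]
    simp [T']) (.of R') (𝟙 _)
  have h2 (e : infFunctions X n U) : infEval (T := T') ⟨_, (infNeighbourhood X n).map
      ((Over.map U.ι).map k).op x.2⟩ (𝟙 (Spec (.of R'))) e = φ (infEval x g e) :=
    (infEval_comp k x (𝟙 _) e).trans ((congrArg (fun t => infEval x t e)
      (Category.id_comp _)).trans (evalPt_specMap g φ _))
  exact hφ ((h2 f).symm.trans (h1.trans (h2 f')))

omit [IsIso j] [Module.FaithfullyFlat A B] in
lemma Chart.mem_infNeighbourhood_of_algVal (c : Chart X (algOver j B)) {n : ℕ} {R : Type u}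
    [CommRing R] [Algebra A R] {b : B →ₐ[A] R} {x : X.obj (op (algOver j R))}
    (h : c.algVal b x ^ (n + 1) = 0) : x ∈ (infNeighbourhood X n).obj (op (algOver j R)) := by
  rw [c.mem_infNeighbourhood_iff n (algMap j b)]
  refine ext_evalPt fun R' f => ?_
  obtain ⟨φ, rfl⟩ := specMap_surjective f
  have h1 := evalPt_specMap (𝟙 (Spec (.of R))) φ ((c.coord (algMap j b) x).1 ^ (n + 1))
  rw [Category.comp_id, map_pow (evalPt (𝟙 (Spec (.of R))))] at h1
  rw [map_zero]
  exact h1.trans ((congrArg φ h).trans (map_zero φ.hom))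

namespace LocalCoords

lemma pullbackMul_mem (l : LocalCoords c q) (hq : 1 ≤ q) {F : FormalGroup B}
    (hF : Chart.IsLaw (A := .of B) c F) {p : ℕ} (hp : F.mulSeries p = PowerSeries.X ^ q)
    {f : infFunctions X q U} (hf : f ∈ augIdeal X q U) :
    pullbackMul p f ∈ augIdeal X q U ^ q := by
  obtain ⟨s, hs, hs'⟩ := Chart.exists_infEval_pullbackMul (A := .of B) c hF p hq
    (fun i hi => by rw [hp, coeff_X_pow, if_neg hi.ne]) hf
  have hsw : (s ⊗ₜ[A] (1 : B)) * l.w = 1 ⊗ₜ s := by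
    let R := DualNumber (B ⊗[A] B)
    let i : B ⊗[A] B →ₐ[A] R := IsScalarTower.toAlgHom A _ R
    let b₀ : B →ₐ[A] R := i.comp includeLeft
    let b₁ : B →ₐ[A] R := i.comp includeRight
    let ε : R := DualNumber.eps
    have he : ε ^ 2 = 0 := by rw [pow_two, DualNumber.eps_mul_eps]
    obtain ⟨x, hx⟩ := c.exists_algVal b₁ (y := ε) ⟨2, he⟩
    have hx2 : c.algVal b₁ x ^ 2 = 0 := by rw [hx, he]
    have hxn := c.mem_infNeighbourhood_of_algVal (n := q) (pow_eq_zero_of_le (by omega) hx2)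
    have h01 := l.algVal_eq b₀ b₁ x hx2
    rw [hx, Chart.comp_pair, Chart.pair_include, AlgHom.comp_id] at h01
    let T : Over (U : Scheme.{u}) := Over.mk (Spec.map (CommRingCat.ofHom (algebraMap A R)) ≫ j)
    have hb (b : B →ₐ[A] R) (hb : c.algVal b x ^ 2 = 0) :
        infEval (T := T) ⟨x, hxn⟩ (𝟙 _) f = b s * c.algVal b x := by
      have ht : Spec.map (CommRingCat.ofHom b.toRingHom) ≫
          Spec.map (CommRingCat.ofHom (algebraMap A B)) ≫ j = T.hom := by
        rw [← Spec.map_comp_assoc]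
        congr 2
        exact CommRingCat.hom_ext (RingHom.ext fun r => b.commutes r)
      refine (hs' T ⟨x, hxn⟩ (Spec.map (CommRingCat.ofHom b.toRingHom)) ht (.of R) (𝟙 _) hb).trans ?_
      refine congrArg (· * c.algVal b x) ?_
      rw [Category.id_comp, ptHom_specMap]
      rfl
    have h := (hb b₀ (by rw [h01, mul_pow, he, mul_zero])).symm.trans (hb b₁ hx2)
    rw [h01, hx, ← mul_assoc] at h
    refine DualNumber.eq_of_algebraMap_mul_eps (Eq.trans ?_ h)
    rw [map_mul]
    rfl
  have hβ (i : l.ι) : ∃ β : A, algebraMap A B β = s * l.m' i ^ q := by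
    refine exists_algebraMap_eq _ ?_
    have h1 : (s * l.m' i ^ q) ⊗ₜ[A] (1 : B) = (s ⊗ₜ[A] 1) * (l.m' i ⊗ₜ[A] 1) ^ q := by
      rw [Algebra.TensorProduct.tmul_pow, Algebra.TensorProduct.tmul_mul_tmul, one_pow, one_mul]
    have h2 : (1 : B) ⊗ₜ[A] (s * l.m' i ^ q) = (1 ⊗ₜ[A] s) * (1 ⊗ₜ[A] l.m' i) ^ q := by
      rw [Algebra.TensorProduct.tmul_pow, Algebra.TensorProduct.tmul_mul_tmul, one_pow, one_mul]
    rw [h1, h2, l.m'_tmul, mul_pow, l.w_pow, ← hsw]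
    ring
  choose β hβ using hβ
  obtain ⟨d, hd⟩ : ∃ d : l.ι → A, ∑ i, d i * l.a i ^ q = 1 := by
    have h1 : Ideal.span (Set.range l.a) = ⊤ := by
      rw [Ideal.eq_top_iff_one, ← l.sum_eq_one]
      exact Ideal.sum_mem _ fun i _ =>
        Ideal.mul_mem_left _ _ (Ideal.subset_span (Set.mem_range_self i))
    have h2 := (Ideal.eq_top_iff_one _).1 (Ideal.span_pow_eq_top _ h1 q)
    rw [← Set.range_comp] at h2
    exact (Ideal.mem_span_range_iff_exists_fun (R := A)).1 h2
  let C (b : A) : infFunctions X q U := infConst ((inv j).appTop ((ΓSpecIso (.of A)).inv b))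
  have h : pullbackMul p f =
      ∑ i, C (d i * β i) * infLine (l.α i) (l.map_α i) ^ q := by
    refine infFunctions_ext_of_faithfullyFlat j B fun T x t ht R g => ?_
    have ht' : t ≫ Spec.map (CommRingCat.ofHom (algebraMap A B)) ≫ j = T.hom := ht
    let t' : T.left ⟶ Spec (.of A) := t ≫ Spec.map (CommRingCat.ofHom (algebraMap A B))
    have hv : c.val (overPt t ht) g x.1 ^ (q + 1) = 0 := by
      have h := (c.mem_infNeighbourhood_iff q (overPt t ht) x.1).1 x.2
      exact (map_pow (evalPt g) _ _).symm.trans ((congrArg _ h).trans (map_zero _))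
    have hC (b : A) : infEval x g (C b) = ptHom (g ≫ t) (algebraMap A B b) := by
      rw [infEval_infConst x g j t' (by simpa [t'] using ht), ← Category.assoc, ptHom_comp _ (g ≫ t),
        ptHom_specMap]
      rfl
    have hL (i : l.ι) : infEval x g (infLine (l.α i) (l.map_α i)) ^ q =
        ptHom (g ≫ t) (l.m i) ^ q * c.val (overPt t ht) g x.1 ^ q := by
      have h1 : infEval x g (infLine (l.α i) (l.map_α i)) = nilEval (ptHom (g ≫ t))
        (l.u i) (c.val (overPt t ht) g x.1) := l.lineVal_α i _ (overPt t ht) x.1 g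
      obtain ⟨v, hv'⟩ := PowerSeries.X_dvd_iff.2 (l.constantCoeff_u i)
      have hnil := c.isNilpotent_val (overPt t ht) g x.1
      have hv0 : coeff 0 v = l.m i := by
        rw [← l.coeff_one_u, hv', coeff_succ_X_mul]
      rw [h1, hv', nilEval_mul _ hnil, nilEval_X _ hnil, mul_pow, mul_comm,
        ← nilEval_pow _ hnil]
      have hw : nilEval (ptHom (g ≫ t)) (v ^ q) (c.val (overPt t ht) g x.1) *
          c.val (overPt t ht) g x.1 ^ q = ptHom (g ≫ t) (coeff 0 (v ^ q)) *
            c.val (overPt t ht) g x.1 ^ q := by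
        rw [nilEval_eq_sum _ _ hv, Finset.sum_mul, Finset.sum_range_succ',
          Finset.sum_eq_zero fun k _ => by
            rw [mul_assoc, ← pow_add, pow_eq_zero_of_le (by omega) hv, mul_zero], zero_add,
          pow_zero, mul_one]
      rw [hw, ← map_pow, coeff_zero_eq_constantCoeff_apply, map_pow,
        ← coeff_zero_eq_constantCoeff_apply, hv0]
    rw [map_sum, hs T x t ht R g, hp, coeff_X_pow, if_pos rfl, mul_one]
    have hsum : ∑ i, algebraMap A B (d i * β i) * l.m i ^ q = s := by
      have h2 (i : l.ι) : algebraMap A B (d i * β i) * l.m i ^ q =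
          s * algebraMap A B (d i * l.a i ^ q) := by
        rw [map_mul, map_mul, map_pow, hβ, l.map_a]
        ring
      rw [Finset.sum_congr rfl fun i _ => h2 i, ← Finset.mul_sum, ← map_sum, hd, map_one, mul_one]
    have h3 (i : l.ι) : infEval x g (C (d i * β i) * infLine (l.α i) (l.map_α i) ^ q) =
        ptHom (g ≫ t) (algebraMap A B (d i * β i) * l.m i ^ q) *
          c.val (overPt t ht) g x.1 ^ q := by
      rw [map_mul, map_pow (infEval x g), hC, hL, map_mul (ptHom (g ≫ t)), map_pow, mul_assoc]
    rw [Finset.sum_congr rfl fun i _ => h3 i, ← Finset.sum_mul, ← map_sum, hsum]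
  rw [h]
  exact Ideal.sum_mem _ fun i _ => Ideal.mul_mem_left _ _
    (Ideal.pow_mem_pow (infLine_mem _ _ (l.α_zero i)) q)

omit [IsIso j] in
/-- A form does not have too large a height. -/
lemma subsingleton_of_hasHeightGE (l : LocalCoords c q) {F : FormalGroup B}
    (hF : Chart.IsLaw (A := .of B) c F) {p h : ℕ} (hq : 1 ≤ q)
    (hp : F.mulSeries p = PowerSeries.X ^ q) (hU : IsAffineOpen U)
    (hX : HasHeightGE X p h) (hqh : q < p ^ h) : Subsingleton A := by
  have ha (i : l.ι) : l.a i = 0 := by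
    refine FaithfulSMul.algebraMap_injective A B ?_
    have h1 := Chart.coeff_subst_mulSeries_eq_zero (A := .of B) hU hX c hF (s := l.u i)
      (infLine_mem (l.α i) (l.map_α i) (l.α_zero i))
      (fun T x t ht R g => l.lineVal_α i _ (overPt t ht) x.1 g) q hqh
    have h3 := coeff_expand_mul q (by omega) (l.u i) 1
    rw [mul_one, PowerSeries.expand_apply, ← hp, l.coeff_one_u] at h3
    rw [l.map_a, ← h3.symm.trans h1 |>.symm, map_zero, zero_mul]
  refine subsingleton_of_zero_eq_one ?_
  rw [← l.sum_eq_one]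
  simp [ha]

end LocalCoords

end

end

noncomputable section

open AlgebraicGeometry.Scheme

/-! ### The height of forms -/

section

variable {S T : Scheme.{u}} {X : (Over S)ᵒᵖ ⥤ AddCommGrpCat.{u}} {k : Type u} [CommRing k]

lemma AlgebraicGeometry.IsAffineOpen.exists_isIso {U : S.Opens} (hU : IsAffineOpen U) :
    ∃ (A : Type u) (_ : CommRing A) (j : Spec (.of A) ⟶ (U : Scheme.{u})), IsIso j :=
  have : IsAffine (U : Scheme.{u}) := hU
  ⟨Γ(U, ⊤), inferInstance, (U : Scheme.{u}).isoSpec.inv,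
    inferInstanceAs (IsIso (U : Scheme.{u}).isoSpec.inv)⟩

lemma HasLawChart.pullback {H : FormalGroup k} (f : T ⟶ S) {B : CommRingCat.{u}} {j : Spec B ⟶ T}
    (h : HasLawChart X H (j ≫ f)) : HasLawChart ((Over.map f).op ⋙ X) H j := by
  obtain ⟨φ, c, hc⟩ := h
  exact ⟨φ, c.pullback f (T := Over.mk j), Chart.IsLaw.pullback hc⟩

lemma lawSieve_pullback_mem {H : FormalGroup k} (h : lawSieve X H ∈ fpqcTopology S) (f : T ⟶ S) :
    lawSieve ((Over.map f).op ⋙ X) H ∈ fpqcTopology T := by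
  refine fpqcTopology.transitive (fpqcTopology.pullback_stable f h) _ fun V g hg => ?_
  obtain ⟨B, j, t, ht, hj⟩ := hg
  refine mem_fpqcTopology_of_affine _ fun R i => ?_
  refine ⟨R, i ≫ g, 𝟙 _, Category.id_comp _, HasLawChart.pullback f ?_⟩
  rw [Category.assoc, ← ht, ← Category.assoc]
  exact hj.comp _

lemma isSheaf_over_map (hX : Presieve.IsSheaf (fpqcTopology.over S) (X ⋙ CategoryTheory.forget _))
    (f : T ⟶ S) : Presieve.IsSheaf (fpqcTopology.over T)
      (((Over.map f).op ⋙ X) ⋙ CategoryTheory.forget _) :=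
  (Over.map f).op_comp_isSheaf_of_isSheaf_type (J := fpqcTopology.over T)
    (K := fpqcTopology.over S) hX

/-- Local coordinates of a form on an affine open subscheme. -/
lemma exists_localCoords_of_lawSieve_mem
    (hX : Presieve.IsSheaf (fpqcTopology.over S) (X ⋙ CategoryTheory.forget _)) {H : FormalGroup k}
    (h : lawSieve X H ∈ fpqcTopology S) {p q : ℕ} (hq : 1 ≤ q)
    (hH : H.mulSeries p = PowerSeries.X ^ q) {U : S.Opens} {A : Type u} [CommRing A]
    (j : Spec (.of A) ⟶ (U : Scheme.{u})) [IsIso j] :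
    ∃ (B : Type u) (_ : CommRing B) (_ : Algebra A B) (_ : Module.FaithfullyFlat A B)
      (c : Chart X (algOver j B)) (F : FormalGroup B), Chart.IsLaw (A := .of B) c F ∧
        F.mulSeries p = PowerSeries.X ^ q ∧ Nonempty (LocalCoords c q) := by
  obtain ⟨ι, _, B, φ, hφ, hflat⟩ := exists_faithfullyFlat_of_mem
    (fpqcTopology.pullback_stable (j ≫ U.ι) h)
  let φ' : A →+* (∀ i, B i) := RingHom.pi fun i => (φ i).hom
  have hlaw : HasLawChart X H ((Spec.map (CommRingCat.ofHom φ') ≫ j) ≫ U.ι) := by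
    refine hasLawChart_pi hX B _ fun i => ?_
    obtain ⟨D, k, t, ht, hk⟩ := hφ i
    have := hk.comp t
    rw [ht] at this
    rwa [Category.assoc, ← Spec.map_comp_assoc]
  let _ := φ'.toAlgebra
  have : Module.FaithfullyFlat A (∀ i, B i) := hflat
  obtain ⟨χ, c, hc⟩ := hlaw
  have hm : (H.map χ).mulSeries p = PowerSeries.X ^ q := by
    rw [FormalGroup.map_mulSeries, hH, map_pow, PowerSeries.map_X]
  let c' : Chart X (algOver j (∀ i, B i)) := c
  refine ⟨∀ i, B i, inferInstance, inferInstance, inferInstance, c', H.map χ,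
    hc, hm, Chart.exists_localCoords (j := j) c' (p := p) hq fun V v x R f => ?_⟩
  have hn := c.isNilpotent_val v f x
  refine (hc.val_nsmul p v x f).trans ?_
  rw [hm, nilEval_pow _ hn, nilEval_X _ hn]

variable {p h : ℕ} [Fact p.Prime]

/-- An fpqc sheaf that is fpqc locally isomorphic to a formal group law `H` with
`[p](T) = T ^ (p ^ h)` is a formal Lie group of height `h`. -/
theorem isFormalLieVariety_and_hasHeight
    (hX : Presieve.IsSheaf (fpqcTopology.over S) (X ⋙ CategoryTheory.forget _)) {H : FormalGroup k}
    (hl : lawSieve X H ∈ fpqcTopology S) (hH : H.mulSeries p = PowerSeries.X ^ (p ^ h)) :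
    IsFormalLieVariety (X ⋙ CategoryTheory.forget _) (fun T => (0 : X.obj T)) ∧
      HasHeight X p h := by
  have hp1 : 1 < p := (Fact.out : p.Prime).one_lt
  have hq : 1 ≤ p ^ h := Nat.one_le_pow _ _ hp1.le
  refine ⟨⟨?_, fun f => map_zero (X.map f).hom, fun s => ?_⟩, fun U f hf => ?_, fun T f hT => ?_⟩
  · rw [isSheaf_iff_isSheaf_of_type]
    refine Presieve.isSheaf_of_le _ ?_ hX
    intro V R hR
    rw [GrothendieckTopology.mem_over_iff] at hR ⊢
    exact fppfTopology_le_fpqcTopology _ hR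
  · obtain ⟨U, hU, hs, -⟩ := exists_isAffineOpen_mem_and_subset (X := S) (x := s) (U := ⊤) trivial
    obtain ⟨A, _, j, _⟩ := hU.exists_isIso
    obtain ⟨B, _, _, _, c, F, -, -, ⟨l⟩⟩ :=
      exists_localCoords_of_lawSieve_mem hX hl hq hH j
    obtain ⟨V, hsV, ⟨c'⟩⟩ := l.exists_chart hX s hs
    exact ⟨V, hsV, c'.exists_iso⟩
  · obtain ⟨A, _, j, _⟩ := U.2.exists_isIso
    obtain ⟨B, _, _, _, c, F, hF, hp, ⟨l⟩⟩ :=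
      exists_localCoords_of_lawSieve_mem hX hl hq hH j
    exact l.pullbackMul_mem hq hF hp hf
  · refine ⟨fun s => ?_⟩
    obtain ⟨U, hU, hs, -⟩ := exists_isAffineOpen_mem_and_subset (X := T) (x := s) (U := ⊤) trivial
    obtain ⟨A, _, j, _⟩ := hU.exists_isIso
    obtain ⟨B, _, _, _, c, F, hF, hp, ⟨l⟩⟩ :=
      exists_localCoords_of_lawSieve_mem (isSheaf_over_map hX f) (lawSieve_pullback_mem hl f) hq hH
        j
    have := l.subsingleton_of_hasHeightGE hF hq hp hU hT
      (Nat.pow_lt_pow_right hp1 (Nat.lt_succ_self h))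
    obtain ⟨y, -⟩ := j.surjective (⟨s, hs⟩ : U)
    exact (inferInstance : IsEmpty (PrimeSpectrum A)).elim y

end

end

noncomputable section

open AlgebraicGeometry.Scheme

/-! ### Charts and frames -/

section

variable {k : Type u} [CommRing k] (hk : ∀ (R : Type u) [CommRing R], Subsingleton (k →+* R))
  {H : FormalGroup k} [H.IsComm] {S : Over (Spec (.of k))}

include hk

/-- A chart in terms of which the addition is `H` is a frame. -/
lemma HasLawChart.nonempty_frame {X : (Over S.left)ᵒᵖ ⥤ AddCommGrpCat.{u}} {B : CommRingCat.{u}}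
    {j : Spec B ⟶ S.left} (h : HasLawChart X H j) {T : Over S} (t : T.left.left ⟶ Spec B)
    (ht : t ≫ j = T.hom.left) :
    Nonempty (Frame H.points (S.iteratedSliceForward.op ⋙ X) T) := by
  obtain ⟨φ, c, hc⟩ := h
  let i : S.iteratedSliceForward.obj T ⟶ Over.mk j := Over.homMk t ht
  let o ⦃V : Over S⦄ (v : V ⟶ T) : S.iteratedSliceForward.obj V ⟶ Over.mk j :=
    S.iteratedSliceForward.map v ≫ i
  have hval ⦃V : Over S⦄ (v : V ⟶ T) (P : FormalGroup.Points H V.left) {R : CommRingCat.{u}}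
      (g : Spec R ⟶ V.left.left) : c.val (o v) g (c.pt (o v) P.pt) = P.val g :=
    congrArg (lineVal g) (c.coord_pt (o v) P.pt)
  refine ⟨{ hom := fun V v => AddMonoidHom.mk'
              (fun P : FormalGroup.Points H V.left => c.pt (o v) P.pt) fun P Q => ?_
            map_hom := fun V V' f v P => ?_
            bijective := fun V v => ?_ }⟩
  · refine c.ext_val (o v) fun R g => ?_
    have h := hc (o v) (c.pt (o v) (FormalGroup.Points.pt P))
      (c.pt (o v) (FormalGroup.Points.pt Q)) R g
    rw [FormalGroup.nilAdd_map] at h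
    refine (hval v (P + Q) g).trans ((FormalGroup.Points.val_add P Q g).trans (Eq.trans ?_
      (h.trans (congrArg₂ (H.nilAdd _) (hval v P g) (hval v Q g))).symm))
    exact congrArg (fun χ => H.nilAdd χ _ _) ((hk R).elim _ _)
  · refine (c.map_pt (S.iteratedSliceForward.map f) (o v) (FormalGroup.Points.pt P)).trans ?_
    refine congrArg (fun a => c.pt a _) ?_
    exact (Category.assoc _ _ _).symm.trans
      (congrArg (· ≫ i) (S.iteratedSliceForward.map_comp f v).symm)
  · exact (Equiv.ofBijective _ (c.bijective (o v))).symm.bijective.comp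
      ⟨fun P Q h => FormalGroup.Points.ext h, fun a => ⟨⟨a⟩, rfl⟩⟩

lemma locallyFramed_of_lawSieve_mem {X : (Over S.left)ᵒᵖ ⥤ AddCommGrpCat.{u}}
    (h : lawSieve X H ∈ fpqcTopology S.left) :
    LocallyFramed (fpqcTopology.over (Spec (.of k))) H.points
      (S.iteratedSliceForward.op ⋙ X) := by
  refine ⟨(Sieve.overEquiv S).symm (lawSieve X H), 
    fpqcTopology.overEquiv_symm_mem_over _ _ h, fun T f hf => ?_⟩
  obtain ⟨B, j, t, ht, hj⟩ := (Sieve.overEquiv_symm_iff _ _).1 hf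
  exact hj.nonempty_frame hk t ht

/-- A frame is a chart in terms of which the addition is `H`. -/
lemma Frame.hasLawChart {Y : (Over S)ᵒᵖ ⥤ AddCommGrpCat.{u}} {B : CommRingCat.{u}}
    {j : Spec B ⟶ S.left} (F : Frame H.points Y (S.iteratedSliceBackward.obj (Over.mk j))) :
    HasLawChart (S.iteratedSliceBackward.op ⋙ Y) H j := by
  let coord ⦃V : Over S.left⦄ (v : V ⟶ Over.mk j) (x : Y.obj (op (S.iteratedSliceBackward.obj V))) :
      FormalGroup.Points H (S.iteratedSliceBackward.obj V).left :=
    F.coord (S.iteratedSliceBackward.map v) x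
  have hadd ⦃V : Over S.left⦄ (v : V ⟶ Over.mk j)
      (x y : Y.obj (op (S.iteratedSliceBackward.obj V))) :
      coord v (x + y) = coord v x + coord v y := by
    refine (F.bijective (S.iteratedSliceBackward.map v)).1 ?_
    refine (F.hom_coord _ _).trans (Eq.trans ?_ (map_add (F.hom _) _ _).symm)
    exact congrArg₂ (· + ·) (F.hom_coord _ _).symm (F.hom_coord _ _).symm
  let c : Chart (S.iteratedSliceBackward.op ⋙ Y) (Over.mk j) :=
    { coord := fun V v x => (coord v x).pt
      map_coord := fun V V' f v x => by
        refine (congrArg FormalGroup.Points.pt (F.map_coord (S.iteratedSliceBackward.map f)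
          (S.iteratedSliceBackward.map v) x)).trans ?_
        rw [← Functor.map_comp]
        rfl
      bijective := fun V v => by
        refine Function.Bijective.comp (g := FormalGroup.Points.pt)
          ⟨fun P Q h => FormalGroup.Points.ext h, fun a => ⟨⟨a⟩, rfl⟩⟩ ?_
        exact (Equiv.ofBijective _ (F.bijective (S.iteratedSliceBackward.map v))).symm.bijective
      coord_zero := fun V v => by
        have h := hadd v 0 0
        rw [add_zero, left_eq_add] at h
        exact congrArg FormalGroup.Points.pt h }
  refine ⟨ptHom (j ≫ S.hom), c, fun V v x y R g => ?_⟩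
  rw [FormalGroup.nilAdd_map]
  refine (congrArg (FormalGroup.Points.val g) (hadd v x y)).trans
    ((FormalGroup.Points.val_add (coord v x) (coord v y) g).trans ?_)
  exact congrArg (fun χ => H.nilAdd χ _ _) ((hk R).elim _ _)

lemma lawSieve_mem_of_locallyFramed {Y : (Over S)ᵒᵖ ⥤ AddCommGrpCat.{u}}
    (h : LocallyFramed (fpqcTopology.over (Spec (.of k))) H.points Y) :
    lawSieve (S.iteratedSliceBackward.op ⋙ Y) H ∈ fpqcTopology S.left := by
  obtain ⟨R, hR, h⟩ := h
  rw [GrothendieckTopology.mem_over_iff] at hR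
  refine fpqcTopology.transitive hR _ fun V g hg => mem_fpqcTopology_of_affine _ fun B i => ?_
  obtain ⟨F⟩ := h _ ((Sieve.overEquiv_iff R (i ≫ g)).1 (Sieve.downward_closed _ hg i))
  exact ⟨B, i ≫ g, 𝟙 _, Category.id_comp _, F.hasLawChart hk⟩

end

end

noncomputable section

open AlgebraicGeometry.Scheme

/-! ### Presheaves on iterated slices -/

section

variable {C : Type u} [Category.{v} C] {Λ : C} {S S' S'' : Over Λ} {D : Type*} [Category D]

/-- The map of presheaves on iterated slices given by a map of presheaves on slices. -/
def sliceMap (f : S ⟶ S') {X : (Over S.left)ᵒᵖ ⥤ D} {Y : (Over S'.left)ᵒᵖ ⥤ D}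
    (α : X ⟶ (Over.map f.left).op ⋙ Y) :
    S.iteratedSliceForward.op ⋙ X ⟶ (Over.map f).op ⋙ S'.iteratedSliceForward.op ⋙ Y where
  app V := α.app (op (S.iteratedSliceForward.obj V.unop))
  naturality _ _ g := α.naturality (S.iteratedSliceForward.map g.unop).op

lemma isIso_sliceMap (f : S ⟶ S') {X : (Over S.left)ᵒᵖ ⥤ D} {Y : (Over S'.left)ᵒᵖ ⥤ D}
    (α : X ⟶ (Over.map f.left).op ⋙ Y) (hα : IsIso α) : IsIso (sliceMap f α) := by
  have (V : (Over S)ᵒᵖ) : IsIso ((sliceMap f α).app V) :=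
    inferInstanceAs (IsIso (α.app (op (S.iteratedSliceForward.obj V.unop))))
  exact NatIso.isIso_of_isIso_app _

lemma sliceMap_compMap (f : S ⟶ S') (g : S' ⟶ S'') {X : (Over S.left)ᵒᵖ ⥤ D}
    {Y : (Over S'.left)ᵒᵖ ⥤ D} {Z : (Over S''.left)ᵒᵖ ⥤ D} (α : X ⟶ (Over.map f.left).op ⋙ Y)
    (β : Y ⟶ (Over.map g.left).op ⋙ Z) : sliceMap (f ≫ g) (SlicePresheaf.compMap α β) =
      SlicePresheaf.compMap (sliceMap f α) (sliceMap g β) := by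
  ext V
  refine (SlicePresheaf.compMap_app α β _).trans
    (Eq.trans ?_ (SlicePresheaf.compMap_app (sliceMap f α) (sliceMap g β) V.unop).symm)
  refine congrArg (α.app _ ≫ ·) (congrArg (β.app _ ≫ ·) (congrArg Z.map ?_))
  apply Quiver.Hom.unop_inj
  ext
  simp
  rfl

lemma sliceMap_idMap (X : (Over S.left)ᵒᵖ ⥤ D) : sliceMap (𝟙 S) (SlicePresheaf.idMap X) =
    SlicePresheaf.idMap (S.iteratedSliceForward.op ⋙ X) := by
  ext V
  change X.map ((Over.mapId S.left).hom.app (S.iteratedSliceForward.obj V.unop)).op =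
    X.map (S.iteratedSliceForward.map ((Over.mapId S).hom.app V.unop)).op
  refine congrArg X.map (Quiver.Hom.unop_inj ?_)
  ext
  simp
  rfl

lemma sliceMap_injective (f : S ⟶ S') {X : (Over S.left)ᵒᵖ ⥤ D} {Y : (Over S'.left)ᵒᵖ ⥤ D}
    {α β : X ⟶ (Over.map f.left).op ⋙ Y} (h : sliceMap f α = sliceMap f β) : α = β := by
  ext V
  exact congrArg (fun γ => γ.app (op (S.iteratedSliceBackward.obj V.unop))) h

lemma exists_sliceMap_eq (f : S ⟶ S') {X : (Over S.left)ᵒᵖ ⥤ D} {Y : (Over S'.left)ᵒᵖ ⥤ D}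
    (β : S.iteratedSliceForward.op ⋙ X ⟶ (Over.map f).op ⋙ S'.iteratedSliceForward.op ⋙ Y)
    [IsIso β] : ∃ (α : X ⟶ (Over.map f.left).op ⋙ Y) (_ : IsIso α), sliceMap f α = β := by
  let α : X ⟶ (Over.map f.left).op ⋙ Y :=
    { app := fun V => β.app (op (S.iteratedSliceBackward.obj V.unop))
      naturality := fun _ _ g => β.naturality (S.iteratedSliceBackward.map g.unop).op }
  refine ⟨α, ?_, ?_⟩
  · have (V : (Over S.left)ᵒᵖ) : IsIso (α.app V) :=
      inferInstanceAs (IsIso (β.app (op (S.iteratedSliceBackward.obj V.unop))))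
    exact NatIso.isIso_of_isIso_app _
  · ext V
    have h := β.naturality (S.iteratedSliceEquiv.unitIso.hom.app V.unop).op
    refine Eq.trans ?_ (h.symm.trans ?_)
    · refine (Category.comp_id _).symm.trans (congrArg (_ ≫ ·) ?_)
      refine (Y.map_id _).symm.trans (congrArg Y.map (congrArg Quiver.Hom.op ?_))
      rfl
    · refine Eq.trans (congrArg (· ≫ _) ?_) (Category.id_comp _)
      refine Eq.trans (congrArg X.map (congrArg Quiver.Hom.op ?_)) (X.map_id _)
      rfl

/-- A presheaf on an iterated slice comes from the slice. -/
def sliceIso (Z : (Over S)ᵒᵖ ⥤ D) :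
    Z ≅ S.iteratedSliceForward.op ⋙ S.iteratedSliceBackward.op ⋙ Z :=
  NatIso.ofComponents (fun V => Z.mapIso (S.iteratedSliceEquiv.unitIso.app V.unop).symm.op)
    fun {V V'} g => by
      have h := S.iteratedSliceEquiv.unitIso.inv.naturality g.unop
      refine (Z.map_comp _ _).symm.trans (Eq.trans ?_ (Z.map_comp _ _))
      exact congrArg (fun t => Z.map (Quiver.Hom.op t)) h.symm

end

/-! ### Frames of presheaves isomorphic to a twist -/

section

variable {C : Type u} [Category.{v} C] {J : GrothendieckTopology C} {G : Cᵒᵖ ⥤ GrpCat.{w}}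
  {E : Cᵒᵖ ⥤ AddCommGrpCat.{w}} {S : C}

lemma frameBGMap_congr (M : AutAction J G E) {S' : C} {X : (Over S)ᵒᵖ ⥤ AddCommGrpCat.{w}}
    {hX : Presieve.IsSheaf (J.over S) (X ⋙ forget _)} {hXf : LocallyFramed J E X}
    {Y : (Over S')ᵒᵖ ⥤ AddCommGrpCat.{w}} {hY : Presieve.IsSheaf (J.over S') (Y ⋙ forget _)}
    {hYf : LocallyFramed J E Y} {f g : S ⟶ S'} (h : f = g) {α : X ⟶ (Over.map f).op ⋙ Y}
    {β : X ⟶ (Over.map g).op ⋙ Y} {_ : IsIso α} {_ : IsIso β} (hαβ : HEq α β) :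
    (frameBGMap M f α : frameBG M X hX hXf ⟶ frameBG M Y hY hYf) = frameBGMap M g β := by
  subst h
  cases hαβ
  rfl

/-- The image of a frame under an isomorphism. -/
def Frame.ofIso {X Y : (Over S)ᵒᵖ ⥤ AddCommGrpCat.{w}} (i : X ≅ Y) {T : Over S}
    (φ : Frame E X T) : Frame E Y T where
  hom V v := (i.hom.app (op V)).hom.comp (φ.hom v)
  map_hom V V' f v e := (NatTrans.naturality_apply i.hom f.op _).symm.trans
    (congrArg (i.hom.app (op V')) (φ.map_hom f v e))
  bijective V v := (ConcreteCategory.bijective_of_isIso (i.hom.app (op V))).comp (φ.bijective v)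

lemma exists_iso_frameBG_of_iso (M : AutAction J G E) (P : SheafTorsor J G S)
    {Y : (Over S)ᵒᵖ ⥤ AddCommGrpCat.{w}} (i : twist M P ≅ Y)
    (hY : Presieve.IsSheaf (J.over S) (Y ⋙ forget _)) (hf : LocallyFramed J E Y) :
    ∃ e : frameBG M Y hY hf ≅ ⟨S, P⟩, e.hom.base = 𝟙 S := by
  let m : P.sheaf ⟶ frameSheaf M Y :=
    { app := fun T => ↾fun x => frameSheafEquiv M Y T.unop ((twistFrame M P x).ofIso i)
      naturality := fun T T' f => by
        ext x
        refine Eq.trans ?_ (frameSheafEquiv_restrict M Y f.unop _)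
        exact congrArg (fun φ => frameSheafEquiv M Y T'.unop (Frame.ofIso i φ))
          (twistFrame_restrict M P f.unop x) }
  obtain ⟨e, he⟩ := BG.exists_iso_of_equivariant (P := P) (Q := frameTorsor M Y hY hf) m
    fun T x g => by
      change frameSheafEquiv M Y T _ = frameSheafEquiv M Y T
        (((frameSheafEquiv M Y T).symm (frameSheafEquiv M Y T _)).act M g)
      rw [Equiv.symm_apply_apply]
      exact congrArg (fun φ => frameSheafEquiv M Y T (Frame.ofIso i φ)) (twistFrame_act M P x g)
  refine ⟨e.symm, ?_⟩
  have h : e.inv.base ≫ e.hom.base = 𝟙 S := congrArg BG.Hom.base e.inv_hom_id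
  rw [he] at h
  exact (Category.comp_id _).symm.trans h

end

/-! ### The equivalence -/

section

variable {p : ℕ}

lemma Fp.subsingleton_ringHom (R : Type u) [CommRing R] : Subsingleton (Fp.{u} p →+* R) :=
  ⟨fun f g => by
    have h := Subsingleton.elim (f.comp (ULift.ringEquiv.symm : ZMod p ≃+* Fp.{u} p).toRingHom)
      (g.comp (ULift.ringEquiv.symm : ZMod p ≃+* Fp.{u} p).toRingHom)
    exact RingHom.ext fun x => congrArg (fun χ : ZMod p →+* R => χ x.down) h⟩

lemma Fp.subsingleton_hom (S : Scheme.{u}) : Subsingleton (S ⟶ Spec (.of (Fp.{u} p))) :=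
  ⟨fun f g => ext_of_isAffine (by
    rw [← cancel_epi (ΓSpecIso (.of (Fp.{u} p))).inv]
    exact CommRingCat.hom_ext ((Fp.subsingleton_ringHom _).elim _ _))⟩

lemma Fp.nonempty_hom {S : Scheme.{u}} (hp : (p : Γ(S, ⊤)) = 0) :
    Nonempty (S ⟶ Spec (.of (Fp.{u} p))) := by
  obtain ⟨φ⟩ := ZMod.exists_ringHom hp
  exact ⟨S.toSpecΓ ≫ Spec.map (CommRingCat.ofHom (φ.comp ULift.ringEquiv.toRingHom))⟩

variable {h : ℕ} (hh : 1 ≤ h) {H : FormalGroup (Fp.{u} p)} [H.IsComm]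
  (hH : H.mulSeries p = PowerSeries.X ^ (p ^ h))

lemma FormalLieGroup.exists_chart {S : Scheme.{u}} (X : FormalLieGroup S) (s : S) :
    ∃ U : S.Opens, s ∈ U ∧ Nonempty (Chart X.presheaf (Over.mk U.ι)) := by
  obtain ⟨U, hs, e, he⟩ := X.isFormalLieVariety.locally_trivial s
  exact ⟨U, hs, ⟨Chart.ofIso U.ι e he⟩⟩

lemma isSheaf_slice {S : Over (Spec (.of (Fp.{u} p)))} {X : (Over S.left)ᵒᵖ ⥤ AddCommGrpCat.{u}}
    (hX : Presieve.IsSheaf (fpqcTopology.over S.left) (X ⋙ CategoryTheory.forget _)) :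
    Presieve.IsSheaf ((fpqcTopology.over (Spec (.of (Fp.{u} p)))).over S)
      ((S.iteratedSliceForward.op ⋙ X) ⋙ CategoryTheory.forget _) :=
  S.iteratedSliceForward.op_comp_isSheaf_of_isSheaf_type
    (J := (fpqcTopology.over (Spec (.of (Fp.{u} p)))).over S) (K := fpqcTopology.over S.left) hX

variable [Fact p.Prime]

include hh hH in
lemma nonempty_base_and_lawSieve_mem (X : (FLG.hasHeight.{u} p h).FullSubcategory) :
    Nonempty (X.obj.base ⟶ Spec (.of (Fp.{u} p))) ∧
      lawSieve X.obj.group.presheaf H ∈ fpqcTopology X.obj.base := by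
  obtain ⟨h1, h2⟩ := lawSieve_mem hh X.obj.group.exists_chart X.property H hH
  exact ⟨Fp.nonempty_hom h1, h2⟩

/-- The base of a formal Lie group of height `h` as a scheme over the prime field. -/
def baseOver (X : (FLG.hasHeight.{u} p h).FullSubcategory) : Over (Spec (.of (Fp.{u} p))) :=
  Over.mk (nonempty_base_and_lawSieve_mem hh hH X).1.some

/-- The morphism of the bases over the prime field. -/
def baseOverMap {X Y : (FLG.hasHeight.{u} p h).FullSubcategory} (f : X ⟶ Y) :
    baseOver hh hH X ⟶ baseOver hh hH Y :=
  Over.homMk f.hom.base ((Fp.subsingleton_hom _).elim _ _)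

lemma isIso_sliceMap_baseOverMap {X Y : (FLG.hasHeight.{u} p h).FullSubcategory} (f : X ⟶ Y) :
    IsIso (sliceMap (baseOverMap hh hH f) f.hom.map) :=
  isIso_sliceMap (baseOverMap hh hH f) f.hom.map f.hom.isIso_map

/-- The torsor of the isomorphisms from `H` to a formal Lie group of height `h`. -/
def isomTorsor (X : (FLG.hasHeight.{u} p h).FullSubcategory) :
    BG (fpqcTopology.over (Spec (.of (Fp.{u} p)))) (autPresheaf H) :=
  frameBG (S := baseOver hh hH X) (FormalGroup.autAction H)
    ((Over.iteratedSliceForward _).op ⋙ X.obj.group.presheaf)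
    (isSheaf_slice (isSheaf_fpqc_of_charts ((isSheaf_iff_isSheaf_of_type _ _).1
      X.obj.group.isFormalLieVariety.isSheaf) X.obj.group.exists_chart))
    (locallyFramed_of_lawSieve_mem (fun R _ => Fp.subsingleton_ringHom R)
      (nonempty_base_and_lawSieve_mem hh hH X).2)

/-- The map of torsors given by a morphism of formal Lie groups. -/
def isomTorsorMap {X Y : (FLG.hasHeight.{u} p h).FullSubcategory} (f : X ⟶ Y) :
    isomTorsor hh hH X ⟶ isomTorsor hh hH Y :=
  have := isIso_sliceMap_baseOverMap hh hH f
  frameBGMap (FormalGroup.autAction H) (baseOverMap hh hH f)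
    (sliceMap (baseOverMap hh hH f) f.hom.map)

/-- The functor from the formal Lie groups of height `h` to the torsors. -/
def isomTorsorFunctor : (FLG.hasHeight.{u} p h).FullSubcategory ⥤
    BG (fpqcTopology.over (Spec (.of (Fp.{u} p)))) (autPresheaf H) where
  obj := isomTorsor hh hH
  map := isomTorsorMap hh hH
  map_id X := by
    have h1 := sliceMap_idMap (S := baseOver hh hH X)
      X.obj.group.presheaf
    have : IsIso (sliceMap (𝟙 (baseOver hh hH X))
      (SlicePresheaf.idMap X.obj.group.presheaf)) := h1 ▸ inferInstance
    exact (frameBGMap_congr (FormalGroup.autAction H) rfl (heq_of_eq h1)).trans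
      (frameBGMap_id (FormalGroup.autAction H))
  map_comp f g := by
    have := isIso_sliceMap_baseOverMap hh hH f
    have := isIso_sliceMap_baseOverMap hh hH g
    have h1 := sliceMap_compMap (baseOverMap hh hH f) (baseOverMap hh hH g) f.hom.map g.hom.map
    have : IsIso (sliceMap (baseOverMap hh hH f ≫ baseOverMap hh hH g)
      (SlicePresheaf.compMap f.hom.map g.hom.map)) := h1 ▸ inferInstance
    exact (frameBGMap_congr (FormalGroup.autAction H) rfl (heq_of_eq h1)).trans
      (frameBGMap_comp (FormalGroup.autAction H) _ _ _ _)

instance : (isomTorsorFunctor hh hH).Faithful where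
  map_injective {X Y} f g hfg := by
    have := isIso_sliceMap_baseOverMap hh hH f
    have := isIso_sliceMap_baseOverMap hh hH g
    obtain ⟨f, α, hα⟩ := f
    obtain ⟨g, β, hβ⟩ := g
    obtain rfl : f = g := congrArg (fun b : isomTorsor hh hH X ⟶ isomTorsor hh hH Y =>
      Over.Hom.left (f := baseOver hh hH X) (g := baseOver hh hH Y) b.base) hfg
    have := isIso_sliceMap (baseOverMap hh hH ⟨⟨f, α, hα⟩⟩) β hβ
    obtain rfl : α = β := sliceMap_injective (baseOverMap hh hH ⟨⟨f, α, hα⟩⟩)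
      (frameBGMap_injective (FormalGroup.autAction H) _ _ _ hfg)
    rfl

instance : (isomTorsorFunctor hh hH).Full where
  map_surjective {X Y} b := by
    obtain ⟨β, _, hb⟩ := exists_frameBGMap_eq (FormalGroup.autAction H) b
    obtain ⟨α, hα, rfl⟩ := exists_sliceMap_eq (S := baseOver hh hH X) (S' := baseOver hh hH Y) b.base β
    exact ⟨⟨⟨b.base.left, α, hα⟩⟩, hb⟩

lemma exists_iso_isomTorsor
    (P : BG (fpqcTopology.over (Spec (.of (Fp.{u} p)))) (autPresheaf H)) :
    ∃ (X : (FLG.hasHeight.{u} p h).FullSubcategory) (e : isomTorsor hh hH X ≅ P),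
      (BG.proj _ _ ⋙ Over.forget _).IsHomLift (𝟙 P.base.left) e.hom := by
  obtain ⟨⟨S, ⟨⟨⟩⟩, s⟩, P⟩ := P
  change S ⟶ Spec (.of (Fp.{u} p)) at s
  have hS : Nonempty (S ⟶ Spec (.of (Fp.{u} p))) := ⟨s⟩
  obtain rfl : s = hS.some := (Fp.subsingleton_hom _).elim _ _
  let S' : Over (Spec (.of (Fp.{u} p))) := Over.mk hS.some
  let M := FormalGroup.autAction H
  let P' : SheafTorsor (fpqcTopology.over (Spec (.of (Fp.{u} p)))) (autPresheaf H) S' := P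
  let Y := S'.iteratedSliceBackward.op ⋙ twist M P'
  have hY : Presieve.IsSheaf (fpqcTopology.over S'.left) (Y ⋙ CategoryTheory.forget _) :=
    S'.iteratedSliceBackward.op_comp_isSheaf_of_isSheaf_type (J := fpqcTopology.over S'.left)
      (K := (fpqcTopology.over (Spec (.of (Fp.{u} p)))).over S') (isSheaf_twist M P')
  have hl := lawSieve_mem_of_locallyFramed (fun R _ => Fp.subsingleton_ringHom R)
    (locallyFramed_twist M P')
  obtain ⟨h1, h2⟩ := isFormalLieVariety_and_hasHeight hY hl hH
  let X : (FLG.hasHeight.{u} p h).FullSubcategory := ⟨⟨S, ⟨Y, h1⟩⟩, h2⟩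
  obtain ⟨e, he⟩ := exists_iso_frameBG_of_iso M P' (sliceIso (twist M P')) (isSheaf_slice hY)
    (locallyFramed_of_lawSieve_mem (fun R _ => Fp.subsingleton_ringHom R) hl)
  refine ⟨X, e, IsHomLift.of_fac' _ _ _ rfl rfl ?_⟩
  exact (congrArg (fun f => f.left) he).trans (by simp; rfl)

end

end

theorem mainTheorem4 (p : ℕ) [Fact p.Prime] (h : ℕ) (hh : 1 ≤ h)
    (H : FormalGroup (ZMod p)) [H.IsComm] (hH : H.mulSeries p = PowerSeries.X ^ (p ^ h)) :
    Nonempty (Bicategory.Equivalence (FLGHeight.{u} p h) (BAut.{u} p H)) := by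
  let H' : FormalGroup (Fp.{u} p) :=
    H.map (ULift.ringEquiv.symm : ZMod p ≃+* Fp.{u} p).toRingHom
  have hH' : H'.mulSeries p = PowerSeries.X ^ (p ^ h) := by
    refine (FormalGroup.map_mulSeries _ _ _).trans ?_
    rw [hH, map_pow, PowerSeries.map_X]
  let F : BasedFunctor (FLGHeight.{u} p h) (BAut.{u} p H) :=
    { toFunctor := isomTorsorFunctor hh hH', w := rfl }
  have hfull : F.toFunctor.Full := inferInstanceAs (isomTorsorFunctor hh hH').Full
  have hfaith : F.toFunctor.Faithful := inferInstanceAs (isomTorsorFunctor hh hH').Faithful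
  refine BasedCategory.nonempty_equivalence F fun P => ?_
  obtain ⟨X, e, he⟩ := exists_iso_isomTorsor hh hH' P
  exact ⟨X, e, he⟩
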